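/- Let $k$ be a field of characteristic $0$; differentials have degree $1$ and signs follow the Koszul rule. Let $\mathcal X$ be a nonsymmetric operad in the symmetric monoidal category of coassociative counital dg coalgebras over $k$, with $\mathcal X(0)=\mathcal X(1)=k$; write $\Delta$, $\varepsilon$ for the coproducts and counits. Let $P(\mathcal X)$ be the graded PROP generated by operations $\phi(x)^r_{k_1\ldots k_n}$ of degree $|x|$ with $k_1+\dots+k_n$ inputs and $r$ outputs, for homogeneous $x\in\mathcal X(n)$, linear in $x$ ($n\ge 0$, $k_i\ge 0$, $0\le r\le k_1+\dots+k_n$), and $D_l^m$ of degree $1$ with $l$ inputs and $m$ outputs ($l>m>0$), subject to the following relations, in which all other symbols $\phi(x)^r_{k_1\ldots k_n}$ and $D_l^m$ are read as $0$: 1. For $\Delta x=\sum x'\otimes x''$ and all $r,r'\geq 0$: $\phi(x)^{r+r'}_{k_1\ldots k_n}=\sum\sum_{0\le p_i\le k_i}\bigl(\phi(x')^{r}_{p_1\ldots p_n}\otimes\phi(x'')^{r'}_{k_1-p_1\ldots k_n-p_n}\bigr)\circ\sigma_{k,p}$, where $\sigma_{k,p}$ is the permutation of inputs that splits the $i$-th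 block of $k_i$ inputs into its first $p_i$ and its last $k_i-p_i$ ones and puts all first parts in front of all last parts; and $D_{p+q+c}^{p+q}=D_{p+c}^{p}\otimes \mathrm{id}_q+\mathrm{id}_p\otimes D_{q+c}^{q}$. 2. If $z\in\mathcal X(n)$ is inserted in the input of $y\in\mathcal X(a+1+b)$ that has $a$ inputs to its left, then $\phi(y\circ_{a+1}z)^r_{u_1\ldots u_aw_1\ldots w_nv_1\ldots v_b}=\sum_{q}\phi(y)^r_{u_1\ldots u_a\,q\,v_1\ldots v_b}\circ\bigl(\mathrm{id}\otimes\phi(z)^q_{w_1\ldots w_n}\otimes\mathrm{id}\bigr)$, the sum being over $0\le q\le w_1+\dots+w_n$. 3. For the operadic unit $1\in\mathcal X(1)$: $\phi(1)^r_{j}$ is the identity if $r=j$ and $0$ otherwise; $\phi(x)^0_{k_1\ldots k_n}=0$ if some $k_i\neq 0$, and $\phi(x)^0_{0\ldots 0}=\varepsilon(x)\,\mathrm{id}_0$. A differential on $P(\mathcal X)$ is a square-zero derivation of degree $1$, with respect to composition and tensor product, that vanishes on permutations. Consider differentials $d$ with $$dD_l^m=-\sum_{m<r<l}D_r^mD_l^r,\qquad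 d\,\phi(x)^r_{k_1\ldots k_n}=\phi(dx)^r_{k_1\ldots k_n}-\sum_{s}D_s^r\,\phi(x)^s_{k_1\ldots k_n}+(-1)^{|x|}\sum_{c=1}^n\sum_{0<q<k_c}\phi(x)^r_{k_1\ldots q\ldots k_n}\circ(\mathrm{id}\otimes D_{k_c}^q\otimes\mathrm{id}),$$ with $q$ in the $c$-th place. (The dg PROP $P(\mathcal X)$ with such a $d$ governs the $\mathcal X$-algebras with unit on the tensor coalgebras $TV$ with a differential whose restriction to $V$ is that of the complex $V$.) Let $\mathcal O(\mathcal X)$ be the symmetric operad of the operations of $P(\mathcal X)$ with one output. A dg operad or dg PROP is called semi-free on given generators if the underlying graded operad or PROP is freely generated by them. **Proposition.** Assume that the operad $(\mathcal X(n))_{n\geq 1}$ is semi-free, freely generated by graded subspaces $\mathcal V(n)\subset\mathcal X(n)$, $n\ge 1$. Then $P(\mathcal X)$ has exactly one differential $d$ given by the formulas above, and the dg PROP $P(\mathcal X)$ and the dg operad $\mathcal O(\mathcal X)$ are semi-free: both are freely generated by the operations $\phi(v)^1_{k_1\ldots k_n}$, depending linearly on $v\in\mathcal V(n)$ ($n\geq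 2$, $k_1,\dots,k_n\geq 1$), and $D^1_l$ ($l>1$). -/

import Mathlib

universe u

namespace XB

open scoped DirectSum TensorProduct

/-! ### Graded operads

A graded vector space is a family of vector spaces indexed by `ℤ`. To avoid transporting along
equalities of arities and degrees, the compositions take proofs that the arities and the degrees of
their arguments add up to those of the value. Signs follow the Koszul rule. -/

/-- A nonsymmetric operad in graded `k`-vector spaces, with operations of all arities `n ≥ 0`.
The inputs of an `m`-ary operation are numbered `0, …, m - 1`, and `circ s _ _ x y` is the partial
composition `x ∘ₛ y` (insertion of `y` in the input `s` of `x`). -/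
structure NSOperad (k : Type u) [Field k] where
  obj : ℕ → ℤ → Type u
  [grp : ∀ n i, AddCommGroup (obj n i)]
  [mod : ∀ n i, Module k (obj n i)]
  one : obj 1 0
  circ : ∀ {m n l : ℕ} {i j t : ℤ}, Fin m → l + 1 = m + n → i + j = t →
    (obj m i →ₗ[k] obj n j →ₗ[k] obj l t)
  one_circ : ∀ {n : ℕ} {i : ℤ} (s : Fin 1) (hl : n + 1 = 1 + n) (ht : 0 + i = i) (y : obj n i),
    circ s hl ht one y = y
  circ_one : ∀ {m : ℕ} {i : ℤ} (s : Fin m) (hl : m + 1 = m + 1) (ht : i + 0 = i) (x : obj m i),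
    circ s hl ht x one = x
  circ_seq : ∀ {m n p l l' q : ℕ} {a b c ab bc abc : ℤ} (s : Fin m) (r : Fin n) (sr : Fin l)
    (_ : (sr : ℕ) = s + r) (h₁ : l + 1 = m + n) (h₂ : q + 1 = l + p) (h₃ : l' + 1 = n + p)
    (h₄ : q + 1 = m + l') (e₁ : a + b = ab) (e₂ : ab + c = abc) (e₃ : b + c = bc)
    (e₄ : a + bc = abc) (x : obj m a) (y : obj n b) (z : obj p c),
    circ sr h₂ e₂ (circ s h₁ e₁ x y) z = circ s h₄ e₄ x (circ r h₃ e₃ y z)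
  circ_par : ∀ {m n p l l' q : ℕ} {a b c ab ac abc : ℤ} (s r : Fin m) (_ : s < r)
    (r' : Fin l) (s' : Fin l') (_ : (r' : ℕ) + 1 = r + n) (_ : (s' : ℕ) = s)
    (h₁ : l + 1 = m + n) (h₂ : q + 1 = l + p) (h₃ : l' + 1 = m + p) (h₄ : q + 1 = l' + n)
    (e₁ : a + b = ab) (e₂ : ab + c = abc) (e₃ : a + c = ac) (e₄ : ac + b = abc)
    (x : obj m a) (y : obj n b) (z : obj p c),
    circ r' h₂ e₂ (circ s h₁ e₁ x y) z =
      (b * c).negOnePow • circ s' h₄ e₄ (circ r h₃ e₃ x z) y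

attribute [instance] NSOperad.grp NSOperad.mod

/-- A morphism between the parts of arity `≥ 1` of two graded nonsymmetric operads. -/
structure NSOperad.PosHom {k : Type u} [Field k] (A B : NSOperad k) where
  map : ∀ n, 1 ≤ n → ∀ i, A.obj n i →ₗ[k] B.obj n i
  map_one : map 1 le_rfl 0 A.one = B.one
  map_circ : ∀ {m n l : ℕ} {i j t : ℤ} (hm : 1 ≤ m) (hn : 1 ≤ n) (hl' : 1 ≤ l) (s : Fin m)
    (hl : l + 1 = m + n) (ht : i + j = t) (x : A.obj m i) (y : A.obj n j),
    map l hl' t (A.circ s hl ht x y) = B.circ s hl ht (map m hm i x) (map n hn j y)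

/-- The part of arity `≥ 1` of the graded operad `A` is freely generated by the graded subspaces
`V n ⊆ A n`, `n ≥ 1`. -/
def NSOperad.PosFreelyGenerated {k : Type u} [Field k] (A : NSOperad.{u} k)
    (V : ∀ n i, Submodule k (A.obj n i)) : Prop :=
  ∀ (B : NSOperad.{u} k) (f : ∀ n, 1 ≤ n → ∀ i, V n i →ₗ[k] B.obj n i),
    ∃! g : A.PosHom B, ∀ n (hn : 1 ≤ n) i (v : V n i), g.map n hn i v = f n hn i v

/-- The position, after an `n`-ary operation has been inserted in the input `s`, of the former
input `a ≠ s`. -/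
def shiftPos (n s a : ℕ) : ℕ := if a < s then a else a + n - 1

/-- `ρ` is the permutation that is induced by a permutation `σ` of the inputs of an `m`-ary
operation and a permutation `τ` of the inputs of an `n`-ary operation, after the latter has been
inserted in the input `s` (before `σ`) or `σ s` (after `σ`) of the former. -/
def IsBlockPerm {m n l : ℕ} (σ : Equiv.Perm (Fin m)) (s : Fin m) (τ : Equiv.Perm (Fin n))
    (ρ : Equiv.Perm (Fin l)) : Prop :=
  (∀ (c : Fin l) (a : Fin m), a ≠ s → (c : ℕ) = shiftPos n s a →
    (ρ c : ℕ) = shiftPos n (σ s) (σ a)) ∧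
  (∀ (c : Fin l) (b : Fin n), (c : ℕ) = s + b → (ρ c : ℕ) = σ s + τ b)

/-- A (symmetric) operad in graded `k`-vector spaces. `act σ` is the right action of `σ`: the
input `a` of `act σ x` is the input `σ a` of `x`. -/
structure SymOperad (k : Type u) [Field k] extends NSOperad k where
  act : ∀ {n : ℕ} {i : ℤ}, Equiv.Perm (Fin n) → (obj n i →ₗ[k] obj n i)
  act_one : ∀ {n : ℕ} {i : ℤ} (x : obj n i), act 1 x = x
  act_mul : ∀ {n : ℕ} {i : ℤ} (σ τ : Equiv.Perm (Fin n)) (x : obj n i),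
    act (σ * τ) x = act τ (act σ x)
  act_circ : ∀ {m n l : ℕ} {i j t : ℤ} (s : Fin m) (hl : l + 1 = m + n) (ht : i + j = t)
    (σ : Equiv.Perm (Fin m)) (τ : Equiv.Perm (Fin n)) (ρ : Equiv.Perm (Fin l))
    (_ : IsBlockPerm σ s τ ρ) (x : obj m i) (y : obj n j),
    circ s hl ht (act σ x) (act τ y) = act ρ (circ (σ s) hl ht x y)

structure SymOperad.Hom {k : Type u} [Field k] (A B : SymOperad k) where
  map : ∀ n i, A.obj n i →ₗ[k] B.obj n i
  map_one : map 1 0 A.one = B.one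
  map_circ : ∀ {m n l : ℕ} {i j t : ℤ} (s : Fin m) (hl : l + 1 = m + n) (ht : i + j = t)
    (x : A.obj m i) (y : A.obj n j),
    map l t (A.circ s hl ht x y) = B.circ s hl ht (map m i x) (map n j y)
  map_act : ∀ {n : ℕ} {i : ℤ} (σ : Equiv.Perm (Fin n)) (x : A.obj n i),
    map n i (A.act σ x) = B.act σ (map n i x)

/-- The graded operad `A` is freely generated by the vector spaces `E s` of operations of arity
`ar s` and degree `deg s`. -/
def SymOperad.FreelyGenerated {k : Type u} [Field k] (A : SymOperad.{u} k) {S : Type}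
    (ar : S → ℕ) (deg : S → ℤ) (E : S → Type u)
    [∀ s, AddCommGroup (E s)] [∀ s, Module k (E s)]
    (gen : ∀ s, E s →ₗ[k] A.obj (ar s) (deg s)) : Prop :=
  ∀ (B : SymOperad.{u} k) (f : ∀ s, E s →ₗ[k] B.obj (ar s) (deg s)),
    ∃! g : A.Hom B, ∀ s (v : E s), g.map (ar s) (deg s) (gen s v) = f s v

/-- A dg operad, with differential of degree `1`. -/
structure DGOperad (k : Type u) [Field k] extends SymOperad k where
  d : ∀ {n : ℕ} {i t : ℤ}, i + 1 = t → (obj n i →ₗ[k] obj n t)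
  d_d : ∀ {n : ℕ} {i t t' : ℤ} (h : i + 1 = t) (h' : t + 1 = t') (x : obj n i), d h' (d h x) = 0
  d_act : ∀ {n : ℕ} {i t : ℤ} (h : i + 1 = t) (σ : Equiv.Perm (Fin n)) (x : obj n i),
    d h (act σ x) = act σ (d h x)
  d_circ : ∀ {m n l : ℕ} {i j t i' j' t' : ℤ} (s : Fin m) (hl : l + 1 = m + n) (ht : i + j = t)
    (hi : i + 1 = i') (hj : j + 1 = j') (ht' : t + 1 = t') (h₁ : i' + j = t') (h₂ : i + j' = t')
    (x : obj m i) (y : obj n j),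
    d ht' (circ s hl ht x y) =
      circ s hl h₁ (d hi x) y + i.negOnePow • circ s hl h₂ x (d hj y)

/-- A dg operad is semi-free on given generators if the underlying graded operad is freely
generated by them. -/
def DGOperad.SemiFreeOn {k : Type u} [Field k] (A : DGOperad.{u} k) {S : Type}
    (ar : S → ℕ) (deg : S → ℤ) (E : S → Type u)
    [∀ s, AddCommGroup (E s)] [∀ s, Module k (E s)]
    (gen : ∀ s, E s →ₗ[k] A.obj (ar s) (deg s)) : Prop :=
  A.toSymOperad.FreelyGenerated ar deg E gen

/-! ### Operads of dg coalgebras -/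

/-- An expression of the coproduct of a homogeneous element `x` of degree `i` of a graded
coalgebra `C = ⨁ i, C i` as a sum of tensor products `left t ⊗ right t` of homogeneous elements of
total degree `i`. -/
structure Splitting (k : Type u) [Field k] {C : ℤ → Type u} [∀ i, AddCommGroup (C i)]
    [∀ i, Module k (C i)] [Coalgebra k (⨁ i, C i)] {i : ℤ} (x : C i) where
  size : ℕ
  degL : Fin size → ℤ
  degR : Fin size → ℤ
  deg_add : ∀ t, degL t + degR t = i
  left : ∀ t, C (degL t)
  right : ∀ t, C (degR t)
  comul_eq : Coalgebra.comul (R := k) (DirectSum.lof k ℤ C i x) =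
    ∑ t, DirectSum.lof k ℤ C (degL t) (left t) ⊗ₜ[k] DirectSum.lof k ℤ C (degR t) (right t)

/-- A nonsymmetric operad `X` in the symmetric monoidal category of (coassociative, counital)
dg coalgebras over `k`, with `X 0 = X 1 = k`. -/
structure CoalgOperad (k : Type u) [Field k] extends NSOperad k where
  /-- the differential, of degree `1` -/
  d : ∀ {n : ℕ} {i t : ℤ}, i + 1 = t → (obj n i →ₗ[k] obj n t)
  d_d : ∀ {n : ℕ} {i t t' : ℤ} (h : i + 1 = t) (h' : t + 1 = t') (x : obj n i), d h' (d h x) = 0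
  d_circ : ∀ {m n l : ℕ} {i j t i' j' t' : ℤ} (s : Fin m) (hl : l + 1 = m + n) (ht : i + j = t)
    (hi : i + 1 = i') (hj : j + 1 = j') (ht' : t + 1 = t') (h₁ : i' + j = t') (h₂ : i + j' = t')
    (x : obj m i) (y : obj n j),
    d ht' (circ s hl ht x y) =
      circ s hl h₁ (d hi x) y + i.negOnePow • circ s hl h₂ x (d hj y)
  /-- the coproduct and the counit of `X n` -/
  [coalg : ∀ n, Coalgebra k (⨁ i, obj n i)]
  /-- the coproduct and the counit have degree `0` -/
  comul_graded : ∀ {n : ℕ} {i : ℤ} (x : obj n i), Nonempty (Splitting k x)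
  counit_graded : ∀ {n : ℕ} {i : ℤ} (x : obj n i), i ≠ 0 →
    Coalgebra.counit (R := k) (DirectSum.lof k ℤ (obj n) i x) = 0
  /-- the coproduct and the counit are compatible with the differentials -/
  comul_d : ∀ {n : ℕ} {i t : ℤ} (h : i + 1 = t) (x : obj n i) (S : Splitting k x),
    Coalgebra.comul (R := k) (DirectSum.lof k ℤ (obj n) t (d h x)) =
      ∑ a, (DirectSum.lof k ℤ (obj n) (S.degL a + 1) (d rfl (S.left a)) ⊗ₜ[k]
          DirectSum.lof k ℤ (obj n) (S.degR a) (S.right a) +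
        (S.degL a).negOnePow • (DirectSum.lof k ℤ (obj n) (S.degL a) (S.left a) ⊗ₜ[k]
          DirectSum.lof k ℤ (obj n) (S.degR a + 1) (d rfl (S.right a))))
  counit_d : ∀ {n : ℕ} {i t : ℤ} (h : i + 1 = t) (x : obj n i),
    Coalgebra.counit (R := k) (DirectSum.lof k ℤ (obj n) t (d h x)) = 0
  /-- the unit and the compositions of the operad are morphisms of coalgebras with counit -/
  comul_one : Coalgebra.comul (R := k) (DirectSum.lof k ℤ (obj 1) 0 one) =
    DirectSum.lof k ℤ (obj 1) 0 one ⊗ₜ[k] DirectSum.lof k ℤ (obj 1) 0 one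
  counit_one : Coalgebra.counit (R := k) (DirectSum.lof k ℤ (obj 1) 0 one) = 1
  comul_circ : ∀ {m n l : ℕ} {i j t : ℤ} (s : Fin m) (hl : l + 1 = m + n) (ht : i + j = t)
    (x : obj m i) (y : obj n j) (S : Splitting k x) (T : Splitting k y),
    Coalgebra.comul (R := k) (DirectSum.lof k ℤ (obj l) t (circ s hl ht x y)) =
      ∑ a, ∑ b, (S.degR a * T.degL b).negOnePow •
        (DirectSum.lof k ℤ (obj l) (S.degL a + T.degL b)
            (circ s hl rfl (S.left a) (T.left b)) ⊗ₜ[k]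
          DirectSum.lof k ℤ (obj l) (S.degR a + T.degR b)
            (circ s hl rfl (S.right a) (T.right b)))
  counit_circ : ∀ {m n l : ℕ} {i j t : ℤ} (s : Fin m) (hl : l + 1 = m + n) (ht : i + j = t)
    (x : obj m i) (y : obj n j),
    Coalgebra.counit (R := k) (DirectSum.lof k ℤ (obj l) t (circ s hl ht x y)) =
      Coalgebra.counit (R := k) (DirectSum.lof k ℤ (obj m) i x) *
        Coalgebra.counit (R := k) (DirectSum.lof k ℤ (obj n) j y)
  /-- `X 0 = X 1 = k`, as coalgebras with counit -/
  counit_bijective_zero :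
    Function.Bijective (Coalgebra.counit (R := k) (A := ⨁ i, obj 0 i))
  counit_bijective_one :
    Function.Bijective (Coalgebra.counit (R := k) (A := ⨁ i, obj 1 i))

attribute [instance] CoalgOperad.coalg

/-- The counit of `X n` on elements of degree `i`. -/
def CoalgOperad.counit {k : Type u} [Field k] (X : CoalgOperad k) {n : ℕ} {i : ℤ}
    (x : X.obj n i) : k :=
  Coalgebra.counit (R := k) (DirectSum.lof k ℤ (X.obj n) i x)


/-! ### Graded PROPs -/

/-- The underlying data of a graded PROP: the spaces `Hom m n i` of operations of degree `i` with
`m` inputs and `n` outputs, the composition `comp _ f g = f ∘ g`, the tensor product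
`hcomp _ _ _ f g = f ⊗ g`, and the permutations; `perm σ` moves the factor in position `a` to the
position `σ a`. -/
structure PROPData (k : Type u) [Field k] where
  Hom : ℕ → ℕ → ℤ → Type u
  [grp : ∀ m n i, AddCommGroup (Hom m n i)]
  [mod : ∀ m n i, Module k (Hom m n i)]
  perm : ∀ {n : ℕ}, Equiv.Perm (Fin n) → Hom n n 0
  comp : ∀ {l m n : ℕ} {i j t : ℤ}, i + j = t → (Hom m n i →ₗ[k] Hom l m j →ₗ[k] Hom l n t)
  hcomp : ∀ {m m' M n n' N : ℕ} {i j t : ℤ}, m + m' = M → n + n' = N → i + j = t →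
    (Hom m n i →ₗ[k] Hom m' n' j →ₗ[k] Hom M N t)

attribute [instance] PROPData.grp PROPData.mod

/-- The bijection from the disjoint union of two blocks of sizes `m` and `m'` to `m + m' = M`
positions. -/
def blocks {m m' M : ℕ} (h : m + m' = M) : Fin m ⊕ Fin m' ≃ Fin M :=
  finSumFinEquiv.trans (finCongr h)

/-- The permutation that acts by `σ` on the first block and by `τ` on the second one. -/
def blockSum {m m' M : ℕ} (h : m + m' = M) (σ : Equiv.Perm (Fin m)) (τ : Equiv.Perm (Fin m')) :
    Equiv.Perm (Fin M) :=
  (blocks h).symm.trans ((Equiv.sumCongr σ τ).trans (blocks h))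

/-- The exchange of a first block of size `m` with a second block of size `m'`. -/
def blockSwap {m m' M : ℕ} (h : m + m' = M) (h' : m' + m = M) : Equiv.Perm (Fin M) :=
  (blocks h).symm.trans ((Equiv.sumComm _ _).trans (blocks h'))

/-- A PROP in graded `k`-vector spaces (a strict symmetric monoidal category enriched in graded
vector spaces, with monoid of objects `ℕ`). -/
structure PROP (k : Type u) [Field k] extends PROPData k where
  comp_assoc : ∀ {p l m n : ℕ} {a b c ab bc abc : ℤ} (e₁ : a + b = ab) (e₂ : ab + c = abc)
    (e₃ : b + c = bc) (e₄ : a + bc = abc) (f : Hom m n a) (g : Hom l m b) (h : Hom p l c),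
    comp e₂ (comp e₁ f g) h = comp e₄ f (comp e₃ g h)
  one_comp : ∀ {m n : ℕ} {i : ℤ} (e : 0 + i = i) (f : Hom m n i), comp e (perm 1) f = f
  comp_one : ∀ {m n : ℕ} {i : ℤ} (e : i + 0 = i) (f : Hom m n i), comp e f (perm 1) = f
  perm_mul : ∀ {n : ℕ} (e : (0 : ℤ) + 0 = 0) (σ τ : Equiv.Perm (Fin n)),
    perm (σ * τ) = comp e (perm σ) (perm τ)
  hcomp_assoc : ∀ {m₁ m₂ m₃ m₁₂ m₂₃ M n₁ n₂ n₃ n₁₂ n₂₃ N : ℕ} {a b c ab bc abc : ℤ}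
    (hm₁ : m₁ + m₂ = m₁₂) (hm₂ : m₁₂ + m₃ = M) (hm₃ : m₂ + m₃ = m₂₃) (hm₄ : m₁ + m₂₃ = M)
    (hn₁ : n₁ + n₂ = n₁₂) (hn₂ : n₁₂ + n₃ = N) (hn₃ : n₂ + n₃ = n₂₃) (hn₄ : n₁ + n₂₃ = N)
    (e₁ : a + b = ab) (e₂ : ab + c = abc) (e₃ : b + c = bc) (e₄ : a + bc = abc)
    (f : Hom m₁ n₁ a) (g : Hom m₂ n₂ b) (h : Hom m₃ n₃ c),
    hcomp hm₂ hn₂ e₂ (hcomp hm₁ hn₁ e₁ f g) h = hcomp hm₄ hn₄ e₄ f (hcomp hm₃ hn₃ e₃ g h)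
  one_hcomp : ∀ {m n : ℕ} {i : ℤ} (hm : 0 + m = m) (hn : 0 + n = n) (e : 0 + i = i)
    (f : Hom m n i), hcomp hm hn e (perm (1 : Equiv.Perm (Fin 0))) f = f
  hcomp_one : ∀ {m n : ℕ} {i : ℤ} (hm : m + 0 = m) (hn : n + 0 = n) (e : i + 0 = i)
    (f : Hom m n i), hcomp hm hn e f (perm (1 : Equiv.Perm (Fin 0))) = f
  perm_hcomp : ∀ {m m' M : ℕ} (h : m + m' = M) (e : (0 : ℤ) + 0 = 0) (σ : Equiv.Perm (Fin m))
    (τ : Equiv.Perm (Fin m')), hcomp h h e (perm σ) (perm τ) = perm (blockSum h σ τ)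
  interchange : ∀ {l m n l' m' n' L M N : ℕ} {a b c d ab cd ac bd t : ℤ}
    (hL : l + l' = L) (hM : m + m' = M) (hN : n + n' = N)
    (e₁ : a + b = ab) (e₂ : c + d = cd) (e₃ : ab + cd = t)
    (e₄ : a + c = ac) (e₅ : b + d = bd) (e₆ : ac + bd = t)
    (f : Hom m n a) (g : Hom m' n' b) (f' : Hom l m c) (g' : Hom l' m' d),
    comp e₃ (hcomp hM hN e₁ f g) (hcomp hL hM e₂ f' g') =
      (b * c).negOnePow • hcomp hL hN e₆ (comp e₄ f f') (comp e₅ g g')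
  symmetry : ∀ {m n m' n' M N : ℕ} {a b ab : ℤ} (hM : m + m' = M) (hM' : m' + m = M)
    (hN : n + n' = N) (hN' : n' + n = N) (e₁ : a + b = ab) (e₂ : b + a = ab)
    (e₃ : ab + 0 = ab) (e₄ : 0 + ab = ab) (f : Hom m n a) (g : Hom m' n' b),
    comp e₃ (hcomp hM' hN' e₂ g f) (perm (blockSwap hM hM')) =
      (a * b).negOnePow • comp e₄ (perm (blockSwap hN hN')) (hcomp hM hN e₁ f g)

structure PROP.Mor {k : Type u} [Field k] (P Q : PROP k) where
  map : ∀ m n i, P.Hom m n i →ₗ[k] Q.Hom m n i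
  map_perm : ∀ {n : ℕ} (σ : Equiv.Perm (Fin n)), map n n 0 (P.perm σ) = Q.perm σ
  map_comp : ∀ {l m n : ℕ} {i j t : ℤ} (e : i + j = t) (f : P.Hom m n i) (g : P.Hom l m j),
    map l n t (P.comp e f g) = Q.comp e (map m n i f) (map l m j g)
  map_hcomp : ∀ {m m' M n n' N : ℕ} {i j t : ℤ} (hM : m + m' = M) (hN : n + n' = N)
    (e : i + j = t) (f : P.Hom m n i) (g : P.Hom m' n' j),
    map M N t (P.hcomp hM hN e f g) = Q.hcomp hM hN e (map m n i f) (map m' n' j g)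

/-- The graded PROP `P` is freely generated by the vector spaces `E s` of operations of degree
`deg s` with `inp s` inputs and `out s` outputs. -/
def PROP.FreelyGenerated {k : Type u} [Field k] (P : PROP.{u} k) {S : Type}
    (inp out : S → ℕ) (deg : S → ℤ) (E : S → Type u)
    [∀ s, AddCommGroup (E s)] [∀ s, Module k (E s)]
    (gen : ∀ s, E s →ₗ[k] P.Hom (inp s) (out s) (deg s)) : Prop :=
  ∀ (Q : PROP.{u} k) (f : ∀ s, E s →ₗ[k] Q.Hom (inp s) (out s) (deg s)),
    ∃! g : P.Mor Q, ∀ s (v : E s), g.map (inp s) (out s) (deg s) (gen s v) = f s v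

/-- A differential (of degree `1`) on a graded PROP. -/
structure PROP.Differential {k : Type u} [Field k] (P : PROP k) where
  d : ∀ {m n : ℕ} {i t : ℤ}, i + 1 = t → (P.Hom m n i →ₗ[k] P.Hom m n t)
  d_d : ∀ {m n : ℕ} {i t t' : ℤ} (h : i + 1 = t) (h' : t + 1 = t') (f : P.Hom m n i),
    d h' (d h f) = 0
  d_perm : ∀ {n : ℕ} {t : ℤ} (h : 0 + 1 = t) (σ : Equiv.Perm (Fin n)), d h (P.perm σ) = 0
  d_comp : ∀ {l m n : ℕ} {i j t i' j' t' : ℤ} (ht : i + j = t)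
    (hi : i + 1 = i') (hj : j + 1 = j') (ht' : t + 1 = t') (h₁ : i' + j = t') (h₂ : i + j' = t')
    (f : P.Hom m n i) (g : P.Hom l m j),
    d ht' (P.comp ht f g) = P.comp h₁ (d hi f) g + i.negOnePow • P.comp h₂ f (d hj g)
  d_hcomp : ∀ {m m' M n n' N : ℕ} {i j t i' j' t' : ℤ} (hM : m + m' = M) (hN : n + n' = N)
    (ht : i + j = t) (hi : i + 1 = i') (hj : j + 1 = j') (ht' : t + 1 = t')
    (h₁ : i' + j = t') (h₂ : i + j' = t') (f : P.Hom m n i) (g : P.Hom m' n' j),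
    d ht' (P.hcomp hM hN ht f g) =
      P.hcomp hM hN h₁ (d hi f) g + i.negOnePow • P.hcomp hM hN h₂ f (d hj g)

/-- A dg PROP. -/
structure DGPROP (k : Type u) [Field k] extends PROP k where
  diff : toPROP.Differential

/-- A dg PROP is semi-free on given generators if the underlying graded PROP is freely generated
by them. -/
def DGPROP.SemiFreeOn {k : Type u} [Field k] (P : DGPROP.{u} k) {S : Type}
    (inp out : S → ℕ) (deg : S → ℤ) (E : S → Type u)
    [∀ s, AddCommGroup (E s)] [∀ s, Module k (E s)]
    (gen : ∀ s, E s →ₗ[k] P.Hom (inp s) (out s) (deg s)) : Prop :=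
  P.toPROP.FreelyGenerated inp out deg E gen

/-- `id ⊗ f ⊗ id`, with identities of `A` factors on the left and of `B` factors on the right. -/
def PROPData.pad {k : Type u} [Field k] (P : PROPData k) {m n M N : ℕ} {i : ℤ} (A B : ℕ)
    (hM : A + m + B = M) (hN : A + n + B = N) : P.Hom m n i →ₗ[k] P.Hom M N i :=
  ((P.hcomp hM hN (add_zero i)).flip (P.perm 1)).comp
    (P.hcomp rfl rfl (zero_add i) (P.perm (1 : Equiv.Perm (Fin A))))

/-! ### The operad of the operations with one output of a PROP -/

section OperadOfPROP

variable {k : Type u} [Field k] (P : PROP k)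

theorem PROP.pad_apply {m n M N : ℕ} {i : ℤ} (A B : ℕ)
    (hM : A + m + B = M) (hN : A + n + B = N) (f : P.Hom m n i) :
    P.pad A B hM hN f = P.hcomp hM hN (add_zero i)
      (P.hcomp rfl rfl (zero_add i) (P.perm (1 : Equiv.Perm (Fin A))) f)
      (P.perm (1 : Equiv.Perm (Fin B))) := rfl

theorem blockSum_one {m m' M : ℕ} (h : m + m' = M) : blockSum h 1 1 = 1 := by
  ext x; simp [blockSum]

theorem blockSum_mul {m m' M : ℕ} (h : m + m' = M) (σ σ' : Equiv.Perm (Fin m))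
    (τ τ' : Equiv.Perm (Fin m')) :
    blockSum h (σ * σ') (τ * τ') = blockSum h σ τ * blockSum h σ' τ' := by
  ext x
  obtain ⟨y, rfl⟩ := (blocks h).surjective x
  rcases y with y | y <;> simp [blockSum]

theorem PROP.one_hcomp_one {m m' M : ℕ} (h : m + m' = M) (e : (0 : ℤ) + 0 = 0) :
    P.hcomp h h e (P.perm (1 : Equiv.Perm (Fin m))) (P.perm (1 : Equiv.Perm (Fin m'))) =
      P.perm 1 := by
  rw [P.perm_hcomp, blockSum_one]

theorem PROP.pad_perm {m M : ℕ} (A B : ℕ) (hM : A + m + B = M) (σ : Equiv.Perm (Fin m)) :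
    P.pad A B hM hM (P.perm σ) = P.perm (blockSum hM (blockSum rfl 1 σ) 1) := by
  rw [P.pad_apply, P.perm_hcomp, P.perm_hcomp]

theorem PROP.pad_one {m M : ℕ} (A B : ℕ) (hM : A + m + B = M) :
    P.pad A B hM hM (P.perm (1 : Equiv.Perm (Fin m))) = P.perm 1 := by
  rw [P.pad_perm, blockSum_one, blockSum_one]

theorem PROP.hcomp_comp_left {l m n C L M N : ℕ} {a b ab : ℤ} (hL : l + C = L) (hM : m + C = M)
    (hN : n + C = N) (e : a + b = ab) (f : P.Hom m n a) (g : P.Hom l m b) :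
    P.hcomp hL hN (add_zero ab) (P.comp e f g) (P.perm (1 : Equiv.Perm (Fin C))) =
      P.comp e (P.hcomp hM hN (add_zero a) f (P.perm 1))
        (P.hcomp hL hM (add_zero b) g (P.perm 1)) := by
  rw [P.interchange hL hM hN _ _ _ e (add_zero 0) (by omega), P.one_comp]
  simp

theorem PROP.hcomp_comp_right {l m n C L M N : ℕ} {a b ab : ℤ} (hL : C + l = L) (hM : C + m = M)
    (hN : C + n = N) (e : a + b = ab) (f : P.Hom m n a) (g : P.Hom l m b) :
    P.hcomp hL hN (zero_add ab) (P.perm (1 : Equiv.Perm (Fin C))) (P.comp e f g) =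
      P.comp e (P.hcomp hM hN (zero_add a) (P.perm 1) f)
        (P.hcomp hL hM (zero_add b) (P.perm 1) g) := by
  rw [P.interchange hL hM hN _ _ _ (add_zero 0) e (by omega), P.one_comp]
  simp

theorem PROP.pad_comp {l m n L M N : ℕ} {a b ab : ℤ} (A B : ℕ) (hL : A + l + B = L)
    (hM : A + m + B = M) (hN : A + n + B = N) (e : a + b = ab)
    (f : P.Hom m n a) (g : P.Hom l m b) :
    P.pad A B hL hN (P.comp e f g) = P.comp e (P.pad A B hM hN f) (P.pad A B hL hM g) := by
  simp only [P.pad_apply]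
  rw [P.hcomp_comp_right rfl rfl rfl e, P.hcomp_comp_left hL hM hN e]

theorem PROP.pad_apply' {m n m' n' M N : ℕ} {i : ℤ} (A B : ℕ) (hm : A + m = m')
    (hn : A + n = n') (hM' : m' + B = M) (hN' : n' + B = N)
    (hM : A + m + B = M) (hN : A + n + B = N) (f : P.Hom m n i) :
    P.pad A B hM hN f = P.hcomp hM' hN' (add_zero i)
      (P.hcomp hm hn (zero_add i) (P.perm (1 : Equiv.Perm (Fin A))) f)
      (P.perm (1 : Equiv.Perm (Fin B))) := by
  subst hm hn; rfl

theorem PROP.pad_pad {m n M N M' N' : ℕ} {i : ℤ} (A B A' B' : ℕ) (hM : A + m + B = M)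
    (hN : A + n + B = N) (hM' : A' + M + B' = M') (hN' : A' + N + B' = N')
    (h₁ : A' + A + m + (B + B') = M') (h₂ : A' + A + n + (B + B') = N') (f : P.Hom m n i) :
    P.pad A' B' hM' hN' (P.pad A B hM hN f) = P.pad (A' + A) (B + B') h₁ h₂ f := by
  rw [P.pad_apply, P.pad_apply, P.pad_apply' (A' + A) (B + B') (m' := A' + (A + m))
    (n' := A' + (A + n)) (by omega) (by omega) (by omega) (by omega)]
  rw [← P.one_hcomp_one (rfl : A' + A = A' + A) (add_zero 0),
    ← P.one_hcomp_one (rfl : B + B' = B + B') (add_zero 0)]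
  rw [← P.hcomp_assoc (m₁₂ := A' + (A + m)) (n₁₂ := A' + (A + n)) rfl (by omega) hM rfl
    rfl (by omega) hN rfl (zero_add i) (add_zero i) (add_zero i) (zero_add i)]
  rw [P.hcomp_assoc (m₁ := A' + (A + m)) (n₁ := A' + (A + n)) (by omega) hM' rfl (by omega)
    (by omega) hN' rfl (by omega) (add_zero i) (add_zero i) (add_zero 0) (add_zero i)]
  rw [P.hcomp_assoc (m₁ := A') (m₂ := A) (m₃ := m) (n₁ := A') (n₂ := A) (n₃ := n)
    rfl (by omega) rfl rfl rfl (by omega) rfl rfl (add_zero 0) (zero_add i) (zero_add i)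
    (zero_add i)]

/-- Operations that are applied to disjoint blocks commute up to the Koszul sign. -/
theorem PROP.pad_comm {m n m' n' L M₁ M₂ N : ℕ} {a b ab : ℤ} (A B C : ℕ)
    (e₁ : a + b = ab) (e₂ : b + a = ab)
    (h₁ : A + m + (B + n' + C) = M₁) (h₂ : A + n + (B + n' + C) = N)
    (h₃ : A + m + B + m' + C = L) (h₄ : A + m + B + n' + C = M₁)
    (h₅ : A + n + B + m' + C = M₂) (h₆ : A + n + B + n' + C = N)
    (h₇ : A + m + (B + m' + C) = L) (h₈ : A + n + (B + m' + C) = M₂)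
    (f : P.Hom m n a) (g : P.Hom m' n' b) :
    P.comp e₁ (P.pad A (B + n' + C) h₁ h₂ f) (P.pad (A + m + B) C h₃ h₄ g) =
      (a * b).negOnePow • P.comp e₂ (P.pad (A + n + B) C h₅ h₆ g)
        (P.pad A (B + m' + C) h₇ h₈ f) := by
  have key : ∀ (x X Y : ℕ) (hX : x + B + m' + C = X) (hY : x + B + n' + C = Y)
      (hX' : x + (B + m' + C) = X) (hY' : x + (B + n' + C) = Y),
      P.pad (x + B) C hX hY g = P.hcomp hX' hY' (zero_add b) (P.perm 1) (P.pad B C rfl rfl g) := by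
    intro x X Y hX hY hX' hY'
    rw [← P.hcomp_one (i := b) (m := X) (n := Y) rfl rfl (add_zero b) (P.hcomp hX' hY' _ _ _),
      ← P.one_hcomp_one (m := 0) (m' := 0) rfl (add_zero 0)]
    have := P.pad_pad B C x 0 (rfl : B + m' + C = _) (rfl : B + n' + C = _)
      (by omega : _ = X) (by omega : _ = Y) (by omega) (by omega) g
    rw [P.one_hcomp_one]
    rw [P.pad_apply' x 0 hX' hY' rfl rfl] at this
    exact this.symm
  rw [key (A + m) _ _ h₃ h₄ h₇ h₁, key (A + n) _ _ h₅ h₆ h₈ h₂, P.pad_apply A (B + n' + C),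
    P.pad_apply A (B + m' + C),
    P.interchange h₇ h₁ h₂ _ _ _ (add_zero a) (zero_add b) e₁, P.interchange h₇ h₈ h₂ _ _ _
    (zero_add a) (add_zero b) e₁, P.one_comp, P.comp_one, P.one_comp, P.comp_one, smul_smul]
  simp [mul_comm b a]

theorem blockSum_val_left {m m' M : ℕ} (h : m + m' = M) (σ : Equiv.Perm (Fin m))
    (τ : Equiv.Perm (Fin m')) (x : Fin M) (y : Fin m) (hx : (x : ℕ) = y) :
    (blockSum h σ τ x : ℕ) = σ y := by
  have : x = blocks h (Sum.inl y) := Fin.ext (by simp [blocks, hx])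
  subst this
  simp [blockSum, blocks]

theorem blockSum_val_right {m m' M : ℕ} (h : m + m' = M) (σ : Equiv.Perm (Fin m))
    (τ : Equiv.Perm (Fin m')) (x : Fin M) (y : Fin m') (hx : (x : ℕ) = m + y) :
    (blockSum h σ τ x : ℕ) = m + τ y := by
  have : x = blocks h (Sum.inr y) := Fin.ext (by simp [blocks, hx])
  subst this
  simp [blockSum, blocks]

theorem blockSwap_val {m m' M : ℕ} (h : m + m' = M) (h' : m' + m = M) (x : Fin M) :
    (blockSwap h h' x : ℕ) = if (x : ℕ) < m then (x : ℕ) + m' else x - m := by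
  obtain ⟨y, rfl⟩ := (blocks h).surjective x
  rcases y with y | y
  · simp [blockSwap, blocks, add_comm]
  · simp [blockSwap, blocks]

/-- The permutation that moves the first block, of size `n`, behind the second one, of size `A`. -/
def toFront {n M : ℕ} (A B : ℕ) (hM : A + n + B = M) : Equiv.Perm (Fin M) :=
  blockSum hM (blockSwap (m := n) (m' := A) (add_comm n A) rfl) 1

theorem toFront_val {n M : ℕ} (A B : ℕ) (hM : A + n + B = M) (x : Fin M) :
    (toFront A B hM x : ℕ) =
      if (x : ℕ) < n then (x : ℕ) + A else if (x : ℕ) < n + A then x - n else x := by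
  by_cases hx : (x : ℕ) < A + n
  · rw [toFront, blockSum_val_left hM _ _ x ⟨x, hx⟩ rfl, blockSwap_val]
    grind
  · have h1 : (x : ℕ) - (A + n) < B := by omega
    rw [toFront, blockSum_val_right hM _ _ x ⟨x - (A + n), h1⟩ (by simp; omega)]
    simp
    split_ifs <;> omega

theorem PROP.pad_toFront {m n M N C : ℕ} {i : ℤ} (A B : ℕ) (hC : A + B = C)
    (hM : A + m + B = M) (hN : A + n + B = N) (hM' : m + C = M) (hN' : n + C = N)
    (f : P.Hom m n i) :
    P.comp (add_zero i) (P.pad A B hM hN f) (P.perm (toFront A B hM)) =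
      P.comp (zero_add i) (P.perm (toFront A B hN))
        (P.hcomp hM' hN' (add_zero i) f (P.perm (1 : Equiv.Perm (Fin C)))) := by
  subst hC
  have h := P.symmetry (add_comm m A) rfl (add_comm n A) rfl (add_zero i) (zero_add i)
    (add_zero i) (zero_add i) f (P.perm (1 : Equiv.Perm (Fin A)))
  have h1 : P.perm (toFront A B hM) = P.hcomp hM hM (add_zero 0)
      (P.perm (blockSwap (m := m) (m' := A) (add_comm m A) rfl)) (P.perm 1) := by
    rw [P.perm_hcomp]; rfl
  have h2 : P.perm (toFront A B hN) = P.hcomp hN hN (add_zero 0)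
      (P.perm (blockSwap (m := n) (m' := A) (add_comm n A) rfl)) (P.perm 1) := by
    rw [P.perm_hcomp]; rfl
  rw [h1, h2, P.pad_apply, ← P.hcomp_comp_left hM hM hN, h,
    ← P.one_hcomp_one (rfl : A + B = A + B) (add_zero 0),
    ← P.hcomp_assoc (add_comm m A) hM rfl hM' (add_comm n A) hN rfl hN' (add_zero i) (add_zero i)
      (add_zero 0) (add_zero i),
    ← P.hcomp_comp_left hM hN hN]
  simp

theorem exists_blockSum {q M : ℕ} (h : 1 + q = M) (π : Equiv.Perm (Fin M))
    (hπ : ∀ x : Fin M, (x : ℕ) = 0 → (π x : ℕ) = 0) : ∃ ρ, π = blockSum h 1 ρ := by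
  let π' : Equiv.Perm (Fin 1 ⊕ Fin q) := (blocks h).trans (π.trans (blocks h).symm)
  have hm : Set.MapsTo π' (Set.range Sum.inl) (Set.range Sum.inl) := by
    rintro _ ⟨y, rfl⟩
    refine ⟨0, ?_⟩
    have : π (blocks h (Sum.inl y)) = blocks h (Sum.inl 0) := Fin.ext (by
      rw [hπ] <;> simp [blocks])
    simp [π', this]
  obtain ⟨⟨σ, ρ⟩, hρ⟩ := Equiv.Perm.mem_sumCongrHom_range_of_perm_mapsTo_inl hm
  refine ⟨ρ, ?_⟩
  have hσ : σ = 1 := Subsingleton.elim _ _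
  subst hσ
  have : π = (blocks h).symm.trans (π'.trans (blocks h)) := by ext x; simp [π']
  rw [this, ← hρ]
  rfl

theorem PROP.perm_comp_pad {n m l : ℕ} {j : ℤ} (A B A' B' : ℕ)
    (hm : A + 1 + B = m) (hl : A + n + B = l) (hm' : A' + 1 + B' = m) (hl' : A' + n + B' = l)
    (σ : Equiv.Perm (Fin m)) (s : Fin m) (hs : (s : ℕ) = A) (hs' : (σ s : ℕ) = A')
    (ρ : Equiv.Perm (Fin l)) (hρ : IsBlockPerm σ s (1 : Equiv.Perm (Fin n)) ρ)
    (y : P.Hom n 1 j) :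
    P.comp (zero_add j) (P.perm σ) (P.pad A B hl hm y) =
      P.comp (add_zero j) (P.pad A' B' hl' hm' y) (P.perm ρ) := by
  obtain ⟨ρ₀, h₀⟩ := exists_blockSum (q := A + B) (M := m) (by omega)
    ((toFront A' B' hm')⁻¹ * σ * toFront A B hm) (by
      intro x hx
      have h1 : toFront A B hm x = s := Fin.ext (by rw [toFront_val, hx, hs]; simp)
      have h2 : σ s = toFront A' B' hm' x := Fin.ext (by rw [toFront_val, hx, hs']; simp)
      simp [Equiv.Perm.mul_apply, h1, h2, hx])
  have hσ : σ * toFront A B hm = toFront A' B' hm' * blockSum (by omega : 1 + (A + B) = m) 1 ρ₀ := by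
    rw [← h₀]; group
  have hAB : A' + B' = A + B := by omega
  have k1 : 1 + (A + B) = m := by omega
  have k2 : n + (A + B) = l := by omega
  have hr : ρ * toFront A B hl = toFront A' B' hl' * blockSum k2 1 ρ₀ := by
    ext x
    simp only [Equiv.Perm.mul_apply]
    by_cases hx : (x : ℕ) < n
    · have h1 : (toFront A B hl x : ℕ) = A + x := by rw [toFront_val]; split_ifs; omega
      rw [hρ.2 _ ⟨x, hx⟩ (by simp [h1, hs]), toFront_val,
        blockSum_val_left _ _ _ x ⟨x, hx⟩ rfl]
      simp [hx, hs', add_comm]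
    · have hx2 : (x : ℕ) - n < A + B := by omega
      set w : Fin (A + B) := ⟨x - n, hx2⟩ with hw
      have hb := blockSum_val_right (m := n) (M := l) (by omega) 1 ρ₀ x w (by simp [hw]; omega)
      have hz : 1 + (w : ℕ) < m := by omega
      set z : Fin m := ⟨1 + w, hz⟩ with hzd
      have hb' := blockSum_val_right (m := 1) (M := m) (by omega) 1 ρ₀ z w (by simp [hzd])
      have hc := congrArg (fun π : Equiv.Perm (Fin m) => (π z : ℕ)) hσ
      simp only [Equiv.Perm.mul_apply] at hc
      rw [toFront_val A' B', hb'] at hc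
      have ha := toFront_val A B hm z
      have hne : toFront A B hm z ≠ s := by
        intro h
        rw [h, hs] at ha
        simp only [hzd, hw] at ha
        split_ifs at ha <;> omega
      rw [toFront_val A' B', hb, hρ.1 (toFront A B hl x) (toFront A B hm z) hne, hc, hs', shiftPos]
      · have := (ρ₀ w).isLt
        split_ifs <;> omega
      · rw [ha, toFront_val, hs, shiftPos]
        simp only [hzd, hw]
        split_ifs <;> omega
  have c1 := P.pad_toFront A B rfl hl hm k2 k1 y
  have c2 := P.pad_toFront A' B' hAB hl' hm' k2 k1 y
  have c3 : P.comp (zero_add j) (P.perm (blockSum k1 1 ρ₀))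
      (P.hcomp k2 k1 (add_zero j) y (P.perm 1)) =
      P.comp (add_zero j) (P.hcomp k2 k1 (add_zero j) y (P.perm 1))
        (P.perm (blockSum k2 1 ρ₀)) := by
    rw [← P.perm_hcomp k1 (add_zero 0), ← P.perm_hcomp k2 (add_zero 0),
      P.interchange k2 k1 k1 _ _ _ (zero_add j) (add_zero 0) (add_zero j),
      P.interchange k2 k2 k1 _ _ _ (add_zero j) (add_zero 0) (add_zero j)]
    simp only [P.one_comp, P.comp_one, zero_mul, mul_zero]
  have c4 : P.comp (add_zero j) (P.comp (zero_add j) (P.perm σ) (P.pad A B hl hm y))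
      (P.perm (toFront A B hl)) =
      P.comp (add_zero j) (P.comp (add_zero j) (P.pad A' B' hl' hm' y) (P.perm ρ))
      (P.perm (toFront A B hl)) := by
    rw [P.comp_assoc _ _ (add_zero j) (zero_add j), c1,
      ← P.comp_assoc (zero_add 0) (zero_add j), ← P.perm_mul, hσ,
      P.perm_mul (zero_add 0), P.comp_assoc _ _ (zero_add j) (zero_add j), c3,
      ← P.comp_assoc (zero_add j) (add_zero j), ← c2,
      P.comp_assoc _ _ (zero_add 0) (add_zero j), P.comp_assoc _ _ (zero_add 0) (add_zero j),
      ← P.perm_mul, ← P.perm_mul, hr]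
  have c5 := congrArg (fun f => P.comp (add_zero j) f (P.perm (toFront A B hl)⁻¹)) c4
  rw [P.comp_assoc _ _ (zero_add 0) (add_zero j), P.comp_assoc _ _ (zero_add 0) (add_zero j),
    ← P.perm_mul, mul_inv_cancel, P.comp_one, P.comp_one] at c5
  exact c5

theorem PROP.pad_congr {m n M N A B A' B' : ℕ} {i : ℤ} (hA : A = A') (hB : B = B')
    (hM : A + m + B = M) (hN : A + n + B = N) (hM' : A' + m + B' = M) (hN' : A' + n + B' = N)
    (f : P.Hom m n i) : P.pad A B hM hN f = P.pad A' B' hM' hN' f := by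
  subst hA hB; rfl

theorem IsBlockPerm.split {m n l : ℕ} {σ : Equiv.Perm (Fin m)} {s : Fin m}
    {τ : Equiv.Perm (Fin n)} {ρ : Equiv.Perm (Fin l)} (A B : ℕ) (hA : (s : ℕ) = A)
    (hm : A + 1 + B = m) (hl : A + n + B = l) (h : IsBlockPerm σ s τ ρ) :
    IsBlockPerm σ s (1 : Equiv.Perm (Fin n)) (ρ * (blockSum hl (blockSum rfl 1 τ) 1)⁻¹) := by
  set β := blockSum hl (blockSum rfl 1 τ) 1 with hβ
  have key : ∀ c : Fin l, ∃ c', c = β c' := fun c => ⟨β⁻¹ c, by simp⟩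
  have hA1 : ∀ x : Fin l, (x : ℕ) < A → (β x : ℕ) = x := by
    intro x hx
    rw [hβ, blockSum_val_left hl _ _ x ⟨x, by omega⟩ rfl, blockSum_val_left rfl _ _ _ ⟨x, hx⟩ rfl]
    rfl
  have hB1 : ∀ x : Fin l, A + n ≤ (x : ℕ) → (β x : ℕ) = x := by
    intro x hx
    rw [hβ, blockSum_val_right hl _ _ x ⟨x - (A + n), by omega⟩ (by simp; omega)]
    simp; omega
  have hn1 : ∀ (x : Fin l) (b : Fin n), (x : ℕ) = A + b → (β x : ℕ) = A + τ b := by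
    intro x b hx
    rw [hβ, blockSum_val_left hl _ _ x ⟨x, by omega⟩ rfl, blockSum_val_right rfl _ _ _ b hx]
  have hcase : ∀ x : Fin l, (x : ℕ) < A ∨ A + n ≤ (x : ℕ) ∨ ∃ b : Fin n, (x : ℕ) = A + b := by
    intro x
    by_cases h1 : (x : ℕ) < A
    · exact Or.inl h1
    by_cases h2 : A + n ≤ (x : ℕ)
    · exact Or.inr (Or.inl h2)
    · exact Or.inr (Or.inr ⟨⟨x - A, by omega⟩, by simp; omega⟩)
  refine ⟨fun c a ha hc => ?_, fun c b hc => ?_⟩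
  · obtain ⟨c', rfl⟩ := key c
    have hne : (a : ℕ) ≠ s := fun h => ha (Fin.ext h)
    have hcc : (c' : ℕ) = shiftPos n s a := by
      rcases hcase c' with h1 | h1 | ⟨b, h1⟩
      · rw [← hc, hA1 _ h1]
      · rw [← hc, hB1 _ h1]
      · have := hn1 _ _ h1
        have := (τ b).isLt
        rw [shiftPos] at hc
        split_ifs at hc <;> omega
    simpa using h.1 c' a ha hcc
  · obtain ⟨c', rfl⟩ := key c
    rcases hcase c' with h1 | h1 | ⟨b', h1⟩
    · have := hA1 _ h1
      omega
    · have := hB1 _ h1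
      omega
    · have h2 := hn1 _ _ h1
      have h3 : τ b' = b := Fin.ext (by omega)
      subst h3
      simpa using h.2 c' b' (by omega)

/-- The operad formed by the operations with one output of a graded PROP:
`x ∘ₛ y = x ∘ (id ⊗ y ⊗ id)`, and permutations act by precomposition. -/
def PROP.operad : SymOperad k where
  obj n i := P.Hom n 1 i
  one := P.perm 1
  circ {m n l _ _ _} s hl ht :=
    (P.comp ht).compl₂ (P.pad (s : ℕ) (m - 1 - s) (by omega) (by omega))
  act σ := (P.comp (add_zero _)).flip (P.perm σ)
  one_circ s hl ht y := by
    simp only [LinearMap.compl₂_apply, P.one_comp]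
    rw [P.pad_congr (A' := 0) (B' := 0) (by omega) (by omega) _ _ (by omega) (by omega),
      P.pad_apply' 0 0 (zero_add _) rfl rfl rfl, P.hcomp_one, P.one_hcomp]
  circ_one s hl ht x := by
    simp only [LinearMap.compl₂_apply, P.pad_one, P.comp_one]
  circ_seq {m n p l l' q _ _ _ _ _ _} s r sr hsr h₁ h₂ h₃ h₄ e₁ e₂ e₃ e₄ x y z := by
    simp only [LinearMap.compl₂_apply]
    rw [P.pad_comp (M := l) (s : ℕ) (m - 1 - s) (by omega) (by omega) (by omega) e₃,
      P.pad_pad (r : ℕ) (n - 1 - r) (s : ℕ) (m - 1 - s) _ _ _ _ (by omega) (by omega),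
      P.comp_assoc e₁ e₂ e₃ e₄]
    rw [P.pad_congr (A' := (sr : ℕ)) (B' := l - 1 - sr) hsr.symm (by omega) _ _ (by omega)
      (by omega)]
  circ_par {m n p l l' q a b c _ _ _} s r hsr r' s' hr' hs' h₁ h₂ h₃ h₄ e₁ e₂ e₃ e₄ x y z := by
    have hsr' : (s : ℕ) < r := hsr
    simp only [LinearMap.compl₂_apply]
    rw [P.comp_assoc e₁ e₂ rfl (by omega), P.comp_assoc e₃ e₄ (add_comm c b) (by omega)]
    rw [P.pad_congr (A := (r' : ℕ)) (A' := s + n + (r - s - 1)) (B' := m - 1 - r) (by omega)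
        (by omega) _ _ (by omega) (by omega),
      P.pad_congr (A := (s : ℕ)) (A' := s) (B' := (r - s - 1) + 1 + (m - 1 - r)) rfl
        (by omega) _ _ (by omega) (by omega),
      P.pad_congr (A := (r : ℕ)) (A' := s + 1 + (r - s - 1)) (B' := m - 1 - r) (by omega)
        (by omega) _ _ (by omega) (by omega),
      P.pad_congr (A := (s' : ℕ)) (A' := s) (B' := (r - s - 1) + p + (m - 1 - r)) (by omega)
        (by omega) _ _ (by omega) (by omega),
      P.pad_comm (M₂ := l') (s : ℕ) (r - s - 1) (m - 1 - r) rfl (add_comm c b)]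
    · simp
    all_goals omega
  act_one x := by simp [P.comp_one]
  act_mul σ τ x := by
    simp only [LinearMap.flip_apply]
    rw [P.perm_mul (add_zero 0), P.comp_assoc (add_zero _) (add_zero _)]
  act_circ {m n l i j t} s hl ht σ τ ρ hρ x y := by
    simp only [LinearMap.compl₂_apply, LinearMap.flip_apply]
    have hs := s.isLt
    have hσ := (σ s).isLt
    have k1 : (s : ℕ) + n + (m - 1 - s) = l := by omega
    rw [P.pad_comp (s : ℕ) (m - 1 - s) k1 k1 (by omega) (add_zero j), P.pad_perm,
      P.comp_assoc (add_zero i) ht (zero_add j) ht,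
      ← P.comp_assoc (zero_add j) (add_zero j) (add_zero j) (zero_add j),
      P.perm_comp_pad (s : ℕ) (m - 1 - s) (σ s : ℕ) (m - 1 - σ s) _ _ (by omega) (by omega)
        σ s rfl rfl _ (hρ.split (s : ℕ) (m - 1 - s) rfl (by omega) k1),
      P.comp_assoc _ _ (add_zero 0) (add_zero j), ← P.perm_mul, inv_mul_cancel_right,
      P.comp_assoc ht (add_zero t) (add_zero j) ht]

theorem PROP.Differential.d_comp_perm {P : PROP k} (D : P.Differential) {l m : ℕ} {i t : ℤ}
    (h : i + 1 = t) (σ : Equiv.Perm (Fin l)) (x : P.Hom l m i) :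
    D.d h (P.comp (add_zero i) x (P.perm σ)) = P.comp (add_zero t) (D.d h x) (P.perm σ) := by
  rw [D.d_comp (add_zero i) h rfl h (add_zero t) (by omega), D.d_perm]
  simp

theorem PROP.Differential.d_pad {P : PROP k} (D : P.Differential) {m n M N : ℕ} {i t : ℤ}
    (A B : ℕ) (hM : A + m + B = M) (hN : A + n + B = N) (h : i + 1 = t) (x : P.Hom m n i) :
    D.d h (P.pad A B hM hN x) = P.pad A B hM hN (D.d h x) := by
  rw [P.pad_apply, P.pad_apply, D.d_hcomp _ _ _ h rfl h (add_zero t) (by omega), D.d_perm,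
    D.d_hcomp _ _ _ rfl h h (by omega) (zero_add t), D.d_perm]
  simp

theorem PROP.Differential.d_comp_pad {P : PROP k} (D : P.Differential) {m n l N A B : ℕ}
    {i j t i' j' t' : ℤ} (hM : A + n + B = l) (hN : A + 1 + B = m) (ht : i + j = t)
    (hi : i + 1 = i') (hj : j + 1 = j') (ht' : t + 1 = t') (h₁ : i' + j = t') (h₂ : i + j' = t')
    (x : P.Hom m N i) (y : P.Hom n 1 j) :
    D.d ht' (P.comp ht x (P.pad A B hM hN y)) = P.comp h₁ (D.d hi x) (P.pad A B hM hN y) +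
      i.negOnePow • P.comp h₂ x (P.pad A B hM hN (D.d hj y)) := by
  rw [D.d_comp ht hi hj ht' h₁ h₂, D.d_pad]

/-- The dg operad formed by the operations with one output of a dg PROP. -/
def DGPROP.operad (Q : DGPROP k) : DGOperad k where
  toSymOperad := Q.toPROP.operad
  d h := Q.diff.d h
  d_d h h' x := Q.diff.d_d h h' x
  d_act h σ x := Q.diff.d_comp_perm h σ x
  d_circ _ _ ht hi hj ht' h₁ h₂ x y :=
    Q.diff.d_comp_pad _ _ ht hi hj ht' h₁ h₂ x y

end OperadOfPROP
/-! ### Graded PROPs presented by generators and relations -/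

section Presentation

variable (k : Type u) [Field k] (G : ℕ → ℕ → ℤ → Type u)

/-- Formal compositions and tensor products of generators and permutations. -/
inductive Term : ℕ → ℕ → ℤ → Type u
  | gen {m n : ℕ} {i : ℤ} (g : G m n i) : Term m n i
  | perm {n : ℕ} (σ : Equiv.Perm (Fin n)) : Term n n 0
  | comp {l m n : ℕ} {i j t : ℤ} (e : i + j = t) (f : Term m n i) (g : Term l m j) : Term l n t
  | hcomp {m m' M n n' N : ℕ} {i j t : ℤ} (hM : m + m' = M) (hN : n + n' = N) (e : i + j = t)
      (f : Term m n i) (g : Term m' n' j) : Term M N t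

/-- Formal linear combinations of terms. -/
noncomputable def termData : PROPData k where
  Hom m n i := Term G m n i →₀ k
  perm σ := Finsupp.single (Term.perm σ) 1
  comp e := Finsupp.linearCombination k fun f => Finsupp.lmapDomain k k fun g => Term.comp e f g
  hcomp hM hN e := Finsupp.linearCombination k fun f =>
    Finsupp.lmapDomain k k fun g => Term.hcomp hM hN e f g

variable {k} {G}

/-- The ideal of `termData k G` that is generated by the differences of the two sides of the
relations `R` and of the axioms of a PROP. -/
inductive PROPIdeal (R : ∀ m n i, (termData k G).Hom m n i → (termData k G).Hom m n i → Prop) :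
    ∀ {m n : ℕ} {i : ℤ}, (termData k G).Hom m n i → Prop
  | rel {m n : ℕ} {i : ℤ} {f g : (termData k G).Hom m n i} : R m n i f g → PROPIdeal R (f - g)
  | zero {m n : ℕ} {i : ℤ} : PROPIdeal R (0 : (termData k G).Hom m n i)
  | add {m n : ℕ} {i : ℤ} {f g : (termData k G).Hom m n i} :
      PROPIdeal R f → PROPIdeal R g → PROPIdeal R (f + g)
  | smul {m n : ℕ} {i : ℤ} (c : k) {f : (termData k G).Hom m n i} :
      PROPIdeal R f → PROPIdeal R (c • f)
  | comp_left {l m n : ℕ} {i j t : ℤ} (e : i + j = t) {f : (termData k G).Hom m n i}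
      (g : (termData k G).Hom l m j) : PROPIdeal R f → PROPIdeal R ((termData k G).comp e f g)
  | comp_right {l m n : ℕ} {i j t : ℤ} (e : i + j = t) (f : (termData k G).Hom m n i)
      {g : (termData k G).Hom l m j} : PROPIdeal R g → PROPIdeal R ((termData k G).comp e f g)
  | hcomp_left {m m' M n n' N : ℕ} {i j t : ℤ} (hM : m + m' = M) (hN : n + n' = N) (e : i + j = t)
      {f : (termData k G).Hom m n i} (g : (termData k G).Hom m' n' j) :
      PROPIdeal R f → PROPIdeal R ((termData k G).hcomp hM hN e f g)
  | hcomp_right {m m' M n n' N : ℕ} {i j t : ℤ} (hM : m + m' = M) (hN : n + n' = N)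
      (e : i + j = t) (f : (termData k G).Hom m n i) {g : (termData k G).Hom m' n' j} :
      PROPIdeal R g → PROPIdeal R ((termData k G).hcomp hM hN e f g)
  | comp_assoc {p l m n : ℕ} {a b c ab bc abc : ℤ} (e₁ : a + b = ab) (e₂ : ab + c = abc)
      (e₃ : b + c = bc) (e₄ : a + bc = abc) (f : (termData k G).Hom m n a)
      (g : (termData k G).Hom l m b) (h : (termData k G).Hom p l c) :
      PROPIdeal R ((termData k G).comp e₂ ((termData k G).comp e₁ f g) h -
        (termData k G).comp e₄ f ((termData k G).comp e₃ g h))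
  | one_comp {m n : ℕ} {i : ℤ} (e : 0 + i = i) (f : (termData k G).Hom m n i) :
      PROPIdeal R ((termData k G).comp e ((termData k G).perm 1) f - f)
  | comp_one {m n : ℕ} {i : ℤ} (e : i + 0 = i) (f : (termData k G).Hom m n i) :
      PROPIdeal R ((termData k G).comp e f ((termData k G).perm 1) - f)
  | perm_mul {n : ℕ} (e : (0 : ℤ) + 0 = 0) (σ τ : Equiv.Perm (Fin n)) :
      PROPIdeal R ((termData k G).perm (σ * τ) -
        (termData k G).comp e ((termData k G).perm σ) ((termData k G).perm τ))
  | hcomp_assoc {m₁ m₂ m₃ m₁₂ m₂₃ M n₁ n₂ n₃ n₁₂ n₂₃ N : ℕ} {a b c ab bc abc : ℤ}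
      (hm₁ : m₁ + m₂ = m₁₂) (hm₂ : m₁₂ + m₃ = M) (hm₃ : m₂ + m₃ = m₂₃) (hm₄ : m₁ + m₂₃ = M)
      (hn₁ : n₁ + n₂ = n₁₂) (hn₂ : n₁₂ + n₃ = N) (hn₃ : n₂ + n₃ = n₂₃) (hn₄ : n₁ + n₂₃ = N)
      (e₁ : a + b = ab) (e₂ : ab + c = abc) (e₃ : b + c = bc) (e₄ : a + bc = abc)
      (f : (termData k G).Hom m₁ n₁ a) (g : (termData k G).Hom m₂ n₂ b)
      (h : (termData k G).Hom m₃ n₃ c) :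
      PROPIdeal R ((termData k G).hcomp hm₂ hn₂ e₂ ((termData k G).hcomp hm₁ hn₁ e₁ f g) h -
        (termData k G).hcomp hm₄ hn₄ e₄ f ((termData k G).hcomp hm₃ hn₃ e₃ g h))
  | one_hcomp {m n : ℕ} {i : ℤ} (hm : 0 + m = m) (hn : 0 + n = n) (e : 0 + i = i)
      (f : (termData k G).Hom m n i) :
      PROPIdeal R ((termData k G).hcomp hm hn e
        ((termData k G).perm (1 : Equiv.Perm (Fin 0))) f - f)
  | hcomp_one {m n : ℕ} {i : ℤ} (hm : m + 0 = m) (hn : n + 0 = n) (e : i + 0 = i)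
      (f : (termData k G).Hom m n i) :
      PROPIdeal R ((termData k G).hcomp hm hn e f
        ((termData k G).perm (1 : Equiv.Perm (Fin 0))) - f)
  | perm_hcomp {m m' M : ℕ} (h : m + m' = M) (e : (0 : ℤ) + 0 = 0) (σ : Equiv.Perm (Fin m))
      (τ : Equiv.Perm (Fin m')) :
      PROPIdeal R ((termData k G).hcomp h h e ((termData k G).perm σ) ((termData k G).perm τ) -
        (termData k G).perm (blockSum h σ τ))
  | interchange {l m n l' m' n' L M N : ℕ} {a b c d ab cd ac bd t : ℤ}
      (hL : l + l' = L) (hM : m + m' = M) (hN : n + n' = N)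
      (e₁ : a + b = ab) (e₂ : c + d = cd) (e₃ : ab + cd = t)
      (e₄ : a + c = ac) (e₅ : b + d = bd) (e₆ : ac + bd = t)
      (f : (termData k G).Hom m n a) (g : (termData k G).Hom m' n' b)
      (f' : (termData k G).Hom l m c) (g' : (termData k G).Hom l' m' d) :
      PROPIdeal R ((termData k G).comp e₃ ((termData k G).hcomp hM hN e₁ f g)
          ((termData k G).hcomp hL hM e₂ f' g') -
        (b * c).negOnePow • (termData k G).hcomp hL hN e₆ ((termData k G).comp e₄ f f')
          ((termData k G).comp e₅ g g'))
  | symmetry {m n m' n' M N : ℕ} {a b ab : ℤ} (hM : m + m' = M) (hM' : m' + m = M)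
      (hN : n + n' = N) (hN' : n' + n = N) (e₁ : a + b = ab) (e₂ : b + a = ab)
      (e₃ : ab + 0 = ab) (e₄ : 0 + ab = ab) (f : (termData k G).Hom m n a)
      (g : (termData k G).Hom m' n' b) :
      PROPIdeal R ((termData k G).comp e₃ ((termData k G).hcomp hM' hN' e₂ g f)
          ((termData k G).perm (blockSwap hM hM')) -
        (a * b).negOnePow • (termData k G).comp e₄ ((termData k G).perm (blockSwap hN hN'))
          ((termData k G).hcomp hM hN e₁ f g))

variable (R : ∀ m n i, (termData k G).Hom m n i → (termData k G).Hom m n i → Prop)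

/-- The ideal `PROPIdeal R` in a given biarity and degree. -/
def relSubmodule (m n : ℕ) (i : ℤ) : Submodule k ((termData k G).Hom m n i) where
  carrier := {f | PROPIdeal R f}
  add_mem' := PROPIdeal.add
  zero_mem' := PROPIdeal.zero
  smul_mem' c _ := PROPIdeal.smul c

/-- A bilinear map descends to quotients. -/
def liftBilin {A B C : Type u} [AddCommGroup A] [Module k A] [AddCommGroup B] [Module k B]
    [AddCommGroup C] [Module k C] (f : A →ₗ[k] B →ₗ[k] C) (I : Submodule k A) (J : Submodule k B)
    (K : Submodule k C) (hI : ∀ a ∈ I, ∀ b, f a b ∈ K) (hJ : ∀ a, ∀ b ∈ J, f a b ∈ K) :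
    (A ⧸ I) →ₗ[k] (B ⧸ J) →ₗ[k] (C ⧸ K) :=
  I.liftQ (J.liftQ (f.compr₂ K.mkQ).flip (fun b hb => by
      ext a; simpa using hJ a b hb)).flip (fun a ha => by
    refine Submodule.linearMap_qext _ (LinearMap.ext fun b => ?_)
    exact (Submodule.Quotient.mk_eq_zero K).2 (hI a ha b))

/-- The graded PROP with generators `G` and relations `R`. -/
noncomputable def presented : PROP k where
  Hom m n i := (termData k G).Hom m n i ⧸ relSubmodule R m n i
  perm σ := Submodule.Quotient.mk ((termData k G).perm σ)
  comp {l m n i j t} e := liftBilin ((termData k G).comp e) (relSubmodule R m n i)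
    (relSubmodule R l m j) (relSubmodule R l n t) (fun _ ha b => PROPIdeal.comp_left e b ha)
    (fun a _ hb => PROPIdeal.comp_right e a hb)
  hcomp {m m' M n n' N i j t} hM hN e := liftBilin ((termData k G).hcomp hM hN e)
    (relSubmodule R m n i) (relSubmodule R m' n' j) (relSubmodule R M N t)
    (fun _ ha b => PROPIdeal.hcomp_left hM hN e b ha)
    (fun a _ hb => PROPIdeal.hcomp_right hM hN e a hb)
  comp_assoc e₁ e₂ e₃ e₄ f g h := by
    induction f using Submodule.Quotient.induction_on with | _ f
    induction g using Submodule.Quotient.induction_on with | _ g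
    induction h using Submodule.Quotient.induction_on with | _ h
    exact (Submodule.Quotient.eq _).2 (PROPIdeal.comp_assoc e₁ e₂ e₃ e₄ f g h)
  one_comp e f := by
    induction f using Submodule.Quotient.induction_on with | _ f
    exact (Submodule.Quotient.eq _).2 (PROPIdeal.one_comp e f)
  comp_one e f := by
    induction f using Submodule.Quotient.induction_on with | _ f
    exact (Submodule.Quotient.eq _).2 (PROPIdeal.comp_one e f)
  perm_mul e σ τ := (Submodule.Quotient.eq _).2 (PROPIdeal.perm_mul e σ τ)
  hcomp_assoc hm₁ hm₂ hm₃ hm₄ hn₁ hn₂ hn₃ hn₄ e₁ e₂ e₃ e₄ f g h := by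
    induction f using Submodule.Quotient.induction_on with | _ f
    induction g using Submodule.Quotient.induction_on with | _ g
    induction h using Submodule.Quotient.induction_on with | _ h
    exact (Submodule.Quotient.eq _).2
      (PROPIdeal.hcomp_assoc hm₁ hm₂ hm₃ hm₄ hn₁ hn₂ hn₃ hn₄ e₁ e₂ e₃ e₄ f g h)
  one_hcomp hm hn e f := by
    induction f using Submodule.Quotient.induction_on with | _ f
    exact (Submodule.Quotient.eq _).2 (PROPIdeal.one_hcomp hm hn e f)
  hcomp_one hm hn e f := by
    induction f using Submodule.Quotient.induction_on with | _ f
    exact (Submodule.Quotient.eq _).2 (PROPIdeal.hcomp_one hm hn e f)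
  perm_hcomp h e σ τ := (Submodule.Quotient.eq _).2 (PROPIdeal.perm_hcomp h e σ τ)
  interchange hL hM hN e₁ e₂ e₃ e₄ e₅ e₆ f g f' g' := by
    induction f using Submodule.Quotient.induction_on with | _ f
    induction g using Submodule.Quotient.induction_on with | _ g
    induction f' using Submodule.Quotient.induction_on with | _ f'
    induction g' using Submodule.Quotient.induction_on with | _ g'
    exact (Submodule.Quotient.eq _).2
      (PROPIdeal.interchange hL hM hN e₁ e₂ e₃ e₄ e₅ e₆ f g f' g')
  symmetry hM hM' hN hN' e₁ e₂ e₃ e₄ f g := by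
    induction f using Submodule.Quotient.induction_on with | _ f
    induction g using Submodule.Quotient.induction_on with | _ g
    exact (Submodule.Quotient.eq _).2
      (PROPIdeal.symmetry hM hM' hN hN' e₁ e₂ e₃ e₄ f g)

/-- The class of a generator in the presented PROP. -/
noncomputable def presentedGen {m n : ℕ} {i : ℤ} (g : G m n i) : (presented R).Hom m n i :=
  Submodule.Quotient.mk (Finsupp.single (Term.gen g) 1)

end Presentation

/-! ### The dg PROP that governs the `X`-algebras with unit on the coalgebras `T V` -/

section GoverningPROP

variable {k : Type u} [Field k] (X : CoalgOperad k)

/-- The generators: `phi κ _ r x` is the operation `φ(x)^r_{κ₁…κₙ} : T^{κ₁} V ⊗ … ⊗ T^{κₙ} V → T^r V`,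
and `D l m` is the component `D_l^m : T^l V → T^m V` of the differential of `T V`. -/
inductive Gen : ℕ → ℕ → ℤ → Type u
  | phi {n M : ℕ} {i : ℤ} (κ : Fin n → ℕ) (hM : ∑ j, κ j = M) (r : ℕ) (x : X.obj n i) : Gen M r i
  | D (l m : ℕ) : Gen l m 1

theorem sum_split {n M : ℕ} {κ : Fin n → ℕ} (p : ∀ j, Fin (κ j + 1)) (hM : ∑ j, κ j = M) :
    ∑ j, (p j : ℕ) + ∑ j, (κ j - p j) = M := by
  rw [← Finset.sum_add_distrib, ← hM]
  exact Finset.sum_congr rfl fun j _ => by have := (p j).isLt; omega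

/-- The permutation of the tensor factors
`T^{κ₁} V ⊗ … ⊗ T^{κₙ} V → (T^{p₁} V ⊗ … ⊗ T^{pₙ} V) ⊗ (T^{κ₁ - p₁} V ⊗ … ⊗ T^{κₙ - pₙ} V)`
that splits the `j`-th word after its `pⱼ`-th letter. -/
def unshuffle {n M : ℕ} (κ : Fin n → ℕ) (p : ∀ j, Fin (κ j + 1)) (hM : ∑ j, κ j = M) :
    Equiv.Perm (Fin M) :=
  (finCongr hM.symm).trans <| finSigmaFinEquiv.symm.trans <|
    (Equiv.sigmaCongrRight fun j =>
      (finCongr (by have := (p j).isLt; omega : κ j = (p j : ℕ) + (κ j - p j))).trans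
        finSumFinEquiv.symm).trans <|
    (Equiv.sigmaSumDistrib _ _).trans <|
    (Equiv.sumCongr finSigmaFinEquiv finSigmaFinEquiv).trans (blocks (sum_split p hM))

theorem sum_append {a n b : ℕ} (u : Fin a → ℕ) (w : Fin n → ℕ) (v : Fin b → ℕ) :
    ∑ j, u j + ∑ j, w j + ∑ j, v j = ∑ j, Fin.append (Fin.append u w) v j := by
  simp [Fin.sum_univ_add]

/-- The relations between operations `φ(x)^r_κ` and `D_l^m` in (the data of) a PROP. -/
inductive Rel (P : PROPData k)
    (φ : ∀ {n M : ℕ} {i : ℤ} (κ : Fin n → ℕ), ∑ j, κ j = M → ∀ r : ℕ, X.obj n i → P.Hom M r i)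
    (D : ∀ l m : ℕ, P.Hom l m 1) :
    ∀ M N i, P.Hom M N i → P.Hom M N i → Prop
  /- `φ(x)^r_κ` is linear in `x`. -/
  | phi_add {n M : ℕ} {i : ℤ} (κ : Fin n → ℕ) (hM : ∑ j, κ j = M) (r : ℕ) (x y : X.obj n i) :
      Rel P φ D M r i (φ κ hM r (x + y)) (φ κ hM r x + φ κ hM r y)
  | phi_smul {n M : ℕ} {i : ℤ} (κ : Fin n → ℕ) (hM : ∑ j, κ j = M) (r : ℕ) (c : k)
      (x : X.obj n i) :
      Rel P φ D M r i (φ κ hM r (c • x)) (c • φ κ hM r x)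
  /- Only the `φ(x)^r_κ` with `r ≤ κ₁ + … + κₙ` and the `D_l^m` with `l > m > 0` occur. -/
  | phi_zero {n M : ℕ} {i : ℤ} (κ : Fin n → ℕ) (hM : ∑ j, κ j = M) (r : ℕ) (x : X.obj n i)
      (hr : M < r) : Rel P φ D M r i (φ κ hM r x) 0
  | D_zero (l m : ℕ) (h : ¬ (0 < m ∧ m < l)) : Rel P φ D l m 1 (D l m) 0
  /- The maps `φₙ` are morphisms of coalgebras: `Δ φ(x) = (φ ⊗ φ)(Δ x)`. -/
  | phi_comul {n M : ℕ} {i : ℤ} (κ : Fin n → ℕ) (hM : ∑ j, κ j = M) (r r' R : ℕ)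
      (hR : r + r' = R) (x : X.obj n i) (S : Splitting k x) :
      Rel P φ D M R i (φ κ hM R x)
        (∑ a, ∑ p : (∀ j, Fin (κ j + 1)),
          P.comp (add_zero i)
            (P.hcomp (sum_split p hM) hR (S.deg_add a)
              (φ (fun j => (p j : ℕ)) rfl r (S.left a))
              (φ (fun j => κ j - p j) rfl r' (S.right a)))
            (P.perm (unshuffle κ p hM)))
  /- `D` is a coderivation: `Δ D = (D ⊗ id + id ⊗ D) Δ`. -/
  | D_comul (p q c L R : ℕ) (hR : p + q = R) (h₁ : p + c + q = L) (h₂ : p + (q + c) = L) :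
      Rel P φ D L R 1 (D L R)
        (P.hcomp h₁ hR (add_zero 1) (D (p + c) p) (P.perm 1) +
          P.hcomp h₂ hR (zero_add 1) (P.perm 1) (D (q + c) q))
  /- The maps `φₙ` form a representation of the operad `X`: `φ(y ∘ z) = φ(y) ∘ (id ⊗ φ(z) ⊗ id)`.
  The operation `z` is inserted in an input of `y` which has `a` inputs to its left and `b` inputs
  to its right. -/
  | phi_circ {a n b M m : ℕ} {i j t : ℤ} (u : Fin a → ℕ) (w : Fin n → ℕ) (v : Fin b → ℕ)
      (hM : ∑ c, Fin.append (Fin.append u w) v c = M) (r : ℕ) (s : Fin (a + 1 + b))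
      (hs : (s : ℕ) = a) (hl : a + n + b + 1 = a + 1 + b + n) (ht : i + j = t)
      (hm : ∑ c, w c = m) (y : X.obj (a + 1 + b) i) (z : X.obj n j) :
      Rel P φ D M r t
        (φ (Fin.append (Fin.append u w) v) hM r (X.circ s hl ht y z))
        (∑ q ∈ Finset.range (m + 1),
          P.comp ht (φ (Fin.append (Fin.append u fun _ : Fin 1 => q) v) rfl r y)
            (P.pad (∑ c, u c) (∑ c, v c) (by rw [← hm, sum_append, hM])
              (by rw [← sum_append]; simp) (φ w hm q z)))
  /- Unit and counit: `φ₁(1)` is the identity, and `φ(x)^0_κ` is `ε(x)` if `κ = 0` and vanishes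
  otherwise. In particular, the element `1` of `X 0 = k` acts as the unit of `T V`. -/
  | phi_one {M : ℕ} (κ : Fin 1 → ℕ) (hM : ∑ j, κ j = M) :
      Rel P φ D M M 0 (φ κ hM M X.one) (P.perm 1)
  | phi_one_zero {M : ℕ} (κ : Fin 1 → ℕ) (hM : ∑ j, κ j = M) (r : ℕ) (hr : r ≠ M) :
      Rel P φ D M r 0 (φ κ hM r X.one) 0
  | phi_counit {n : ℕ} (κ : Fin n → ℕ) (hM : ∑ j, κ j = 0) (x : X.obj n 0) :
      Rel P φ D 0 0 0 (φ κ hM 0 x) (X.counit x • P.perm 1)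
  | phi_counit_zero {n M : ℕ} {i : ℤ} (κ : Fin n → ℕ) (hM : ∑ j, κ j = M) (x : X.obj n i)
      (h : M ≠ 0 ∨ i ≠ 0) : Rel P φ D M 0 i (φ κ hM 0 x) 0

/-- The graded PROP `P(X)`. -/
noncomputable def gradedPROP : PROP k :=
  presented (G := Gen X) (Rel X (termData k (Gen X))
    (fun κ hM r x => Finsupp.single (Term.gen (Gen.phi κ hM r x)) 1)
    (fun l m => Finsupp.single (Term.gen (Gen.D l m)) 1))

/-- The operation `φ(x)^r_κ` in `P(X)`. -/
noncomputable def phi {n M : ℕ} {i : ℤ} (κ : Fin n → ℕ) (hM : ∑ j, κ j = M) (r : ℕ)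
    (x : X.obj n i) : (gradedPROP X).Hom M r i :=
  presentedGen _ (Gen.phi κ hM r x)

/-- The operation `φ(x)^r_κ` in `P(X)` as a linear function of `x`. -/
noncomputable def phiLin {n M : ℕ} {i : ℤ} (κ : Fin n → ℕ) (hM : ∑ j, κ j = M) (r : ℕ) :
    X.obj n i →ₗ[k] (gradedPROP X).Hom M r i where
  toFun := phi X κ hM r
  map_add' x y := (Submodule.Quotient.eq _).2 (PROPIdeal.rel (Rel.phi_add κ hM r x y))
  map_smul' c x := (Submodule.Quotient.eq _).2 (PROPIdeal.rel (Rel.phi_smul κ hM r c x))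

/-- The operation `D_l^m` in `P(X)`. -/
noncomputable def opD (l m : ℕ) : (gradedPROP X).Hom l m 1 :=
  presentedGen _ (Gen.D l m)

theorem sum_pad {n M : ℕ} (κ : Fin n → ℕ) (hM : ∑ j, κ j = M) (c : Fin n) :
    ∑ j ∈ Finset.Iio c, κ j + κ c + ∑ j ∈ Finset.Ioi c, κ j = M := by
  have h : (Finset.univ : Finset (Fin n)) = (Finset.Iio c ∪ {c}) ∪ Finset.Ioi c := by
    ext j; simpa using le_or_gt j c
  rw [← hM, h, Finset.sum_union, Finset.sum_union, Finset.sum_singleton]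
  · simp
  · rw [Finset.disjoint_left]
    intro j hj hj'
    simp only [Finset.mem_union, Finset.mem_Iio, Finset.mem_singleton, Finset.mem_Ioi] at hj hj'
    rcases hj with hj | hj
    · exact absurd hj' (not_lt.2 hj.le)
    · exact absurd hj' (by simp [hj])

theorem sum_pad_update {n : ℕ} (κ : Fin n → ℕ) (c : Fin n) (q : ℕ) :
    ∑ j ∈ Finset.Iio c, κ j + q + ∑ j ∈ Finset.Ioi c, κ j = ∑ j, Function.update κ c q j := by
  rw [← sum_pad (Function.update κ c q) rfl c, Function.update_self]
  congr 1
  · congr 1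
    exact Finset.sum_congr rfl fun j hj =>
      (Function.update_of_ne (Finset.mem_Iio.1 hj).ne _ _).symm
  · exact Finset.sum_congr rfl fun j hj =>
      (Function.update_of_ne (Finset.mem_Ioi.1 hj).ne' _ _).symm

/-- The differential of `P(X)` is determined by
`d D_l^m = - ∑_{m < r < l} D_r^m D_l^r` and
`d φ(x)^r_κ = φ(d x)^r_κ - ∑_s D_s^r φ(x)^s_κ
  + (-1)^{|x|} ∑_c ∑_q φ(x)^r_{κ₁ … q … κₙ} (id ⊗ D_{κ_c}^q ⊗ id)`, with `q` in the place `c`.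
This says that the map `d + D` is a differential of the coalgebra `T V` and that the `φₙ` are
compatible with the differentials. -/
structure IsGoverningDifferential (δ : (gradedPROP X).Differential) : Prop where
  d_D : ∀ (l m : ℕ) (h : (1 : ℤ) + 1 = 2), δ.d h (opD X l m) =
    - ∑ r ∈ Finset.Ioo m l, (gradedPROP X).comp h (opD X r m) (opD X l r)
  d_phi : ∀ {n M : ℕ} {i t : ℤ} (κ : Fin n → ℕ) (hM : ∑ j, κ j = M) (r : ℕ) (x : X.obj n i)
    (h : i + 1 = t) (h' : 1 + i = t), δ.d h (phi X κ hM r x) =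
      phi X κ hM r (X.d h x)
      - ∑ s ∈ Finset.Ioc r M, (gradedPROP X).comp h' (opD X s r) (phi X κ hM s x)
      + i.negOnePow • ∑ c, ∑ q ∈ Finset.Ioo 0 (κ c),
          (gradedPROP X).comp h (phi X (Function.update κ c q) rfl r x)
            ((gradedPROP X).pad (∑ j ∈ Finset.Iio c, κ j) (∑ j ∈ Finset.Ioi c, κ j)
              (sum_pad κ hM c) (sum_pad_update κ c q) (opD X (κ c) q))

/-- The dg PROP `P(X)` with the differential `δ`. -/
noncomputable def dgPROP (δ : (gradedPROP X).Differential) : DGPROP k where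
  toPROP := gradedPROP X
  diff := δ

/-- The dg operad `O(X)` of the operations with one output of `P(X)`. -/
noncomputable def dgOperad (δ : (gradedPROP X).Differential) : DGOperad k :=
  (dgPROP X δ).operad

/-- The indices of the free generators: those of `φ(v)^1_{κ₁…κₙ}`, `|v| = i`, `κⱼ ≥ 1`, `n ≥ 2`,
and of `D^1_l`, `l > 1`. -/
inductive GenIndex : Type
  | phi (n : ℕ) (hn : 2 ≤ n) (κ : Fin n → ℕ) (hκ : ∀ j, 1 ≤ κ j) (i : ℤ) : GenIndex
  | D (l : ℕ) (hl : 1 < l) : GenIndex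

/-- The number of inputs of a free generator. -/
def GenIndex.arity : GenIndex → ℕ
  | .phi _ _ κ _ _ => ∑ j, κ j
  | .D l _ => l

/-- The degree of a free generator. -/
def GenIndex.degree : GenIndex → ℤ
  | .phi _ _ _ _ i => i
  | .D _ _ => 1

variable {X} (V : ∀ n i, Submodule k (X.obj n i))

/-- The space of free generators with a given index: a copy of `V n i` for `φ(v)^1_κ`, and `k` for
`D^1_l`. -/
def genSpace : GenIndex → Type u
  | .phi n _ _ _ i => V n i
  | .D _ _ => k

instance (s : GenIndex) : AddCommGroup (genSpace V s) :=
  match s with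
  | .phi n _ _ _ i => inferInstanceAs (AddCommGroup (V n i))
  | .D _ _ => inferInstanceAs (AddCommGroup k)

instance (s : GenIndex) : Module k (genSpace V s) :=
  match s with
  | .phi n _ _ _ i => inferInstanceAs (Module k (V n i))
  | .D _ _ => inferInstanceAs (Module k k)

/-- `v ↦ φ(v)^1_κ`, and `c ↦ c D^1_l`. -/
noncomputable def genMap (s : GenIndex) :
    genSpace V s →ₗ[k] (gradedPROP X).Hom s.arity 1 s.degree :=
  match s with
  | .phi n _ κ _ i => (phiLin X κ rfl 1).comp (V n i).subtype
  | .D l _ => LinearMap.toSpanSingleton k _ (opD X l 1)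

end GoverningPROP

end XB

namespace XB
open scoped DirectSum TensorProduct

/-! ### Permutations that move a block rigidly -/

theorem exists_blockSum_of_fix {n q M : ℕ} (h : n + q = M) (π : Equiv.Perm (Fin M))
    (hπ : ∀ x : Fin M, (x : ℕ) < n → π x = x) : ∃ ρ, π = blockSum h 1 ρ := by
  let π' : Equiv.Perm (Fin n ⊕ Fin q) := (blocks h).trans (π.trans (blocks h).symm)
  have h1 : ∀ y : Fin n, π' (Sum.inl y) = Sum.inl y := by
    intro y
    have : π (blocks h (Sum.inl y)) = blocks h (Sum.inl y) := hπ _ (by simp [blocks])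
    simp [π', this]
  have hm : Set.MapsTo π' (Set.range Sum.inl) (Set.range Sum.inl) := by
    rintro _ ⟨y, rfl⟩
    exact ⟨y, (h1 y).symm⟩
  obtain ⟨⟨σ, ρ⟩, hρ⟩ := Equiv.Perm.mem_sumCongrHom_range_of_perm_mapsTo_inl hm
  refine ⟨ρ, ?_⟩
  have hσ : σ = 1 := by
    ext y
    have := congrArg (fun e => e (Sum.inl y)) hρ
    simp only [Equiv.Perm.sumCongrHom_apply, Equiv.Perm.sumCongr_apply, Sum.map_inl, h1] at this
    simpa using congrArg Fin.val (Sum.inl.inj this)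
  subst hσ
  have : π = (blocks h).symm.trans (π'.trans (blocks h)) := by ext x; simp [π']
  rw [this, ← hρ]
  rfl

/-- `σ` moves the block of size `n` at the position `A` rigidly to the position `A'`, `ρ` moves
the block of size `m` at the position `A` rigidly to `A'`, and the two permutations agree on the
positions outside of these blocks. -/
def RigidMove (A A' m n : ℕ) {M N : ℕ} (ρ : Equiv.Perm (Fin M)) (σ : Equiv.Perm (Fin N)) : Prop :=
  (∀ y : Fin N, A ≤ (y : ℕ) → (y : ℕ) < A + n → (σ y : ℕ) + A = y + A') ∧
  (∀ x : Fin M, A ≤ (x : ℕ) → (x : ℕ) < A + m → (ρ x : ℕ) + A = x + A') ∧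
  ∀ (x : Fin M) (y : Fin N), ((x : ℕ) < A ∧ (y : ℕ) = x ∨ A + m ≤ (x : ℕ) ∧ (y : ℕ) + m = x + n) →
    ((ρ x : ℕ) < A' ∧ (σ y : ℕ) = ρ x ∨ A' + m ≤ (ρ x : ℕ) ∧ (σ y : ℕ) + m = ρ x + n)

theorem PROP.perm_comp_pad_of_rigidMove {k : Type u} [Field k] (P : PROP k) {m n M N : ℕ} {i : ℤ}
    (A B A' B' : ℕ) (hM : A + m + B = M) (hN : A + n + B = N) (hM' : A' + m + B' = M)
    (hN' : A' + n + B' = N) (ρ : Equiv.Perm (Fin M)) (σ : Equiv.Perm (Fin N))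
    (h : RigidMove A A' m n ρ σ) (f : P.Hom m n i) :
    P.comp (zero_add i) (P.perm σ) (P.pad A B hM hN f) =
      P.comp (add_zero i) (P.pad A' B' hM' hN' f) (P.perm ρ) := by
  have k1 : n + (A + B) = N := by omega
  have k2 : m + (A + B) = M := by omega
  have hAB : A' + B' = A + B := by omega
  obtain ⟨hσ1, hρ1, hout⟩ := h
  obtain ⟨ρ₀, h₀⟩ := exists_blockSum_of_fix k1 ((toFront A' B' hN')⁻¹ * σ * toFront A B hN) (by
      intro x hx
      have h1 : σ (toFront A B hN x) = toFront A' B' hN' x := by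
        have ha : (toFront A B hN x : ℕ) = x + A := by rw [toFront_val, if_pos hx]
        have := hσ1 (toFront A B hN x) (by omega) (by omega)
        refine Fin.ext ?_
        rw [toFront_val A' B', if_pos hx]
        omega
      simp [Equiv.Perm.mul_apply, h1])
  have hσ : σ * toFront A B hN = toFront A' B' hN' * blockSum k1 1 ρ₀ := by
    rw [← h₀]; group
  have hr : ρ * toFront A B hM = toFront A' B' hM' * blockSum k2 1 ρ₀ := by
    ext x
    simp only [Equiv.Perm.mul_apply]
    by_cases hx : (x : ℕ) < m
    · have h1 : (toFront A B hM x : ℕ) = x + A := by rw [toFront_val, if_pos hx]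
      have := hρ1 (toFront A B hM x) (by omega) (by omega)
      have h2 := blockSum_val_left k2 1 ρ₀ x ⟨x, hx⟩ rfl
      rw [toFront_val A' B', h2]
      simp [hx]
      omega
    · have hx2 : (x : ℕ) - m < A + B := by omega
      set w : Fin (A + B) := ⟨x - m, hx2⟩ with hw
      have hb := blockSum_val_right k2 1 ρ₀ x w (by simp [hw]; omega)
      have hz : n + (w : ℕ) < N := by omega
      set z : Fin N := ⟨n + w, hz⟩ with hzd
      have hb' := blockSum_val_right k1 1 ρ₀ z w (by simp [hzd])
      have hc := congrArg (fun π : Equiv.Perm (Fin N) => (π z : ℕ)) hσ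
      simp only [Equiv.Perm.mul_apply] at hc
      rw [toFront_val A' B', hb'] at hc
      have ha := toFront_val A B hN z
      have ha' := toFront_val A B hM x
      have hwv : (w : ℕ) = x - m := rfl
      have hzv : (z : ℕ) = n + w := rfl
      have := hout (toFront A B hM x) (toFront A B hN z) (by
        rw [ha, ha']
        split_ifs <;> omega)
      have hlt := (ρ₀ w).isLt
      rw [toFront_val A' B', hb]
      split_ifs at hc ⊢ <;> omega
  have c1 := P.pad_toFront A B rfl hM hN k2 k1 f
  have c2 := P.pad_toFront A' B' hAB hM' hN' k2 k1 f
  have c3 : P.comp (zero_add i) (P.perm (blockSum k1 1 ρ₀))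
      (P.hcomp k2 k1 (add_zero i) f (P.perm 1)) =
      P.comp (add_zero i) (P.hcomp k2 k1 (add_zero i) f (P.perm 1))
        (P.perm (blockSum k2 1 ρ₀)) := by
    rw [← P.perm_hcomp k1 (add_zero 0), ← P.perm_hcomp k2 (add_zero 0),
      P.interchange k2 k1 k1 _ _ _ (zero_add i) (add_zero 0) (add_zero i),
      P.interchange k2 k2 k1 _ _ _ (add_zero i) (add_zero 0) (add_zero i)]
    simp only [P.one_comp, P.comp_one, zero_mul, mul_zero]
  have c4 : P.comp (add_zero i) (P.comp (zero_add i) (P.perm σ) (P.pad A B hM hN f))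
      (P.perm (toFront A B hM)) =
      P.comp (add_zero i) (P.comp (add_zero i) (P.pad A' B' hM' hN' f) (P.perm ρ))
      (P.perm (toFront A B hM)) := by
    rw [P.comp_assoc _ _ (add_zero i) (zero_add i), c1,
      ← P.comp_assoc (zero_add 0) (zero_add i), ← P.perm_mul, hσ,
      P.perm_mul (zero_add 0), P.comp_assoc _ _ (zero_add i) (zero_add i), c3,
      ← P.comp_assoc (zero_add i) (add_zero i), ← c2,
      P.comp_assoc _ _ (zero_add 0) (add_zero i), P.comp_assoc _ _ (zero_add 0) (add_zero i),
      ← P.perm_mul, ← P.perm_mul, hr]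
  have c5 := congrArg (fun f => P.comp (add_zero i) f (P.perm (toFront A B hM)⁻¹)) c4
  rw [P.comp_assoc _ _ (zero_add 0) (add_zero i), P.comp_assoc _ _ (zero_add 0) (add_zero i),
    ← P.perm_mul, mul_inv_cancel, P.comp_one, P.comp_one] at c5
  exact c5

end XB

namespace XB
open scoped DirectSum TensorProduct

/-! ### Words of natural numbers -/

/-- The sum of the first `n` entries of `K`. -/
def psum (K : ℕ → ℕ) (n : ℕ) : ℕ := ∑ j ∈ Finset.range n, K j

@[simp] theorem psum_zero (K : ℕ → ℕ) : psum K 0 = 0 := rfl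

theorem psum_succ (K : ℕ → ℕ) (n : ℕ) : psum K (n + 1) = psum K n + K n :=
  Finset.sum_range_succ _ _

theorem psum_congr {K K' : ℕ → ℕ} {n : ℕ} (h : ∀ j < n, K j = K' j) : psum K n = psum K' n :=
  Finset.sum_congr rfl fun j hj => h j (Finset.mem_range.1 hj)

theorem psum_mono (K : ℕ → ℕ) {m n : ℕ} (h : m ≤ n) : psum K m ≤ psum K n :=
  Finset.sum_le_sum_of_subset (Finset.range_mono h)

/-- The word in which the `n` letters of `K` from the position `s` on are replaced by `q`. -/
def upd (K : ℕ → ℕ) (s n q : ℕ) : ℕ → ℕ :=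
  fun j => if j < s then K j else if j = s then q else K (j + n - 1)

/-- The word `K` from the position `s` on. -/
def res (K : ℕ → ℕ) (s : ℕ) : ℕ → ℕ := fun j => K (s + j)

theorem psum_res (K : ℕ → ℕ) (s n : ℕ) : psum K s + psum (res K s) n = psum K (s + n) := by
  induction n with
  | zero => simp
  | succ n ih => rw [psum_succ, ← add_assoc, ih, ← add_assoc, psum_succ]; rfl

theorem psum_upd_le (K : ℕ → ℕ) (n q : ℕ) {s j : ℕ} (h : j ≤ s) : psum (upd K s n q) j = psum K j :=
  psum_congr fun i hi => by simp [upd, show i < s by omega]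

theorem psum_upd_gt (K : ℕ → ℕ) (n q : ℕ) {s j : ℕ} (h : s < j) :
    psum (upd K s n q) j + psum K (s + n) = psum K s + q + psum K (j + n - 1) := by
  induction j, h using Nat.le_induction with
  | base =>
    rw [psum_succ, psum_upd_le K n q le_rfl]
    simp [upd, show s.succ + n - 1 = s + n by omega]
  | succ j h ih =>
    have h1 : j + 1 + n - 1 = (j + n - 1) + 1 := by omega
    rw [psum_succ, h1, psum_succ K]
    have h2 : upd K s n q j = K (j + n - 1) := by
      simp [upd, show ¬ j < s by omega, show ¬ j = s by omega]
    omega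

/-! ### The endomorphism operad of the tensor coalgebra -/

section EndOperad

variable {k : Type u} [Field k] (P : PROP k)

/-- Families `f_K : T^{K₁} V ⊗ … ⊗ T^{Kₙ} V → T^r V` of operations of degree `i`. -/
def famSub (n r : ℕ) (i : ℤ) :
    Submodule k (∀ (M : ℕ) (_ : {K : ℕ → ℕ // psum K n = M}), P.Hom M r i) where
  carrier := {f | ∀ (K K' : ℕ → ℕ) (_ : ∀ j < n, K j = K' j) (M : ℕ) (h : psum K n = M)
    (h' : psum K' n = M), f M ⟨K, h⟩ = f M ⟨K', h'⟩}
  add_mem' hf hg K K' hK M h h' := by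
    simp only [Pi.add_apply]; rw [hf K K' hK M h h', hg K K' hK M h h']
  zero_mem' _ _ _ _ _ _ := rfl
  smul_mem' c f hf K K' hK M h h' := by
    simp only [Pi.smul_apply]; rw [hf K K' hK M h h']

abbrev Fam (n r : ℕ) (i : ℤ) : Type u := famSub P n r i

variable {P}

/-- The component `f_K`. -/
def Fam.val {n r : ℕ} {i : ℤ} (f : Fam P n r i) (K : ℕ → ℕ) (M : ℕ)
    (h : psum K n = M) : P.Hom M r i := f.1 M ⟨K, h⟩

theorem Fam.congr {n r : ℕ} {i : ℤ} (f : Fam P n r i) {K K' : ℕ → ℕ} (hK : ∀ j < n, K j = K' j)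
    {M : ℕ} (h : psum K n = M) (h' : psum K' n = M) : f.val K M h = f.val K' M h' :=
  f.2 K K' hK M h h'

theorem Fam.ext {n r : ℕ} {i : ℤ} {f g : Fam P n r i}
    (h : ∀ K M (hM : psum K n = M), f.val K M hM = g.val K M hM) : f = g :=
  Subtype.ext (funext fun M => funext fun K => h K.1 M K.2)

@[simp] theorem Fam.val_add {n r : ℕ} {i : ℤ} (f g : Fam P n r i) (K : ℕ → ℕ) (M : ℕ)
    (h : psum K n = M) : (f + g).val K M h = f.val K M h + g.val K M h := rfl

@[simp] theorem Fam.val_smul {n r : ℕ} {i : ℤ} (c : k) (f : Fam P n r i) (K : ℕ → ℕ) (M : ℕ)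
    (h : psum K n = M) : (c • f).val K M h = c • f.val K M h := rfl

@[simp] theorem Fam.val_zero {n r : ℕ} {i : ℤ} (K : ℕ → ℕ) (M : ℕ)
    (h : psum K n = M) : (0 : Fam P n r i).val K M h = 0 := rfl

/-- A family of operations, from its components. -/
def Fam.mk {n r : ℕ} {i : ℤ} (f : ∀ (K : ℕ → ℕ) (M : ℕ), psum K n = M → P.Hom M r i)
    (hf : ∀ (K K' : ℕ → ℕ) (_ : ∀ j < n, K j = K' j) (M : ℕ) (h : psum K n = M)
      (h' : psum K' n = M), f K M h = f K' M h') : Fam P n r i :=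
  ⟨fun M K => f K.1 M K.2, hf⟩

variable (P)

/-- Families `f_K^r : T^{K₁} V ⊗ … ⊗ T^{Kₙ} V → T^r V`, which vanish if `r > K₁ + … + Kₙ`. -/
def endSub (n : ℕ) (i : ℤ) : Submodule k (∀ r, Fam P n r i) where
  carrier := {f | ∀ r K M (h : psum K n = M), M < r → (f r).val K M h = 0}
  add_mem' {f g} hf hg r K M h hr := by
    simp only [Pi.add_apply, Fam.val_add]
    rw [hf r K M h hr, hg r K M h hr, add_zero]
  zero_mem' _ _ _ _ _ := rfl
  smul_mem' c f hf r K M h hr := by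
    simp only [Pi.smul_apply, Fam.val_smul]
    rw [hf r K M h hr, smul_zero]

def EndObj (n : ℕ) (i : ℤ) : Type u := endSub P n i

instance (n : ℕ) (i : ℤ) : AddCommGroup (EndObj P n i) :=
  inferInstanceAs (AddCommGroup (endSub P n i))

instance (n : ℕ) (i : ℤ) : Module k (EndObj P n i) := inferInstanceAs (Module k (endSub P n i))

variable {P}

/-- The component `f^r_K`. -/
def EndObj.val {n : ℕ} {i : ℤ} (f : EndObj P n i) (r : ℕ) (K : ℕ → ℕ) (M : ℕ)
    (h : psum K n = M) : P.Hom M r i := (f.1 r).val K M h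

theorem EndObj.ext {n : ℕ} {i : ℤ} {f g : EndObj P n i}
    (h : ∀ r K M (hM : psum K n = M), f.val r K M hM = g.val r K M hM) : f = g :=
  Subtype.ext (funext fun r => Fam.ext (h r))

theorem EndObj.congr {n r : ℕ} {i : ℤ} (f : EndObj P n i) {K K' : ℕ → ℕ}
    (hK : ∀ j < n, K j = K' j)
    {M : ℕ} (h : psum K n = M) (h' : psum K' n = M) : f.val r K M h = f.val r K' M h' :=
  (f.1 r).congr hK h h'

theorem EndObj.vanish {n : ℕ} {i : ℤ} (f : EndObj P n i) {r : ℕ} {K : ℕ → ℕ} {M : ℕ}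
    (h : psum K n = M) (hr : M < r) : f.val r K M h = 0 := f.2 r K M h hr

@[simp] theorem EndObj.val_add {n r : ℕ} {i : ℤ} (f g : EndObj P n i) (K : ℕ → ℕ) (M : ℕ)
    (h : psum K n = M) : (f + g).val r K M h = f.val r K M h + g.val r K M h := rfl

@[simp] theorem EndObj.val_smul {n r : ℕ} {i : ℤ} (c : k) (f : EndObj P n i) (K : ℕ → ℕ) (M : ℕ)
    (h : psum K n = M) : (c • f).val r K M h = c • f.val r K M h := rfl

@[simp] theorem EndObj.val_zero {n r : ℕ} {i : ℤ} (K : ℕ → ℕ) (M : ℕ)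
    (h : psum K n = M) : (0 : EndObj P n i).val r K M h = 0 := rfl

/-- The component `f^r_K` as a linear function of `f`. -/
def EndObj.valLin {n : ℕ} {i : ℤ} (r : ℕ) (K : ℕ → ℕ) (M : ℕ)
    (h : psum K n = M) : EndObj P n i →ₗ[k] P.Hom M r i where
  toFun f := f.val r K M h
  map_add' _ _ := rfl
  map_smul' _ _ := rfl

/-- The components `f^r_K` for fixed `r`. -/
def EndObj.fam {n : ℕ} {i : ℤ} (r : ℕ) : EndObj P n i →ₗ[k] Fam P n r i where
  toFun f := f.1 r
  map_add' _ _ := rfl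
  map_smul' _ _ := rfl

theorem upd_psum {K : ℕ → ℕ} {m n l s A W B M : ℕ} (q : ℕ) (hs : s < m) (hl : l + 1 = m + n)
    (hA : psum K s = A) (hW : psum (res K s) n = W) (hM : psum K l = M) (hB : A + W + B = M) :
    psum (upd K s n q) m = A + q + B := by
  have h1 := psum_upd_gt K n q hs
  have h2 := psum_res K s n
  have h3 : m + n - 1 = l := by omega
  rw [h3] at h1
  omega

theorem res_psum_le {K : ℕ → ℕ} {m n l s : ℕ} (hs : s < m) (hl : l + 1 = m + n) :
    psum K s + psum (res K s) n ≤ psum K l := by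
  rw [psum_res]; exact psum_mono K (by omega)

/-- The components of the composition `f ∘ₛ g`. -/
def circVal {m n l : ℕ} {i j t : ℤ} (s : Fin m) (hl : l + 1 = m + n) (ht : i + j = t)
    (f : EndObj P m i) (g : EndObj P n j) (r : ℕ) (K : ℕ → ℕ) (M : ℕ) (hM : psum K l = M) :
    P.Hom M r t :=
  ∑ q ∈ Finset.range (psum (res K s) n + 1),
    P.comp ht
      (f.val r (upd K s n q) (psum K s + q + (M - psum K s - psum (res K s) n))
        (upd_psum q s.isLt hl rfl rfl hM
          (by have := res_psum_le (K := K) s.isLt hl; omega)))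
      (P.pad (psum K s) (M - psum K s - psum (res K s) n)
        (by have := res_psum_le (K := K) s.isLt hl; omega) rfl (g.val q (res K s) _ rfl))

theorem circVal_eq {m n l : ℕ} {i j t : ℤ} (s : Fin m) (hl : l + 1 = m + n) (ht : i + j = t)
    (f : EndObj P m i) (g : EndObj P n j) (r : ℕ) (K : ℕ → ℕ) (M : ℕ) (hM : psum K l = M)
    {A W B : ℕ} (L : ℕ) (hA : psum K s = A) (hW : psum (res K s) n = W) (hB : A + W + B = M)
    (hL : W < L) :
    circVal s hl ht f g r K M hM = ∑ q ∈ Finset.range L,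
      P.comp ht (f.val r (upd K s n q) (A + q + B) (upd_psum q s.isLt hl hA hW hM hB))
        (P.pad A B hB rfl (g.val q (res K s) W hW)) := by
  subst hA hW
  obtain rfl : B = M - psum K s - psum (res K s) n := by omega
  refine Finset.sum_subset (Finset.range_mono hL) fun q _ hq => ?_
  rw [g.vanish _ (by simpa using hq)]
  simp

variable (P) in
/-- The identity, as a family of operations. -/
def endOne : EndObj P 1 0 :=
  ⟨fun r => Fam.mk (fun _ M _ => if h : M = r then h ▸ P.perm 1 else 0) fun _ _ _ _ _ _ => rfl,
    fun r _ M _ hr => dif_neg (by omega)⟩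

theorem endOne_self {K : ℕ → ℕ} {M : ℕ} (h : psum K 1 = M) :
    (endOne P).val M K M h = P.perm 1 := dif_pos rfl

theorem endOne_ne {K : ℕ → ℕ} {M r : ℕ} (h : psum K 1 = M) (hr : M ≠ r) :
    (endOne P).val r K M h = 0 := dif_neg hr

theorem upd_congr {K K' : ℕ → ℕ} {m n l s q : ℕ} (hs : s < m) (hl : l + 1 = m + n)
    (h : ∀ j < l, K j = K' j) : ∀ j < m, upd K s n q j = upd K' s n q j := by
  intro j hj
  unfold upd
  split_ifs
  · exact h j (by omega)
  · rfl
  · exact h _ (by omega)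

theorem res_congr {K K' : ℕ → ℕ} {m n l s : ℕ} (hs : s < m) (hl : l + 1 = m + n)
    (h : ∀ j < l, K j = K' j) : ∀ j < n, res K s j = res K' s j :=
  fun j hj => h _ (by omega)

/-- The composition `f ∘ₛ g` of families. -/
def endCirc {m n l : ℕ} {i j t : ℤ} (s : Fin m) (hl : l + 1 = m + n) (ht : i + j = t)
    (f : EndObj P m i) (g : EndObj P n j) : EndObj P l t :=
  ⟨fun r => Fam.mk (circVal s hl ht f g r) fun K K' hK M h h' => by
    have hs := s.isLt
    have e1 : psum K' s = psum K s := psum_congr fun a ha => (hK a (by omega)).symm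
    have e2 : psum (res K' s) n = psum (res K s) n :=
      (psum_congr (res_congr s.isLt hl hK)).symm
    have e3 := res_psum_le (K := K) s.isLt hl
    rw [circVal_eq s hl ht f g r K M h (B := M - psum K s - psum (res K s) n)
      (psum (res K s) n + 1) rfl rfl (by omega) (by omega),
      circVal_eq s hl ht f g r K' M h' (B := M - psum K s - psum (res K s) n)
        (psum (res K s) n + 1) e1 e2 (by omega) (by omega)]
    refine Finset.sum_congr rfl fun q _ => ?_
    rw [f.congr (upd_congr s.isLt hl hK) _ (by
        rw [← psum_congr (upd_congr s.isLt hl hK)]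
        exact upd_psum q s.isLt hl rfl rfl h (by omega)),
      g.congr (res_congr s.isLt hl hK) _ e2],
   fun r K M h hr => by
    have e3 := res_psum_le (K := K) s.isLt hl
    change circVal s hl ht f g r K M h = 0
    refine Finset.sum_eq_zero fun q hq => ?_
    rw [Finset.mem_range] at hq
    rw [f.vanish _ (by omega)]
    simp⟩

theorem endCirc_val {m n l : ℕ} {i j t : ℤ} (s : Fin m) (hl : l + 1 = m + n) (ht : i + j = t)
    (f : EndObj P m i) (g : EndObj P n j) (r : ℕ) (K : ℕ → ℕ) (M : ℕ) (hM : psum K l = M)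
    {A W B : ℕ} (L : ℕ) (hA : psum K s = A) (hW : psum (res K s) n = W) (hB : A + W + B = M)
    (hL : W < L) :
    (endCirc s hl ht f g).val r K M hM = ∑ q ∈ Finset.range L,
      P.comp ht (f.val r (upd K s n q) (A + q + B) (upd_psum q s.isLt hl hA hW hM hB))
        (P.pad A B hB rfl (g.val q (res K s) W hW)) :=
  circVal_eq s hl ht f g r K M hM L hA hW hB hL

theorem exists_splitPoint {K : ℕ → ℕ} {m n l s : ℕ} (hs : s < m) (hl : l + 1 = m + n) :
    ∃ B, psum K s + psum (res K s) n + B = psum K l := by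
  have := res_psum_le (K := K) hs hl
  exact ⟨psum K l - psum K s - psum (res K s) n, by omega⟩

/-- The composition `f ∘ₛ g` of families as a bilinear map. -/
def endCircLin {m n l : ℕ} {i j t : ℤ} (s : Fin m) (hl : l + 1 = m + n) (ht : i + j = t) :
    EndObj P m i →ₗ[k] EndObj P n j →ₗ[k] EndObj P l t :=
  LinearMap.mk₂ k (endCirc s hl ht)
    (fun f f' g => EndObj.ext fun r K M hM => by
      subst hM
      obtain ⟨B, hB⟩ := exists_splitPoint (K := K) s.isLt hl
      simp only [EndObj.val_add]
      simp only [endCirc_val s hl ht _ g r K _ rfl _ rfl rfl hB (Nat.lt_succ_self _),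
        EndObj.val_add, map_add, LinearMap.add_apply, Finset.sum_add_distrib])
    (fun c f g => EndObj.ext fun r K M hM => by
      subst hM
      obtain ⟨B, hB⟩ := exists_splitPoint (K := K) s.isLt hl
      simp only [EndObj.val_smul]
      simp only [endCirc_val s hl ht _ g r K _ rfl _ rfl rfl hB (Nat.lt_succ_self _),
        EndObj.val_smul, map_smul, LinearMap.smul_apply, Finset.smul_sum])
    (fun f g g' => EndObj.ext fun r K M hM => by
      subst hM
      obtain ⟨B, hB⟩ := exists_splitPoint (K := K) s.isLt hl
      simp only [EndObj.val_add]
      simp only [endCirc_val s hl ht f _ r K _ rfl _ rfl rfl hB (Nat.lt_succ_self _),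
        EndObj.val_add, map_add, Finset.sum_add_distrib])
    (fun c f g => EndObj.ext fun r K M hM => by
      subst hM
      obtain ⟨B, hB⟩ := exists_splitPoint (K := K) s.isLt hl
      simp only [EndObj.val_smul]
      simp only [endCirc_val s hl ht f _ r K _ rfl _ rfl rfl hB (Nat.lt_succ_self _),
        EndObj.val_smul, map_smul, Finset.smul_sum])

theorem endOne_circ {n : ℕ} {i : ℤ} (s : Fin 1) (hl : n + 1 = 1 + n) (ht : 0 + i = i)
    (g : EndObj P n i) : endCirc s hl ht (endOne P) g = g := by
  refine EndObj.ext fun r K M hM => ?_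
  obtain rfl : s = 0 := Subsingleton.elim _ _
  have hres : ∀ j < n, res K ((0 : Fin 1) : ℕ) j = K j := fun j _ => by simp [res]
  have hW : psum (res K ((0 : Fin 1) : ℕ)) n = M := by rw [psum_congr hres, hM]
  by_cases hr : r ≤ M
  · rw [endCirc_val 0 hl ht _ g r K M hM (A := 0) (B := 0) (M + 1) rfl hW (by omega) (by omega),
      Finset.sum_eq_single r]
    · have h1 : ∀ (N : ℕ) (hN : 0 + r + 0 = N) (h : psum (upd K ((0 : Fin 1) : ℕ) n r) 1 = N)
          (h2 : 0 + M + 0 = M),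
          P.comp ht ((endOne P).val r (upd K ((0 : Fin 1) : ℕ) n r) N h)
            (P.pad 0 0 h2 hN (g.val r (res K ((0 : Fin 1) : ℕ)) M hW)) = g.val r K M hM := by
        intro N hN h h2
        obtain rfl : r = N := by omega
        rw [endOne_self, P.one_comp, P.pad_apply' 0 0 (zero_add _) (zero_add _) rfl rfl,
          P.hcomp_one, P.one_hcomp]
        exact g.congr hres _ _
      exact h1 _ rfl _ _
    · intro b _ hb
      rw [endOne_ne _ (by omega)]
      simp
    · intro h
      simp at h
      omega
  · rw [EndObj.vanish _ _ (by omega), EndObj.vanish _ _ (by omega)]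

theorem endCirc_one {m : ℕ} {i : ℤ} (s : Fin m) (hl : m + 1 = m + 1) (ht : i + 0 = i)
    (f : EndObj P m i) : endCirc s hl ht f (endOne P) = f := by
  refine EndObj.ext fun r K M hM => ?_
  subst hM
  obtain ⟨B, hB⟩ := exists_splitPoint (K := K) s.isLt hl
  rw [endCirc_val s hl ht f _ r K _ rfl _ rfl rfl hB (Nat.lt_succ_self _),
    Finset.sum_eq_single (psum (res K s) 1)]
  · rw [endOne_self]
    have h1 : ∀ (N : ℕ) (hN : psum K s + psum (res K s) 1 + B = N)
        (h : psum (upd K s 1 (psum (res K s) 1)) m = N),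
        P.comp ht (f.val r (upd K s 1 (psum (res K s) 1)) N h)
          (P.pad (psum K s) B hB hN (P.perm 1)) = f.val r K _ rfl := by
      intro N hN h
      obtain rfl : psum K m = N := by omega
      rw [P.pad_one, P.comp_one]
      refine f.congr (fun j _ => ?_) _ _
      unfold upd
      split_ifs with h1 h2
      · rfl
      · rw [h2]; simp [psum_succ, res]
      · simp
    exact h1 _ rfl _
  · intro b _ hb
    rw [endOne_ne _ (Ne.symm hb)]
    simp
  · intro h
    simp at h

end EndOperad
end XB

namespace XB
open scoped DirectSum TensorProduct

section EndOperadAxioms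

variable {k : Type u} [Field k] {P : PROP k}

theorem res_upd_add (K : ℕ → ℕ) (s r p c : ℕ) :
    res (upd K (s + r) p c) s = upd (res K s) r p c := by
  funext j
  unfold res upd
  split_ifs <;> first | rfl | omega | (congr 1; omega)

theorem upd_upd_add (K : ℕ → ℕ) {s r n p : ℕ} (c b : ℕ) (hr : r < n) :
    upd (upd K (s + r) p c) s n b = upd K s (n + p - 1) b := by
  funext j
  unfold upd
  split_ifs <;> first | rfl | omega | (congr 1; omega)

theorem res_res (K : ℕ → ℕ) (s r : ℕ) : res (res K s) r = res K (s + r) := by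
  funext j; simp [res, add_assoc]

theorem upd_upd_comm (K : ℕ → ℕ) {s r r' n p : ℕ} (q₁ q₂ : ℕ) (hs : s < r)
    (hr : r' + 1 = r + n) :
    upd (upd K r' p q₂) s n q₁ = upd (upd K s n q₁) r p q₂ := by
  funext j
  unfold upd
  split_ifs <;> first | rfl | omega | (congr 1; omega)

theorem res_upd_lt (K : ℕ → ℕ) {s r' n p : ℕ} (q : ℕ) (h : s + n ≤ r') :
    ∀ j < n, res (upd K r' p q) s j = res K s j := by
  intro j hj
  simp [res, upd, show s + j < r' by omega]

theorem res_upd_gt (K : ℕ → ℕ) {s r r' n : ℕ} (q : ℕ) (hs : s < r)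
    (hr : r' + 1 = r + n) : res (upd K s n q) r = res K r' := by
  funext j
  simp only [res, upd, show ¬ r + j < s by omega, show ¬ r + j = s by omega, if_false]
  congr 1
  omega

theorem endCirc_seq {m n p l l' q : ℕ} {a b c ab bc abc : ℤ} (s : Fin m) (r : Fin n) (sr : Fin l)
    (hsr : (sr : ℕ) = s + r) (h₁ : l + 1 = m + n) (h₂ : q + 1 = l + p) (h₃ : l' + 1 = n + p)
    (h₄ : q + 1 = m + l') (e₁ : a + b = ab) (e₂ : ab + c = abc) (e₃ : b + c = bc)
    (e₄ : a + bc = abc) (x : EndObj P m a) (y : EndObj P n b) (z : EndObj P p c) :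
    endCirc sr h₂ e₂ (endCirc s h₁ e₁ x y) z = endCirc s h₄ e₄ x (endCirc r h₃ e₃ y z) := by
  refine EndObj.ext fun R K M hM => ?_
  have hs := s.isLt
  have hr := r.isLt
  obtain ⟨b0, hb0⟩ := exists_splitPoint (K := K) hs h₄
  obtain ⟨b1, hb1⟩ := exists_splitPoint (K := res K s) hr h₃
  obtain ⟨a0, ha0⟩ : ∃ a0, psum K s = a0 := ⟨_, rfl⟩
  obtain ⟨a1, ha1⟩ : ∃ a1, psum (res K s) r = a1 := ⟨_, rfl⟩
  obtain ⟨w, hw⟩ : ∃ w, psum (res (res K s) r) p = w := ⟨_, rfl⟩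
  have hsr' : psum K sr = a0 + a1 := by rw [hsr, ← psum_res, ha0, ha1]
  have hw' : psum (res K sr) p = w := by rw [hsr, ← res_res, hw]
  rw [ha1, hw] at hb1
  rw [ha0, ← hb1, hM] at hb0
  have hres : ∀ d, res (upd K sr p d) s = upd (res K s) r p d := fun d => by
    rw [hsr, res_upd_add]
  rw [endCirc_val sr h₂ e₂ _ z R K M hM (B := b1 + b0) (w + 1) hsr' hw' (by omega) (by omega),
    endCirc_val s h₄ e₄ x _ R K M hM (W := a1 + w + b1) (B := b0) (M + 1) ha0 hb1.symm (by omega)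
      (by omega)]
  have hL : ∀ d ∈ Finset.range (w + 1),
      P.comp e₂ ((endCirc s h₁ e₁ x y).val R (upd K sr p d) (a0 + a1 + d + (b1 + b0))
        (upd_psum (B := b1 + b0) d sr.isLt h₂ hsr' hw' hM (by omega)))
        (P.pad (M := M) (a0 + a1) (b1 + b0) (by omega) rfl (z.val d (res K sr) w hw')) =
      ∑ e ∈ Finset.range (M + 1), P.comp e₂ (P.comp e₁ (x.val R (upd (upd K sr p d) s n e)
        (a0 + e + b0) (by
          rw [hsr, upd_upd_add _ _ _ hr, show n + p - 1 = l' by omega]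
          exact upd_psum (B := b0) e hs h₄ ha0 hb1.symm hM (by omega)))
        (P.pad (M := a0 + a1 + d + (b1 + b0)) a0 b0 (by omega) rfl
          (y.val e (res (upd K sr p d) s) (a1 + d + b1) (by
          rw [hres]; exact upd_psum d hr h₃ ha1 hw hb1.symm rfl))))
        (P.pad (M := M) (a0 + a1) (b1 + b0) (by omega) rfl (z.val d (res K sr) w hw')) := by
    intro d hd
    rw [Finset.mem_range] at hd
    rw [endCirc_val s h₁ e₁ x y R (upd K sr p d) (a0 + a1 + d + (b1 + b0)) _ (A := a0)
      (W := a1 + d + b1) (B := b0) (M + 1) (by rw [psum_upd_le _ _ _ (by omega), ha0]) (by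
        rw [hres]; exact upd_psum d hr h₃ ha1 hw hb1.symm rfl) (by omega) (by omega)]
    simp only [map_sum, LinearMap.sum_apply]
  rw [Finset.sum_congr rfl hL, Finset.sum_comm]
  refine Finset.sum_congr rfl fun e he => ?_
  rw [endCirc_val r h₃ e₃ y z e (res K s) (a1 + w + b1) hb1.symm (w + 1) ha1 hw rfl (by omega)]
  simp only [map_sum]
  refine Finset.sum_congr rfl fun d hd => ?_
  rw [P.comp_assoc e₁ e₂ e₃ e₄, P.pad_comp a0 b0 (by omega) rfl rfl e₃,
    P.pad_pad a1 b1 a0 b0 _ _ _ _ (by omega) (by omega)]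
  rw [x.congr (K := upd (upd K sr p d) s n e) (K' := upd K s l' e)
    (fun j _ => by rw [hsr, upd_upd_add _ _ _ hr, show n + p - 1 = l' by omega]) _
    (upd_psum e hs h₄ ha0 hb1.symm hM (by omega))]
  rw [y.congr (K := res (upd K sr p d) s) (K' := upd (res K s) r p d)
    (fun j _ => by rw [hres]) _ (upd_psum d hr h₃ ha1 hw hb1.symm rfl)]
  rw [z.congr (K := res K sr) (K' := res (res K s) r)
    (fun j _ => by rw [res_res, hsr]) _ hw]
  congr 1
  have key : ∀ (N N' : ℕ) (g1 : a0 + e + b0 = N) (g2 : a0 + (a1 + d + b1) + b0 = N')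
      (g2' : a0 + a1 + d + (b1 + b0) = N')
      (g3 : a0 + a1 + w + (b1 + b0) = M) (F : P.Hom (a1 + d + b1) e b) (G : P.Hom w d c),
      P.comp e₃ (P.pad a0 b0 g2 g1 F) (P.pad (a0 + a1) (b1 + b0) g3 g2' G) =
      P.comp e₃ (P.pad a0 b0 rfl g1 F) (P.pad (a0 + a1) (b1 + b0) g3 (by omega) G) := by
    intro N N' g1 g2 g2' g3 F G
    subst g2
    rfl
  exact key _ _ rfl (by omega) rfl (by omega) _ _

theorem endCirc_par {m n p l l' q : ℕ} {a b c ab ac abc : ℤ} (s r : Fin m) (hsr : s < r)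
    (r' : Fin l) (s' : Fin l') (hr' : (r' : ℕ) + 1 = r + n) (hs' : (s' : ℕ) = s)
    (h₁ : l + 1 = m + n) (h₂ : q + 1 = l + p) (h₃ : l' + 1 = m + p) (h₄ : q + 1 = l' + n)
    (e₁ : a + b = ab) (e₂ : ab + c = abc) (e₃ : a + c = ac) (e₄ : ac + b = abc)
    (x : EndObj P m a) (y : EndObj P n b) (z : EndObj P p c) :
    endCirc r' h₂ e₂ (endCirc s h₁ e₁ x y) z =
      (b * c).negOnePow • endCirc s' h₄ e₄ (endCirc r h₃ e₃ x z) y := by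
  refine EndObj.ext fun R K M hM => ?_
  have hs := s.isLt
  have hr := r.isLt
  have hsr0 : (s : ℕ) < r := hsr
  obtain ⟨b0, hb0⟩ := exists_splitPoint (K := K) r'.isLt h₂
  obtain ⟨a0, ha0⟩ : ∃ a0, psum K s = a0 := ⟨_, rfl⟩
  obtain ⟨w, hw⟩ : ∃ w, psum (res K s) n = w := ⟨_, rfl⟩
  obtain ⟨v, hv⟩ : ∃ v, psum (res K r') p = v := ⟨_, rfl⟩
  obtain ⟨d0, hd0⟩ : ∃ d0, psum K r' = a0 + w + d0 := by
    have h1 := psum_res K s n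
    have h2 := psum_mono K (show (s : ℕ) + n ≤ r' by omega)
    exact ⟨psum K r' - a0 - w, by omega⟩
  rw [hd0, hv, hM] at hb0
  have hr1 : ∀ f, psum (upd K s n f) r = a0 + f + d0 := fun f => by
    have h1 := psum_res K s n
    have h2 := psum_upd_gt K n f hsr0
    rw [show (r : ℕ) + n - 1 = r' by omega] at h2
    omega
  have hres2 : ∀ f, res (upd K s n f) r = res K r' := fun f => res_upd_gt K f hsr0 hr'
  have hres1 : ∀ e, ∀ j < n, res (upd K r' p e) s j = res K s j :=
    fun e => res_upd_lt K e (by omega)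
  have hps : ∀ f, psum (upd K s n f) l' = a0 + f + (d0 + v + b0) := fun f =>
    upd_psum (s := s) f (by omega) h₄ ha0 hw hM (by omega)
  rw [endCirc_val r' h₂ e₂ _ z R K M hM (v + 1) hd0 hv hb0 (by omega)]
  have hL : ∀ e ∈ Finset.range (v + 1),
      P.comp e₂ ((endCirc s h₁ e₁ x y).val R (upd K r' p e) (a0 + w + d0 + e + b0)
        (upd_psum e r'.isLt h₂ hd0 hv hM hb0))
        (P.pad (a0 + w + d0) b0 hb0 rfl (z.val e (res K r') v hv)) =
      ∑ f ∈ Finset.range (w + 1), P.comp e₂ (P.comp e₁ (x.val R (upd (upd K r' p e) s n f)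
        (a0 + f + (d0 + e + b0)) (by
          rw [upd_upd_comm K f e hsr0 hr',
            upd_psum (K := upd K s n f) (B := b0) (M := a0 + f + (d0 + v + b0)) e hr h₃ (hr1 f)
              (by rw [hres2, hv])
              (hps f)
              (by omega)]
          omega))
        (P.pad (M := a0 + w + d0 + e + b0) a0 (d0 + e + b0) (by omega) rfl
          (y.val f (res K s) w hw)))
        (P.pad (a0 + w + d0) b0 hb0 rfl (z.val e (res K r') v hv)) := by
    intro e he
    rw [endCirc_val s h₁ e₁ x y R (upd K r' p e) (a0 + w + d0 + e + b0) _ (A := a0)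
      (W := w) (B := d0 + e + b0) (w + 1) (by rw [psum_upd_le _ _ _ (by omega), ha0]) (by
        rw [psum_congr (hres1 e), hw]) (by omega) (by omega)]
    simp only [map_sum, LinearMap.sum_apply]
    refine Finset.sum_congr rfl fun f _ => ?_
    rw [y.congr (hres1 e) _ hw]
  rw [Finset.sum_congr rfl hL, Finset.sum_comm]
  have hR : (endCirc s' h₄ e₄ (endCirc r h₃ e₃ x z) y).val R K M hM =
      ∑ f ∈ Finset.range (w + 1), ∑ e ∈ Finset.range (v + 1),
        P.comp e₄ (P.comp e₃ (x.val R (upd (upd K s n f) r p e) (a0 + f + d0 + e + b0) (by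
          exact upd_psum (K := upd K s n f) (B := b0) (M := a0 + f + (d0 + v + b0)) e hr h₃ (hr1 f)
              (by rw [hres2, hv])
              (hps f)
              (by omega)))
          (P.pad (M := a0 + f + (d0 + v + b0)) (a0 + f + d0) b0 (by omega) rfl
            (z.val e (res K r') v hv)))
          (P.pad (M := M) a0 (d0 + v + b0) (by omega) rfl (y.val f (res K s) w hw)) := by
    rw [endCirc_val s' h₄ e₄ _ y R K M hM (A := a0) (W := w) (B := d0 + v + b0) (w + 1)
      (by rw [hs', ha0]) (by rw [hs', hw]) (by omega) (by omega)]
    refine Finset.sum_congr rfl fun f _ => ?_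
    rw [endCirc_val r h₃ e₃ x z R _ (a0 + f + (d0 + v + b0)) _ (A := a0 + f + d0)
      (W := v) (B := b0) (v + 1) (by rw [hs', hr1]) (by rw [hs', hres2, hv]) (by omega) (by omega)]
    simp only [map_sum, LinearMap.sum_apply]
    refine Finset.sum_congr rfl fun e _ => ?_
    simp only [hs', hres2]
  change _ = (b * c).negOnePow • (endCirc s' h₄ e₄ (endCirc r h₃ e₃ x z) y).val R K M hM
  rw [hR, Finset.smul_sum]
  refine Finset.sum_congr rfl fun f _ => ?_
  rw [Finset.smul_sum]
  refine Finset.sum_congr rfl fun e _ => ?_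
  have h0 : psum (upd (upd K s n f) r p e) m = a0 + f + d0 + e + b0 :=
    upd_psum (K := upd K s n f) (B := b0) (M := a0 + f + (d0 + v + b0)) e hr h₃ (hr1 f)
      (by rw [hres2, hv]) (hps f) (by omega)
  have key : ∀ (N N₁ N₂ : ℕ) (h : psum (upd (upd K r' p e) s n f) m = N)
      (g₁ : a0 + f + (d0 + e + b0) = N)
      (g₂ : a0 + w + (d0 + e + b0) = N₁) (g₂' : a0 + w + d0 + e + b0 = N₁)
      (g₃ : a0 + f + d0 + v + b0 = N₂) (g₃' : a0 + f + (d0 + v + b0) = N₂)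
      (g₄ : a0 + w + (d0 + v + b0) = M) (Y : P.Hom w f b) (Z : P.Hom v e c),
      P.comp e₂ (P.comp e₁ (x.val R (upd (upd K r' p e) s n f) N h)
        (P.pad a0 (d0 + e + b0) g₂ g₁ Y)) (P.pad (a0 + w + d0) b0 hb0 g₂' Z) =
      (b * c).negOnePow • P.comp e₄ (P.comp e₃ (x.val R (upd (upd K s n f) r p e) _ h0)
        (P.pad (a0 + f + d0) b0 g₃ rfl Z)) (P.pad a0 (d0 + v + b0) g₄ g₃' Y) := by
    intro N N₁ N₂ h g₁ g₂ g₂' g₃ g₃' g₄ Y Z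
    obtain rfl : a0 + f + d0 + e + b0 = N := by omega
    rw [x.congr (fun j _ => by rw [upd_upd_comm K f e hsr0 hr']) h h0,
      P.comp_assoc e₁ e₂ rfl (by omega), P.comp_assoc e₃ e₄ (add_comm c b) (by omega),
      P.pad_comm (M₂ := N₂) a0 d0 b0 rfl (add_comm c b) g₂ g₁ hb0 g₂' g₃ rfl g₄ g₃']
    simp
  exact key _ _ _ _ rfl _ rfl _ rfl _ _ _

variable (P) in
/-- The endomorphism operad of the tensor coalgebra `T V`, in terms of operations on `V`. -/
def endOperad : NSOperad k where
  obj n i := EndObj P n i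
  one := endOne P
  circ s hl ht := endCircLin s hl ht
  one_circ s hl ht y := endOne_circ s hl ht y
  circ_one s hl ht x := endCirc_one s hl ht x
  circ_seq s r sr h h₁ h₂ h₃ h₄ e₁ e₂ e₃ e₄ x y z :=
    endCirc_seq s r sr h h₁ h₂ h₃ h₄ e₁ e₂ e₃ e₄ x y z
  circ_par s r hsr r' s' hr' hs' h₁ h₂ h₃ h₄ e₁ e₂ e₃ e₄ x y z :=
    endCirc_par s r hsr r' s' hr' hs' h₁ h₂ h₃ h₄ e₁ e₂ e₃ e₄ x y z

end EndOperadAxioms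
end XB

namespace XB
open scoped DirectSum TensorProduct

/-! ### Unshuffles -/

theorem psum_add_sum {n M : ℕ} (p p' : ℕ → ℕ) (h : psum p n + psum p' n = M) :
    ∑ j : Fin n, (p j + p' j) = M := by
  rw [Finset.sum_add_distrib, ← h, psum, psum, Finset.sum_range, Finset.sum_range]

/-- The permutation that splits the `j`-th block, of size `p j + p' j`, into a first part of size
`p j` and a second part of size `p' j`, and moves all first parts in front of all second parts. -/
def unsh (n : ℕ) (p p' : ℕ → ℕ) {M : ℕ} (h : psum p n + psum p' n = M) : Equiv.Perm (Fin M) :=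
  unshuffle (n := n) (fun j => p j + p' j) (fun j => ⟨p j, by omega⟩) (psum_add_sum p p' h)

theorem finSigmaFinEquiv_val {n : ℕ} (K : ℕ → ℕ) (j : Fin n) (t : Fin (K j)) :
    (finSigmaFinEquiv (n := fun i : Fin n => K i) ⟨j, t⟩ : ℕ) = psum K j + t := by
  rw [finSigmaFinEquiv_apply, psum, Finset.sum_range]
  rfl

theorem finSigmaFinEquiv_val' {n : ℕ} (κ : Fin n → ℕ) (K : ℕ → ℕ) (hK : ∀ j : Fin n, κ j = K j)
    (j : Fin n) (t : Fin (κ j)) :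
    (finSigmaFinEquiv (n := κ) ⟨j, t⟩ : ℕ) = psum K j + t := by
  obtain rfl : κ = fun j : Fin n => K j := funext hK
  exact finSigmaFinEquiv_val K j t

theorem unshuffle_val_left {n M : ℕ} (κ : Fin n → ℕ) (P : ∀ j, Fin (κ j + 1))
    (hM : ∑ j, κ j = M) (p p' : ℕ → ℕ) (hp : ∀ j, (P j : ℕ) = p j)
    (hp' : ∀ j, κ j = p j + p' j) (j : Fin n) (t : ℕ) (ht : t < p j) (x : Fin M)
    (hx : (x : ℕ) = psum p j + psum p' j + t) :
    (unshuffle κ P hM x : ℕ) = psum p j + t := by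
  have hs : psum (fun j => p j + p' j) j = psum p j + psum p' j := by
    simp [psum, Finset.sum_add_distrib]
  have hx' : x = finCongr hM (finSigmaFinEquiv ⟨j, ⟨t, by rw [hp']; omega⟩⟩) := by
    refine Fin.ext ?_
    rw [hx, finCongr_apply, Fin.val_cast,
      finSigmaFinEquiv_val' κ (fun j => p j + p' j) hp', hs]
  have h2 : (finCongr (by have := (P j).isLt; omega : κ j = (P j : ℕ) + (κ j - P j)))
      ⟨t, by rw [hp']; omega⟩ = finSumFinEquiv (Sum.inl ⟨t, by rw [hp]; exact ht⟩) := by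
    ext; simp
  rw [hx']
  simp only [unshuffle, Equiv.trans_apply, finCongr_apply, Fin.cast_cast, Fin.cast_eq_self,
    Equiv.symm_apply_apply, Equiv.sigmaCongrRight_apply]
  rw [finCongr_apply] at h2
  rw [h2, Equiv.symm_apply_apply]
  simp only [Equiv.sigmaSumDistrib_apply, Sum.map_inl, Equiv.sumCongr_apply, blocks,
    Equiv.trans_apply, finSumFinEquiv_apply_left, finCongr_apply, Fin.val_cast, Fin.val_castAdd]
  rw [finSigmaFinEquiv_val' _ p hp]

theorem unshuffle_val_right {n M : ℕ} (κ : Fin n → ℕ) (P : ∀ j, Fin (κ j + 1))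
    (hM : ∑ j, κ j = M) (p p' : ℕ → ℕ) (hp : ∀ j, (P j : ℕ) = p j)
    (hp' : ∀ j, κ j = p j + p' j) (j : Fin n) (t : ℕ) (ht : t < p' j) (x : Fin M)
    (hx : (x : ℕ) = psum p j + psum p' j + p j + t) :
    (unshuffle κ P hM x : ℕ) = psum p n + psum p' j + t := by
  have hs : psum (fun j => p j + p' j) j = psum p j + psum p' j := by
    simp [psum, Finset.sum_add_distrib]
  have hx' : x = finCongr hM (finSigmaFinEquiv ⟨j, ⟨p j + t, by rw [hp']; omega⟩⟩) := by
    refine Fin.ext ?_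
    rw [hx, finCongr_apply, Fin.val_cast,
      finSigmaFinEquiv_val' κ (fun j => p j + p' j) hp', hs, add_assoc]
  have h2 : (finCongr (by have := (P j).isLt; omega : κ j = (P j : ℕ) + (κ j - P j)))
      ⟨p j + t, by rw [hp']; omega⟩ =
      finSumFinEquiv (Sum.inr ⟨t, by rw [hp, hp']; omega⟩) := by
    ext; simp [hp]
  rw [hx']
  simp only [unshuffle, Equiv.trans_apply, finCongr_apply, Fin.cast_cast, Fin.cast_eq_self,
    Equiv.symm_apply_apply, Equiv.sigmaCongrRight_apply]
  rw [finCongr_apply] at h2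
  rw [h2, Equiv.symm_apply_apply]
  simp only [Equiv.sigmaSumDistrib_apply, Sum.map_inr, Equiv.sumCongr_apply, blocks,
    Equiv.trans_apply, finSumFinEquiv_apply_right, finCongr_apply, Fin.val_cast, Fin.val_natAdd]
  rw [finSigmaFinEquiv_val' _ p' (fun j => by rw [hp, hp']; omega), ← add_assoc]
  congr 2
  rw [psum, Finset.sum_range]
  exact Finset.sum_congr rfl fun j _ => hp j

theorem unsh_left {n M : ℕ} {p p' : ℕ → ℕ} (h : psum p n + psum p' n = M) {j t : ℕ} (hj : j < n)
    (ht : t < p j) (x : Fin M) (hx : (x : ℕ) = psum p j + psum p' j + t) :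
    (unsh n p p' h x : ℕ) = psum p j + t :=
  unshuffle_val_left _ _ _ p p' (fun _ => rfl) (fun _ => rfl) ⟨j, hj⟩ t ht x hx

theorem unsh_right {n M : ℕ} {p p' : ℕ → ℕ} (h : psum p n + psum p' n = M) {j t : ℕ} (hj : j < n)
    (ht : t < p' j) (x : Fin M) (hx : (x : ℕ) = psum p j + psum p' j + p j + t) :
    (unsh n p p' h x : ℕ) = psum p n + psum p' j + t :=
  unshuffle_val_right _ _ _ p p' (fun _ => rfl) (fun _ => rfl) ⟨j, hj⟩ t ht x hx

theorem exists_slot {n : ℕ} (p p' : ℕ → ℕ) {x : ℕ} (hx : x < psum p n + psum p' n) :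
    ∃ j < n, (∃ t < p j, x = psum p j + psum p' j + t) ∨
      ∃ t < p' j, x = psum p j + psum p' j + p j + t := by
  induction n with
  | zero => simp at hx
  | succ n ih =>
    by_cases h : x < psum p n + psum p' n
    · obtain ⟨j, hj, hh⟩ := ih h
      exact ⟨j, by omega, hh⟩
    · rw [psum_succ, psum_succ] at hx
      refine ⟨n, by omega, ?_⟩
      by_cases h' : x < psum p n + psum p' n + p n
      · exact Or.inl ⟨x - (psum p n + psum p' n), by omega, by omega⟩
      · exact Or.inr ⟨x - (psum p n + psum p' n + p n), by omega, by omega⟩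

theorem eq_unsh {n M : ℕ} {p p' : ℕ → ℕ} (h : psum p n + psum p' n = M) (σ : Equiv.Perm (Fin M))
    (h₁ : ∀ j < n, ∀ t < p j, ∀ x : Fin M, (x : ℕ) = psum p j + psum p' j + t →
      (σ x : ℕ) = psum p j + t)
    (h₂ : ∀ j < n, ∀ t < p' j, ∀ x : Fin M, (x : ℕ) = psum p j + psum p' j + p j + t →
      (σ x : ℕ) = psum p n + psum p' j + t) : σ = unsh n p p' h := by
  ext x
  obtain ⟨j, hj, ⟨t, ht, hx⟩ | ⟨t, ht, hx⟩⟩ := exists_slot (n := n) p p' (lt_of_lt_of_eq x.isLt h.symm)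
  · rw [h₁ j hj t ht x hx, unsh_left h hj ht x hx]
  · rw [h₂ j hj t ht x hx, unsh_right h hj ht x hx]

theorem unshuffle_eq_unsh {n M : ℕ} (κ : Fin n → ℕ) (P : ∀ j, Fin (κ j + 1))
    (hM : ∑ j, κ j = M) (p p' : ℕ → ℕ) (hp : ∀ j, (P j : ℕ) = p j)
    (hp' : ∀ j, κ j = p j + p' j) (h : psum p n + psum p' n = M) :
    unshuffle κ P hM = unsh n p p' h :=
  eq_unsh h _ (fun j hj t ht x hx => unshuffle_val_left κ P hM p p' hp hp' ⟨j, hj⟩ t ht x hx)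
    (fun j hj t ht x hx => unshuffle_val_right κ P hM p p' hp hp' ⟨j, hj⟩ t ht x hx)

/-- The word `U` with the letter `q` in the position `s`. -/
def setAt (U : ℕ → ℕ) (s q : ℕ) : ℕ → ℕ := fun j => if j = s then q else U j

theorem psum_setAt_le (U : ℕ → ℕ) (q : ℕ) {s j : ℕ} (h : j ≤ s) :
    psum (setAt U s q) j = psum U j :=
  psum_congr fun i hi => by simp [setAt, show i ≠ s by omega]

theorem psum_setAt_gt (U : ℕ → ℕ) (q : ℕ) {s j : ℕ} (h : s < j) :
    psum (setAt U s q) j + U s = psum U j + q := by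
  induction j, h using Nat.le_induction with
  | base => rw [psum_succ, psum_succ, psum_setAt_le U q le_rfl]; simp [setAt]; omega
  | succ j h ih =>
    rw [psum_succ, psum_succ]
    have : setAt U s q j = U j := by simp [setAt, show j ≠ s by omega]
    omega

theorem rigidMove_left {m s M N : ℕ} {U U' : ℕ → ℕ} (hs : s < m) (w q c : ℕ)
    (hU : U s = 0) (hU' : U' s = 0)
    (hM : psum (setAt U s w) m + psum (setAt U' s c) m = M)
    (hN : psum (setAt U s q) m + psum (setAt U' s c) m = N) :
    RigidMove (psum U s + psum U' s) (psum U s) w q (unsh m _ _ hM) (unsh m _ _ hN) := by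
  have e1 : ∀ j, s < j → ∀ q, psum (setAt U s q) j = psum U j + q := fun j hj q => by
    have := psum_setAt_gt U q hj; omega
  have e1' : ∀ j, s < j → ∀ q, psum (setAt U' s q) j = psum U' j + q := fun j hj q => by
    have := psum_setAt_gt U' q hj; omega
  have e2 : ∀ j, j ≤ s → ∀ q, psum (setAt U s q) j = psum U j := fun j hj q =>
    psum_setAt_le U q hj
  have e2' : ∀ j, j ≤ s → ∀ q, psum (setAt U' s q) j = psum U' j := fun j hj q =>
    psum_setAt_le U' q hj
  have v : ∀ q, setAt U s q s = q := fun q => by simp [setAt]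
  have v' : ∀ q, setAt U' s q s = q := fun q => by simp [setAt]
  have n1 : ∀ j, j ≠ s → ∀ q, setAt U s q j = U j := fun j hj q => by simp [setAt, hj]
  have n1' : ∀ j, j ≠ s → ∀ q, setAt U' s q j = U' j := fun j hj q => by simp [setAt, hj]
  have m1 : ∀ {a b}, a ≤ b → psum U a ≤ psum U b := fun h => psum_mono U h
  have m1' : ∀ {a b}, a ≤ b → psum U' a ≤ psum U' b := fun h => psum_mono U' h
  refine ⟨fun y h1 h2 => ?_, fun x h1 h2 => ?_, fun x y hxy => ?_⟩
  · rw [unsh_left hN hs (t := y - (psum U s + psum U' s)) (by rw [v]; omega) y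
      (by rw [e2 s le_rfl, e2' s le_rfl]; omega), e2 s le_rfl]
    omega
  · rw [unsh_left hM hs (t := x - (psum U s + psum U' s)) (by rw [v]; omega) x
      (by rw [e2 s le_rfl, e2' s le_rfl]; omega), e2 s le_rfl]
    omega
  · obtain ⟨j, hj, ⟨t, ht, hx⟩ | ⟨t, ht, hx⟩⟩ := exists_slot (n := m) _ _ (lt_of_lt_of_eq x.isLt hM.symm)
    · rcases lt_trichotomy j s with hjs | rfl | hjs
      · have f := e2 j hjs.le
        have f' := e2' j hjs.le
        have g := m1 (show j + 1 ≤ s by omega)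
        have g' := m1' (show j + 1 ≤ s by omega)
        rw [psum_succ] at g g'
        rw [n1 j (by omega)] at ht
        rw [f, f'] at hx
        rw [unsh_left hM hj (by rw [n1 j (by omega)]; exact ht) x (by rw [f, f']; omega),
          unsh_left hN hj (t := t) (by rw [n1 j (by omega)]; exact ht) y (by rw [f, f']; omega),
          f, f]
        omega
      · rw [v] at ht
        rw [e2 j le_rfl, e2' j le_rfl] at hx
        omega
      · have f := e1 j hjs
        have f' := e1' j hjs
        have g := m1 hjs.le
        have g' := m1' hjs.le
        rw [n1 j (by omega)] at ht
        rw [f, f'] at hx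
        rw [unsh_left hM hj (by rw [n1 j (by omega)]; exact ht) x (by rw [f, f']; omega),
          unsh_left hN hj (t := t) (by rw [n1 j (by omega)]; exact ht) y (by rw [f, f']; omega),
          f, f]
        omega
    · have fm := e1 m hs
      have gm := m1 hs.le
      rcases lt_trichotomy j s with hjs | rfl | hjs
      · have f := e2 j hjs.le
        have f' := e2' j hjs.le
        have g := m1 (show j + 1 ≤ s by omega)
        have g' := m1' (show j + 1 ≤ s by omega)
        rw [psum_succ] at g g'
        rw [n1' j (by omega)] at ht
        rw [f, f', n1 j (by omega)] at hx
        rw [unsh_right hM hj (t := t) (by rw [n1' j (by omega)]; exact ht) x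
            (by rw [f, f', n1 j (by omega)]; omega),
          unsh_right hN hj (t := t) (by rw [n1' j (by omega)]; exact ht) y
            (by rw [f, f', n1 j (by omega)]; omega), fm, fm, f']
        omega
      · have f' := e2' j le_rfl
        have f := e2 j le_rfl
        rw [v'] at ht
        rw [f, f', v] at hx
        rw [unsh_right hM hj (t := t) (by rw [v']; exact ht) x (by rw [f, f', v]; omega),
          unsh_right hN hj (t := t) (by rw [v']; exact ht) y
            (by rw [f, f', v]; omega), fm, fm, f']
        omega
      · have f := e1 j hjs
        have f' := e1' j hjs
        have g := m1 hjs.le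
        have g' := m1' hjs.le
        rw [n1' j (by omega)] at ht
        rw [f, f', n1 j (by omega)] at hx
        rw [unsh_right hM hj (t := t) (by rw [n1' j (by omega)]; exact ht) x
            (by rw [f, f', n1 j (by omega)]; omega),
          unsh_right hN hj (t := t) (by rw [n1' j (by omega)]; exact ht) y
            (by rw [f, f', n1 j (by omega)]; omega), fm, fm, f']
        omega

theorem rigidMove_right {m s M N : ℕ} {U U' : ℕ → ℕ} (hs : s < m) (w q c : ℕ)
    (hU : U s = 0) (hU' : U' s = 0)
    (hM : psum (setAt U s c) m + psum (setAt U' s w) m = M)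
    (hN : psum (setAt U s c) m + psum (setAt U' s q) m = N) :
    RigidMove (psum U s + psum U' s + c) (psum (setAt U s c) m + psum U' s) w q
      (unsh m _ _ hM) (unsh m _ _ hN) := by
  have e1 : ∀ j, s < j → ∀ q, psum (setAt U s q) j = psum U j + q := fun j hj q => by
    have := psum_setAt_gt U q hj; omega
  have e1' : ∀ j, s < j → ∀ q, psum (setAt U' s q) j = psum U' j + q := fun j hj q => by
    have := psum_setAt_gt U' q hj; omega
  have e2 : ∀ j, j ≤ s → ∀ q, psum (setAt U s q) j = psum U j := fun j hj q =>
    psum_setAt_le U q hj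
  have e2' : ∀ j, j ≤ s → ∀ q, psum (setAt U' s q) j = psum U' j := fun j hj q =>
    psum_setAt_le U' q hj
  have v : ∀ q, setAt U s q s = q := fun q => by simp [setAt]
  have v' : ∀ q, setAt U' s q s = q := fun q => by simp [setAt]
  have n1 : ∀ j, j ≠ s → ∀ q, setAt U s q j = U j := fun j hj q => by simp [setAt, hj]
  have n1' : ∀ j, j ≠ s → ∀ q, setAt U' s q j = U' j := fun j hj q => by simp [setAt, hj]
  have m1 : ∀ {a b}, a ≤ b → psum U a ≤ psum U b := fun h => psum_mono U h
  have m1' : ∀ {a b}, a ≤ b → psum U' a ≤ psum U' b := fun h => psum_mono U' h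
  have fm := e1 m hs c
  have gm := m1 hs.le
  refine ⟨fun y h1 h2 => ?_, fun x h1 h2 => ?_, fun x y hxy => ?_⟩
  · rw [unsh_right hN hs (t := y - (psum U s + psum U' s + c)) (by rw [v']; omega) y
      (by rw [e2 s le_rfl, e2' s le_rfl, v]; omega), e2' s le_rfl]
    omega
  · rw [unsh_right hM hs (t := x - (psum U s + psum U' s + c)) (by rw [v']; omega) x
      (by rw [e2 s le_rfl, e2' s le_rfl, v]; omega), e2' s le_rfl]
    omega
  · obtain ⟨j, hj, ⟨t, ht, hx⟩ | ⟨t, ht, hx⟩⟩ := exists_slot (n := m) _ _ (lt_of_lt_of_eq x.isLt hM.symm)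
    · have gj := m1 (show j + 1 ≤ m by omega)
      rw [psum_succ] at gj
      rcases lt_trichotomy j s with hjs | rfl | hjs
      · have f := e2 j hjs.le
        have f' := e2' j hjs.le
        have g := m1 (show j + 1 ≤ s by omega)
        have g' := m1' (show j + 1 ≤ s by omega)
        rw [psum_succ] at g g'
        rw [n1 j (by omega)] at ht
        rw [f, f'] at hx
        rw [unsh_left hM hj (by rw [n1 j (by omega)]; exact ht) x (by rw [f, f']; omega),
          unsh_left hN hj (t := t) (by rw [n1 j (by omega)]; exact ht) y (by rw [f, f']; omega),
          f, fm]
        omega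
      · have f' := e2' j le_rfl
        have f := e2 j le_rfl
        rw [v] at ht
        rw [f, f'] at hx
        rw [unsh_left hM hj (t := t) (by rw [v]; exact ht) x (by rw [f, f']; omega),
          unsh_left hN hj (t := t) (by rw [v]; exact ht) y (by rw [f, f']; omega), f, fm]
        omega
      · have f := e1 j hjs
        have f' := e1' j hjs
        have g := m1 hjs.le
        have g' := m1' hjs.le
        rw [n1 j (by omega)] at ht
        rw [f, f'] at hx
        rw [unsh_left hM hj (by rw [n1 j (by omega)]; exact ht) x (by rw [f, f']; omega),
          unsh_left hN hj (t := t) (by rw [n1 j (by omega)]; exact ht) y (by rw [f, f']; omega),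
          f, fm]
        omega
    · rcases lt_trichotomy j s with hjs | rfl | hjs
      · have f := e2 j hjs.le
        have f' := e2' j hjs.le
        have g := m1 (show j + 1 ≤ s by omega)
        have g' := m1' (show j + 1 ≤ s by omega)
        rw [psum_succ] at g g'
        rw [n1' j (by omega)] at ht
        rw [f, f', n1 j (by omega)] at hx
        rw [unsh_right hM hj (t := t) (by rw [n1' j (by omega)]; exact ht) x
            (by rw [f, f', n1 j (by omega)]; omega),
          unsh_right hN hj (t := t) (by rw [n1' j (by omega)]; exact ht) y
            (by rw [f, f', n1 j (by omega)]; omega), f', f']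
        omega
      · have f' := e2' j le_rfl
        have f := e2 j le_rfl
        rw [v'] at ht
        rw [f, f', v] at hx
        omega
      · have f := e1 j hjs
        have f' := e1' j hjs
        have g := m1 hjs.le
        have g' := m1' hjs.le
        rw [n1' j (by omega)] at ht
        rw [f, f', n1 j (by omega)] at hx
        rw [unsh_right hM hj (t := t) (by rw [n1' j (by omega)]; exact ht) x
            (by rw [f, f', n1 j (by omega)]; omega),
          unsh_right hN hj (t := t) (by rw [n1' j (by omega)]; exact ht) y
            (by rw [f, f', n1 j (by omega)]; omega), f', f']
        omega

end XB

namespace XB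
open scoped DirectSum TensorProduct

theorem unsh_congr {n M : ℕ} {p p' q q' : ℕ → ℕ} (hp : ∀ j < n, p j = q j)
    (hp' : ∀ j < n, p' j = q' j) (h : psum p n + psum p' n = M) (h' : psum q n + psum q' n = M) :
    unsh n p p' h = unsh n q q' h' := by
  have e : ∀ j ≤ n, psum p j = psum q j := fun j hj => psum_congr fun i hi => hp i (by omega)
  have e' : ∀ j ≤ n, psum p' j = psum q' j := fun j hj => psum_congr fun i hi => hp' i (by omega)
  refine eq_unsh _ _ (fun j hj t ht x hx => ?_) (fun j hj t ht x hx => ?_)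
  · rw [unsh_left h hj (by rw [hp j hj]; exact ht) x (by rw [hx, e j hj.le, e' j hj.le]), e j hj.le]
  · rw [unsh_right h hj (by rw [hp' j hj]; exact ht) x
      (by rw [hx, e j hj.le, e' j hj.le, hp j hj]), e n le_rfl, e' j hj.le]

theorem upd_eq_setAt (K : ℕ → ℕ) (s n q : ℕ) : upd K s n q = setAt (upd K s n 0) s q := by
  funext j
  by_cases h : j = s <;> simp [upd, setAt, h]

theorem rigidMove_left_of_eq {m s M N w q c : ℕ} {U U' x y z : ℕ → ℕ} (hs : s < m)
    (hU : U s = 0) (hU' : U' s = 0) (hx : x = setAt U s w) (hy : y = setAt U s q)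
    (hz : z = setAt U' s c) (hM : psum x m + psum z m = M) (hN : psum y m + psum z m = N) :
    RigidMove (psum U s + psum U' s) (psum U s) w q (unsh m x z hM) (unsh m y z hN) := by
  subst hx hy hz
  exact rigidMove_left hs w q c hU hU' hM hN

theorem rigidMove_right_of_eq {m s M N w q c : ℕ} {U U' x y z : ℕ → ℕ} (hs : s < m)
    (hU : U s = 0) (hU' : U' s = 0) (hx : x = setAt U' s w) (hy : y = setAt U' s q)
    (hz : z = setAt U s c) (hM : psum z m + psum x m = M) (hN : psum z m + psum y m = N) :
    RigidMove (psum U s + psum U' s + c) (psum z m + psum U' s) w q (unsh m z x hM)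
      (unsh m z y hN) := by
  subst hx hy hz
  exact rigidMove_right hs w q c hU hU' hM hN

theorem psum_upd_res (p : ℕ → ℕ) {s n w j : ℕ} (hw : psum (res p s) n = w) (h : s < j) :
    psum (upd p s n w) j = psum p (j + n - 1) := by
  have h1 := psum_upd_gt p n w h
  have h2 := psum_res p s n
  omega

/-- An unshuffle of many blocks is an unshuffle of fewer blocks, one of which is made up of
unshuffled blocks. -/
theorem unsh_mul_blockSum {m n l s M A W B w w' : ℕ} {p p' : ℕ → ℕ} (hs : s < m)
    (hl : l + 1 = m + n) (hw : psum (res p s) n = w) (hw' : psum (res p' s) n = w')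
    (hW : psum (res p s) n + psum (res p' s) n = W) (hA : psum p s + psum p' s = A)
    (hB : A + W + B = M) (hM : psum p l + psum p' l = M)
    (hM' : psum (upd p s n w) m + psum (upd p' s n w') m = M) :
    unsh m (upd p s n w) (upd p' s n w') hM' *
      blockSum hB (blockSum rfl 1 (unsh n (res p s) (res p' s) hW)) 1 = unsh l p p' hM := by
  set β := blockSum hB (blockSum rfl 1 (unsh n (res p s) (res p' s) hW)) 1 with hβ
  have β1 : ∀ x : Fin M, (x : ℕ) < A → (β x : ℕ) = x := fun x hx => by
    rw [hβ, blockSum_val_left hB _ _ x ⟨x, by omega⟩ rfl, blockSum_val_left rfl _ _ _ ⟨x, hx⟩ rfl]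
    rfl
  have β2 : ∀ x : Fin M, A + W ≤ (x : ℕ) → (β x : ℕ) = x := fun x hx => by
    rw [hβ, blockSum_val_right hB _ _ x ⟨x - (A + W), by omega⟩ (by simp; omega)]
    simp; omega
  have β3 : ∀ (x : Fin M) (y : Fin W), (x : ℕ) = A + y →
      (β x : ℕ) = A + unsh n (res p s) (res p' s) hW y := fun x y hx => by
    rw [hβ, blockSum_val_left hB _ _ x ⟨x, by omega⟩ rfl, blockSum_val_right rfl _ _ _ y hx]
  have e : ∀ j, s < j → psum (upd p s n w) j = psum p (j + n - 1) := fun j hj =>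
    psum_upd_res p hw hj
  have e' : ∀ j, s < j → psum (upd p' s n w') j = psum p' (j + n - 1) := fun j hj =>
    psum_upd_res p' hw' hj
  have r : ∀ j, psum p s + psum (res p s) j = psum p (s + j) := psum_res p s
  have r' : ∀ j, psum p' s + psum (res p' s) j = psum p' (s + j) := psum_res p' s
  have em : psum (upd p s n w) m = psum p l := by rw [e m hs]; congr 1; omega
  refine eq_unsh _ _ (fun j hj t ht x hx => ?_) (fun j hj t ht x hx => ?_)
  · rw [Equiv.Perm.mul_apply]
    have g : psum p (j + 1) = psum p j + p j := psum_succ p j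
    rcases lt_or_ge j s with hjs | hjs
    · have m1 := psum_mono p (show j + 1 ≤ s by omega)
      have m2 := psum_mono p' (show j ≤ s by omega)
      have f := psum_upd_le p n w hjs.le
      have f' := psum_upd_le p' n w' hjs.le
      have hb := β1 x (by omega)
      rw [unsh_left hM' (j := j) (t := t) (by omega) (by simpa [upd, hjs] using ht) _
        (by rw [hb, hx, f, f']), f]
    rcases lt_or_ge j (s + n) with hjn | hjn
    · obtain ⟨i, rfl⟩ := Nat.exists_eq_add_of_le hjs
      have m1 := psum_mono p (show s + i + 1 ≤ s + n by omega)
      have m2 := psum_mono p' (show s + i ≤ s + n by omega)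
      have q1 := r i
      have q1' := r' i
      have q2 := r n
      have q2' := r' n
      have hy : psum (res p s) i + psum (res p' s) i + t < W := by omega
      have hb := β3 x ⟨_, hy⟩ (by simp only []; omega)
      rw [unsh_left hW (j := i) (t := t) (by omega) ht ⟨_, hy⟩ rfl] at hb
      have f := psum_upd_le p n w (le_refl s)
      have f' := psum_upd_le p' n w' (le_refl s)
      rw [unsh_left hM' (j := s) (t := psum (res p s) i + t) hs (by simp [upd]; omega) _
        (by rw [hb, f, f']; omega), f]
      omega
    · have q2 := r n
      have q2' := r' n
      have m1 := psum_mono p hjn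
      have m1' := psum_mono p' hjn
      have hb := β2 x (by omega)
      obtain ⟨i, hi⟩ : ∃ i, i + n - 1 = j ∧ s < i ∧ i < m := ⟨j + 1 - n, by omega⟩
      have f := e i hi.2.1
      have f' := e' i hi.2.1
      rw [hi.1] at f f'
      rw [unsh_left hM' (j := i) (t := t) hi.2.2 (by
        simpa [upd, show ¬ i < s by omega, show ¬ i = s by omega, hi.1] using ht) _
        (by rw [hb, hx, f, f']), f]
  · rw [Equiv.Perm.mul_apply]
    have g : psum p (j + 1) = psum p j + p j := psum_succ p j
    have g' : psum p' (j + 1) = psum p' j + p' j := psum_succ p' j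
    rcases lt_or_ge j s with hjs | hjs
    · have m1 := psum_mono p (show j + 1 ≤ s by omega)
      have m2 := psum_mono p' (show j + 1 ≤ s by omega)
      have f := psum_upd_le p n w hjs.le
      have f' := psum_upd_le p' n w' hjs.le
      have hb := β1 x (by omega)
      rw [unsh_right hM' (j := j) (t := t) (by omega) (by simpa [upd, hjs] using ht) _
        (by rw [hb, hx, f, f']; simp [upd, hjs]), em, f']
    rcases lt_or_ge j (s + n) with hjn | hjn
    · obtain ⟨i, rfl⟩ := Nat.exists_eq_add_of_le hjs
      have m1 := psum_mono p (show s + i + 1 ≤ s + n by omega)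
      have m2 := psum_mono p' (show s + i + 1 ≤ s + n by omega)
      have q1 := r i
      have q1' := r' i
      have q2 := r n
      have q2' := r' n
      have hy : psum (res p s) i + psum (res p' s) i + p (s + i) + t < W := by omega
      have hb := β3 x ⟨_, hy⟩ (by simp only []; omega)
      rw [unsh_right hW (j := i) (t := t) (by omega) ht ⟨_, hy⟩ rfl] at hb
      have f := psum_upd_le p n w (le_refl s)
      have f' := psum_upd_le p' n w' (le_refl s)
      rw [unsh_right hM' (j := s) (t := psum (res p' s) i + t) hs (by simp [upd]; omega) _
        (by rw [hb, f, f']; simp [upd]; omega), em, f']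
      omega
    · have q2 := r n
      have q2' := r' n
      have m1 := psum_mono p hjn
      have m1' := psum_mono p' hjn
      have hb := β2 x (by omega)
      obtain ⟨i, hi⟩ : ∃ i, i + n - 1 = j ∧ s < i ∧ i < m := ⟨j + 1 - n, by omega⟩
      have he := e i hi.2.1
      have he' := e' i hi.2.1
      rw [hi.1] at he he'
      rw [unsh_right hM' (j := i) (t := t) hi.2.2 (by
        simpa [upd, show ¬ i < s by omega, show ¬ i = s by omega, hi.1] using ht) _
        (by rw [hb, hx, he, he']
            simp [upd, show ¬ i < s by omega, show ¬ i = s by omega, hi.1]), em, he']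

/-- Coassociativity of unshuffles. -/
theorem unsh_coassoc {n M N N' : ℕ} {a b c p q : ℕ → ℕ} (hp : ∀ j < n, a j + b j = p j)
    (hq : ∀ j < n, b j + c j = q j)
    (h₁ : psum a n + psum b n = N) (h₂ : psum p n + psum c n = M) (h₃ : psum b n + psum c n = N')
    (h₄ : psum a n + psum q n = M) (h₅ : N + psum c n = M) (h₆ : psum a n + N' = M) :
    blockSum h₅ (unsh n a b h₁) 1 * unsh n p c h₂ =
      blockSum h₆ 1 (unsh n b c h₃) * unsh n a q h₄ := by
  have ep : ∀ j ≤ n, psum p j = psum a j + psum b j := fun j hj => by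
    rw [psum_congr (K' := fun j => a j + b j) (fun i hi => (hp i (by omega)).symm)]
    simp [psum, Finset.sum_add_distrib]
  have eq : ∀ j ≤ n, psum q j = psum b j + psum c j := fun j hj => by
    rw [psum_congr (K' := fun j => b j + c j) (fun i hi => (hq i (by omega)).symm)]
    simp [psum, Finset.sum_add_distrib]
  have epn := ep n le_rfl
  have eqn := eq n le_rfl
  ext x
  simp only [Equiv.Perm.mul_apply]
  obtain ⟨j, hj, hh⟩ := exists_slot (n := n) p c (lt_of_lt_of_eq x.isLt h₂.symm)
  have epj := ep j hj.le
  have eqj := eq j hj.le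
  have hpj := hp j hj
  have hqj := hq j hj
  have ga := psum_mono a (show j + 1 ≤ n by omega)
  have gb := psum_mono b (show j + 1 ≤ n by omega)
  have gc := psum_mono c (show j + 1 ≤ n by omega)
  rw [psum_succ] at ga gb gc
  rcases hh with ⟨t, ht, hx⟩ | ⟨t, ht, hx⟩
  · have l1 := unsh_left h₂ hj ht x hx
    by_cases hta : t < a j
    · have l2 := unsh_left h₁ hj hta ⟨psum a j + psum b j + t, by omega⟩ rfl
      have l3 := unsh_left h₄ hj hta x (by omega)
      rw [blockSum_val_left h₅ _ _ _ ⟨psum a j + psum b j + t, by omega⟩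
          (by rw [l1]; simp only []; omega), l2,
        blockSum_val_left h₆ _ _ _ ⟨psum a j + t, by omega⟩ (by rw [l3])]
      rfl
    · obtain ⟨t', rfl⟩ := Nat.exists_eq_add_of_le (not_lt.1 hta)
      have l2 := unsh_right h₁ hj (t := t') (by omega)
        ⟨psum a j + psum b j + a j + t', by omega⟩ rfl
      have l3 := unsh_right h₄ hj (t := t') (by omega) x (by omega)
      have l4 := unsh_left h₃ hj (t := t') (by omega) ⟨psum b j + psum c j + t', by omega⟩ rfl
      rw [blockSum_val_left h₅ _ _ _ ⟨psum a j + psum b j + a j + t', by omega⟩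
          (by rw [l1]; simp only []; omega), l2,
        blockSum_val_right h₆ _ _ _ ⟨psum b j + psum c j + t', by omega⟩
          (by rw [l3]; simp only []; omega), l4]
      omega
  · have l1 := unsh_right h₂ hj ht x hx
    have l3 := unsh_right h₄ hj (t := b j + t) (by omega) x (by omega)
    have l4 := unsh_right h₃ hj (t := t) (by omega)
      ⟨psum b j + psum c j + b j + t, by omega⟩ rfl
    rw [blockSum_val_right h₅ _ _ _ ⟨psum c j + t, by omega⟩ (by rw [l1]; simp only []; omega),
      blockSum_val_right h₆ _ _ _ ⟨psum b j + psum c j + b j + t, by omega⟩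
        (by rw [l3]; simp only []; omega), l4]
    simp only [Equiv.Perm.coe_one, id_eq]
    omega

section

variable {k : Type u} [Field k] (P : PROP k)

theorem PROP.hcomp_eq_comp {m m' M n n' N M' : ℕ} {a b ab : ℤ} (hM : m + m' = M) (hN : n + n' = N)
    (hM' : m + n' = M') (e : a + b = ab) (f : P.Hom m n a) (g : P.Hom m' n' b) :
    P.hcomp hM hN e f g = P.comp e (P.hcomp hM' hN (add_zero a) f (P.perm 1))
      (P.hcomp hM hM' (zero_add b) (P.perm 1) g) := by
  rw [P.interchange hM hM' hN _ _ _ (add_zero a) (zero_add b) e, P.comp_one, P.one_comp]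
  simp

theorem PROP.hcomp_perm_one {m n C M N : ℕ} {a : ℤ} (hM : m + C = M) (hN : n + C = N)
    (h₁ : 0 + m + C = M) (h₂ : 0 + n + C = N) (f : P.Hom m n a) :
    P.hcomp hM hN (add_zero a) f (P.perm (1 : Equiv.Perm (Fin C))) = P.pad 0 C h₁ h₂ f := by
  rw [P.pad_apply' 0 C (zero_add m) (zero_add n) hM hN, P.one_hcomp]

theorem PROP.perm_one_hcomp {m n C M N : ℕ} {a : ℤ} (hM : C + m = M) (hN : C + n = N)
    (h₁ : C + m + 0 = M) (h₂ : C + n + 0 = N) (f : P.Hom m n a) :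
    P.hcomp hM hN (zero_add a) (P.perm (1 : Equiv.Perm (Fin C))) f = P.pad C 0 h₁ h₂ f := by
  rw [P.pad_apply' C 0 hM hN rfl rfl, P.hcomp_one]

theorem PROP.pad_hcomp {w w' W q q' Q M N M' : ℕ} {a b ab : ℤ} (A B : ℕ) (hW : w + w' = W)
    (hQ : q + q' = Q) (e : a + b = ab) (hM : A + W + B = M) (hN : A + Q + B = N)
    (h₁ : A + w + (q' + B) = M') (h₂ : A + q + (q' + B) = N)
    (h₃ : A + w + w' + B = M) (h₄ : A + w + q' + B = M')
    (f : P.Hom w q a) (g : P.Hom w' q' b) :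
    P.pad A B hM hN (P.hcomp hW hQ e f g) =
      P.comp e (P.pad A (q' + B) h₁ h₂ f) (P.pad (A + w) B h₃ h₄ g) := by
  rw [P.hcomp_eq_comp hW hQ rfl e, P.pad_comp A B hM (by omega : _ = M') hN e,
    P.hcomp_perm_one _ _ (by omega) (by omega), P.perm_one_hcomp _ _ (by omega) (by omega),
    P.pad_pad 0 q' A B _ _ _ _ (by omega) (by omega), P.pad_pad w 0 A B _ _ _ _ (by omega)
    (by omega), P.pad_congr (A := A + 0) (A' := A) rfl rfl _ _ h₁ h₂,
    P.pad_congr (A := A + w) rfl (zero_add B) _ _ h₃ h₄]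

theorem PROP.hcomp_pad_pad {w w' q q' M₁ M₂ N₁ N₂ M N M' : ℕ} {a b ab : ℤ} (A B A' B' : ℕ)
    (h₁ : A + w + B = M₁) (h₂ : A + q + B = N₁) (h₃ : A' + w' + B' = M₂) (h₄ : A' + q' + B' = N₂)
    (hM : M₁ + M₂ = M) (hN : N₁ + N₂ = N) (e : a + b = ab)
    (g₁ : A + w + (B + N₂) = M') (g₂ : A + q + (B + N₂) = N)
    (g₃ : M₁ + A' + w' + B' = M) (g₄ : M₁ + A' + q' + B' = M')
    (f : P.Hom w q a) (g : P.Hom w' q' b) :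
    P.hcomp hM hN e (P.pad A B h₁ h₂ f) (P.pad A' B' h₃ h₄ g) =
      P.comp e (P.pad A (B + N₂) g₁ g₂ f) (P.pad (M₁ + A') B' g₃ g₄ g) := by
  rw [P.hcomp_eq_comp hM hN (by omega : _ = M') e,
    P.hcomp_perm_one _ _ (by omega) (by omega), P.perm_one_hcomp _ _ (by omega) (by omega),
    P.pad_pad A B 0 N₂ _ _ _ _ (by omega) (by omega), P.pad_pad A' B' M₁ 0 _ _ _ _ (by omega)
    (by omega), P.pad_congr (A := 0 + A) (zero_add A) rfl _ _ g₁ g₂,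
    P.pad_congr (A := M₁ + A') (B := B' + 0) (B' := B') rfl rfl _ _ g₃ g₄]

/-- Unshuffles are natural with respect to operations on the two parts of one of the blocks. -/
theorem PROP.unsh_comp_pad {m n l s M N M₁ M₂ N₁ N₂ A B W Q w w' q q' a₁ a₂ b₁ b₂ : ℕ}
    {i j t : ℤ} {p p' : ℕ → ℕ} (hs : s < m) (hl : l + 1 = m + n) (hw : psum (res p s) n = w)
    (hw' : psum (res p' s) n = w') (ha₁ : psum p s = a₁) (ha₂ : psum p' s = a₂)
    (hM₁ : psum p l = M₁) (hM₂ : psum p' l = M₂) (hb₁ : a₁ + w + b₁ = M₁) (hb₂ : a₂ + w' + b₂ = M₂)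
    (hc₁ : a₁ + q + b₁ = N₁) (hc₂ : a₂ + q' + b₂ = N₂)
    (hA : a₁ + a₂ = A) (hB : b₁ + b₂ = B) (hW : w + w' = W) (hQ : q + q' = Q)
    (hM : M₁ + M₂ = M) (hN : N₁ + N₂ = N) (hAM : A + W + B = M) (hAN : A + Q + B = N)
    (e : i + j = t)
    (k₁ : psum (upd p s n q) m + psum (upd p' s n q') m = N)
    (k₂ : psum (res p s) n + psum (res p' s) n = W) (k₃ : psum p l + psum p' l = M)
    (f : P.Hom w q i) (g : P.Hom w' q' j) :
    P.comp (zero_add t) (P.perm (unsh m (upd p s n q) (upd p' s n q') k₁))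
      (P.pad A B hAM hAN (P.comp (add_zero t) (P.hcomp hW hQ e f g)
        (P.perm (unsh n (res p s) (res p' s) k₂)))) =
    P.comp (add_zero t) (P.hcomp hM hN e (P.pad a₁ b₁ hb₁ hc₁ f) (P.pad a₂ b₂ hb₂ hc₂ g))
      (P.perm (unsh l p p' k₃)) := by
  have u0 : ∀ c, psum (upd p s n c) m = a₁ + c + b₁ := fun c => upd_psum c hs hl ha₁ hw hM₁ hb₁
  have u0' : ∀ c, psum (upd p' s n c) m = a₂ + c + b₂ :=
    fun c => upd_psum c hs hl ha₂ hw' hM₂ hb₂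
  have v : upd p s n 0 s = 0 := by simp [upd]
  have v' : upd p' s n 0 s = 0 := by simp [upd]
  have z : psum (upd p s n 0) s = a₁ := by rw [psum_upd_le p n 0 le_rfl, ha₁]
  have z' : psum (upd p' s n 0) s = a₂ := by rw [psum_upd_le p' n 0 le_rfl, ha₂]
  obtain ⟨N', hN'⟩ : ∃ N', a₁ + w + b₁ + (a₂ + q' + b₂) = N' := ⟨_, rfl⟩
  have k₄ : psum (upd p s n w) m + psum (upd p' s n q') m = N' := by
    rw [u0, u0', hN']
  have k₅ : psum (upd p s n w) m + psum (upd p' s n w') m = M := by rw [u0, u0']; omega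
  have R₁ : RigidMove A a₁ w q (unsh m (upd p s n w) (upd p' s n q') k₄)
      (unsh m (upd p s n q) (upd p' s n q') k₁) := by
    subst hA
    rw [← z, ← z']
    exact rigidMove_left_of_eq hs v v' (upd_eq_setAt _ _ _ _) (upd_eq_setAt _ _ _ _)
      (upd_eq_setAt _ _ _ _) k₄ k₁
  have R₂ : RigidMove (A + w) (M₁ + a₂) w' q' (unsh m (upd p s n w) (upd p' s n w') k₅)
      (unsh m (upd p s n w) (upd p' s n q') k₄) := by
    have h := rigidMove_right_of_eq hs v v' (upd_eq_setAt _ _ _ _) (upd_eq_setAt _ _ _ _)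
      (upd_eq_setAt _ _ _ _) k₅ k₄
    rwa [z, z', hA, u0, hb₁] at h
  rw [P.pad_comp A B hAM hAM hAN (add_zero t), P.pad_perm,
    P.pad_hcomp (M' := N') A B hW hQ e hAM hAN (by omega) (by omega)
      (by omega) (by omega),
    P.hcomp_pad_pad (M' := N') a₁ b₁ a₂ b₂ hb₁ hc₁ hb₂ hc₂ hM hN e
      (by omega) (by omega) (by omega) (by omega)]
  rw [← P.comp_assoc (zero_add t) (add_zero t) (add_zero t) (zero_add t),
    ← P.comp_assoc (zero_add i) e e (zero_add t),
    P.perm_comp_pad_of_rigidMove A (q' + B) a₁ (b₁ + N₂) _ _ (by omega) (by omega) _ _ R₁,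
    P.comp_assoc (add_zero i) e (zero_add j) e,
    P.perm_comp_pad_of_rigidMove (A + w) B (M₁ + a₂) b₂ _ _ (by omega) (by omega) _ _ R₂,
    ← P.comp_assoc e (add_zero t) (add_zero j) e,
    P.comp_assoc _ _ (add_zero 0) (add_zero t), ← P.perm_mul,
    unsh_mul_blockSum hs hl hw hw' k₂ (by omega) hAM k₃ k₅]

end
end XB

namespace XB
open scoped DirectSum TensorProduct

/-! ### Words below a given word -/

open Classical in
/-- The words with at most `n` letters that are bounded by `K`. -/
noncomputable def box (n : ℕ) (K : ℕ → ℕ) : Finset (ℕ → ℕ) :=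
  (Fintype.piFinset fun j : Fin n => Finset.range (K j + 1)).image
    fun p j => if h : j < n then p ⟨j, h⟩ else 0

theorem mem_box {n : ℕ} {K p : ℕ → ℕ} :
    p ∈ box n K ↔ (∀ j < n, p j ≤ K j) ∧ ∀ j, n ≤ j → p j = 0 := by
  simp only [box, Finset.mem_image, Fintype.mem_piFinset, Finset.mem_range, Nat.lt_succ_iff]
  constructor
  · rintro ⟨q, hq, rfl⟩
    exact ⟨fun j hj => by simpa [hj] using hq ⟨j, hj⟩, fun j hj => by simp [not_lt.2 hj]⟩
  · rintro ⟨h, h'⟩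
    refine ⟨fun j => p j, fun j => h j j.isLt, funext fun j => ?_⟩
    split_ifs with hj
    · rfl
    · exact (h' j (not_lt.1 hj)).symm

theorem box_congr {n : ℕ} {K K' : ℕ → ℕ} (h : ∀ j < n, K j = K' j) : box n K = box n K' := by
  ext p
  simp only [mem_box]
  refine and_congr_left fun _ => forall₂_congr fun j hj => by rw [h j hj]

theorem psum_add_sub {n M : ℕ} {K p : ℕ → ℕ} (h : ∀ j < n, p j ≤ K j) (hM : psum K n = M) :
    psum p n + psum (K - p) n = M := by
  rw [← hM, psum, psum, psum, ← Finset.sum_add_distrib]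
  refine Finset.sum_congr rfl fun j hj => ?_
  have := h j (Finset.mem_range.1 hj)
  simp only [Pi.sub_apply]
  omega

/-- The word `p` cut off after `n` letters. -/
def cut (n : ℕ) (p : ℕ → ℕ) : ℕ → ℕ := fun j => if j < n then p j else 0

theorem cut_apply {n j : ℕ} (p : ℕ → ℕ) (h : j < n) : cut n p j = p j := if_pos h

theorem upd_sub (K p : ℕ → ℕ) (s n q y : ℕ) :
    upd (K - p) s n (q - y) = upd K s n q - upd p s n y := by
  funext j
  simp only [upd, Pi.sub_apply]
  split_ifs <;> rfl

theorem upd_same (K : ℕ → ℕ) (s n q : ℕ) : upd K s n q s = q := by simp [upd]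

/-- A sum over the words below a word, split according to the letter in one position. -/
theorem sum_box_upd {α : Type*} [AddCommMonoid α] {m s : ℕ} (hs : s < m) (K : ℕ → ℕ) (n q : ℕ)
    (h : (ℕ → ℕ) → α) : ∑ p ∈ box m (upd K s n q), h p =
      ∑ y ∈ Finset.range (q + 1), ∑ x ∈ box m (upd K s n 0), h (setAt x s y) := by
  rw [← Finset.sum_product']
  refine Finset.sum_bij' (fun p _ => (p s, setAt p s 0)) (fun yx _ => setAt yx.2 s yx.1)
    ?_ ?_ ?_ ?_ ?_
  · intro p hp
    rw [mem_box] at hp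
    have h1 := hp.1 s hs
    simp only [upd_same] at h1
    simp only [Finset.mem_product, Finset.mem_range, mem_box]
    refine ⟨by omega, fun j hj => ?_, fun j hj => ?_⟩
    · have := hp.1 j hj
      simp only [setAt, upd] at this ⊢
      split_ifs at this ⊢ <;> omega
    · have := hp.2 j hj
      simp only [setAt]; split_ifs <;> omega
  · rintro ⟨y, x⟩ hx
    simp only [Finset.mem_product, Finset.mem_range, mem_box] at hx ⊢
    refine ⟨fun j hj => ?_, fun j hj => ?_⟩
    · have := hx.2.1 j hj
      simp only [setAt, upd] at this ⊢
      split_ifs at this ⊢ <;> omega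
    · have := hx.2.2 j hj
      simp only [setAt]; split_ifs <;> omega
  · intro p hp
    funext j
    by_cases hj : j = s <;> simp [setAt, hj]
  · rintro ⟨y, x⟩ hx
    simp only [Finset.mem_product, Finset.mem_range, mem_box] at hx
    have h1 := hx.2.1 s hs
    simp only [upd_same] at h1
    ext j
    · simp [setAt]
    · by_cases hj : j = s
      · subst hj; simp [setAt]; omega
      · simp [setAt, hj]
  · intro p hp
    congr 1
    funext j
    by_cases hj : j = s <;> simp [setAt, hj]

/-- A sum over the words below a word, split into a block of letters and the remaining letters. -/
theorem sum_box_glue {α : Type*} [AddCommMonoid α] {m n l s : ℕ} (hs : s < m)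
    (hl : l + 1 = m + n) (K : ℕ → ℕ) (h : (ℕ → ℕ) → (ℕ → ℕ) → α) :
    ∑ p ∈ box l K, h (upd p s n 0) (cut n (res p s)) =
      ∑ x ∈ box m (upd K s n 0), ∑ z ∈ box n (res K s), h x z := by
  rw [← Finset.sum_product']
  refine Finset.sum_bij' (fun p _ => (upd p s n 0, cut n (res p s)))
    (fun xz _ => fun j => if j < s then xz.1 j else if j < s + n then xz.2 (j - s) else
      xz.1 (j + 1 - n)) ?_ ?_ ?_ ?_ ?_
  · intro p hp
    rw [mem_box] at hp
    simp only [Finset.mem_product, mem_box]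
    refine ⟨⟨fun j hj => ?_, fun j hj => ?_⟩, fun j hj => ?_, fun j hj => ?_⟩
    · simp only [upd]
      split_ifs
      · exact hp.1 _ (by omega)
      · exact le_rfl
      · exact hp.1 _ (by omega)
    · simp only [upd]
      split_ifs
      · omega
      · rfl
      · exact hp.2 _ (by omega)
    · rw [cut_apply _ hj]; exact hp.1 _ (by omega)
    · exact if_neg (by omega)
  · rintro ⟨x, z⟩ hx
    simp only [Finset.mem_product, mem_box] at hx ⊢
    obtain ⟨⟨h1, h2⟩, h3, h4⟩ := hx
    refine ⟨fun j hj => ?_, fun j hj => ?_⟩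
    · split_ifs with c1 c2
      · have := h1 j (by omega)
        simpa [upd, c1] using this
      · have := h3 (j - s) (by omega)
        rwa [res, Nat.add_sub_cancel' (by omega)] at this
      · have := h1 (j + 1 - n) (by omega)
        simpa [upd, show ¬ j + 1 - n < s by omega, show ¬ j + 1 - n = s by omega,
          show j + 1 - n + n - 1 = j by omega] using this
    · split_ifs with c1 c2
      · omega
      · omega
      · exact h2 _ (by omega)
  · intro p hp
    funext j
    simp only [upd, cut, res]
    split_ifs with c1 c2
    · rfl
    · congr 1; omega
    · omega
    · omega
    · omega
    · congr 1; omega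
  · rintro ⟨x, z⟩ hx
    simp only [Finset.mem_product, mem_box] at hx
    obtain ⟨⟨h1, h2⟩, h3, h4⟩ := hx
    have h5 := h1 s hs
    rw [upd_same] at h5
    ext j
    · simp only [upd]
      split_ifs
      · rfl
      · subst j; omega
      · omega
      · omega
      · congr 1; omega
    · simp only [cut, res]
      split_ifs
      · omega
      · congr 1; omega
      · omega
      · exact (h4 j (by omega)).symm
  · intro p hp
    rfl

theorem sum_range_diag {α : Type*} [AddCommMonoid α] (N : ℕ) (T : ℕ → ℕ → α)
    (h : ∀ y y', N ≤ y + y' → T y y' = 0) :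
    ∑ q ∈ Finset.range N, ∑ y ∈ Finset.range (q + 1), T y (q - y) =
      ∑ y ∈ Finset.range N, ∑ y' ∈ Finset.range N, T y y' := by
  rw [Finset.sum_range_diag_flip]
  refine Finset.sum_congr rfl fun y hy => ?_
  refine Finset.sum_subset (Finset.range_mono (by omega)) fun y' _ hy' => h _ _ ?_
  simp only [Finset.mem_range] at hy hy'
  omega

/-! ### The convolution of families of operations -/

section Convolution

variable {k : Type u} [Field k] {P : PROP k}

theorem Fam.mk_val {n r : ℕ} {i : ℤ} (f : ∀ (K : ℕ → ℕ) (M : ℕ), psum K n = M → P.Hom M r i)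
    (hf : ∀ (K K' : ℕ → ℕ) (_ : ∀ j < n, K j = K' j) (M : ℕ) (h : psum K n = M)
      (h' : psum K' n = M), f K M h = f K' M h') (K : ℕ → ℕ) (M : ℕ) (h : psum K n = M) :
    (Fam.mk f hf).val K M h = f K M h := rfl

/-- `(f_p ⊗ g_{p'}) ∘ σ`, where `σ` splits each block of inputs into its two parts. -/
def convTerm {n r r' R : ℕ} {a b t : ℤ} (hR : r + r' = R) (e : a + b = t) (f : Fam P n r a)
    (g : Fam P n r' b) (M : ℕ) (p p' : ℕ → ℕ) : P.Hom M R t :=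
  if h : psum p n + psum p' n = M then
    P.comp (add_zero t) (P.hcomp h hR e (f.val p _ rfl) (g.val p' _ rfl)) (P.perm (unsh n p p' h))
  else 0

theorem convTerm_eq {n r r' R M M₁ M₂ : ℕ} {a b t : ℤ} (hR : r + r' = R) (e : a + b = t)
    (f : Fam P n r a) (g : Fam P n r' b) {p p' : ℕ → ℕ} (h₁ : psum p n = M₁) (h₂ : psum p' n = M₂)
    (h : M₁ + M₂ = M) (h' : psum p n + psum p' n = M) :
    convTerm hR e f g M p p' =
      P.comp (add_zero t) (P.hcomp h hR e (f.val p _ h₁) (g.val p' _ h₂))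
        (P.perm (unsh n p p' h')) := by
  subst h₁ h₂
  exact dif_pos _

theorem convTerm_congr {n r r' R M : ℕ} {a b t : ℤ} (hR : r + r' = R) (e : a + b = t)
    (f : Fam P n r a) (g : Fam P n r' b) {p p' q q' : ℕ → ℕ} (hp : ∀ j < n, p j = q j)
    (hp' : ∀ j < n, p' j = q' j) : convTerm hR e f g M p p' = convTerm hR e f g M q q' := by
  have e1 := psum_congr hp
  have e2 := psum_congr hp'
  by_cases h : psum p n + psum p' n = M
  · rw [convTerm_eq hR e f g rfl rfl h h, convTerm_eq hR e f g e1.symm e2.symm h (by omega),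
      f.congr hp, g.congr hp', unsh_congr hp hp']
  · rw [convTerm, convTerm, dif_neg h, dif_neg (by omega)]

theorem convTerm_add_left {n r r' R : ℕ} {a b t : ℤ} (hR : r + r' = R) (e : a + b = t)
    (f f' : Fam P n r a) (g : Fam P n r' b) (M : ℕ) (p p' : ℕ → ℕ) :
    convTerm hR e (f + f') g M p p' = convTerm hR e f g M p p' + convTerm hR e f' g M p p' := by
  unfold convTerm
  split_ifs
  · simp only [Fam.val_add, map_add, LinearMap.add_apply]
  · simp

theorem convTerm_smul_left {n r r' R : ℕ} {a b t : ℤ} (hR : r + r' = R) (e : a + b = t)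
    (c : k) (f : Fam P n r a) (g : Fam P n r' b) (M : ℕ) (p p' : ℕ → ℕ) :
    convTerm hR e (c • f) g M p p' = c • convTerm hR e f g M p p' := by
  unfold convTerm
  split_ifs
  · simp only [Fam.val_smul, map_smul, LinearMap.smul_apply]
  · simp

theorem convTerm_add_right {n r r' R : ℕ} {a b t : ℤ} (hR : r + r' = R) (e : a + b = t)
    (f : Fam P n r a) (g g' : Fam P n r' b) (M : ℕ) (p p' : ℕ → ℕ) :
    convTerm hR e f (g + g') M p p' = convTerm hR e f g M p p' + convTerm hR e f g' M p p' := by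
  unfold convTerm
  split_ifs
  · simp only [Fam.val_add, map_add, LinearMap.add_apply]
  · simp

theorem convTerm_smul_right {n r r' R : ℕ} {a b t : ℤ} (hR : r + r' = R) (e : a + b = t)
    (c : k) (f : Fam P n r a) (g : Fam P n r' b) (M : ℕ) (p p' : ℕ → ℕ) :
    convTerm hR e f (c • g) M p p' = c • convTerm hR e f g M p p' := by
  unfold convTerm
  split_ifs
  · simp only [Fam.val_smul, map_smul, LinearMap.smul_apply]
  · simp

/-- The convolution of two families of operations, with respect to the deconcatenation of words. -/
noncomputable def conv {n r r' R : ℕ} {a b t : ℤ} (hR : r + r' = R) (e : a + b = t) :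
    Fam P n r a →ₗ[k] Fam P n r' b →ₗ[k] Fam P n R t :=
  LinearMap.mk₂ k (fun f g => Fam.mk
      (fun K M _ => ∑ p ∈ box n K, convTerm hR e f g M p (K - p))
      fun K K' hK M _ _ => by
        rw [box_congr hK]
        exact Finset.sum_congr rfl fun p _ => convTerm_congr hR e f g (fun _ _ => rfl)
          fun j hj => by simp [hK j hj])
    (fun f f' g => Fam.ext fun K M _ => by
      simp only [Fam.val, Fam.mk, convTerm_add_left, Finset.sum_add_distrib]; rfl)
    (fun c f g => Fam.ext fun K M _ => by
      simp only [Fam.val, Fam.mk, convTerm_smul_left, ← Finset.smul_sum]; rfl)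
    (fun f g g' => Fam.ext fun K M _ => by
      simp only [Fam.val, Fam.mk, convTerm_add_right, Finset.sum_add_distrib]; rfl)
    (fun c f g => Fam.ext fun K M _ => by
      simp only [Fam.val, Fam.mk, convTerm_smul_right, ← Finset.smul_sum]; rfl)

theorem conv_val {n r r' R : ℕ} {a b t : ℤ} (hR : r + r' = R) (e : a + b = t) (f : Fam P n r a)
    (g : Fam P n r' b) (K : ℕ → ℕ) (M : ℕ) (h : psum K n = M) :
    (conv hR e f g).val K M h = ∑ p ∈ box n K, convTerm hR e f g M p (K - p) := rfl

theorem Fam.val_sum {n r : ℕ} {i : ℤ} {ι : Type*} (s : Finset ι) (f : ι → Fam P n r i)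
    (K : ℕ → ℕ) (M : ℕ) (h : psum K n = M) :
    (∑ t ∈ s, f t).val K M h = ∑ t ∈ s, (f t).val K M h := by
  classical
  induction s using Finset.induction_on with
  | empty => simp
  | insert t s ht ih => rw [Finset.sum_insert ht, Finset.sum_insert ht, Fam.val_add, ih]

/-- The convolution is associative. -/
theorem conv_assoc {n r₁ r₂ r₃ r₁₂ r₂₃ R : ℕ} {a b c ab bc abc : ℤ}
    (h₁ : r₁ + r₂ = r₁₂) (h₂ : r₁₂ + r₃ = R) (h₃ : r₂ + r₃ = r₂₃) (h₄ : r₁ + r₂₃ = R)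
    (e₁ : a + b = ab) (e₂ : ab + c = abc) (e₃ : b + c = bc) (e₄ : a + bc = abc)
    (f : Fam P n r₁ a) (g : Fam P n r₂ b) (h : Fam P n r₃ c) :
    conv h₂ e₂ (conv h₁ e₁ f g) h = conv h₄ e₄ f (conv h₃ e₃ g h) := by
  refine Fam.ext fun K M hM => ?_
  have L : ∀ p ∈ box n K, convTerm h₂ e₂ (conv h₁ e₁ f g) h M p (K - p) =
      ∑ x ∈ box n p, convTerm h₄ e₄ f
        (Fam.mk (fun q _ _ => convTerm h₃ e₃ g h _ (p - x) (q - (p - x))) fun q q' hq _ _ _ =>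
          convTerm_congr h₃ e₃ g h (fun _ _ => rfl) fun j hj => by simp [hq j hj]) M x (K - x) := by
    intro p hp
    have hp' := (mem_box.1 hp).1
    have hsum := psum_add_sub hp' hM
    rw [convTerm_eq h₂ e₂ _ _ rfl rfl hsum hsum, conv_val]
    simp only [map_sum, LinearMap.sum_apply]
    refine Finset.sum_congr rfl fun x hx => ?_
    have hx' := (mem_box.1 hx).1
    have hxK : ∀ j < n, x j ≤ K j := fun j hj => (hx' j hj).trans (hp' j hj)
    have s1 := psum_add_sub hx' rfl
    have s2 := psum_add_sub hxK hM
    have s3 : psum (p - x) n + psum (K - p) n = psum (K - x) n := by omega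
    have s4 : psum (p - x) n + psum (K - x - (p - x)) n = psum (K - x) n :=
      psum_add_sub (fun j hj => by
        have := hx' j hj; have := hp' j hj; simp only [Pi.sub_apply]; omega) rfl
    have s5 : ∀ j < n, (K - x - (p - x)) j = (K - p) j := fun j hj => by
        have := hx' j hj; have := hp' j hj; simp only [Pi.sub_apply]; omega
    rw [convTerm_eq h₁ e₁ _ _ rfl rfl s1 s1, convTerm_eq h₄ e₄ _ _ rfl rfl s2 s2]
    rw [Fam.mk_val, convTerm_congr h₃ e₃ g h (fun _ _ => rfl) s5, convTerm_eq h₃ e₃ _ _ rfl rfl s3 s3]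
    have i1 := P.interchange (f := P.hcomp s1 h₁ e₁ (f.val x _ rfl) (g.val (p - x) _ rfl))
      (g := h.val (K - p) _ rfl) (f' := P.perm (unsh n x (p - x) s1)) (g' := P.perm 1)
      hsum hsum h₂ e₂ (add_zero 0) (add_zero abc) (add_zero ab) (add_zero c) e₂
    have i2 := P.interchange (f := f.val x _ rfl)
      (g := P.hcomp s3 h₃ e₃ (g.val (p - x) _ rfl) (h.val (K - p) _ rfl))
      (f' := P.perm 1) (g' := P.perm (unsh n (p - x) (K - p) s3))
      s2 s2 h₄ e₄ (add_zero 0) (add_zero abc) (add_zero a) (add_zero bc) e₄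
    simp only [mul_zero, Int.negOnePow_zero, one_smul, P.comp_one] at i1 i2
    rw [← i1, P.perm_hcomp, P.comp_assoc _ _ (add_zero 0) (add_zero abc), ← P.perm_mul,
      unsh_coassoc (q := K - x) (N' := psum (K - x) n) (fun j hj => by
        have := hx' j hj; simp only [Pi.sub_apply]; omega) (fun j hj => by
        have := hx' j hj; have := hp' j hj; simp only [Pi.sub_apply]; omega) s1 hsum s3 s2 hsum s2,
      P.perm_mul (add_zero 0), ← P.comp_assoc (add_zero abc) (add_zero abc), ← P.perm_hcomp s2 (add_zero 0),
      P.hcomp_assoc _ _ s3 s2 _ _ h₃ h₄ _ _ e₃ e₄, i2]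
  rw [conv_val, conv_val, Finset.sum_congr rfl L]
  have R' : ∀ x ∈ box n K, convTerm h₄ e₄ f (conv h₃ e₃ g h) M x (K - x) =
      ∑ y ∈ box n (K - x), convTerm h₄ e₄ f
        (Fam.mk (fun q _ _ => convTerm h₃ e₃ g h _ y (q - y)) fun q q' hq _ _ _ =>
          convTerm_congr h₃ e₃ g h (fun _ _ => rfl) fun j hj => by simp [hq j hj]) M x (K - x) := by
    intro x hx
    have s2 := psum_add_sub (mem_box.1 hx).1 hM
    simp only [convTerm_eq h₄ e₄ _ _ rfl rfl s2 s2, conv_val, map_sum, LinearMap.sum_apply]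
    rfl
  rw [Finset.sum_congr rfl R', Finset.sum_sigma', Finset.sum_sigma']
  refine Finset.sum_bij' (fun px _ => ⟨px.2, px.1 - px.2⟩) (fun xy _ => ⟨xy.1 + xy.2, xy.1⟩)
    ?_ ?_ ?_ ?_ ?_
  · rintro ⟨p, x⟩ h
    simp only [Finset.mem_sigma, mem_box, Pi.sub_apply] at h ⊢
    refine ⟨⟨fun j hj => (h.2.1 j hj).trans (h.1.1 j hj), h.2.2⟩, fun j hj => ?_, fun j hj => ?_⟩
    · have := h.2.1 j hj; have := h.1.1 j hj; omega
    · simp [h.1.2 j hj]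
  · rintro ⟨x, y⟩ h
    simp only [Finset.mem_sigma, mem_box, Pi.sub_apply, Pi.add_apply] at h ⊢
    refine ⟨⟨fun j hj => ?_, fun j hj => ?_⟩, fun j hj => by omega, h.1.2⟩
    · have := h.2.1 j hj; have := h.1.1 j hj; omega
    · simp [h.1.2 j hj, h.2.2 j hj]
  · rintro ⟨p, x⟩ h
    simp only [Finset.mem_sigma, mem_box] at h
    simp only [Sigma.mk.injEq, heq_eq_eq, and_true]
    funext j
    simp only [Pi.sub_apply, Pi.add_apply]
    by_cases hj : j < n
    · have := h.2.1 j hj; omega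
    · simp [h.1.2 j (by omega), h.2.2 j (by omega)]
  · rintro ⟨x, y⟩ h
    simp
  · rintro ⟨p, x⟩ h
    rfl

end Convolution
end XB

namespace XB
open scoped DirectSum TensorProduct

/-- The sign `(-1)^z` as an element of `k`. -/
def ksign (k : Type u) [Field k] (z : ℤ) : k := ((z.negOnePow : ℤ) : k)

theorem negOnePow_smul {k : Type u} [Field k] {M : Type*} [AddCommGroup M] [Module k M] (z : ℤ)
    (x : M) : z.negOnePow • x = ksign k z • x := by
  rw [Units.smul_def, ksign, Int.cast_smul_eq_zsmul]

theorem ksign_add (k : Type u) [Field k] (y z : ℤ) : ksign k (y + z) = ksign k y * ksign k z := by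
  simp [ksign, Int.negOnePow_add]

@[simp] theorem ksign_zero (k : Type u) [Field k] : ksign k 0 = 1 := by simp [ksign]

@[simp] theorem ksign_one (k : Type u) [Field k] : ksign k 1 = -1 := by simp [ksign]

@[simp] theorem ksign_mul_self (k : Type u) [Field k] (z : ℤ) : ksign k z * ksign k z = 1 := by
  rw [← ksign_add, ksign, Int.negOnePow_even _ ⟨z, rfl⟩]; simp

section Cosplit

variable {k : Type u} [Field k] {P : PROP k}

theorem convTerm_comp_pad {m n l s r r' R M N A B W y y' Q M₁ M₂ a₁ a₂ b₁ b₂ w w' : ℕ}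
    {a b c d ab cd ac bd t : ℤ} (hs : s < m) (hl : l + 1 = m + n) (hR : r + r' = R)
    (hQ : y + y' = Q) (e₁ : a + b = ab) (e₂ : c + d = cd) (e₃ : ab + cd = t)
    (e₄ : a + c = ac) (e₅ : b + d = bd) (e₆ : ac + bd = t)
    (f : EndObj P m a) (g : EndObj P m b) (f' : EndObj P n c) (g' : EndObj P n d) {p p' : ℕ → ℕ}
    (hw : psum (res p s) n = w) (hw' : psum (res p' s) n = w') (hW : w + w' = W)
    (ha₁ : psum p s = a₁) (ha₂ : psum p' s = a₂)
    (hM₁ : psum p l = M₁) (hM₂ : psum p' l = M₂) (hb₁ : a₁ + w + b₁ = M₁) (hb₂ : a₂ + w' + b₂ = M₂)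
    (hA : a₁ + a₂ = A) (hB : b₁ + b₂ = B) (hM : A + W + B = M) (hN : A + Q + B = N)
    (h₁ : psum (upd p s n y) m = a₁ + y + b₁) (h₂ : psum (upd p' s n y') m = a₂ + y' + b₂)
    (hM' : M₁ + M₂ = M) (h : psum p l + psum p' l = M) :
    P.comp e₃ (convTerm hR e₁ (f.fam r) (g.fam r') N (upd p s n y) (upd p' s n y'))
      (P.pad A B hM hN (convTerm hQ e₂ (f'.fam y) (g'.fam y') W (res p s) (res p' s))) =
    (b * c).negOnePow • P.comp (add_zero t) (P.hcomp hM' hR e₆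
        (P.comp e₄ (f.val r (upd p s n y) _ h₁) (P.pad a₁ b₁ hb₁ rfl (f'.val y (res p s) w hw)))
        (P.comp e₅ (g.val r' (upd p' s n y') _ h₂)
          (P.pad a₂ b₂ hb₂ rfl (g'.val y' (res p' s) w' hw'))))
      (P.perm (unsh l p p' h)) := by
  have k₁ : a₁ + y + b₁ + (a₂ + y' + b₂) = N := by omega
  rw [convTerm_eq hR e₁ _ _ h₁ h₂ k₁ (by omega), convTerm_eq hQ e₂ _ _ hw hw' hW (by omega),
    P.comp_assoc (add_zero ab) e₃ (zero_add cd) e₃,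
    P.unsh_comp_pad hs hl hw hw' ha₁ ha₂ hM₁ hM₂ hb₁ hb₂ rfl rfl hA hB hW hQ hM' k₁ hM hN e₂
      _ _ h, ← P.comp_assoc e₃ (add_zero t) (add_zero cd) e₃,
    P.interchange hM' k₁ hR e₁ e₂ e₃ e₄ e₅ e₆]
  rw [Units.smul_def, Units.smul_def, map_zsmul, LinearMap.smul_apply]
  rfl

/-- Composition is compatible with convolution. -/
theorem conv_endCirc {m n l r r' R M A B W : ℕ}
    {a b c d ab cd ac bd t : ℤ} (s : Fin m) (hl : l + 1 = m + n) (hR : r + r' = R)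
    (e₁ : a + b = ab) (e₂ : c + d = cd) (e₃ : ab + cd = t)
    (e₄ : a + c = ac) (e₅ : b + d = bd) (e₆ : ac + bd = t)
    (f : EndObj P m a) (g : EndObj P m b) (f' : EndObj P n c) (g' : EndObj P n d) (K : ℕ → ℕ)
    (hM : psum K l = M) (hA : psum K s = A) (hW : psum (res K s) n = W) (hB : A + W + B = M) :
    ∑ q ∈ Finset.range (W + 1), ∑ y ∈ Finset.range (q + 1), ∑ x ∈ box m (upd K s n 0),
      P.comp e₃ (convTerm hR e₁ (f.fam r) (g.fam r') (A + q + B) (setAt x s y)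
        (upd K s n q - setAt x s y))
      (P.pad A B hB rfl (∑ z ∈ box n (res K s),
        if h : y + (q - y) = q then
          convTerm h e₂ (f'.fam y) (g'.fam (q - y)) W z (res K s - z) else 0)) =
    (b * c).negOnePow • (conv hR e₆ ((endCirc s hl e₄ f f').fam r)
      ((endCirc s hl e₅ g g').fam r')).val K M hM := by
  set T : (ℕ → ℕ) → (ℕ → ℕ) → ℕ → ℕ → P.Hom M R t := fun x z y y' =>
    P.comp e₃ (convTerm hR e₁ (f.fam r) (g.fam r') (A + (y + y') + B) (setAt x s y)
        (upd K s n (y + y') - setAt x s y))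
      (P.pad A B hB rfl (convTerm rfl e₂ (f'.fam y) (g'.fam y') W z (res K s - z))) with hT
  have L : ∀ q ∈ Finset.range (W + 1), ∀ y ∈ Finset.range (q + 1), ∀ x ∈ box m (upd K s n 0),
      P.comp e₃ (convTerm hR e₁ (f.fam r) (g.fam r') (A + q + B) (setAt x s y)
        (upd K s n q - setAt x s y))
      (P.pad A B hB rfl (∑ z ∈ box n (res K s),
        if h : y + (q - y) = q then
          convTerm h e₂ (f'.fam y) (g'.fam (q - y)) W z (res K s - z) else 0)) =
      ∑ z ∈ box n (res K s), T x z y (q - y) := by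
    intro q _ y hy x _
    obtain ⟨y', rfl⟩ := Nat.exists_eq_add_of_le (show y ≤ q by rw [Finset.mem_range] at hy; omega)
    have h : y + y' - y = y' := by omega
    rw [h]
    simp only [map_sum, hT, dite_true]
  rw [Finset.sum_congr rfl fun q hq => Finset.sum_congr rfl fun y hy =>
    Finset.sum_congr rfl (L q hq y hy)]
  have V : ∀ p, ∀ y y', T (upd p s n 0) (cut n (res p s)) y y' =
      P.comp e₃ (convTerm hR e₁ (f.fam r) (g.fam r') (A + (y + y') + B) (upd p s n y)
        (upd (K - p) s n y'))
      (P.pad A B hB rfl (convTerm rfl e₂ (f'.fam y) (g'.fam y') W (res p s) (res (K - p) s))) := by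
    intro p y y'
    have h1 := upd_sub K p s n (y + y') y
    rw [Nat.add_sub_cancel_left] at h1
    simp only [hT]
    rw [← upd_eq_setAt, ← h1, convTerm_congr rfl e₂ (f'.fam y) (g'.fam y') (q := res p s)
      (q' := res (K - p) s) (fun j hj => cut_apply _ hj) (fun j hj => by
        simp only [Pi.sub_apply, cut_apply _ hj, res])]
  have E : ∀ p ∈ box l K, (∀ y y', W + 1 ≤ y + y' → T (upd p s n 0) (cut n (res p s)) y y' = 0) ∧
      ∑ y ∈ Finset.range (W + 1), ∑ y' ∈ Finset.range (W + 1),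
        T (upd p s n 0) (cut n (res p s)) y y' =
      (b * c).negOnePow • convTerm hR e₆ ((endCirc s hl e₄ f f').fam r)
        ((endCirc s hl e₅ g g').fam r') M p (K - p) := by
    intro p hp
    have hp' := (mem_box.1 hp).1
    have hs := s.isLt
    have s1 := psum_add_sub hp' hM
    have s2 : psum (res p s) n + psum (res (K - p) s) n = W :=
      psum_add_sub (K := res K s) (fun j hj => hp' _ (by omega)) hW
    have s3 : psum p s + psum (K - p) s = A := psum_add_sub (fun j hj => hp' _ (by omega)) hA
    obtain ⟨b₁, hb₁⟩ := exists_splitPoint (K := p) s.isLt hl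
    obtain ⟨b₂, hb₂⟩ := exists_splitPoint (K := K - p) s.isLt hl
    have key : ∀ y y', T (upd p s n 0) (cut n (res p s)) y y' = _ := fun y y' =>
      (V p y y').trans (convTerm_comp_pad s.isLt hl hR rfl e₁ e₂ e₃ e₄ e₅ e₆ f g f' g' rfl rfl s2
        rfl rfl rfl rfl hb₁ hb₂ s3 (by omega) hB rfl (upd_psum y s.isLt hl rfl rfl rfl hb₁)
        (upd_psum y' s.isLt hl rfl rfl rfl hb₂) s1 s1)
    constructor
    · intro y y' hy
      rw [key]
      by_cases h : psum (res p s) n < y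
      · rw [f'.vanish _ h]; simp
      · rw [g'.vanish (r := y') _ (by omega)]; simp
    · rw [convTerm_eq hR e₆ _ _ rfl rfl s1 s1]
      change _ = (b * c).negOnePow • P.comp (add_zero t) (P.hcomp s1 hR e₆
        ((endCirc s hl e₄ f f').val r p _ rfl) ((endCirc s hl e₅ g g').val r' (K - p) _ rfl)) _
      rw [endCirc_val s hl e₄ f f' r p _ rfl (W + 1) rfl rfl hb₁ (by omega),
        endCirc_val s hl e₅ g g' r' (K - p) _ rfl (W + 1) rfl rfl hb₂ (by omega)]
      simp only [key, map_sum, LinearMap.sum_apply, Finset.smul_sum]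
      exact Finset.sum_comm
  calc _ = ∑ x ∈ box m (upd K s n 0), ∑ z ∈ box n (res K s),
        ∑ q ∈ Finset.range (W + 1), ∑ y ∈ Finset.range (q + 1), T x z y (q - y) := by
        rw [Finset.sum_congr rfl fun q _ => Finset.sum_comm, Finset.sum_comm]
        refine Finset.sum_congr rfl fun x _ => ?_
        rw [Finset.sum_congr rfl fun q _ => Finset.sum_comm, Finset.sum_comm]
    _ = ∑ p ∈ box l K, ∑ q ∈ Finset.range (W + 1), ∑ y ∈ Finset.range (q + 1),
        T (upd p s n 0) (cut n (res p s)) y (q - y) :=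
        (sum_box_glue s.isLt hl K fun x z => ∑ q ∈ Finset.range (W + 1),
          ∑ y ∈ Finset.range (q + 1), T x z y (q - y)).symm
    _ = _ := by
        rw [conv_val, Finset.smul_sum]
        refine Finset.sum_congr rfl fun p hp => ?_
        rw [sum_range_diag _ _ (E p hp).1, (E p hp).2]

/-- The family `f` decomposes as `∑ Fₜ ⊗ Gₜ` under the deconcatenation of words. -/
def IsCosplit {ι : Type*} [Fintype ι] {n : ℕ} {i : ℤ} (f : EndObj P n i) (dl dr : ι → ℤ)
    (hd : ∀ t, dl t + dr t = i) (F : ∀ t, EndObj P n (dl t)) (G : ∀ t, EndObj P n (dr t)) : Prop :=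
  ∀ (r r' R : ℕ) (hR : r + r' = R),
    f.fam R = ∑ t, conv hR (hd t) ((F t).fam r) ((G t).fam r')

theorem IsCosplit.endCirc {ι ι' : Type*} [Fintype ι] [Fintype ι'] {m n l : ℕ} {i j t : ℤ}
    {f : EndObj P m i} {dl dr : ι → ℤ} {hd : ∀ t, dl t + dr t = i}
    {F : ∀ t, EndObj P m (dl t)} {G : ∀ t, EndObj P m (dr t)}
    {g : EndObj P n j} {dl' dr' : ι' → ℤ} {hd' : ∀ t, dl' t + dr' t = j}
    {F' : ∀ t, EndObj P n (dl' t)} {G' : ∀ t, EndObj P n (dr' t)}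
    (hf : IsCosplit f dl dr hd F G) (hg : IsCosplit g dl' dr' hd' F' G')
    (s : Fin m) (hl : l + 1 = m + n) (ht : i + j = t) :
    IsCosplit (XB.endCirc s hl ht f g) (fun c : ι × ι' => dl c.1 + dl' c.2)
      (fun c => dr c.1 + dr' c.2) (fun c => by have := hd c.1; have := hd' c.2; omega)
      (fun c => ksign k (dr c.1 * dl' c.2) • XB.endCirc s hl rfl (F c.1) (F' c.2))
      (fun c => XB.endCirc s hl rfl (G c.1) (G' c.2)) := by
  intro r r' R hR
  refine Fam.ext fun K M hM => ?_
  subst hM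
  obtain ⟨B, hB⟩ := exists_splitPoint (K := K) s.isLt hl
  change (XB.endCirc s hl ht f g).val R K _ rfl = _
  rw [endCirc_val s hl ht f g R K _ rfl _ rfl rfl hB (Nat.lt_succ_self _), Fam.val_sum,
    Fintype.sum_prod_type]
  have h1 : ∀ (c : ι) (c' : ι') (e : dl c + dl' c' + (dr c + dr' c') = t), (conv hR e
      ((EndObj.fam r) (ksign k (dr c * dl' c') • XB.endCirc s hl rfl (F c) (F' c')))
      ((EndObj.fam r') (XB.endCirc s hl rfl (G c) (G' c')))).val K _ rfl = _ := fun c c' e => by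
    refine Eq.trans ?_ (conv_endCirc s hl hR (hd c) (hd' c') ht rfl rfl e (F c) (G c) (F' c')
      (G' c') K rfl rfl rfl hB).symm
    rw [map_smul, map_smul, LinearMap.smul_apply, Fam.val_smul, ← negOnePow_smul]
  simp only [h1]
  have h2 : ∀ q, f.val R (upd K s n q) (psum K s + q + B) (upd_psum q s.isLt hl rfl rfl rfl hB) =
      ∑ c, ∑ y ∈ Finset.range (q + 1), ∑ x ∈ box m (upd K s n 0),
        convTerm hR (hd c) ((F c).fam r) ((G c).fam r') (psum K s + q + B) (setAt x s y)
          (upd K s n q - setAt x s y) := fun q => by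
    change (f.fam R).val _ _ _ = _
    rw [hf r r' R hR, Fam.val_sum]
    refine Finset.sum_congr rfl fun c _ => ?_
    rw [conv_val, sum_box_upd s.isLt]
  simp only [h2, map_sum, LinearMap.sum_apply]
  rw [Finset.sum_comm]
  refine Finset.sum_congr rfl fun c _ => ?_
  conv_rhs => rw [Finset.sum_comm]
  refine Finset.sum_congr rfl fun q _ => ?_
  conv_rhs => rw [Finset.sum_comm]
  refine Finset.sum_congr rfl fun y hy => ?_
  conv_rhs => rw [Finset.sum_comm]
  refine Finset.sum_congr rfl fun x _ => ?_
  rw [Finset.mem_range] at hy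
  have h3 : y + (q - y) = q := by omega
  change P.comp ht _ (P.pad _ _ _ _ ((g.fam q).val _ _ _)) = _
  rw [hg y (q - y) q h3, Fam.val_sum]
  simp only [map_sum, conv_val, h3, dite_true]

end Cosplit
end XB

namespace XB
open scoped DirectSum TensorProduct

theorem unsh_zero_left {n M : ℕ} {p p' : ℕ → ℕ} (hp : ∀ j < n, p j = 0)
    (h : psum p n + psum p' n = M) : unsh n p p' h = 1 := by
  have e : ∀ j ≤ n, psum p j = 0 := fun j hj =>
    Finset.sum_eq_zero fun i hi => hp i (by rw [Finset.mem_range] at hi; omega)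
  refine (eq_unsh h 1 (fun j hj t ht x hx => ?_) (fun j hj t ht x hx => ?_)).symm
  · rw [hp j hj] at ht; omega
  · have e1 := e j hj.le
    have e2 := e n le_rfl
    have e3 := hp j hj
    simp only [Equiv.Perm.coe_one, id_eq]
    omega

theorem unsh_zero_right {n M : ℕ} {p p' : ℕ → ℕ} (hp : ∀ j < n, p' j = 0)
    (h : psum p n + psum p' n = M) : unsh n p p' h = 1 := by
  have e : ∀ j ≤ n, psum p' j = 0 := fun j hj =>
    Finset.sum_eq_zero fun i hi => hp i (by rw [Finset.mem_range] at hi; omega)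
  refine (eq_unsh h 1 (fun j hj t ht x hx => ?_) (fun j hj t ht x hx => ?_)).symm
  · have e1 := e j hj.le
    simp only [Equiv.Perm.coe_one, id_eq]
    omega
  · rw [hp j hj] at ht; omega

theorem unsh_one {M : ℕ} {p p' : ℕ → ℕ} (h : psum p 1 + psum p' 1 = M) : unsh 1 p p' h = 1 := by
  refine (eq_unsh h 1 (fun j hj t ht x hx => ?_) (fun j hj t ht x hx => ?_)).symm
  · obtain rfl : j = 0 := by omega
    simpa using hx
  · obtain rfl : j = 0 := by omega
    simpa [psum_succ] using hx

theorem eq_zero_of_psum {n : ℕ} {p : ℕ → ℕ} (h : psum p n = 0) : ∀ j < n, p j = 0 := fun j hj =>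
  (Finset.sum_eq_zero_iff.1 h) j (Finset.mem_range.2 hj)

section Convolution

variable {k : Type u} [Field k] {P : PROP k}

variable (P) in
/-- The projection of the tensor coalgebra to its component of degree `0`. -/
def unitHom : ∀ M, P.Hom M 0 0
  | 0 => P.perm 1
  | _ + 1 => 0

variable (P) in
/-- The unit of the convolution. -/
def famUnit (n : ℕ) : Fam P n 0 0 :=
  Fam.mk (fun _ M _ => unitHom P M) fun _ _ _ _ _ _ => rfl

theorem famUnit_zero {n : ℕ} {K : ℕ → ℕ} (h : psum K n = 0) :
    (famUnit P n).val K 0 h = P.perm 1 := rfl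

theorem famUnit_ne {n : ℕ} {K : ℕ → ℕ} {M : ℕ} (h : psum K n = M) (hM : M ≠ 0) :
    (famUnit P n).val K M h = 0 := by
  cases M with
  | zero => exact absurd rfl hM
  | succ M => rfl

theorem convTerm_eq_zero_left {n r r' R : ℕ} {a b t : ℤ} (hR : r + r' = R) (e : a + b = t)
    (f : Fam P n r a) (g : Fam P n r' b) (M : ℕ) {p p' : ℕ → ℕ} (h : f.val p _ rfl = 0) :
    convTerm hR e f g M p p' = 0 := by
  unfold convTerm
  split_ifs
  · rw [h]; simp
  · rfl

theorem convTerm_eq_zero_right {n r r' R : ℕ} {a b t : ℤ} (hR : r + r' = R) (e : a + b = t)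
    (f : Fam P n r a) (g : Fam P n r' b) (M : ℕ) {p p' : ℕ → ℕ} (h : g.val p' _ rfl = 0) :
    convTerm hR e f g M p p' = 0 := by
  unfold convTerm
  split_ifs
  · rw [h]; simp
  · rfl

theorem conv_unit_left {n r : ℕ} {a : ℤ} (hR : 0 + r = r) (e : 0 + a = a) (f : Fam P n r a) :
    conv hR e (famUnit P n) f = f := by
  refine Fam.ext fun K M hM => ?_
  rw [conv_val, Finset.sum_eq_single 0]
  · have h0 : psum 0 n = 0 := Finset.sum_eq_zero fun _ _ => rfl
    rw [convTerm_eq hR e _ _ h0 (by simpa using hM) (zero_add M) (by simp [h0, hM]),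
      unsh_zero_left (p := 0) fun _ _ => rfl, famUnit_zero, P.one_hcomp, P.comp_one]
    exact f.congr (fun j _ => by simp) _ _
  · intro p hp hne
    refine convTerm_eq_zero_left _ _ _ _ _ (famUnit_ne _ fun h0 => hne (funext fun j => ?_))
    by_cases hj : j < n
    · exact eq_zero_of_psum h0 j hj
    · exact (mem_box.1 hp).2 j (by omega)
  · intro h
    exact absurd (mem_box.2 ⟨fun j _ => Nat.zero_le _, fun _ _ => rfl⟩) h

theorem conv_unit_right {n r : ℕ} {a : ℤ} (hR : r + 0 = r) (e : a + 0 = a) (f : Fam P n r a) :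
    conv hR e f (famUnit P n) = f := by
  refine Fam.ext fun K M hM => ?_
  have hc : ∀ j < n, cut n K j = K j := fun j hj => cut_apply K hj
  rw [conv_val, Finset.sum_eq_single (cut n K)]
  · have h0 : psum (K - cut n K) n = 0 := Finset.sum_eq_zero fun j hj => by
      simp [hc j (Finset.mem_range.1 hj)]
    have h1 : psum (cut n K) n = M := by rw [psum_congr hc, hM]
    rw [convTerm_eq hR e _ _ h1 h0 (add_zero M) (by simp [h0, h1]),
      unsh_zero_right (fun j hj => by simp [hc j hj]), famUnit_zero, P.hcomp_one, P.comp_one]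
    exact f.congr hc _ _
  · intro p hp hne
    refine convTerm_eq_zero_right _ _ _ _ _ (famUnit_ne _ fun h0 => hne (funext fun j => ?_))
    rw [mem_box] at hp
    by_cases hj : j < n
    · have := eq_zero_of_psum h0 j hj
      have := hp.1 j hj
      rw [hc j hj]
      simp only [Pi.sub_apply] at *
      omega
    · rw [hp.2 j (by omega), cut, if_neg hj]
  · intro h
    exact absurd (mem_box.2 ⟨fun j hj => (hc j hj).le, fun j hj => if_neg (by omega)⟩) h

theorem conv_vanish {n r r' R : ℕ} {a b t : ℤ} (hR : r + r' = R) (e : a + b = t)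
    {f : Fam P n r a} {g : Fam P n r' b}
    (hf : ∀ K M (h : psum K n = M), M < r → f.val K M h = 0)
    (hg : ∀ K M (h : psum K n = M), M < r' → g.val K M h = 0) (K : ℕ → ℕ) (M : ℕ)
    (h : psum K n = M) (hM : M < R) : (conv hR e f g).val K M h = 0 := by
  rw [conv_val]
  refine Finset.sum_eq_zero fun p hp => ?_
  have h1 := psum_add_sub (mem_box.1 hp).1 h
  by_cases hr : psum p n < r
  · exact convTerm_eq_zero_left _ _ _ _ _ (hf _ _ _ hr)
  · exact convTerm_eq_zero_right _ _ _ _ _ (hg _ _ _ (by omega))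

theorem conv_one_val {r r' R M : ℕ} {a b t : ℤ} (hR : r + r' = R) (e : a + b = t)
    (f : Fam P 1 r a) (g : Fam P 1 r' b) (K : ℕ → ℕ) (hM : psum K 1 = M) :
    (conv hR e f g).val K M hM = ∑ y ∈ Finset.range (M + 1), if h : y + (M - y) = M then
      P.hcomp h hR e (f.val (fun _ => y) y (by simp [psum])) (g.val (fun _ => M - y) (M - y)
        (by simp [psum])) else 0 := by
  have hK : K 0 = M := by simpa [psum] using hM
  rw [conv_val]
  refine Finset.sum_bij' (fun p _ => p 0) (fun y _ => setAt 0 0 y) ?_ ?_ ?_ ?_ ?_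
  · intro p hp
    have := (mem_box.1 hp).1 0 (by omega)
    rw [Finset.mem_range]; omega
  · intro y hy
    rw [Finset.mem_range] at hy
    refine mem_box.2 ⟨fun j hj => ?_, fun j hj => ?_⟩
    · obtain rfl : j = 0 := by omega
      simp [setAt]; omega
    · simp [setAt]; omega
  · intro p hp
    funext j
    by_cases hj : j = 0
    · simp [setAt, hj]
    · simp [setAt, hj, (mem_box.1 hp).2 j (by omega)]
  · intro y _
    simp [setAt]
  · intro p hp
    have h1 := (mem_box.1 hp).1 0 (by omega)
    have h2 : p 0 + (M - p 0) = M := by omega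
    rw [dif_pos h2, convTerm_eq hR e f g (M₁ := p 0) (M₂ := M - p 0) (by simp [psum])
      (by simp [psum, hK]) h2 (by simp [psum]; omega), unsh_one, P.comp_one,
      f.congr (K := p) (K' := fun _ => p 0) (fun j hj => by
        obtain rfl : j = 0 := by omega
        rfl), g.congr (K := K - p) (K' := fun _ => M - p 0) (fun j hj => by
        obtain rfl : j = 0 := by omega
        simp [hK])]

/-- The convolution of two families of one word, at a word of known decomposition. -/
theorem conv_one_val_single {r r' R M y y' : ℕ} {a b t : ℤ} (hR : r + r' = R) (e : a + b = t)
    (f : Fam P 1 r a) (g : Fam P 1 r' b) (K : ℕ → ℕ) (hM : psum K 1 = M) (hy : y + y' = M)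
    (h0 : ∀ z z', z + z' = M → z ≠ y → f.val (fun _ => z) z (by simp [psum]) = 0 ∨
      g.val (fun _ => z') z' (by simp [psum]) = 0) :
    (conv hR e f g).val K M hM =
      P.hcomp hy hR e (f.val (fun _ => y) y (by simp [psum])) (g.val (fun _ => y') y'
        (by simp [psum])) := by
  obtain rfl : y' = M - y := by omega
  rw [conv_one_val, Finset.sum_eq_single y, dif_pos hy]
  · intro z hz hne
    rw [Finset.mem_range] at hz
    have hz' : z + (M - z) = M := by omega
    rw [dif_pos hz']
    rcases h0 z _ hz' hne with h | h <;> rw [h] <;> simp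
  · intro h
    rw [Finset.mem_range] at h
    omega

theorem conv_endOne {r r' R : ℕ} (hR : r + r' = R) (e : (0 : ℤ) + 0 = 0) :
    conv hR e ((endOne P).fam r) ((endOne P).fam r') = (endOne P).fam R := by
  refine Fam.ext fun K M hM => ?_
  change _ = (endOne P).val R K M hM
  by_cases h : M = R
  · subst h
    rw [conv_one_val_single hR e ((endOne P).fam r) ((endOne P).fam r') K hM hR
      (fun z z' _ hz => Or.inl (endOne_ne (r := r) _ hz))]
    change P.hcomp hR hR e ((endOne P).val r _ r _) ((endOne P).val r' _ r' _) = _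
    rw [endOne_self, endOne_self, P.one_hcomp_one, endOne_self]
  · rw [endOne_ne _ h, conv_one_val]
    refine Finset.sum_eq_zero fun y hy => ?_
    rw [Finset.mem_range] at hy
    rw [dif_pos (by omega)]
    by_cases hyr : y = r
    · change P.hcomp _ hR e _ ((endOne P).val r' _ _ _) = _
      rw [endOne_ne (r := r') _ (by omega)]; simp
    · change P.hcomp _ hR e ((endOne P).val r _ _ _) _ = _
      rw [endOne_ne (r := r) _ (by omega)]; simp

end Convolution
end XB

namespace XB
open scoped DirectSum TensorProduct

/-! ### Subspaces of a PROP that are closed under all operations -/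

/-- A family of subspaces of a PROP that contains the permutations and is closed under composition
and tensor product. -/
structure PROP.IsClosed {k : Type u} [Field k] (P : PROP k)
    (S : ∀ m n i, Submodule k (P.Hom m n i)) : Prop where
  perm_mem : ∀ {n : ℕ} (σ : Equiv.Perm (Fin n)), P.perm σ ∈ S n n 0
  comp_mem : ∀ {l m n : ℕ} {i j t : ℤ} (e : i + j = t) (f : P.Hom m n i) (g : P.Hom l m j),
    f ∈ S m n i → g ∈ S l m j → P.comp e f g ∈ S l n t
  hcomp_mem : ∀ {m m' M n n' N : ℕ} {i j t : ℤ} (hM : m + m' = M) (hN : n + n' = N)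
    (e : i + j = t) (f : P.Hom m n i) (g : P.Hom m' n' j),
    f ∈ S m n i → g ∈ S m' n' j → P.hcomp hM hN e f g ∈ S M N t

theorem PROP.IsClosed.pad_mem {k : Type u} [Field k] {P : PROP k}
    {S : ∀ m n i, Submodule k (P.Hom m n i)} (hS : P.IsClosed S) {m n M N : ℕ} {i : ℤ} (A B : ℕ)
    (hM : A + m + B = M) (hN : A + n + B = N) {f : P.Hom m n i} (hf : f ∈ S m n i) :
    P.pad A B hM hN f ∈ S M N i :=
  hS.hcomp_mem _ _ _ _ _ (hS.hcomp_mem _ _ _ _ _ (hS.perm_mem _) hf) (hS.perm_mem _)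

section Presentation

variable {k : Type u} [Field k] {G : ℕ → ℕ → ℤ → Type u} (Q : PROP k)
  (γ : ∀ {m n : ℕ} {i : ℤ}, G m n i → Q.Hom m n i)

/-- The value of a term in a PROP, for given values of the generators. -/
def Term.eval : ∀ {m n : ℕ} {i : ℤ}, Term G m n i → Q.Hom m n i
  | _, _, _, .gen g => γ g
  | _, _, _, .perm σ => Q.perm σ
  | _, _, _, .comp e f g => Q.comp e f.eval g.eval
  | _, _, _, .hcomp hM hN e f g => Q.hcomp hM hN e f.eval g.eval

theorem linearCombination_mapDomain {α β γ : Type*} {A B C : Type*} [AddCommGroup A] [Module k A]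
    [AddCommGroup B] [Module k B] [AddCommGroup C] [Module k C] (op : α → β → γ)
    (b : A →ₗ[k] B →ₗ[k] C) (ea : α → A) (eb : β → B) (ec : γ → C)
    (h : ∀ x y, ec (op x y) = b (ea x) (eb y)) (f : α →₀ k) (g : β →₀ k) :
    Finsupp.linearCombination k ec
      (Finsupp.linearCombination k (fun x => Finsupp.lmapDomain k k fun y => op x y) f g) =
      b (Finsupp.linearCombination k ea f) (Finsupp.linearCombination k eb g) := by
  induction f using Finsupp.induction_linear with
  | zero => simp
  | add f f' hf hf' => simp only [map_add, LinearMap.add_apply, hf, hf']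
  | single x c =>
    induction g using Finsupp.induction_linear with
    | zero => simp
    | add g g' hg hg' => simp only [map_add, hg, hg']
    | single y c' =>
      simp only [Finsupp.linearCombination_single, LinearMap.smul_apply, Finsupp.lmapDomain_apply,
        Finsupp.mapDomain_single, Finsupp.smul_single, map_smul, h, smul_smul, smul_eq_mul]
      rw [mul_comm]

theorem termData_comp_single {l m n : ℕ} {i j t : ℤ} (e : i + j = t) (f : Term G m n i)
    (g : Term G l m j) : (termData k G).comp e (Finsupp.single f 1) (Finsupp.single g 1) =
      Finsupp.single (Term.comp e f g) 1 := by
  change Finsupp.linearCombination k (fun f => Finsupp.lmapDomain k k fun g => Term.comp e f g)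
    (Finsupp.single f 1) (Finsupp.single g 1) = _
  simp

theorem termData_hcomp_single {m m' M n n' N : ℕ} {i j t : ℤ} (hM : m + m' = M) (hN : n + n' = N)
    (e : i + j = t) (f : Term G m n i) (g : Term G m' n' j) :
    (termData k G).hcomp hM hN e (Finsupp.single f 1) (Finsupp.single g 1) =
      Finsupp.single (Term.hcomp hM hN e f g) 1 := by
  change Finsupp.linearCombination k (fun f => Finsupp.lmapDomain k k fun g =>
    Term.hcomp hM hN e f g) (Finsupp.single f 1) (Finsupp.single g 1) = _
  simp

/-- The value of a linear combination of terms. -/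
noncomputable def evalLin (m n : ℕ) (i : ℤ) : (termData k G).Hom m n i →ₗ[k] Q.Hom m n i :=
  Finsupp.linearCombination k (Term.eval Q γ)

theorem evalLin_single {m n : ℕ} {i : ℤ} (t : Term G m n i) :
    evalLin Q γ m n i (Finsupp.single t 1) = t.eval Q γ :=
  (Finsupp.linearCombination_single k 1 t).trans (one_smul k _)

theorem evalLin_gen {m n : ℕ} {i : ℤ} (g : G m n i) :
    evalLin Q γ m n i (Finsupp.single (Term.gen g) 1) = γ g := evalLin_single Q γ _

theorem evalLin_perm {n : ℕ} (σ : Equiv.Perm (Fin n)) :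
    evalLin Q γ n n 0 ((termData k G).perm σ) = Q.perm σ := evalLin_single Q γ _

theorem evalLin_comp {l m n : ℕ} {i j t : ℤ} (e : i + j = t) (f : (termData k G).Hom m n i)
    (g : (termData k G).Hom l m j) : evalLin Q γ l n t ((termData k G).comp e f g) =
      Q.comp e (evalLin Q γ m n i f) (evalLin Q γ l m j g) :=
  linearCombination_mapDomain (Term.comp e) (Q.comp e) (Term.eval Q γ) (Term.eval Q γ)
    (Term.eval Q γ) (fun _ _ => rfl) f g

theorem evalLin_hcomp {m m' M n n' N : ℕ} {i j t : ℤ} (hM : m + m' = M) (hN : n + n' = N)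
    (e : i + j = t) (f : (termData k G).Hom m n i) (g : (termData k G).Hom m' n' j) :
    evalLin Q γ M N t ((termData k G).hcomp hM hN e f g) =
      Q.hcomp hM hN e (evalLin Q γ m n i f) (evalLin Q γ m' n' j g) :=
  linearCombination_mapDomain (Term.hcomp hM hN e) (Q.hcomp hM hN e) (Term.eval Q γ)
    (Term.eval Q γ) (Term.eval Q γ) (fun _ _ => rfl) f g

theorem evalLin_smul {m n : ℕ} {i : ℤ} (z : ℤ) (f : (termData k G).Hom m n i) :
    evalLin Q γ m n i (z.negOnePow • f) = z.negOnePow • evalLin Q γ m n i f := by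
  rw [negOnePow_smul (k := k), negOnePow_smul (k := k), map_smul]

variable {R : ∀ m n i, (termData k G).Hom m n i → (termData k G).Hom m n i → Prop}

theorem evalLin_of_mem (hR : ∀ m n i f g, R m n i f g → evalLin Q γ m n i f = evalLin Q γ m n i g)
    {m n : ℕ} {i : ℤ} {f : (termData k G).Hom m n i} (hf : PROPIdeal R f) :
    evalLin Q γ m n i f = 0 := by
  induction hf with
  | rel h => rw [map_sub, hR _ _ _ _ _ h, sub_self]
  | zero => exact map_zero _
  | add _ _ h h' => rw [map_add, h, h', add_zero]
  | smul c _ h => rw [map_smul, h, smul_zero]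
  | comp_left e g _ h => rw [evalLin_comp, h]; simp
  | comp_right e g _ h => rw [evalLin_comp, h]; simp
  | hcomp_left hM hN e g _ h => rw [evalLin_hcomp, h]; simp
  | hcomp_right hM hN e g _ h => rw [evalLin_hcomp, h]; simp
  | comp_assoc e₁ e₂ e₃ e₄ f g h =>
    simp only [map_sub, evalLin_comp]; rw [Q.comp_assoc e₁ e₂ e₃ e₄, sub_self]
  | one_comp e f => rw [map_sub, evalLin_comp, evalLin_perm, Q.one_comp, sub_self]
  | comp_one e f => rw [map_sub, evalLin_comp, evalLin_perm, Q.comp_one, sub_self]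
  | perm_mul e σ τ =>
    rw [map_sub, evalLin_comp, evalLin_perm, evalLin_perm, evalLin_perm, Q.perm_mul e, sub_self]
  | hcomp_assoc hm₁ hm₂ hm₃ hm₄ hn₁ hn₂ hn₃ hn₄ e₁ e₂ e₃ e₄ f g h =>
    simp only [map_sub, evalLin_hcomp]
    rw [Q.hcomp_assoc hm₁ hm₂ hm₃ hm₄ hn₁ hn₂ hn₃ hn₄ e₁ e₂ e₃ e₄, sub_self]
  | one_hcomp hm hn e f => rw [map_sub, evalLin_hcomp, evalLin_perm, Q.one_hcomp, sub_self]
  | hcomp_one hm hn e f => rw [map_sub, evalLin_hcomp, evalLin_perm, Q.hcomp_one, sub_self]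
  | perm_hcomp h e σ τ =>
    rw [map_sub, evalLin_hcomp, evalLin_perm, evalLin_perm, evalLin_perm, Q.perm_hcomp, sub_self]
  | interchange hL hM hN e₁ e₂ e₃ e₄ e₅ e₆ f g f' g' =>
    rw [map_sub, evalLin_smul]
    simp only [evalLin_comp, evalLin_hcomp]
    rw [Q.interchange hL hM hN e₁ e₂ e₃ e₄ e₅ e₆, sub_self]
  | symmetry hM hM' hN hN' e₁ e₂ e₃ e₄ f g =>
    rw [map_sub, evalLin_smul]
    simp only [evalLin_comp, evalLin_hcomp, evalLin_perm]
    rw [Q.symmetry hM hM' hN hN' e₁ e₂ e₃ e₄, sub_self]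

/-- The universal property of a presented PROP: existence. -/
noncomputable def presentedLift
    (hR : ∀ m n i f g, R m n i f g → evalLin Q γ m n i f = evalLin Q γ m n i g) :
    (presented R).Mor Q where
  map m n i := (relSubmodule R m n i).liftQ (evalLin Q γ m n i) fun _ hf =>
    evalLin_of_mem Q γ hR hf
  map_perm σ := evalLin_perm Q γ σ
  map_comp e f g := by
    induction f using Submodule.Quotient.induction_on with | _ f
    induction g using Submodule.Quotient.induction_on with | _ g
    exact evalLin_comp Q γ e f g
  map_hcomp hM hN e f g := by
    induction f using Submodule.Quotient.induction_on with | _ f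
    induction g using Submodule.Quotient.induction_on with | _ g
    exact evalLin_hcomp Q γ hM hN e f g

theorem presentedLift_gen
    (hR : ∀ m n i f g, R m n i f g → evalLin Q γ m n i f = evalLin Q γ m n i g)
    {m n : ℕ} {i : ℤ} (g : G m n i) :
    (presentedLift Q γ hR).map m n i (presentedGen R g) = γ g := evalLin_gen Q γ g

theorem presented_closed_eq_top {S : ∀ m n i, Submodule k ((presented R).Hom m n i)}
    (hS : (presented R).IsClosed S)
    (hgen : ∀ {m n : ℕ} {i : ℤ} (g : G m n i), presentedGen R g ∈ S m n i) {m n : ℕ} {i : ℤ}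
    (f : (presented R).Hom m n i) : f ∈ S m n i := by
  have key : ∀ {m n : ℕ} {i : ℤ} (t : Term G m n i),
      (Submodule.Quotient.mk (Finsupp.single t 1) : (presented R).Hom m n i) ∈ S m n i := by
    intro m n i t
    induction t with
    | gen g => exact hgen g
    | perm σ => exact hS.perm_mem σ
    | comp e f g hf hg =>
      rw [← termData_comp_single]
      exact hS.comp_mem e _ _ hf hg
    | hcomp hM hN e f g hf hg =>
      rw [← termData_hcomp_single]
      exact hS.hcomp_mem hM hN e _ _ hf hg
  have key' : ∀ f : Term G m n i →₀ k,
      (Submodule.Quotient.mk f : (presented R).Hom m n i) ∈ S m n i := by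
    intro f
    induction f using Finsupp.induction_linear with
    | zero => exact Submodule.zero_mem _
    | add f g hf hg => exact Submodule.add_mem _ hf hg
    | single t c =>
      have : Finsupp.single t c = c • Finsupp.single t 1 := by simp
      rw [this]
      exact Submodule.smul_mem _ c (key t)
  induction f using Submodule.Quotient.induction_on with | _ f
  exact key' f

end Presentation

theorem PROP.Mor.ext_map {k : Type u} [Field k] {P Q : PROP k} {g h : P.Mor Q}
    (H : ∀ m n i f, g.map m n i f = h.map m n i f) : g = h := by
  cases g; cases h
  congr 1
  funext m n i
  exact LinearMap.ext (H m n i)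

/-- The subspaces on which two morphisms of PROPs agree. -/
def PROP.Mor.eqLocus {k : Type u} [Field k] {P Q : PROP k} (g h : P.Mor Q) (m n : ℕ) (i : ℤ) :
    Submodule k (P.Hom m n i) := LinearMap.eqLocus (g.map m n i) (h.map m n i)

theorem PROP.Mor.isClosed_eqLocus {k : Type u} [Field k] {P Q : PROP k} (g h : P.Mor Q) :
    P.IsClosed (g.eqLocus h) where
  perm_mem σ := by
    change g.map _ _ _ _ = h.map _ _ _ _
    rw [g.map_perm, h.map_perm]
  comp_mem e f f' hf hf' := by
    change g.map _ _ _ _ = h.map _ _ _ _ at hf hf' ⊢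
    rw [g.map_comp, h.map_comp, hf, hf']
  hcomp_mem hM hN e f f' hf hf' := by
    change g.map _ _ _ _ = h.map _ _ _ _ at hf hf' ⊢
    rw [g.map_hcomp, h.map_hcomp, hf, hf']

theorem PROP.Mor.map_pad {k : Type u} [Field k] {P Q : PROP k} (g : P.Mor Q)
    {m n M N : ℕ} {i : ℤ} (A B : ℕ) (hM : A + m + B = M) (hN : A + n + B = N) (f : P.Hom m n i) :
    g.map M N i (P.pad A B hM hN f) = Q.pad A B hM hN (g.map m n i f) := by
  rw [P.pad_apply, Q.pad_apply, g.map_hcomp, g.map_hcomp, g.map_perm, g.map_perm]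

end XB

namespace XB
open scoped DirectSum TensorProduct

/-- The word with the letters `κ`. -/
def word {n : ℕ} (κ : Fin n → ℕ) : ℕ → ℕ := fun j => if h : j < n then κ ⟨j, h⟩ else 0

@[simp] theorem word_val {n : ℕ} (κ : Fin n → ℕ) (j : Fin n) : word κ j = κ j := by simp [word]

theorem word_lt {n j : ℕ} (κ : Fin n → ℕ) (h : j < n) : word κ j = κ ⟨j, h⟩ := dif_pos h

theorem psum_eq_sum (K : ℕ → ℕ) (n : ℕ) : psum K n = ∑ j : Fin n, K j := by
  rw [psum, Finset.sum_range]

theorem psum_word {n : ℕ} (κ : Fin n → ℕ) : psum (word κ) n = ∑ j, κ j := by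
  simp [psum_eq_sum]

theorem sum_box_word {α : Type*} [AddCommMonoid α] {n : ℕ} (κ : Fin n → ℕ) (h : (ℕ → ℕ) → α) :
    ∑ p ∈ box n (word κ), h p = ∑ p : (∀ j, Fin (κ j + 1)), h (word fun j => (p j : ℕ)) := by
  refine Finset.sum_bij' (fun p hp => fun j => ⟨p j, by
      have := (mem_box.1 hp).1 j j.isLt
      rw [word_val] at this; omega⟩) (fun p _ => word fun j => (p j : ℕ)) ?_ ?_ ?_ ?_ ?_
  · intro p _; exact Finset.mem_univ _
  · intro p _
    refine mem_box.2 ⟨fun j hj => ?_, fun j hj => dif_neg (by omega)⟩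
    rw [word_lt _ hj, word_lt _ hj]
    have := (p ⟨j, hj⟩).isLt
    omega
  · intro p hp
    funext j
    by_cases hj : j < n
    · rw [word_lt _ hj]
    · rw [word, dif_neg hj, (mem_box.1 hp).2 j (by omega)]
  · intro p _
    funext j
    simp
  · intro p hp
    congr 1
    funext j
    by_cases hj : j < n
    · rw [word_lt _ hj]
    · rw [word, dif_neg hj, (mem_box.1 hp).2 j (by omega)]

section

variable {k : Type u} [Field k] {Q : PROP k}

theorem conv_val_word {n r r' R M : ℕ} {a b t : ℤ} (hR : r + r' = R) (e : a + b = t)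
    (f : Fam Q n r a) (g : Fam Q n r' b) (κ : Fin n → ℕ) (hM : ∑ j, κ j = M)
    (h : psum (word κ) n = M) :
    (conv hR e f g).val (word κ) M h = ∑ p : (∀ j, Fin (κ j + 1)),
      Q.comp (add_zero t)
        (Q.hcomp (sum_split p hM) hR e (f.val (word fun j => (p j : ℕ)) _ (psum_word _))
          (g.val (word fun j => κ j - p j) _ (psum_word _)))
        (Q.perm (unshuffle κ p hM)) := by
  rw [conv_val, sum_box_word]
  refine Finset.sum_congr rfl fun p _ => ?_
  have h1 : ∀ j < n, (word κ - word fun j => (p j : ℕ)) j = word (fun j => κ j - p j) j :=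
    fun j hj => by simp [word_lt _ hj]
  rw [convTerm_congr hR e f g (fun _ _ => rfl) h1,
    convTerm_eq hR e f g (psum_word _) (psum_word _) (sum_split p hM)
      (by rw [psum_word, psum_word]; exact sum_split p hM),
    unshuffle_eq_unsh κ p hM (word fun j => (p j : ℕ)) (word fun j => κ j - p j)
      (fun j => by simp) (fun j => by simp; have := (p j).isLt; omega)]

theorem append_word {a n b : ℕ} (u : Fin a → ℕ) (w : Fin n → ℕ) (v : Fin b → ℕ) (j : ℕ)
    (hj : j < a + n + b) : word (Fin.append (Fin.append u w) v) j =
      if j < a then word u j else if j < a + n then word w (j - a) else word v (j - (a + n)) := by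
  rw [word_lt _ hj]
  obtain ⟨c, hc⟩ : ∃ c : Fin (a + n + b), (c : ℕ) = j := ⟨⟨j, hj⟩, rfl⟩
  subst hc
  induction c using Fin.addCases with
  | right c =>
    have h1 : ¬ (a + n + (c : ℕ) < a) := by omega
    have h2 : ¬ (a + n + (c : ℕ) < a + n) := by omega
    simp only [Fin.val_natAdd, h1, h2, if_false, Nat.add_sub_cancel_left, word_val]
    exact Fin.append_right _ _ _
  | left c =>
    induction c using Fin.addCases with
    | left c =>
      simp only [Fin.val_castAdd, Fin.is_lt, if_true, word_val]
      exact (Fin.append_left _ _ _).trans (Fin.append_left _ _ _)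
    | right c =>
      have h1 : ¬ (a + (c : ℕ) < a) := by omega
      have h2 : a + (c : ℕ) < a + n := by omega
      simp only [Fin.val_castAdd, Fin.val_natAdd, h1, h2, if_true, if_false,
        Nat.add_sub_cancel_left, word_val]
      exact (Fin.append_left _ _ _).trans (Fin.append_right _ _ _)

theorem endCirc_val_append {a n b r M m : ℕ} {i j t : ℤ} (u : Fin a → ℕ) (w : Fin n → ℕ)
    (v : Fin b → ℕ) (s : Fin (a + 1 + b)) (hs : (s : ℕ) = a)
    (hl : a + n + b + 1 = a + 1 + b + n) (ht : i + j = t) (hm : ∑ c, w c = m)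
    (f : EndObj Q (a + 1 + b) i) (g : EndObj Q n j)
    (hM : psum (word (Fin.append (Fin.append u w) v)) (a + n + b) = M)
    (h₁ : ∑ c, u c + m + ∑ c, v c = M)
    (h₂ : ∀ q, ∑ c, u c + q + ∑ c, v c = ∑ c, Fin.append (Fin.append u fun _ : Fin 1 => q) v c) :
    (endCirc s hl ht f g).val r (word (Fin.append (Fin.append u w) v)) M hM =
      ∑ q ∈ Finset.range (m + 1), Q.comp ht
        (f.val r (word (Fin.append (Fin.append u fun _ : Fin 1 => q) v)) _ (psum_word _))
        (Q.pad (∑ c, u c) (∑ c, v c) h₁ (h₂ q) (g.val q (word w) m ((psum_word w).trans hm))) := by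
  have e1 : psum (word (Fin.append (Fin.append u w) v)) s = ∑ c, u c := by
    rw [← psum_word u, hs]
    exact psum_congr fun j hj => by rw [append_word _ _ _ _ (by omega), if_pos hj]
  have e2 : ∀ j < n, res (word (Fin.append (Fin.append u w) v)) s j = word w j := fun j hj => by
    rw [res, hs, append_word _ _ _ _ (by omega), if_neg (by omega), if_pos (by omega),
      Nat.add_sub_cancel_left]
  have e3 : psum (res (word (Fin.append (Fin.append u w) v)) s) n = m := by
    rw [psum_congr e2, psum_word, hm]
  rw [endCirc_val s hl ht f g r _ M hM (m + 1) e1 e3 h₁ (by omega)]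
  refine Finset.sum_congr rfl fun q _ => ?_
  rw [g.congr e2 e3 ((psum_word w).trans hm)]
  have e4 : ∀ j < a + 1 + b, upd (word (Fin.append (Fin.append u w) v)) s n q j =
      word (Fin.append (Fin.append u fun _ : Fin 1 => q) v) j := fun j hj => by
    rw [append_word _ _ _ _ hj, upd, hs]
    split_ifs with h1 h2 h3 h4
    · rw [append_word _ _ _ _ (by omega), if_pos h1]
    · subst h2; simp [word]
    · omega
    · omega
    · rw [append_word _ _ _ _ (by omega), if_neg (by omega), if_neg (by omega)]
      congr 1; omega
  have key : ∀ (N : ℕ) (hN : ∑ c, u c + q + ∑ c, v c = N)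
      (h' : psum (upd (word (Fin.append (Fin.append u w) v)) s n q) (a + 1 + b) =
        ∑ c, u c + q + ∑ c, v c)
      (h : psum (word (Fin.append (Fin.append u fun _ : Fin 1 => q) v)) (a + 1 + b) = N),
      Q.comp ht (f.val r (upd (word (Fin.append (Fin.append u w) v)) s n q) _ h')
        (Q.pad (∑ c, u c) (∑ c, v c) h₁ rfl (g.val q (word w) m ((psum_word w).trans hm))) =
      Q.comp ht (f.val r (word (Fin.append (Fin.append u fun _ : Fin 1 => q) v)) N h)
        (Q.pad (∑ c, u c) (∑ c, v c) h₁ hN (g.val q (word w) m ((psum_word w).trans hm))) := by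
    intro N hN h' h
    subst hN
    rw [f.congr e4]
  exact key _ (h₂ q) _ _

end

section Representations

variable {k : Type u} [Field k] {X : CoalgOperad k} {Q : PROP k}

/-- The families of operations `Φ x` for `x ∈ X n` form a morphism of coalgebras. -/
structure IsCoalgMap {n : ℕ} (Φ : ∀ i, X.obj n i →ₗ[k] EndObj Q n i) : Prop where
  comul : ∀ {i : ℤ} (x : X.obj n i) (S : Splitting k x),
    IsCosplit (Φ i x) S.degL S.degR S.deg_add (fun a => Φ _ (S.left a)) (fun a => Φ _ (S.right a))
  counit : ∀ x : X.obj n 0, (Φ 0 x).fam 0 = X.counit x • famUnit Q n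
  counit_ne : ∀ {i : ℤ} (x : X.obj n i), i ≠ 0 → (Φ i x).fam 0 = 0

/-- The family of operations `D` is a coderivation that lowers the degree of tensors. -/
structure IsCoder (D : EndObj Q 1 1) : Prop where
  zero : ∀ {r M : ℕ} {K : ℕ → ℕ} (h : psum K 1 = M), ¬ (0 < r ∧ r < M) → D.val r K M h = 0
  comul : ∀ {r r' R : ℕ} (hR : r + r' = R), D.fam R =
    conv hR (add_zero 1) (D.fam r) ((endOne Q).fam r') +
      conv hR (zero_add 1) ((endOne Q).fam r) (D.fam r')

variable (X Q) in
/-- An `X`-algebra structure on a tensor coalgebra in `Q`, with a differential. -/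
structure Rep where
  Φ : ∀ n i, X.obj n i →ₗ[k] EndObj Q n i
  D : EndObj Q 1 1
  coalg : ∀ n, IsCoalgMap (Φ n)
  coder : IsCoder D
  map_one : Φ 1 0 X.one = endOne Q
  map_circ : ∀ {m n l : ℕ} {i j t : ℤ} (s : Fin m) (hl : l + 1 = m + n) (ht : i + j = t)
    (x : X.obj m i) (y : X.obj n j), Φ l t (X.circ s hl ht x y) = endCirc s hl ht (Φ m i x) (Φ n j y)

theorem psum_const_one (l : ℕ) : psum (fun _ => l) 1 = l := by simp [psum]

/-- The values of the generators of `P(X)`. -/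
def Rep.gen (ρ : Rep X Q) : ∀ {m n : ℕ} {i : ℤ}, Gen X m n i → Q.Hom m n i
  | _, _, _, .phi κ hM r x => (ρ.Φ _ _ x).val r (word κ) _ ((psum_word κ).trans hM)
  | _, _, _, .D l m => ρ.D.val m (fun _ => l) l (psum_const_one l)

theorem conv_coder_left (D : EndObj Q 1 1) {p q c L R : ℕ} (hR : p + q = R)
    (h₁ : p + c + q = L) (h : psum (fun _ => L) 1 = L) :
    (conv hR (add_zero 1) (D.fam p) ((endOne Q).fam q)).val (fun _ => L) L h =
      Q.hcomp h₁ hR (add_zero 1) (D.val p (fun _ => p + c) (p + c) (psum_const_one _))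
        (Q.perm 1) := by
  rw [conv_one_val_single hR (add_zero 1) (D.fam p) ((endOne Q).fam q) _ h h₁
    fun z z' hz hne => Or.inr (endOne_ne (r := q) _ (by omega))]
  congr 1
  exact endOne_self _

theorem conv_coder_right (D : EndObj Q 1 1) {p q c L R : ℕ} (hR : p + q = R)
    (h₁ : p + (q + c) = L) (h : psum (fun _ => L) 1 = L) :
    (conv hR (zero_add 1) ((endOne Q).fam p) (D.fam q)).val (fun _ => L) L h =
      Q.hcomp h₁ hR (zero_add 1) (Q.perm 1)
        (D.val q (fun _ => q + c) (q + c) (psum_const_one _)) := by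
  rw [conv_one_val_single hR (zero_add 1) ((endOne Q).fam p) (D.fam q) _ h h₁
    fun z z' hz hne => Or.inl (endOne_ne (r := p) _ (by omega))]
  congr 2
  exact endOne_self _

/-- The relations of `P(X)` hold in a representation. -/
theorem Rep.map_rel (ρ : Rep X Q) (T : PROPData k)
    (φ : ∀ {n M : ℕ} {i : ℤ} (κ : Fin n → ℕ), ∑ j, κ j = M → ∀ r : ℕ, X.obj n i → T.Hom M r i)
    (D : ∀ l m : ℕ, T.Hom l m 1) (ev : ∀ m n i, T.Hom m n i →ₗ[k] Q.Hom m n i)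
    (ev_perm : ∀ {n : ℕ} (σ : Equiv.Perm (Fin n)), ev n n 0 (T.perm σ) = Q.perm σ)
    (ev_comp : ∀ {l m n : ℕ} {i j t : ℤ} (e : i + j = t) (f : T.Hom m n i) (g : T.Hom l m j),
      ev l n t (T.comp e f g) = Q.comp e (ev m n i f) (ev l m j g))
    (ev_hcomp : ∀ {m m' M n n' N : ℕ} {i j t : ℤ} (hM : m + m' = M) (hN : n + n' = N)
      (e : i + j = t) (f : T.Hom m n i) (g : T.Hom m' n' j),
      ev M N t (T.hcomp hM hN e f g) = Q.hcomp hM hN e (ev m n i f) (ev m' n' j g))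
    (ev_phi : ∀ {n M : ℕ} {i : ℤ} (κ : Fin n → ℕ) (hM : ∑ j, κ j = M) (r : ℕ) (x : X.obj n i),
      ev M r i (φ κ hM r x) = (ρ.Φ _ _ x).val r (word κ) _ ((psum_word κ).trans hM))
    (ev_D : ∀ l m, ev l m 1 (D l m) = ρ.D.val m (fun _ => l) l (psum_const_one l))
    {M N : ℕ} {i : ℤ} {f g : T.Hom M N i} (h : Rel X T φ D M N i f g) :
    ev M N i f = ev M N i g := by
  have ev_pad : ∀ {m n M N : ℕ} {i : ℤ} (A B : ℕ) (hM : A + m + B = M) (hN : A + n + B = N)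
      (f : T.Hom m n i), ev M N i (T.pad A B hM hN f) = Q.pad A B hM hN (ev m n i f) := by
    intro m n M N i A B hM hN f
    simp only [PROPData.pad, LinearMap.comp_apply, LinearMap.flip_apply, ev_hcomp, ev_perm]
  cases h with
  | phi_add κ hM r x y => simp only [ev_phi, map_add, EndObj.val_add]
  | phi_smul κ hM r c x => simp only [ev_phi, map_smul, EndObj.val_smul]
  | phi_zero κ hM r x hr =>
    rw [map_zero, ev_phi]
    exact EndObj.vanish _ _ hr
  | D_zero l m h =>
    rw [map_zero, ev_D]
    exact ρ.coder.zero _ h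
  | phi_comul κ hM r r' R hR x S =>
    simp only [map_sum, ev_comp, ev_hcomp, ev_perm, ev_phi]
    change ((ρ.Φ _ _ x).fam N).val _ _ _ = _
    rw [(ρ.coalg _).comul x S r r' N hR, Fam.val_sum]
    refine Finset.sum_congr rfl fun a _ => ?_
    rw [conv_val_word hR _ _ _ κ hM]
    rfl
  | D_comul p q c L R hR h₁ h₂ =>
    simp only [map_add, ev_hcomp, ev_perm, ev_D]
    change (ρ.D.fam N).val _ _ _ = _
    rw [ρ.coder.comul hR, Fam.val_add, conv_coder_left ρ.D hR h₁,
      conv_coder_right ρ.D hR h₂]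
  | phi_circ u w v hM r s hs hl ht hm y z =>
    simp only [map_sum, ev_comp, ev_pad, ev_phi]
    rw [ρ.map_circ, endCirc_val_append u w v s hs hl ht hm]
  | phi_one κ hM => rw [ev_phi, ev_perm, ρ.map_one, endOne_self]
  | phi_one_zero κ hM r hr => rw [ev_phi, map_zero, ρ.map_one, endOne_ne _ hr.symm]
  | phi_counit κ hM x =>
    rw [ev_phi, map_smul, ev_perm]
    change ((ρ.Φ _ _ x).fam 0).val _ _ _ = _
    rw [(ρ.coalg _).counit, Fam.val_smul, famUnit_zero]
  | phi_counit_zero κ hM x h =>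
    rw [ev_phi, map_zero]
    change ((ρ.Φ _ _ x).fam 0).val _ _ _ = _
    by_cases hi : i = 0
    · subst hi
      rw [(ρ.coalg _).counit, Fam.val_smul, famUnit_ne _ (by simpa using h), smul_zero]
    · rw [(ρ.coalg _).counit_ne x hi, Fam.val_zero]

/-- The morphism of PROPs that is given by a representation. -/
noncomputable def Rep.toMor (ρ : Rep X Q) : (gradedPROP X).Mor Q :=
  presentedLift Q ρ.gen fun _ _ _ _ _ h => ρ.map_rel (termData k (Gen X)) _ _ (evalLin Q ρ.gen)
    (evalLin_perm Q ρ.gen) (evalLin_comp Q ρ.gen) (evalLin_hcomp Q ρ.gen)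
    (fun _ _ _ _ => evalLin_gen Q ρ.gen _) (fun _ _ => evalLin_gen Q ρ.gen _) h

theorem Rep.toMor_phi (ρ : Rep X Q) {n M : ℕ} {i : ℤ} (κ : Fin n → ℕ) (hM : ∑ j, κ j = M) (r : ℕ)
    (x : X.obj n i) : ρ.toMor.map M r i (phi X κ hM r x) =
      (ρ.Φ n i x).val r (word κ) M ((psum_word κ).trans hM) := presentedLift_gen _ _ _ _

theorem Rep.toMor_opD (ρ : Rep X Q) (l m : ℕ) : ρ.toMor.map l m 1 (opD X l m) =
    ρ.D.val m (fun _ => l) l (psum_const_one l) := presentedLift_gen _ _ _ _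

end Representations
end XB

namespace XB
open scoped DirectSum TensorProduct

section UniversalRepresentation

variable {k : Type u} [Field k] {X : CoalgOperad k} {Q : PROP k} (T : PROPData k)
    (φ : ∀ {n M : ℕ} {i : ℤ} (κ : Fin n → ℕ), ∑ j, κ j = M → ∀ r : ℕ, X.obj n i → T.Hom M r i)
    (D : ∀ l m : ℕ, T.Hom l m 1) (ev : ∀ m n i, T.Hom m n i →ₗ[k] Q.Hom m n i)
    (ev_perm : ∀ {n : ℕ} (σ : Equiv.Perm (Fin n)), ev n n 0 (T.perm σ) = Q.perm σ)
    (ev_comp : ∀ {l m n : ℕ} {i j t : ℤ} (e : i + j = t) (f : T.Hom m n i) (g : T.Hom l m j),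
      ev l n t (T.comp e f g) = Q.comp e (ev m n i f) (ev l m j g))
    (ev_hcomp : ∀ {m m' M n n' N : ℕ} {i j t : ℤ} (hM : m + m' = M) (hN : n + n' = N)
      (e : i + j = t) (f : T.Hom m n i) (g : T.Hom m' n' j),
      ev M N t (T.hcomp hM hN e f g) = Q.hcomp hM hN e (ev m n i f) (ev m' n' j g))
    (ev_rel : ∀ {M N : ℕ} {i : ℤ} {f g : T.Hom M N i}, Rel X T φ D M N i f g →
      ev M N i f = ev M N i g)

include ev_rel

/-- The families of operations `φ(x)`. -/
def relPhi (n : ℕ) (i : ℤ) : X.obj n i →ₗ[k] EndObj Q n i where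
  toFun x := ⟨fun r => Fam.mk (fun K M h => ev M r i (φ (fun j : Fin n => K j)
      ((psum_eq_sum K n).symm.trans h) r x)) fun K K' hK M h h' => by
        have : (fun j : Fin n => K j) = fun j : Fin n => K' j := funext fun j => hK j j.isLt
        congr 1
        subst h
        congr 1,
    fun r K M h hr => (ev_rel (Rel.phi_zero _ _ r x hr)).trans (map_zero _)⟩
  map_add' x y := EndObj.ext fun r K M hM => (ev_rel (Rel.phi_add _ _ r x y)).trans (map_add _ _ _)
  map_smul' c x := EndObj.ext fun r K M hM =>
    (ev_rel (Rel.phi_smul _ _ r c x)).trans (map_smul _ _ _)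

theorem relPhi_val {n : ℕ} {i : ℤ} (x : X.obj n i) (r : ℕ) (K : ℕ → ℕ) (M : ℕ) (h : psum K n = M)
    (κ : Fin n → ℕ) (hκ : ∀ j, κ j = K j) (hM : ∑ j, κ j = M) :
    (relPhi T φ D ev ev_rel n i x).val r K M h = ev M r i (φ κ hM r x) := by
  obtain rfl : κ = fun j : Fin n => K j := funext hκ
  rfl

/-- The family of operations `D`. -/
def relD : EndObj Q 1 1 :=
  ⟨fun r => Fam.mk (fun _ M _ => ev M r 1 (D M r)) fun _ _ _ _ _ _ => rfl,
    fun r K M h hr => (ev_rel (Rel.D_zero _ _ (by omega))).trans (map_zero _)⟩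

include ev_perm ev_comp ev_hcomp

theorem relPhi_comul (n : ℕ) {i : ℤ} (x : X.obj n i) (S : Splitting k x) :
    IsCosplit (relPhi T φ D ev ev_rel n i x) S.degL S.degR S.deg_add
      (fun a => relPhi T φ D ev ev_rel n _ (S.left a))
      (fun a => relPhi T φ D ev ev_rel n _ (S.right a)) := by
  intro r r' R hR
  refine Fam.ext fun K M hM => ?_
  have hM' : ∑ j : Fin n, K j = M := (psum_eq_sum K n).symm.trans hM
  have hw : ∀ j < n, K j = word (fun j : Fin n => K j) j := fun j hj =>
    (word_lt (fun j : Fin n => K j) hj).symm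
  rw [Fam.congr _ hw _ ((psum_word _).trans hM'), Fam.congr _ hw hM ((psum_word _).trans hM')]
  change (relPhi T φ D ev ev_rel n i x).val R _ _ _ = _
  rw [relPhi_val T φ D ev ev_rel x R _ M _ (fun j : Fin n => K j)
      (fun j => (word_val (fun j : Fin n => K j) j).symm) hM',
    ev_rel (Rel.phi_comul _ hM' r r' R hR x S), Fam.val_sum, map_sum]
  refine Finset.sum_congr rfl fun a _ => ?_
  rw [conv_val_word hR _ _ _ _ hM', map_sum]
  refine Finset.sum_congr rfl fun p _ => ?_
  rw [ev_comp, ev_hcomp, ev_perm]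
  congr 3
  · congr 1
    exact (relPhi_val T φ D ev ev_rel (S.left a) r _ _ _ _ (fun j => (word_val _ j).symm) _).symm
  · exact (relPhi_val T φ D ev ev_rel (S.right a) r' _ _ _ _ (fun j => (word_val _ j).symm) _).symm

theorem relPhi_coalg (n : ℕ) : IsCoalgMap (relPhi T φ D ev ev_rel n) where
  comul x S := relPhi_comul T φ D ev ev_perm ev_comp ev_hcomp ev_rel n x S
  counit x := by
    refine Fam.ext fun K M hM => ?_
    rw [Fam.val_smul]
    change ev M 0 0 _ = _
    by_cases h : M = 0
    · subst h
      rw [famUnit_zero, ev_rel (Rel.phi_counit _ _ x), map_smul, ev_perm]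
    · rw [famUnit_ne _ h, smul_zero, ev_rel (Rel.phi_counit_zero _ _ x (Or.inl h)), map_zero]
  counit_ne x hi := by
    refine Fam.ext fun K M hM => ?_
    exact (ev_rel (Rel.phi_counit_zero _ _ x (Or.inr hi))).trans (map_zero _)

omit ev_comp in
theorem relD_coder : IsCoder (relD T φ D ev ev_rel) where
  zero h hr := (ev_rel (Rel.D_zero _ _ hr)).trans (map_zero _)
  comul {r r' R} hR := by
    refine Fam.ext fun K M hM => ?_
    have hw : ∀ j < 1, K j = (fun _ => M : ℕ → ℕ) j := fun j hj => by
      obtain rfl : j = 0 := by omega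
      simpa [psum] using hM
    rw [Fam.congr _ hw _ (psum_const_one M), Fam.congr _ hw hM (psum_const_one M)]
    by_cases hRM : R ≤ M
    · obtain ⟨c, rfl⟩ := Nat.exists_eq_add_of_le hRM
      rw [Fam.val_add, conv_coder_left _ hR (by omega : r + c + r' = _),
        conv_coder_right _ hR (by omega : r + (r' + c) = _)]
      change ev _ _ _ _ = Q.hcomp _ _ _ (ev _ _ _ _) _ + Q.hcomp _ _ _ _ (ev _ _ _ _)
      rw [ev_rel (Rel.D_comul r r' c _ R hR (by omega) (by omega)), map_add, ev_hcomp, ev_hcomp,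
        ev_perm, ev_perm]
    · have h1 : ∀ r K M (h : psum K 1 = M), M < r →
          ((relD T φ D ev ev_rel).fam r).val K M h = 0 :=
        fun r K M h hr => EndObj.vanish (relD T φ D ev ev_rel) h hr
      have h2 : ∀ r K M (h : psum K 1 = M), M < r → ((endOne Q).fam r).val K M h = 0 :=
        fun r K M h hr => EndObj.vanish (endOne Q) h hr
      rw [h1 _ _ _ _ (by omega), Fam.val_add, conv_vanish hR _ (h1 r) (h2 r') _ _ _ (by omega),
        conv_vanish hR _ (h2 r) (h1 r') _ _ _ (by omega), add_zero]

omit ev_comp ev_hcomp in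
theorem relPhi_one : relPhi T φ D ev ev_rel 1 0 X.one = endOne Q := by
  refine EndObj.ext fun r K M hM => ?_
  change ev M r 0 _ = _
  by_cases h : r = M
  · subst h
    rw [endOne_self, ev_rel (Rel.phi_one _ _), ev_perm]
  · rw [endOne_ne _ (Ne.symm h), ev_rel (Rel.phi_one_zero _ _ r h), map_zero]

theorem relPhi_circ {m n l : ℕ} {i j t : ℤ} (s : Fin m) (hl : l + 1 = m + n) (ht : i + j = t)
    (x : X.obj m i) (y : X.obj n j) : relPhi T φ D ev ev_rel l t (X.circ s hl ht x y) =
      endCirc s hl ht (relPhi T φ D ev ev_rel m i x) (relPhi T φ D ev ev_rel n j y) := by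
  have ev_pad : ∀ {m n M N : ℕ} {i : ℤ} (A B : ℕ) (hM : A + m + B = M) (hN : A + n + B = N)
      (f : T.Hom m n i), ev M N i (T.pad A B hM hN f) = Q.pad A B hM hN (ev m n i f) := by
    intro m n M N i A B hM hN f
    simp only [PROPData.pad, LinearMap.comp_apply, LinearMap.flip_apply, ev_hcomp, ev_perm]
  obtain ⟨a, ha⟩ : ∃ a, a = (s : ℕ) := ⟨_, rfl⟩
  obtain ⟨b, hb⟩ : ∃ b, m = a + 1 + b := ⟨m - (a + 1), by have := s.isLt; omega⟩
  subst hb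
  obtain rfl : l = a + n + b := by omega
  refine EndObj.ext fun r K M hM => ?_
  set u : Fin a → ℕ := fun c => K c
  set w : Fin n → ℕ := fun c => K (a + c)
  set v : Fin b → ℕ := fun c => K (a + n + c)
  have hw : ∀ c < a + n + b, K c = word (Fin.append (Fin.append u w) v) c := fun c hc => by
    rw [append_word _ _ _ _ hc]
    split_ifs with h1 h2
    · rw [word_lt _ h1]
    · rw [word_lt _ (by omega)]
      simp only [w]
      congr 1; omega
    · rw [word_lt _ (by omega)]
      simp only [v]
      congr 1; omega
  have hM' : psum (word (Fin.append (Fin.append u w) v)) (a + n + b) = M := by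
    rw [← psum_congr hw, hM]
  have hM'' : ∑ c, Fin.append (Fin.append u w) v c = M := by rw [← psum_word, hM']
  rw [EndObj.congr _ hw hM hM', EndObj.congr _ hw hM hM', relPhi_val T φ D ev ev_rel _ r _ M _ _
    (fun c => (word_val _ c).symm) hM'', ev_rel (Rel.phi_circ u w v hM'' r s ha.symm hl ht rfl x y),
    endCirc_val_append u w v s ha.symm hl ht rfl _ _ _ (by rw [sum_append, hM''])
      (fun q => by rw [← sum_append]; simp), map_sum]
  refine Finset.sum_congr rfl fun q _ => ?_
  rw [ev_comp, ev_pad, relPhi_val T φ D ev ev_rel _ r _ _ _ _ (fun c => (word_val _ c).symm) rfl,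
    relPhi_val T φ D ev ev_rel _ q _ _ _ _ (fun c => (word_val _ c).symm) rfl]

/-- A representation in `Q`, from operations that satisfy the relations of `P(X)`. -/
def Rep.ofRel : Rep X Q where
  Φ := relPhi T φ D ev ev_rel
  D := relD T φ D ev ev_rel
  coalg := relPhi_coalg T φ D ev ev_perm ev_comp ev_hcomp ev_rel
  coder := relD_coder T φ D ev ev_perm ev_hcomp ev_rel
  map_one := relPhi_one T φ D ev ev_perm ev_rel
  map_circ := relPhi_circ T φ D ev ev_perm ev_comp ev_hcomp ev_rel

end UniversalRepresentation

section

variable {k : Type u} [Field k] (X : CoalgOperad k)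

/-- The universal representation, in `P(X)`. -/
noncomputable def univRep : Rep X (gradedPROP X) :=
  Rep.ofRel (Q := gradedPROP X) (termData k (Gen X))
    (fun κ hM r x => Finsupp.single (Term.gen (Gen.phi κ hM r x)) 1)
    (fun l m => Finsupp.single (Term.gen (Gen.D l m)) 1)
    (fun m n i => (relSubmodule _ m n i).mkQ)
    (fun _ => rfl) (fun _ _ _ => rfl) (fun _ _ _ _ _ => rfl)
    (fun h => (Submodule.Quotient.eq _).2 (PROPIdeal.rel h))

theorem univRep_Φ {n : ℕ} {i : ℤ} (x : X.obj n i) (r : ℕ) (K : ℕ → ℕ) (M : ℕ) (h : psum K n = M)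
    (κ : Fin n → ℕ) (hκ : ∀ j, κ j = K j) (hM : ∑ j, κ j = M) :
    ((univRep X).Φ n i x).val r K M h = phi X κ hM r x := by
  obtain rfl : κ = fun j : Fin n => K j := funext hκ
  rfl

theorem univRep_D (r : ℕ) (K : ℕ → ℕ) (M : ℕ) (h : psum K 1 = M) :
    (univRep X).D.val r K M h = opD X M r := rfl

theorem phi_eq_univRep {n M : ℕ} {i : ℤ} (κ : Fin n → ℕ) (hM : ∑ j, κ j = M) (r : ℕ)
    (x : X.obj n i) :
    phi X κ hM r x = ((univRep X).Φ n i x).val r (word κ) M ((psum_word κ).trans hM) :=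
  (univRep_Φ X x r _ M _ κ (fun j => (word_val κ j).symm) hM).symm

variable {X}

/-- A closed family of subspaces of `P(X)` that contains the generators is everything. -/
theorem gradedPROP_closed_eq_top {S : ∀ m n i, Submodule k ((gradedPROP X).Hom m n i)}
    (hS : (gradedPROP X).IsClosed S)
    (hphi : ∀ {n : ℕ} {i : ℤ} (x : X.obj n i) (r : ℕ) (K : ℕ → ℕ) (M : ℕ) (h : psum K n = M),
      ((univRep X).Φ n i x).val r K M h ∈ S M r i)
    (hD : ∀ (l m : ℕ), opD X l m ∈ S l m 1) {m n : ℕ} {i : ℤ}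
    (f : (gradedPROP X).Hom m n i) : f ∈ S m n i := by
  refine presented_closed_eq_top hS (fun {m n i} g => ?_) f
  cases g with
  | phi κ hM r x =>
    have := hphi x n (word κ) m ((psum_word κ).trans hM)
    rwa [← phi_eq_univRep X κ hM n x] at this
  | D l m => exact hD _ _

end
end XB

namespace XB
open scoped DirectSum TensorProduct

/-! ### Insertions of a unary operation of degree one -/

section UnaryInsertion

variable {k : Type u} [Field k] (A : NSOperad k) {D : A.obj 1 1}

theorem NSOperad.circ_congr {m n l : ℕ} {i j t : ℤ} {s s' : Fin m} (h : (s : ℕ) = s')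
    (hl : l + 1 = m + n) (ht : i + j = t) (x : A.obj m i) (y : A.obj n j) :
    A.circ s hl ht x y = A.circ s' hl ht x y := by
  obtain rfl : s = s' := Fin.ext h
  rfl

/-- The sum of the insertions of `D` in all inputs. -/
def NSOperad.insertAll (D : A.obj 1 1) {n : ℕ} {i t : ℤ} (h : i + 1 = t) :
    A.obj n i →ₗ[k] A.obj n t :=
  ∑ c : Fin n, (A.circ c rfl h).flip D

theorem NSOperad.insertAll_apply (D : A.obj 1 1) {n : ℕ} {i t : ℤ} (h : i + 1 = t)
    (x : A.obj n i) : A.insertAll D h x = ∑ c : Fin n, A.circ c rfl h x D := by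
  simp [NSOperad.insertAll]

theorem NSOperad.insertAll_circ {m n l : ℕ} {i j t i' j' t' : ℤ} (s : Fin m)
    (hl : l + 1 = m + n) (ht : i + j = t) (hi : i + 1 = i') (hj : j + 1 = j') (ht' : t + 1 = t')
    (h₁ : i' + j = t') (h₂ : i + j' = t') (x : A.obj m i) (y : A.obj n j) :
    A.insertAll D ht' (A.circ s hl ht x y) = A.circ s hl h₂ x (A.insertAll D hj y) +
      ksign k j • (A.circ s hl h₁ (A.insertAll D hi x) y -
        A.circ s hl h₁ (A.circ s rfl hi x D) y) := by
  obtain ⟨a, ha⟩ : ∃ a, a = (s : ℕ) := ⟨_, rfl⟩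
  obtain ⟨b, hb⟩ : ∃ b, m = a + 1 + b := ⟨m - (a + 1), by have := s.isLt; omega⟩
  subst hb
  obtain rfl : l = a + n + b := by omega
  have e1 : ∀ c : Fin a, A.circ (Fin.castAdd b (Fin.castAdd n c)) rfl ht' (A.circ s hl ht x y) D =
      ksign k j • A.circ s hl h₁ (A.circ (Fin.castAdd b (Fin.castAdd 1 c)) rfl hi x D) y := by
    intro c
    have h := A.circ_par (Fin.castAdd b (Fin.castAdd 1 c)) s (by rw [Fin.lt_def]; simp; omega)
      s (Fin.castAdd b (Fin.castAdd n c)) (by simp) (by simp)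
      rfl hl hl rfl hi h₁ ht ht' x D y
    rw [h, negOnePow_smul (k := k), smul_smul, one_mul, ksign_mul_self, one_smul]
  have e2 : ∀ c : Fin n, A.circ (Fin.castAdd b (Fin.natAdd a c)) rfl ht' (A.circ s hl ht x y) D =
      A.circ s hl h₂ x (A.circ c rfl hj y D) := fun c =>
    A.circ_seq s c _ (by simp [ha]) hl rfl rfl hl ht ht' hj h₂ x y D
  have e3 : ∀ c : Fin b, A.circ (Fin.natAdd (a + n) c) rfl ht' (A.circ s hl ht x y) D =
      ksign k j • A.circ s hl h₁ (A.circ (Fin.natAdd (a + 1) c) rfl hi x D) y := by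
    intro c
    have h := A.circ_par s (Fin.natAdd (a + 1) c) (by rw [Fin.lt_def]; simp; omega)
      (Fin.natAdd (a + n) c) s (by simp; omega) rfl hl rfl rfl hl ht ht' hi h₁ x y D
    rw [h, negOnePow_smul (k := k), mul_one]
  have e4 : A.circ (Fin.castAdd b (Fin.natAdd a (0 : Fin 1))) rfl hi x D = A.circ s rfl hi x D :=
    A.circ_congr (by simp [ha]) _ _ _ _
  rw [A.insertAll_apply, A.insertAll_apply, A.insertAll_apply, Fin.sum_univ_add, Fin.sum_univ_add]
  simp only [e1, e2, e3]
  rw [Fin.sum_univ_add (a := a + 1), Fin.sum_univ_add (a := a)]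
  simp only [Finset.univ_unique, Fin.default_eq_zero, Finset.sum_singleton]
  rw [e4]
  simp only [map_add, map_sum, LinearMap.add_apply, LinearMap.sum_apply, ← Finset.smul_sum,
    smul_add, smul_sub]
  abel

theorem NSOperad.circ_insertAll {n : ℕ} {i j j' t : ℤ} (hl : n + 1 = 1 + n)
    (hj : j + 1 = j') (ht : i + j = t) (ht' : i + j' = t') (h : t + 1 = t') (x : A.obj 1 i)
    (y : A.obj n j) : A.circ 0 hl ht' x (A.insertAll D hj y) =
      A.insertAll D h (A.circ 0 hl ht x y) := by
  rw [A.insertAll_apply, A.insertAll_apply, map_sum]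
  exact Finset.sum_congr rfl fun c _ =>
    (A.circ_seq 0 c c (by simp) hl rfl rfl hl ht h hj ht' x y D).symm

theorem NSOperad.insertAll_insertAll {n : ℕ} {i i' i'' : ℤ} (hi : i + 1 = i') (hi' : i' + 1 = i'')
    (h : i + 2 = i'') (h2 : (1 : ℤ) + 1 = 2) (x : A.obj n i) :
    A.insertAll D hi' (A.insertAll D hi x) =
      ∑ c : Fin n, A.circ c rfl h x (A.circ 0 rfl h2 D D) := by
  rw [A.insertAll_apply D hi, map_sum]
  simp only [A.insertAll_apply D hi']
  have key : ∀ c c' : Fin n, c < c' → A.circ c' rfl hi' (A.circ c rfl hi x D) D =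
      - A.circ c rfl hi' (A.circ c' rfl hi x D) D := by
    intro c c' hc
    rw [A.circ_par c c' hc c' c rfl rfl rfl rfl rfl rfl hi hi' hi hi' x D D]
    simp
  have diag : ∀ c : Fin n, A.circ c rfl hi' (A.circ c rfl hi x D) D =
      A.circ c rfl h x (A.circ 0 rfl h2 D D) := fun c =>
    A.circ_seq c 0 c (by simp) rfl rfl rfl rfl hi hi' h2 h x D D
  have off : ∀ c c' : Fin n, c ≠ c' → A.circ c' rfl hi' (A.circ c rfl hi x D) D +
      A.circ c rfl hi' (A.circ c' rfl hi x D) D = 0 := by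
    intro c c' hc
    rcases lt_or_gt_of_ne hc with h1 | h1
    · rw [key c c' h1]; abel
    · rw [key c' c h1]; abel
  have split : ∀ F : Fin n → Fin n → A.obj n i'', (∀ c c', c ≠ c' → F c c' + F c' c = 0) →
      ∑ c, ∑ c', F c c' = ∑ c, F c c := by
    intro F hF
    have h1 : ∑ c, ∑ c', F c c' = ∑ c, F c c + ∑ p ∈ Finset.univ.offDiag, F p.1 p.2 := by
      rw [← Finset.sum_product', ← Finset.diag_union_offDiag,
        Finset.sum_union (Finset.disjoint_diag_offDiag _), Finset.sum_diag]
    rw [h1, add_eq_left]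
    refine Finset.sum_involution (fun p _ => p.swap) ?_ ?_ ?_ ?_
    · intro p hp
      exact hF _ _ (Finset.mem_offDiag.1 hp).2.2
    · intro p hp _ h
      exact (Finset.mem_offDiag.1 hp).2.2 (congrArg Prod.snd h)
    · intro p hp
      have := Finset.mem_offDiag.1 hp
      simpa using fun h => this.2.2 h.symm
    · intro p _
      simp
  rw [split _ fun c c' hc => off c c' hc]
  exact Finset.sum_congr rfl fun c _ => diag c

end UnaryInsertion
end XB

namespace XB
open scoped DirectSum TensorProduct

/-! ### Dual numbers with coefficients in a PROP -/

section DualNumbers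

variable {k : Type u} [Field k]

theorem ksign_mul_add_one (a b : ℤ) : ksign k (a * (b + 1)) = ksign k (a * b) * ksign k a := by
  rw [mul_add, mul_one, ksign_add]

theorem ksign_add_one_mul (a b : ℤ) : ksign k ((a + 1) * b) = ksign k (a * b) * ksign k b := by
  rw [add_mul, one_mul, ksign_add]

/-- A bilinear operation extended to dual numbers by the Leibniz rule. -/
def leibniz {A A' B B' C C' : Type u} [AddCommGroup A] [Module k A] [AddCommGroup A'] [Module k A']
    [AddCommGroup B] [Module k B] [AddCommGroup B'] [Module k B'] [AddCommGroup C] [Module k C]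
    [AddCommGroup C'] [Module k C'] (c : k) (f : A →ₗ[k] B →ₗ[k] C) (f' : A' →ₗ[k] B →ₗ[k] C')
    (f'' : A →ₗ[k] B' →ₗ[k] C') : (A × A') →ₗ[k] (B × B') →ₗ[k] (C × C') :=
  LinearMap.mk₂ k (fun x y => (f x.1 y.1, f' x.2 y.1 + c • f'' x.1 y.2))
    (fun x x' y => by ext <;> simp; abel)
    (fun a x y => by ext <;> simp [smul_comm c a])
    (fun x y y' => by ext <;> simp; abel)
    (fun a x y => by ext <;> simp [smul_comm c a])

variable (P : PROP k)

/-- The PROP `P[ε]`, with `ε` of degree `-1` and `ε² = 0`. The pair `(f, f')` stands for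
`f + ε f'`. -/
def PROP.dual : PROP k where
  Hom m n i := P.Hom m n i × P.Hom m n (i + 1)
  perm σ := (P.perm σ, 0)
  comp {l m n i j t} e := leibniz (ksign k i) (P.comp e)
    (P.comp (by omega : i + 1 + j = t + 1)) (P.comp (by omega : i + (j + 1) = t + 1))
  hcomp {m m' M n n' N i j t} hM hN e := leibniz (ksign k i) (P.hcomp hM hN e)
    (P.hcomp hM hN (by omega : i + 1 + j = t + 1)) (P.hcomp hM hN (by omega : i + (j + 1) = t + 1))
  comp_assoc {_ _ _ _ a b c ab bc abc} e₁ e₂ e₃ e₄ f g h := by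
    subst e₁ e₂ e₃
    simp only [leibniz, LinearMap.mk₂_apply, map_add, map_smul, LinearMap.add_apply,
      LinearMap.smul_apply]
    rw [P.comp_assoc _ _ rfl e₄ f.1, P.comp_assoc _ _ rfl (by omega) f.2,
      P.comp_assoc _ _ (by omega : b + 1 + c = b + c + 1) (by omega) f.1 g.2,
      P.comp_assoc _ _ (by omega : b + (c + 1) = b + c + 1) (by omega) f.1 g.1 h.2, ksign_add]
    refine Prod.ext rfl ?_
    simp only [smul_add, smul_smul, add_assoc]
  one_comp e f := by
    simp only [leibniz, LinearMap.mk₂_apply]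
    rw [P.one_comp, P.one_comp]; simp
  comp_one e f := by
    simp only [leibniz, LinearMap.mk₂_apply]
    rw [P.comp_one, P.comp_one]; simp
  perm_mul e σ τ := by
    simp only [leibniz, LinearMap.mk₂_apply]
    rw [P.perm_mul e]; simp
  hcomp_assoc {_ _ _ _ _ _ _ _ _ _ _ _ a b c ab bc abc} hm₁ hm₂ hm₃ hm₄ hn₁ hn₂ hn₃ hn₄ e₁ e₂ e₃ e₄ f g h := by
    subst e₁ e₂ e₃
    simp only [leibniz, LinearMap.mk₂_apply, map_add, map_smul, LinearMap.add_apply,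
      LinearMap.smul_apply]
    rw [P.hcomp_assoc hm₁ hm₂ hm₃ hm₄ hn₁ hn₂ hn₃ hn₄ _ _ rfl e₄ f.1,
      P.hcomp_assoc hm₁ hm₂ hm₃ hm₄ hn₁ hn₂ hn₃ hn₄ _ _ rfl (by omega) f.2,
      P.hcomp_assoc hm₁ hm₂ hm₃ hm₄ hn₁ hn₂ hn₃ hn₄ _ _ (by omega : b + 1 + c = b + c + 1) (by omega)
        f.1 g.2,
      P.hcomp_assoc hm₁ hm₂ hm₃ hm₄ hn₁ hn₂ hn₃ hn₄ _ _ (by omega : b + (c + 1) = b + c + 1) (by omega)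
        f.1 g.1 h.2, ksign_add]
    refine Prod.ext rfl ?_
    simp only [smul_add, smul_smul, add_assoc]
  one_hcomp hm hn e f := by
    simp only [leibniz, LinearMap.mk₂_apply]
    rw [P.one_hcomp, P.one_hcomp]; simp
  hcomp_one hm hn e f := by
    simp only [leibniz, LinearMap.mk₂_apply]
    rw [P.hcomp_one, P.hcomp_one]; simp
  perm_hcomp h e σ τ := by
    simp only [leibniz, LinearMap.mk₂_apply]
    rw [P.perm_hcomp]; simp
  interchange {_ _ _ _ _ _ _ _ _ a b c d ab cd ac bd t} hL hM hN e₁ e₂ e₃ e₄ e₅ e₆ f g f' g' := by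
    subst e₁ e₂ e₃ e₄ e₅
    simp only [leibniz, LinearMap.mk₂_apply, map_add, map_smul, LinearMap.add_apply,
      LinearMap.smul_apply]
    rw [P.interchange hL hM hN _ _ _ rfl rfl e₆ f.1 g.1 f'.1 g'.1,
      P.interchange hL hM hN _ _ _ (by omega : a + 1 + c = a + c + 1) rfl (by omega) f.2 g.1 f'.1 g'.1,
      P.interchange hL hM hN _ _ _ rfl (by omega : b + 1 + d = b + d + 1) (by omega) f.1 g.2 f'.1 g'.1,
      P.interchange hL hM hN _ _ _ (by omega : a + (c + 1) = a + c + 1) rfl (by omega) f.1 g.1 f'.2 g'.1,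
      P.interchange hL hM hN _ _ _ rfl (by omega : b + (d + 1) = b + d + 1) (by omega) f.1 g.1 f'.1 g'.2]
    simp only [negOnePow_smul (k := k)]
    refine Prod.ext rfl ?_
    simp only [Prod.smul_snd, smul_add, smul_smul, ksign_mul_add_one, ksign_add_one_mul, ksign_add]
    have h1 : ksign k a * ksign k b * (ksign k (b * c) * ksign k b) = ksign k (b * c) * ksign k a := by
      linear_combination ksign k a * ksign k (b * c) * ksign_mul_self k b
    have h2 : ksign k a * (ksign k (b * c) * ksign k c) =
        ksign k (b * c) * (ksign k a * ksign k c) := by ring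
    have h3 : ksign k a * ksign k b * (ksign k c * ksign k (b * c)) =
        ksign k (b * c) * (ksign k a * ksign k c * ksign k b) := by ring
    rw [h1, h2, h3]
    abel
  symmetry {_ _ _ _ _ _ a b ab} hM hM' hN hN' e₁ e₂ e₃ e₄ f g := by
    subst e₁
    simp only [leibniz, LinearMap.mk₂_apply, map_add, map_smul, LinearMap.add_apply,
      LinearMap.smul_apply]
    rw [P.symmetry hM hM' hN hN' rfl e₂ e₃ e₄ f.1 g.1,
      P.symmetry hM hM' hN hN' (by omega : a + 1 + b = a + b + 1) (by omega) (by omega) (by omega) f.2 g.1,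
      P.symmetry hM hM' hN hN' (by omega : a + (b + 1) = a + b + 1) (by omega) (by omega) (by omega) f.1 g.2]
    simp only [negOnePow_smul (k := k)]
    refine Prod.ext rfl ?_
    simp only [Prod.smul_snd, smul_add, smul_smul, ksign_mul_add_one, ksign_add_one_mul, map_zero,
      smul_zero, add_zero, ksign_zero, one_smul, zero_add, LinearMap.zero_apply]
    have h1 : ksign k b * (ksign k (a * b) * ksign k b) = ksign k (a * b) := by
      linear_combination ksign k (a * b) * ksign_mul_self k b
    rw [h1]
    simp only [one_mul]
    abel

theorem PROP.dual_comp {l m n : ℕ} {i j t : ℤ} (e : i + j = t) (f : P.dual.Hom m n i)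
    (g : P.dual.Hom l m j) (h₁ : i + 1 + j = t + 1) (h₂ : i + (j + 1) = t + 1) :
    P.dual.comp e f g =
      (P.comp e f.1 g.1, P.comp h₁ f.2 g.1 + ksign k i • P.comp h₂ f.1 g.2) := rfl

theorem PROP.dual_hcomp {m m' M n n' N : ℕ} {i j t : ℤ} (hM : m + m' = M) (hN : n + n' = N)
    (e : i + j = t) (f : P.dual.Hom m n i) (g : P.dual.Hom m' n' j) (h₁ : i + 1 + j = t + 1)
    (h₂ : i + (j + 1) = t + 1) : P.dual.hcomp hM hN e f g =
      (P.hcomp hM hN e f.1 g.1, P.hcomp hM hN h₁ f.2 g.1 + ksign k i • P.hcomp hM hN h₂ f.1 g.2) :=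
  rfl

theorem PROP.dual_perm {n : ℕ} (σ : Equiv.Perm (Fin n)) : P.dual.perm σ = (P.perm σ, 0) := rfl

theorem PROP.dual_pad {m n M N : ℕ} {i : ℤ} (A B : ℕ) (hM : A + m + B = M) (hN : A + n + B = N)
    (f : P.dual.Hom m n i) :
    P.dual.pad A B hM hN f = (P.pad A B hM hN f.1, P.pad A B hM hN f.2) := by
  rw [P.dual.pad_apply, P.pad_apply, P.pad_apply, P.dual_hcomp _ _ _ _ _ (by omega) (by omega),
    P.dual_hcomp _ _ _ _ _ (by omega) (by omega)]
  simp [P.dual_perm]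
  rfl

end DualNumbers
end XB

namespace XB
open scoped DirectSum TensorProduct

section DualFamilies

variable {k : Type u} [Field k] {P : PROP k}

theorem PROP.dual_fst_sum {ι : Type*} {m n : ℕ} {i : ℤ} (s : Finset ι)
    (f : ι → P.dual.Hom m n i) : (∑ a ∈ s, f a).1 = ∑ a ∈ s, (f a).1 :=
  Prod.fst_sum (N := P.Hom m n (i + 1)) (f := f)

theorem PROP.dual_snd_sum {ι : Type*} {m n : ℕ} {i : ℤ} (s : Finset ι)
    (f : ι → P.dual.Hom m n i) : (∑ a ∈ s, f a).2 = ∑ a ∈ s, (f a).2 :=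
  Prod.snd_sum (M := P.Hom m n i) (f := f)

/-- The first components of a family of operations in `P[ε]`. -/
def Fam.fst {n r : ℕ} {i : ℤ} : Fam P.dual n r i →ₗ[k] Fam P n r i where
  toFun f := Fam.mk (fun K M h => (f.val K M h).1) fun K K' hK M h h' => by rw [f.congr hK h h']
  map_add' _ _ := rfl
  map_smul' _ _ := rfl

/-- The second components of a family of operations in `P[ε]`. -/
def Fam.snd {n r : ℕ} {i : ℤ} : Fam P.dual n r i →ₗ[k] Fam P n r (i + 1) where
  toFun f := Fam.mk (fun K M h => (f.val K M h).2) fun K K' hK M h h' => by rw [f.congr hK h h']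
  map_add' _ _ := rfl
  map_smul' _ _ := rfl

theorem Fam.fst_val {n r : ℕ} {i : ℤ} (f : Fam P.dual n r i) (K : ℕ → ℕ) (M : ℕ)
    (h : psum K n = M) : (Fam.fst f).val K M h = (f.val K M h).1 := rfl

theorem Fam.snd_val {n r : ℕ} {i : ℤ} (f : Fam P.dual n r i) (K : ℕ → ℕ) (M : ℕ)
    (h : psum K n = M) : (Fam.snd f).val K M h = (f.val K M h).2 := rfl

theorem Fam.dual_ext {n r : ℕ} {i : ℤ} {f g : Fam P.dual n r i} (h₁ : Fam.fst f = Fam.fst g)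
    (h₂ : Fam.snd f = Fam.snd g) : f = g :=
  Fam.ext fun K M h => Prod.ext (congrArg (fun f => Fam.val f K M h) h₁)
    (congrArg (fun f => Fam.val f K M h) h₂)

/-- The first components of a family of operations in `P[ε]`. -/
def EndObj.fst {n : ℕ} {i : ℤ} (f : EndObj P.dual n i) : EndObj P n i :=
  ⟨fun r => Fam.fst (f.1 r), fun _ _ _ h hr => congrArg Prod.fst (f.vanish h hr)⟩

/-- The second components of a family of operations in `P[ε]`. -/
def EndObj.snd {n : ℕ} {i : ℤ} (f : EndObj P.dual n i) : EndObj P n (i + 1) :=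
  ⟨fun r => Fam.snd (f.1 r), fun _ _ _ h hr => congrArg Prod.snd (f.vanish h hr)⟩

/-- The family of operations in `P[ε]` with given components. -/
def EndObj.dualMk {n : ℕ} {i : ℤ} (f : EndObj P n i) (g : EndObj P n (i + 1)) :
    EndObj P.dual n i :=
  ⟨fun r => Fam.mk (P := P.dual) (fun K M h => (f.val r K M h, g.val r K M h))
      fun _ _ hK _ h h' => by rw [f.congr hK h h', g.congr hK h h'],
    fun _ _ _ h hr => Prod.ext (f.vanish h hr) (g.vanish h hr)⟩

theorem EndObj.dual_ext {n : ℕ} {i : ℤ} {f g : EndObj P.dual n i} (h₁ : f.fst = g.fst)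
    (h₂ : f.snd = g.snd) : f = g :=
  EndObj.ext fun r K M h => Prod.ext (congrArg (fun f => EndObj.val f r K M h) h₁)
    (congrArg (fun f => EndObj.val f r K M h) h₂)

theorem EndObj.fst_dualMk {n : ℕ} {i : ℤ} (f : EndObj P n i) (g : EndObj P n (i + 1)) :
    (EndObj.dualMk f g).fst = f := rfl

theorem EndObj.snd_dualMk {n : ℕ} {i : ℤ} (f : EndObj P n i) (g : EndObj P n (i + 1)) :
    (EndObj.dualMk f g).snd = g := rfl

theorem EndObj.fst_fam {n : ℕ} {i : ℤ} (f : EndObj P.dual n i) (r : ℕ) :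
    Fam.fst (f.fam r) = f.fst.fam r := rfl

theorem EndObj.snd_fam {n : ℕ} {i : ℤ} (f : EndObj P.dual n i) (r : ℕ) :
    Fam.snd (f.fam r) = f.snd.fam r := rfl

theorem EndObj.fst_val {n : ℕ} {i : ℤ} (f : EndObj P.dual n i) (r : ℕ) (K : ℕ → ℕ) (M : ℕ)
    (h : psum K n = M) : f.fst.val r K M h = (f.val r K M h).1 := rfl

theorem EndObj.snd_val {n : ℕ} {i : ℤ} (f : EndObj P.dual n i) (r : ℕ) (K : ℕ → ℕ) (M : ℕ)
    (h : psum K n = M) : f.snd.val r K M h = (f.val r K M h).2 := rfl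

theorem endOne_fst : (endOne P.dual).fst = endOne P := by
  refine EndObj.ext fun r K M h => ?_
  rw [EndObj.fst_val]
  by_cases hr : M = r
  · subst hr
    rw [endOne_self, endOne_self]; rfl
  · rw [endOne_ne _ hr, endOne_ne _ hr]; rfl

theorem endOne_snd : (endOne P.dual).snd = 0 := by
  refine EndObj.ext fun r K M h => ?_
  rw [EndObj.snd_val]
  by_cases hr : M = r
  · subst hr
    rw [endOne_self]; rfl
  · rw [endOne_ne _ hr]; rfl

theorem famUnit_fst (n : ℕ) : Fam.fst (famUnit P.dual n) = famUnit P n := by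
  refine Fam.ext fun K M h => ?_
  rw [Fam.fst_val]
  by_cases hr : M = 0
  · subst hr; rfl
  · rw [famUnit_ne _ hr, famUnit_ne _ hr]; rfl

theorem famUnit_snd (n : ℕ) : Fam.snd (famUnit P.dual n) = 0 := by
  refine Fam.ext fun K M h => ?_
  rw [Fam.snd_val]
  by_cases hr : M = 0
  · subst hr; rfl
  · rw [famUnit_ne _ hr]; rfl

theorem conv_fst {n r r' R : ℕ} {a b t : ℤ} (hR : r + r' = R) (e : a + b = t)
    (f : Fam P.dual n r a) (g : Fam P.dual n r' b) :
    Fam.fst (conv hR e f g) = conv hR e (Fam.fst f) (Fam.fst g) := by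
  refine Fam.ext fun K M h => ?_
  rw [Fam.fst_val, conv_val, conv_val, PROP.dual_fst_sum]
  refine Finset.sum_congr rfl fun p hp => ?_
  have h' := psum_add_sub (mem_box.1 hp).1 h
  rw [convTerm_eq hR e _ _ rfl rfl h' h', convTerm_eq hR e _ _ rfl rfl h' h']
  rfl

theorem conv_snd {n r r' R : ℕ} {a b t : ℤ} (hR : r + r' = R) (e : a + b = t)
    (h₁ : a + 1 + b = t + 1) (h₂ : a + (b + 1) = t + 1)
    (f : Fam P.dual n r a) (g : Fam P.dual n r' b) :
    Fam.snd (conv hR e f g) = conv hR h₁ (Fam.snd f) (Fam.fst g) +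
      ksign k a • conv hR h₂ (Fam.fst f) (Fam.snd g) := by
  refine Fam.ext fun K M h => ?_
  rw [Fam.snd_val, Fam.val_add, Fam.val_smul, conv_val, conv_val, conv_val, PROP.dual_snd_sum,
    Finset.smul_sum, ← Finset.sum_add_distrib]
  refine Finset.sum_congr rfl fun p hp => ?_
  have h' := psum_add_sub (mem_box.1 hp).1 h
  rw [convTerm_eq hR e _ _ rfl rfl h' h', convTerm_eq hR h₁ _ _ rfl rfl h' h',
    convTerm_eq hR h₂ _ _ rfl rfl h' h', P.dual_comp _ _ _ (by omega) (by omega), P.dual_perm]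
  rw [P.dual_hcomp _ _ _ _ _ h₁ h₂]
  simp only [map_zero, smul_zero, add_zero, map_add, map_smul, LinearMap.add_apply,
    LinearMap.smul_apply]
  rfl

theorem endCirc_fst {m n l : ℕ} {i j t : ℤ} (s : Fin m) (hl : l + 1 = m + n) (ht : i + j = t)
    (f : EndObj P.dual m i) (g : EndObj P.dual n j) :
    (endCirc s hl ht f g).fst = endCirc s hl ht f.fst g.fst := by
  refine EndObj.ext fun r K M hM => ?_
  subst hM
  obtain ⟨B, hB⟩ := exists_splitPoint (K := K) s.isLt hl
  rw [EndObj.fst_val, endCirc_val s hl ht f g r K _ rfl _ rfl rfl hB (Nat.lt_succ_self _),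
    endCirc_val s hl ht _ _ r K _ rfl _ rfl rfl hB (Nat.lt_succ_self _), PROP.dual_fst_sum]
  refine Finset.sum_congr rfl fun q _ => ?_
  rw [P.dual_comp _ _ _ (by omega) (by omega), P.dual_pad]
  rfl

theorem endCirc_snd {m n l : ℕ} {i j t : ℤ} (s : Fin m) (hl : l + 1 = m + n) (ht : i + j = t)
    (h₁ : i + 1 + j = t + 1) (h₂ : i + (j + 1) = t + 1)
    (f : EndObj P.dual m i) (g : EndObj P.dual n j) :
    (endCirc s hl ht f g).snd = endCirc s hl h₁ f.snd g.fst +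
      ksign k i • endCirc s hl h₂ f.fst g.snd := by
  refine EndObj.ext fun r K M hM => ?_
  subst hM
  obtain ⟨B, hB⟩ := exists_splitPoint (K := K) s.isLt hl
  rw [EndObj.snd_val, EndObj.val_add, EndObj.val_smul,
    endCirc_val s hl ht f g r K _ rfl _ rfl rfl hB (Nat.lt_succ_self _),
    endCirc_val s hl h₁ _ _ r K _ rfl _ rfl rfl hB (Nat.lt_succ_self _),
    endCirc_val s hl h₂ _ _ r K _ rfl _ rfl rfl hB (Nat.lt_succ_self _), PROP.dual_snd_sum,
    Finset.smul_sum, ← Finset.sum_add_distrib]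
  refine Finset.sum_congr rfl fun q _ => ?_
  rw [P.dual_comp _ _ _ h₁ h₂, P.dual_pad]
  rfl

end DualFamilies

section Coproducts

variable {k : Type u} [Field k] {X : CoalgOperad k} {Q : PROP k}

/-- The convolution of `F` and `G` as a function on `X n ⊗ X n`, with values of degree `i`. -/
noncomputable def convEval {n r r' R : ℕ} (hR : r + r' = R)
    (F : ∀ a, X.obj n a →ₗ[k] Fam Q n r a) (G : ∀ b, X.obj n b →ₗ[k] Fam Q n r' b) (i : ℤ) :
    ((⨁ a, X.obj n a) ⊗[k] ⨁ b, X.obj n b) →ₗ[k] Fam Q n R i :=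
  TensorProduct.lift (DirectSum.toModule k ℤ _ fun a => LinearMap.flip
    (DirectSum.toModule k ℤ _ fun b =>
      if e : a + b = i then ((conv hR e).compl₁₂ (F a) (G b)).flip else 0))

theorem convEval_lof {n r r' R : ℕ} (hR : r + r' = R)
    (F : ∀ a, X.obj n a →ₗ[k] Fam Q n r a) (G : ∀ b, X.obj n b →ₗ[k] Fam Q n r' b) {a b i : ℤ}
    (e : a + b = i) (x : X.obj n a) (y : X.obj n b) :
    convEval hR F G i (DirectSum.lof k ℤ _ a x ⊗ₜ DirectSum.lof k ℤ _ b y) =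
      conv hR e (F a x) (G b y) := by
  rw [convEval, TensorProduct.lift.tmul, DirectSum.toModule_lof, LinearMap.flip_apply,
    DirectSum.toModule_lof, dif_pos e]
  rfl

theorem convEval_splitting {n r r' R : ℕ} (hR : r + r' = R)
    (F : ∀ a, X.obj n a →ₗ[k] Fam Q n r a) (G : ∀ b, X.obj n b →ₗ[k] Fam Q n r' b) {i : ℤ}
    {x : X.obj n i} (S : Splitting k x) :
    convEval hR F G i (Coalgebra.comul (R := k) (DirectSum.lof k ℤ (X.obj n) i x)) =
      ∑ a, conv hR (S.deg_add a) (F _ (S.left a)) (G _ (S.right a)) := by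
  rw [S.comul_eq, map_sum]
  exact Finset.sum_congr rfl fun a _ => convEval_lof hR F G (S.deg_add a) _ _

theorem IsCoalgMap.fam_eq {n : ℕ} {Φ : ∀ i, X.obj n i →ₗ[k] EndObj Q n i} (h : IsCoalgMap Φ)
    {i : ℤ} (x : X.obj n i) {r r' R : ℕ} (hR : r + r' = R) : (Φ i x).fam R =
      convEval hR (fun a => (EndObj.fam r).comp (Φ a)) (fun b => (EndObj.fam r').comp (Φ b)) i
        (Coalgebra.comul (R := k) (DirectSum.lof k ℤ (X.obj n) i x)) := by
  obtain ⟨S⟩ := X.comul_graded x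
  rw [convEval_splitting hR _ _ S]
  exact h.comul x S r r' R hR

end Coproducts
end XB

namespace XB
open scoped DirectSum TensorProduct

section Coderivations

variable {k : Type u} [Field k] {P : PROP k}

/-- The family `D` or the identity. -/
def coderOrOne (D : EndObj P 1 1) : ∀ b : Bool, EndObj P 1 (bif b then 1 else 0)
  | true => D
  | false => endOne P

theorem IsCoder.isCosplit {D : EndObj P 1 1} (hD : IsCoder D) :
    IsCosplit (ι := Bool) D (fun b => bif b then 1 else 0) (fun b => bif !b then 1 else 0)
      (fun b => by cases b <;> rfl) (coderOrOne D) (fun b => coderOrOne D (!b)) := by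
  intro r r' R hR
  rw [Fintype.sum_bool, hD.comul hR]
  rfl

variable {ι : Type*} [Fintype ι] {n : ℕ} {i t : ℤ} {f : EndObj P n i} {dl dr : ι → ℤ}
  {hd : ∀ t, dl t + dr t = i} {F : ∀ t, EndObj P n (dl t)} {G : ∀ t, EndObj P n (dr t)}

theorem IsCosplit.coder_circ (hf : IsCosplit f dl dr hd F G) {D : EndObj P 1 1} (hD : IsCoder D)
    (hl : n + 1 = 1 + n) (ht : 1 + i = t) {r r' R : ℕ} (hR : r + r' = R) :
    (XB.endCirc 0 hl ht D f).fam R = ∑ c,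
      (conv hR (by rw [← ht, ← hd c]; ring) ((XB.endCirc 0 hl (add_comm 1 (dl c)) D (F c)).fam r)
          ((G c).fam r') +
        ksign k (dl c) • conv hR (by rw [← ht, ← hd c]; ring) ((F c).fam r)
          ((XB.endCirc 0 hl (add_comm 1 (dr c)) D (G c)).fam r')) := by
  rw [hD.isCosplit.endCirc hf 0 hl ht r r' R hR, Fintype.sum_prod_type, Fintype.sum_bool,
    ← Finset.sum_add_distrib]
  refine Finset.sum_congr rfl fun c _ => ?_
  have key : ∀ (a a' b b' : ℤ) (ha : 1 + dl c = a) (ha' : 0 + dl c = a') (hb : 0 + dr c = b)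
      (hb' : 1 + dr c = b') (e : a + b = t) (e' : a' + b' = t),
      conv hR e ((EndObj.fam r) (ksign k (0 * dl c) • XB.endCirc 0 hl ha D (F c)))
        ((EndObj.fam r') (XB.endCirc 0 hl hb (endOne P) (G c))) +
      conv hR e' ((EndObj.fam r) (ksign k (1 * dl c) • XB.endCirc 0 hl ha' (endOne P) (F c)))
        ((EndObj.fam r') (XB.endCirc 0 hl hb' D (G c))) =
      conv hR (by rw [← ht, ← hd c]; ring) ((XB.endCirc 0 hl (add_comm 1 (dl c)) D (F c)).fam r)
          ((G c).fam r') +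
        ksign k (dl c) • conv hR (by rw [← ht, ← hd c]; ring) ((F c).fam r)
          ((XB.endCirc 0 hl (add_comm 1 (dr c)) D (G c)).fam r') := by
    intro a a' b b' ha ha' hb hb' e e'
    obtain rfl : a = dl c + 1 := by omega
    obtain rfl : a' = dl c := by omega
    obtain rfl : b = dr c := by omega
    obtain rfl : b' = dr c + 1 := by omega
    rw [endOne_circ, endOne_circ]
    simp
  exact key _ _ _ _ rfl rfl rfl rfl _ _

theorem IsCosplit.circ_coder (hf : IsCosplit f dl dr hd F G) {D : EndObj P 1 1} (hD : IsCoder D)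
    (s : Fin n) (hl : n + 1 = n + 1) (ht : i + 1 = t) {r r' R : ℕ} (hR : r + r' = R) :
    (XB.endCirc s hl ht f D).fam R = ∑ c,
      (ksign k (dr c) • conv hR (by rw [← ht, ← hd c]; ring)
          ((XB.endCirc s hl rfl (F c) D).fam r) ((G c).fam r') +
        conv hR (by rw [← ht, ← hd c]; ring) ((F c).fam r)
          ((XB.endCirc s hl rfl (G c) D).fam r')) := by
  rw [hf.endCirc hD.isCosplit s hl ht r r' R hR, Fintype.sum_prod_type]
  refine Finset.sum_congr rfl fun c _ => ?_
  rw [Fintype.sum_bool]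
  have key : ∀ (a a' b b' : ℤ) (ha : dl c + 1 = a) (ha' : dl c + 0 = a') (hb : dr c + 0 = b)
      (hb' : dr c + 1 = b') (e : a + b = t) (e' : a' + b' = t),
      conv hR e ((EndObj.fam r) (ksign k (dr c * 1) • XB.endCirc s hl ha (F c) D))
        ((EndObj.fam r') (XB.endCirc s hl hb (G c) (endOne P))) +
      conv hR e' ((EndObj.fam r) (ksign k (dr c * 0) • XB.endCirc s hl ha' (F c) (endOne P)))
        ((EndObj.fam r') (XB.endCirc s hl hb' (G c) D)) =
      ksign k (dr c) • conv hR (by rw [← ht, ← hd c]; ring)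
          ((XB.endCirc s hl rfl (F c) D).fam r) ((G c).fam r') +
        conv hR (by rw [← ht, ← hd c]; ring) ((F c).fam r)
          ((XB.endCirc s hl rfl (G c) D).fam r') := by
    intro a a' b b' ha ha' hb hb' e e'
    obtain rfl : a = dl c + 1 := by omega
    obtain rfl : a' = dl c := by omega
    obtain rfl : b = dr c := by omega
    obtain rfl : b' = dr c + 1 := by omega
    rw [endCirc_one, endCirc_one]
    simp
  exact key _ _ _ _ rfl rfl rfl rfl _ _

/-- The sum of the insertions of `D` in all inputs. -/
def endInsert (D : EndObj P 1 1) {n : ℕ} {i t : ℤ} (h : i + 1 = t) :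
    EndObj P n i →ₗ[k] EndObj P n t :=
  ∑ c : Fin n, (endCircLin c rfl h).flip D

omit [Fintype ι] in
theorem endInsert_apply (D : EndObj P 1 1) {n : ℕ} {i t : ℤ} (h : i + 1 = t) (f : EndObj P n i) :
    endInsert D h f = ∑ c : Fin n, endCirc c rfl h f D := by
  simp only [endInsert, LinearMap.sum_apply]
  rfl

theorem IsCosplit.insertAll_coder (hf : IsCosplit f dl dr hd F G) {D : EndObj P 1 1}
    (hD : IsCoder D) (ht : i + 1 = t) {r r' R : ℕ} (hR : r + r' = R) :
    EndObj.fam R (endInsert D ht f) = ∑ c,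
      (ksign k (dr c) • conv hR (by rw [← ht, ← hd c]; ring)
          (EndObj.fam r (endInsert D rfl (F c))) ((G c).fam r') +
        conv hR (by rw [← ht, ← hd c]; ring) ((F c).fam r)
          (EndObj.fam r' (endInsert D rfl (G c)))) := by
  simp only [endInsert_apply, map_sum, LinearMap.sum_apply]
  rw [Finset.sum_congr rfl fun s _ => hf.circ_coder hD s rfl ht hR, Finset.sum_comm]
  refine Finset.sum_congr rfl fun c _ => ?_
  rw [Finset.sum_add_distrib, Finset.smul_sum]

theorem IsCoder.endCirc_comul {D : EndObj P 1 1} (hD : IsCoder D) (h : (1 : ℤ) + 1 = 2)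
    {r r' R : ℕ} (hR : r + r' = R) : (endCirc 0 rfl h D D).fam R =
      conv hR (add_zero 2) ((endCirc 0 rfl h D D).fam r) ((endOne P).fam r') +
        conv hR (zero_add 2) ((endOne P).fam r) ((endCirc 0 rfl h D D).fam r') := by
  rw [hD.isCosplit.coder_circ hD rfl h hR, Fintype.sum_bool]
  have key : ∀ (a a' : ℤ) (ha : 1 + 0 = a) (ha' : 1 + 1 = a') (e₁ : a' + 0 = 2) (e₂ : 1 + a = 2)
      (e₃ : a + 1 = 2) (e₄ : 0 + a' = 2), conv hR e₁ ((endCirc 0 rfl ha' D D).fam r)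
        ((endOne P).fam r') +
      ksign k 1 • conv hR e₂ (D.fam r) ((endCirc 0 rfl ha D (endOne P)).fam r') +
      (conv hR e₃ ((endCirc 0 rfl ha D (endOne P)).fam r) (D.fam r') +
      ksign k 0 • conv hR e₄ ((endOne P).fam r) ((endCirc 0 rfl ha' D D).fam r')) =
      conv hR (add_zero 2) ((endCirc 0 rfl h D D).fam r) ((endOne P).fam r') +
        conv hR (zero_add 2) ((endOne P).fam r) ((endCirc 0 rfl h D D).fam r') := by
    intro a a' ha ha' e₁ e₂ e₃ e₄
    obtain rfl : a = 1 := by omega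
    obtain rfl : a' = 2 := by omega
    rw [endCirc_one, ksign_one, ksign_zero]
    module
  exact key (0 + 1) (1 + 1) rfl rfl _ _ _ _

end Coderivations
end XB

namespace XB
open scoped DirectSum TensorProduct

section Differential

variable {k : Type u} [Field k] {X : CoalgOperad k} {P : PROP k}

theorem CoalgOperad.eq_zero_of_counit {n : ℕ} {i : ℤ}
    (h : Function.Bijective (Coalgebra.counit (R := k) (A := ⨁ i, X.obj n i))) (x : X.obj n i)
    (hx : X.counit x = 0) : x = 0 := by
  have h1 := h.1 (hx.trans (map_zero _).symm)
  exact DirectSum.of_injective (β := fun i => X.obj n i) i (h1.trans (map_zero _).symm)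

theorem CoalgOperad.d_one {t : ℤ} (h : 0 + 1 = t) : X.d h X.one = 0 :=
  X.eq_zero_of_counit X.counit_bijective_one _ (X.counit_d h X.one)

/-- The commutator of a representation with the differentials. -/
noncomputable def Rep.bdry (ρ : Rep X P) (n : ℕ) (i : ℤ) : X.obj n i →ₗ[k] EndObj P n (i + 1) :=
  (ρ.Φ n (i + 1)).comp (X.d rfl) -
    (endCircLin 0 (add_comm n 1) (add_comm 1 i) ρ.D).comp (ρ.Φ n i) +
    ksign k i • (endInsert ρ.D rfl).comp (ρ.Φ n i)

theorem Rep.bdry_apply (ρ : Rep X P) {n : ℕ} {i : ℤ} (x : X.obj n i) : ρ.bdry n i x =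
    ρ.Φ n (i + 1) (X.d rfl x) - endCirc 0 (add_comm n 1) (add_comm 1 i) ρ.D (ρ.Φ n i x) +
      ksign k i • endInsert ρ.D rfl (ρ.Φ n i x) := rfl

/-- An identity between compositions with a unary operation of degree `1`. -/
theorem NSOperad.bdry_circ (A : NSOperad k) (D : A.obj 1 1) {m n l : ℕ} {i j t : ℤ} (s : Fin m)
    (hl : l + 1 = m + n) (ht : i + j = t) (h₁ : i + 1 + j = t + 1) (h₂ : i + (j + 1) = t + 1)
    (x : A.obj m i) (y : A.obj n j) (x' : A.obj m (i + 1)) (y' : A.obj n (j + 1)) :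
    A.circ s hl h₁ x' y + ksign k i • A.circ s hl h₂ x y' -
        A.circ 0 (add_comm l 1) (add_comm 1 t) D (A.circ s hl ht x y) +
        ksign k t • A.insertAll D rfl (A.circ s hl ht x y) =
      A.circ s hl h₁ (x' - A.circ 0 (add_comm m 1) (add_comm 1 i) D x +
        ksign k i • A.insertAll D rfl x) y +
      ksign k i • A.circ s hl h₂ x (y' - A.circ 0 (add_comm n 1) (add_comm 1 j) D y +
        ksign k j • A.insertAll D rfl y) := by
  rw [A.insertAll_circ s hl ht rfl rfl rfl h₁ h₂]
  simp only [map_add, map_sub, map_smul, LinearMap.add_apply, LinearMap.sub_apply,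
    LinearMap.smul_apply, smul_add, smul_sub, smul_smul]
  rw [← A.circ_seq 0 s s (by simp) (add_comm m 1) hl hl (add_comm l 1) (add_comm 1 i) h₁ ht
      (add_comm 1 t) D x y,
    A.circ_seq s 0 s (by simp) rfl hl (add_comm n 1) hl rfl h₁ (add_comm 1 j) h₂ x D y]
  have ht' : ksign k t = ksign k i * ksign k j := by rw [← ksign_add, ht]
  have h : ksign k i * ksign k j * ksign k j = ksign k i := by
    rw [mul_assoc, ksign_mul_self, mul_one]
  rw [ht', h]
  abel

theorem Rep.bdry_circ (ρ : Rep X P) {m n l : ℕ} {i j t : ℤ} (s : Fin m) (hl : l + 1 = m + n)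
    (ht : i + j = t) (h₁ : i + 1 + j = t + 1) (h₂ : i + (j + 1) = t + 1)
    (x : X.obj m i) (y : X.obj n j) : ρ.bdry l t (X.circ s hl ht x y) =
      endCirc s hl h₁ (ρ.bdry m i x) (ρ.Φ n j y) +
        ksign k i • endCirc s hl h₂ (ρ.Φ m i x) (ρ.bdry n j y) := by
  have e := (endOperad P).bdry_circ ρ.D s hl ht h₁ h₂ (ρ.Φ m i x) (ρ.Φ n j y)
    (ρ.Φ m (i + 1) (X.d rfl x)) (ρ.Φ n (j + 1) (X.d rfl y))
  rw [Rep.bdry_apply, X.d_circ s hl ht rfl rfl rfl h₁ h₂, map_add, negOnePow_smul (k := k),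
    map_smul, ρ.map_circ, ρ.map_circ, ρ.map_circ]
  exact e

theorem Rep.bdry_comul (ρ : Rep X P) {n : ℕ} {i : ℤ} (x : X.obj n i) (S : Splitting k x)
    {r r' R : ℕ} (hR : r + r' = R) : (ρ.bdry n i x).fam R = ∑ a,
      (conv hR (by have := S.deg_add a; omega) ((ρ.bdry n _ (S.left a)).fam r)
          ((ρ.Φ n _ (S.right a)).fam r') +
        ksign k (S.degL a) • conv hR (by have := S.deg_add a; omega) ((ρ.Φ n _ (S.left a)).fam r)
          ((ρ.bdry n _ (S.right a)).fam r')) := by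
  have hc := (ρ.coalg n).comul x S
  rw [Rep.bdry_apply, map_add, map_sub, map_smul, (ρ.coalg n).fam_eq _ hR, X.comul_d rfl x S,
    hc.coder_circ ρ.coder _ _ hR, hc.insertAll_coder ρ.coder _ hR, map_sum,
    ← Finset.sum_sub_distrib, Finset.smul_sum, ← Finset.sum_add_distrib]
  refine Finset.sum_congr rfl fun a _ => ?_
  rw [map_add, negOnePow_smul (k := k), map_smul,
    convEval_lof hR _ _ (by have := S.deg_add a; omega : S.degL a + 1 + S.degR a = i + 1),
    convEval_lof hR _ _ (by have := S.deg_add a; omega : S.degL a + (S.degR a + 1) = i + 1)]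
  simp only [LinearMap.comp_apply]
  rw [Rep.bdry_apply, Rep.bdry_apply]
  have h1 : ksign k i = ksign k (S.degL a) * ksign k (S.degR a) := by rw [← ksign_add, S.deg_add a]
  have h2 : ksign k (S.degL a) * ksign k (S.degR a) * ksign k (S.degR a) = ksign k (S.degL a) := by
    rw [mul_assoc, ksign_mul_self, mul_one]
  rw [h1]
  simp only [map_add, map_sub, map_smul, LinearMap.add_apply, LinearMap.sub_apply,
    LinearMap.smul_apply, smul_add, smul_sub, smul_smul, h2]
  abel

theorem Rep.bdry_counit (ρ : Rep X P) {n : ℕ} {i : ℤ} (x : X.obj n i) :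
    (ρ.bdry n i x).fam 0 = 0 := by
  rw [Rep.bdry_apply, map_add, map_sub, map_smul]
  have h1 : (ρ.Φ n (i + 1) (X.d rfl x)).fam 0 = 0 := by
    by_cases hi : i + 1 = 0
    · have key : ∀ (t : ℤ) (h : i + 1 = t), t = 0 → (ρ.Φ n t (X.d h x)).fam 0 = 0 := by
        intro t h ht
        subst ht
        rw [(ρ.coalg n).counit]
        have : X.counit (X.d h x) = 0 := X.counit_d h x
        rw [this, zero_smul]
      exact key _ rfl hi
    · exact (ρ.coalg n).counit_ne _ hi
  have hD : ∀ {M : ℕ} {K : ℕ → ℕ} (h : psum K 1 = M), ρ.D.val 0 K M h = 0 := fun h =>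
    ρ.coder.zero h (by omega)
  have hΦ : ∀ {M : ℕ} {K : ℕ → ℕ} (h : psum K n = M), M ≠ 0 → (ρ.Φ n i x).val 0 K M h = 0 := by
    intro M K h hM
    change ((ρ.Φ n i x).fam 0).val _ _ _ = _
    by_cases hi : i = 0
    · subst hi
      rw [(ρ.coalg n).counit, Fam.val_smul, famUnit_ne _ hM, smul_zero]
    · rw [(ρ.coalg n).counit_ne _ hi, Fam.val_zero]
  have h2 : (endCirc 0 (add_comm n 1) (add_comm 1 i) ρ.D (ρ.Φ n i x)).fam 0 = 0 := by
    refine Fam.ext fun K M hM => ?_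
    subst hM
    obtain ⟨B, hB⟩ := exists_splitPoint (K := K) (m := 1) (s := (0 : Fin 1)) (Fin.isLt _)
      (add_comm n 1)
    change (endCirc 0 (add_comm n 1) (add_comm 1 i) ρ.D (ρ.Φ n i x)).val 0 K _ _ = 0
    rw [endCirc_val _ _ _ _ _ 0 K _ rfl _ rfl rfl hB (Nat.lt_succ_self _)]
    refine Finset.sum_eq_zero fun q _ => ?_
    rw [hD, map_zero, LinearMap.zero_apply]
  have h3 : (endInsert ρ.D rfl (ρ.Φ n i x)).fam 0 = 0 := by
    rw [endInsert_apply, map_sum]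
    refine Finset.sum_eq_zero fun c _ => Fam.ext fun K M hM => ?_
    subst hM
    obtain ⟨B, hB⟩ := exists_splitPoint (K := K) (n := 1) c.isLt rfl
    change (endCirc c rfl rfl (ρ.Φ n i x) ρ.D).val 0 K _ _ = 0
    rw [endCirc_val _ _ _ _ _ 0 K _ rfl _ rfl rfl hB (Nat.lt_succ_self _)]
    refine Finset.sum_eq_zero fun q _ => ?_
    rcases Nat.eq_zero_or_pos q with rfl | hq
    · rw [hD, map_zero, map_zero]
    · rw [hΦ _ (by omega), map_zero, LinearMap.zero_apply]
  rw [h1, h2, h3]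
  simp

theorem Rep.bdry_one (ρ : Rep X P) : ρ.bdry 1 0 X.one = 0 := by
  rw [Rep.bdry_apply, X.d_one, map_zero, ρ.map_one, endInsert_apply, Fin.sum_univ_one]
  have e1 : endCirc 0 (add_comm 1 1) (add_comm 1 0) ρ.D (endOne P) = ρ.D :=
    endCirc_one 0 _ (add_zero 1) _
  have e2 : endCirc 0 rfl (rfl : (0 : ℤ) + 1 = 0 + 1) (endOne P) ρ.D = ρ.D :=
    endOne_circ 0 _ (zero_add 1) _
  rw [e1, e2]
  simp

/-- The operations `Φ x + ε ∂Φ x`. -/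
noncomputable def Rep.dualΦ (ρ : Rep X P) (n : ℕ) (i : ℤ) : X.obj n i →ₗ[k] EndObj P.dual n i where
  toFun x := EndObj.dualMk (ρ.Φ n i x) (ρ.bdry n i x)
  map_add' x y := EndObj.dual_ext (map_add (ρ.Φ n i) x y) (map_add (ρ.bdry n i) x y)
  map_smul' c x := EndObj.dual_ext (map_smul (ρ.Φ n i) c x) (map_smul (ρ.bdry n i) c x)

theorem Rep.dualΦ_fst (ρ : Rep X P) {n : ℕ} {i : ℤ} (x : X.obj n i) :
    (ρ.dualΦ n i x).fst = ρ.Φ n i x := rfl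

theorem Rep.dualΦ_snd (ρ : Rep X P) {n : ℕ} {i : ℤ} (x : X.obj n i) :
    (ρ.dualΦ n i x).snd = ρ.bdry n i x := rfl

theorem Rep.isCoalgMap_dualΦ (ρ : Rep X P) (n : ℕ) : IsCoalgMap (ρ.dualΦ n) where
  comul x S r r' R hR := by
    refine Fam.dual_ext ?_ ?_
    · rw [map_sum, EndObj.fst_fam, ρ.dualΦ_fst, (ρ.coalg n).comul x S r r' R hR]
      refine Finset.sum_congr rfl fun a _ => ?_
      rw [conv_fst, EndObj.fst_fam, EndObj.fst_fam, ρ.dualΦ_fst, ρ.dualΦ_fst]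
    · rw [map_sum, EndObj.snd_fam, ρ.dualΦ_snd, ρ.bdry_comul x S hR]
      refine Finset.sum_congr rfl fun a _ => ?_
      rw [conv_snd hR (S.deg_add a) (by have := S.deg_add a; omega)
        (by have := S.deg_add a; omega), EndObj.fst_fam, EndObj.fst_fam, EndObj.snd_fam,
        EndObj.snd_fam, ρ.dualΦ_fst, ρ.dualΦ_fst, ρ.dualΦ_snd, ρ.dualΦ_snd]
  counit x := by
    refine Fam.dual_ext ?_ ?_
    · rw [map_smul, famUnit_fst, EndObj.fst_fam, ρ.dualΦ_fst, (ρ.coalg n).counit]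
    · rw [map_smul, famUnit_snd, smul_zero, EndObj.snd_fam, ρ.dualΦ_snd, ρ.bdry_counit]
  counit_ne x hi := by
    refine Fam.dual_ext ?_ ?_
    · rw [EndObj.fst_fam, ρ.dualΦ_fst, (ρ.coalg n).counit_ne x hi, map_zero]
    · rw [EndObj.snd_fam, ρ.dualΦ_snd, ρ.bdry_counit, map_zero]

theorem IsCoder.circ_zero {D : EndObj P 1 1} (hD : IsCoder D) {r M : ℕ} {K : ℕ → ℕ}
    (h : psum K 1 = M) (hr : ¬ (0 < r ∧ r < M)) : (endCirc 0 rfl rfl D D).val r K M h = 0 := by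
  subst h
  obtain ⟨B, hB⟩ := exists_splitPoint (K := K) (m := 1) (n := 1) (s := (0 : Fin 1))
    (Fin.isLt _) rfl
  rw [endCirc_val _ _ _ _ _ r K _ rfl _ rfl rfl hB (Nat.lt_succ_self _)]
  refine Finset.sum_eq_zero fun q _ => ?_
  have h1 : psum K ((0 : Fin 1) : ℕ) = 0 := rfl
  have h2 : psum (res K ((0 : Fin 1) : ℕ)) 1 = psum K 1 := by simp [psum, res]
  by_cases hq : 0 < q ∧ q < psum (res K ((0 : Fin 1) : ℕ)) 1
  · rw [hD.zero _ (by omega), map_zero, LinearMap.zero_apply]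
  · rw [hD.zero _ hq, map_zero, map_zero]

theorem IsCoder.dual {D : EndObj P 1 1} (hD : IsCoder D) :
    IsCoder (EndObj.dualMk D (-endCirc 0 rfl rfl D D)) where
  zero {r M K} h hr := Prod.ext (hD.zero h hr)
    (neg_eq_zero.2 (hD.circ_zero h hr) : -(endCirc 0 rfl rfl D D).val r K M h = 0)
  comul {r r' R} hR := by
    refine Fam.dual_ext ?_ ?_
    · rw [map_add, conv_fst, conv_fst, EndObj.fst_fam, EndObj.fst_fam, EndObj.fst_fam,
        EndObj.fst_fam, EndObj.fst_fam, endOne_fst]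
      exact hD.comul hR
    · rw [map_add, conv_snd hR _ (by norm_num) (by norm_num), conv_snd hR _ (by norm_num)
        (by norm_num)]
      simp only [EndObj.fst_fam, EndObj.snd_fam, endOne_fst, endOne_snd, map_zero, smul_zero,
        add_zero, LinearMap.zero_apply, zero_add, ksign_zero, one_smul, EndObj.fst_dualMk,
        EndObj.snd_dualMk, map_neg, LinearMap.neg_apply]
      rw [← neg_add, neg_inj]
      exact hD.endCirc_comul rfl hR

/-- The representation in `P[ε]` whose `ε`-component is the boundary of a representation. -/
noncomputable def Rep.dual (ρ : Rep X P) : Rep X P.dual where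
  Φ := ρ.dualΦ
  D := EndObj.dualMk ρ.D (-endCirc 0 rfl rfl ρ.D ρ.D)
  coalg := ρ.isCoalgMap_dualΦ
  coder := ρ.coder.dual
  map_one := by
    refine EndObj.dual_ext ?_ ?_
    · rw [ρ.dualΦ_fst, ρ.map_one, endOne_fst]
    · rw [ρ.dualΦ_snd, ρ.bdry_one, endOne_snd]
  map_circ {m n l i j t} s hl ht x y := by
    refine EndObj.dual_ext ?_ ?_
    · rw [endCirc_fst, ρ.dualΦ_fst, ρ.dualΦ_fst, ρ.dualΦ_fst, ρ.map_circ s hl ht x y]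
    · rw [endCirc_snd s hl ht (by omega) (by omega), ρ.dualΦ_fst, ρ.dualΦ_fst, ρ.dualΦ_snd,
        ρ.dualΦ_snd, ρ.dualΦ_snd, ρ.bdry_circ s hl ht (by omega) (by omega) x y]

end Differential
end XB

namespace XB
open scoped DirectSum TensorProduct

section MapFamilies

variable {k : Type u} [Field k] {P Q : PROP k}

/-- The image of a family of operations under a morphism of PROPs. -/
def Fam.map (g : P.Mor Q) {n r : ℕ} {i : ℤ} : Fam P n r i →ₗ[k] Fam Q n r i where
  toFun f := Fam.mk (fun K M h => g.map M r i (f.val K M h))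
    fun _ _ hK _ h h' => by rw [f.congr hK h h']
  map_add' _ _ := Fam.ext fun _ _ _ => map_add _ _ _
  map_smul' _ _ := Fam.ext fun _ _ _ => map_smul _ _ _

/-- The image of a family of operations under a morphism of PROPs. -/
def EndObj.map (g : P.Mor Q) {n : ℕ} {i : ℤ} : EndObj P n i →ₗ[k] EndObj Q n i where
  toFun f := ⟨fun r => Fam.map g (f.fam r), fun r _ M h hr =>
    (congrArg (g.map M r i) (f.vanish h hr)).trans (map_zero _)⟩
  map_add' _ _ := EndObj.ext fun _ _ _ _ => map_add _ _ _
  map_smul' _ _ := EndObj.ext fun _ _ _ _ => map_smul _ _ _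

theorem EndObj.map_val (g : P.Mor Q) {n : ℕ} {i : ℤ} (f : EndObj P n i) (r : ℕ) (K : ℕ → ℕ)
    (M : ℕ) (h : psum K n = M) : (EndObj.map g f).val r K M h = g.map M r i (f.val r K M h) := rfl

theorem EndObj.map_endCirc (g : P.Mor Q) {m n l : ℕ} {i j t : ℤ} (s : Fin m)
    (hl : l + 1 = m + n) (ht : i + j = t) (f : EndObj P m i) (f' : EndObj P n j) :
    EndObj.map g (endCirc s hl ht f f') = endCirc s hl ht (EndObj.map g f) (EndObj.map g f') := by
  refine EndObj.ext fun r K M hM => ?_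
  subst hM
  obtain ⟨B, hB⟩ := exists_splitPoint (K := K) s.isLt hl
  rw [EndObj.map_val, endCirc_val s hl ht f f' r K _ rfl _ rfl rfl hB (Nat.lt_succ_self _),
    endCirc_val s hl ht _ _ r K _ rfl _ rfl rfl hB (Nat.lt_succ_self _), map_sum]
  refine Finset.sum_congr rfl fun q _ => ?_
  rw [g.map_comp, g.map_pad]
  rfl

end MapFamilies

section Differential

variable {k : Type u} [Field k] (X : CoalgOperad k)

/-- The morphism `f ↦ f + ε d f`. -/
noncomputable def dualMor : (gradedPROP X).Mor (gradedPROP X).dual := (univRep X).dual.toMor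

theorem map_univRep_Φ {Q : PROP k} (ρ : Rep X Q) {n : ℕ} {i : ℤ} (x : X.obj n i) :
    EndObj.map ρ.toMor ((univRep X).Φ n i x) = ρ.Φ n i x := by
  refine EndObj.ext fun r K M hM => ?_
  have hM' : ∑ j : Fin n, K j = M := (psum_eq_sum K n).symm.trans hM
  rw [EndObj.map_val, univRep_Φ X x r K M hM (fun j => K j) (fun _ => rfl) hM', ρ.toMor_phi]
  exact EndObj.congr _ (fun j hj => word_lt _ hj) _ _

theorem map_univRep_D {Q : PROP k} (ρ : Rep X Q) : EndObj.map ρ.toMor (univRep X).D = ρ.D := by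
  refine EndObj.ext fun r K M hM => ?_
  rw [EndObj.map_val, univRep_D, ρ.toMor_opD]
  refine EndObj.congr _ (fun j hj => ?_) _ _
  obtain rfl : j = 0 := by omega
  simpa [psum] using hM.symm

theorem dualMor_fst {m n : ℕ} {i : ℤ} (f : (gradedPROP X).Hom m n i) :
    ((dualMor X).map m n i f).1 = f := by
  let S : ∀ m n i, Submodule k ((gradedPROP X).Hom m n i) := fun m n i =>
    LinearMap.eqLocus ((LinearMap.fst k ((gradedPROP X).Hom m n i)
      ((gradedPROP X).Hom m n (i + 1))).comp ((dualMor X).map m n i)) LinearMap.id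
  have hS : (gradedPROP X).IsClosed S := by
    refine ⟨fun σ => ?_, fun e f g hf hg => ?_, fun hM hN e f g hf hg => ?_⟩
    · change ((dualMor X).map _ _ _ _).1 = _
      rw [(dualMor X).map_perm]; rfl
    · change ((dualMor X).map _ _ _ _).1 = _ at hf hg ⊢
      rw [(dualMor X).map_comp, PROP.dual_comp _ _ _ _ (by omega) (by omega)]
      change (gradedPROP X).comp e _ _ = _
      rw [hf, hg]
      rfl
    · change ((dualMor X).map _ _ _ _).1 = _ at hf hg ⊢
      rw [(dualMor X).map_hcomp, PROP.dual_hcomp _ _ _ _ _ _ (by omega) (by omega)]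
      change (gradedPROP X).hcomp hM hN e _ _ = _
      rw [hf, hg]
      rfl
  refine gradedPROP_closed_eq_top hS (fun x r K M h => ?_) (fun l m => ?_) f
  · exact congrArg (fun f : EndObj (gradedPROP X).dual _ _ => (f.val r K M h).1)
      (map_univRep_Φ X (univRep X).dual x)
  · exact congrArg (fun f : EndObj (gradedPROP X).dual 1 1 =>
      (f.val m (fun _ => l) l (psum_const_one l)).1) (map_univRep_D X (univRep X).dual)

/-- The derivation `d` of `P(X)`. -/
noncomputable def derivHom {m n : ℕ} {i t : ℤ} (h : i + 1 = t) :
    (gradedPROP X).Hom m n i →ₗ[k] (gradedPROP X).Hom m n t :=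
  h ▸ (LinearMap.snd k ((gradedPROP X).Hom m n i) ((gradedPROP X).Hom m n (i + 1))).comp
    ((dualMor X).map m n i)

theorem derivHom_rfl {m n : ℕ} {i : ℤ} (f : (gradedPROP X).Hom m n i) :
    derivHom X rfl f = ((dualMor X).map m n i f).2 := rfl

theorem derivHom_perm {n : ℕ} {t : ℤ} (h : 0 + 1 = t) (σ : Equiv.Perm (Fin n)) :
    derivHom X h ((gradedPROP X).perm σ) = 0 := by
  subst h
  rw [derivHom_rfl, (dualMor X).map_perm]; rfl

theorem derivHom_comp {l m n : ℕ} {i j t i' j' t' : ℤ} (ht : i + j = t)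
    (hi : i + 1 = i') (hj : j + 1 = j') (ht' : t + 1 = t') (h₁ : i' + j = t') (h₂ : i + j' = t')
    (f : (gradedPROP X).Hom m n i) (g : (gradedPROP X).Hom l m j) :
    derivHom X ht' ((gradedPROP X).comp ht f g) = (gradedPROP X).comp h₁ (derivHom X hi f) g +
      i.negOnePow • (gradedPROP X).comp h₂ f (derivHom X hj g) := by
  subst hi hj ht'
  rw [derivHom_rfl, (dualMor X).map_comp, PROP.dual_comp _ _ _ _ h₁ h₂, negOnePow_smul (k := k)]
  change (gradedPROP X).comp h₁ _ ((dualMor X).map _ _ _ _).1 +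
    ksign k i • (gradedPROP X).comp h₂ ((dualMor X).map _ _ _ _).1 _ = _
  rw [dualMor_fst, dualMor_fst]
  rfl

theorem derivHom_hcomp {m m' M n n' N : ℕ} {i j t i' j' t' : ℤ} (hM : m + m' = M) (hN : n + n' = N)
    (ht : i + j = t) (hi : i + 1 = i') (hj : j + 1 = j') (ht' : t + 1 = t')
    (h₁ : i' + j = t') (h₂ : i + j' = t') (f : (gradedPROP X).Hom m n i)
    (g : (gradedPROP X).Hom m' n' j) :
    derivHom X ht' ((gradedPROP X).hcomp hM hN ht f g) =
      (gradedPROP X).hcomp hM hN h₁ (derivHom X hi f) g +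
        i.negOnePow • (gradedPROP X).hcomp hM hN h₂ f (derivHom X hj g) := by
  subst hi hj ht'
  rw [derivHom_rfl, (dualMor X).map_hcomp, PROP.dual_hcomp _ _ _ _ _ _ h₁ h₂,
    negOnePow_smul (k := k)]
  change (gradedPROP X).hcomp hM hN h₁ _ ((dualMor X).map _ _ _ _).1 +
    ksign k i • (gradedPROP X).hcomp hM hN h₂ ((dualMor X).map _ _ _ _).1 _ = _
  rw [dualMor_fst, dualMor_fst]
  rfl

/-- The derivation `d` on families of operations. -/
noncomputable def derivEnd {n : ℕ} {i : ℤ} :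
    EndObj (gradedPROP X) n i →ₗ[k] EndObj (gradedPROP X) n (i + 1) where
  toFun f := (EndObj.map (dualMor X) f).snd
  map_add' f g := by rw [map_add]; rfl
  map_smul' c f := by rw [map_smul]; rfl

theorem derivEnd_circ {m n l : ℕ} {i j t : ℤ} (s : Fin m) (hl : l + 1 = m + n) (ht : i + j = t)
    (h₁ : i + 1 + j = t + 1) (h₂ : i + (j + 1) = t + 1)
    (f : EndObj (gradedPROP X) m i) (g : EndObj (gradedPROP X) n j) :
    derivEnd X (endCirc s hl ht f g) = endCirc s hl h₁ (derivEnd X f) g +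
      ksign k i • endCirc s hl h₂ f (derivEnd X g) := by
  have e : ∀ {n : ℕ} {i : ℤ} (f : EndObj (gradedPROP X) n i),
      (EndObj.map (dualMor X) f).fst = f := fun f =>
    EndObj.ext fun r K M h => dualMor_fst X _
  have := endCirc_snd s hl ht h₁ h₂ (EndObj.map (dualMor X) f) (EndObj.map (dualMor X) g)
  rw [← EndObj.map_endCirc, e, e] at this
  exact this

theorem derivEnd_Φ {n : ℕ} {i : ℤ} (x : X.obj n i) :
    derivEnd X ((univRep X).Φ n i x) = (univRep X).bdry n i x :=
  congrArg EndObj.snd (map_univRep_Φ X (univRep X).dual x)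

theorem derivEnd_D : derivEnd X (univRep X).D = -endCirc 0 rfl rfl (univRep X).D (univRep X).D :=
  congrArg EndObj.snd (map_univRep_D X (univRep X).dual)

end Differential

section SquareZero

variable {k : Type u} [Field k]

theorem NSOperad.bdry_bdry (A : NSOperad k) (D : A.obj 1 1) {n : ℕ} {i : ℤ} (x : A.obj n i)
    (x' : A.obj n (i + 1)) (hl : n + 1 = 1 + n) (h₁ : 1 + i = i + 1) (h₂ : 1 + (i + 1) = i + 1 + 1)
    (h₃ : 1 + 1 + i = i + 1 + 1) (h₄ : i + (1 + 1) = i + 1 + 1) :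
    0 - A.circ 0 hl h₂ D x' + ksign k (i + 1) • A.insertAll D rfl x' -
      (A.circ 0 hl h₃ (-A.circ 0 rfl rfl D D) x +
        ksign k 1 • A.circ 0 hl h₂ D (x' - A.circ 0 hl h₁ D x + ksign k i • A.insertAll D rfl x)) +
      ksign k i • (A.insertAll D rfl (x' - A.circ 0 hl h₁ D x + ksign k i • A.insertAll D rfl x) +
        ksign k i • ∑ c : Fin n, A.circ c rfl h₄ x (-A.circ 0 rfl rfl D D)) = 0 := by
  have e1 := A.circ_seq 0 0 0 (by simp) rfl hl hl hl rfl h₃ h₁ h₂ D D x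
  have e2 := A.circ_insertAll (D := D) hl (rfl : i + 1 = i + 1) h₁ h₂ rfl D x
  have e3 := A.insertAll_insertAll (D := D) (rfl : i + 1 = i + 1) rfl h₄ rfl x
  simp only [map_add, map_sub, map_smul, map_neg, LinearMap.neg_apply, e1, e2, e3,
    Finset.sum_neg_distrib, ksign_add, ksign_one]
  simp only [smul_add, smul_sub, smul_neg, smul_smul, ksign_mul_self, mul_neg, mul_one, neg_mul,
    one_mul, neg_smul, one_smul]
  abel

end SquareZero

section Differential

variable {k : Type u} [Field k] (X : CoalgOperad k)

theorem derivEnd_insert {n : ℕ} {i : ℤ} (f : EndObj (gradedPROP X) n i)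
    (h₄ : i + (1 + 1) = i + 1 + 1) (D : EndObj (gradedPROP X) 1 1) :
    derivEnd X (endInsert D rfl f) = endInsert D rfl (derivEnd X f) +
      ksign k i • ∑ c : Fin n, endCirc c rfl h₄ f (derivEnd X D) := by
  rw [endInsert_apply, endInsert_apply, map_sum, Finset.smul_sum, ← Finset.sum_add_distrib]
  exact Finset.sum_congr rfl fun c _ => derivEnd_circ X c rfl rfl rfl h₄ f D

theorem derivEnd_derivEnd_Φ {n : ℕ} {i : ℤ} (x : X.obj n i) :
    derivEnd X (derivEnd X ((univRep X).Φ n i x)) = 0 := by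
  have h₄ : i + (1 + 1) = i + 1 + 1 := by ring
  have := (endOperad (gradedPROP X)).bdry_bdry (univRep X).D ((univRep X).Φ n i x)
    ((univRep X).Φ n (i + 1) (X.d rfl x)) (add_comm n 1) (add_comm 1 i) (add_comm 1 _)
    (by ring) h₄
  rw [derivEnd_Φ, Rep.bdry_apply, map_add, map_sub, map_smul, derivEnd_Φ, Rep.bdry_apply, X.d_d,
    map_zero, derivEnd_circ X 0 _ _ (by ring) (by ring), derivEnd_insert X _ h₄, derivEnd_Φ,
    derivEnd_D, Rep.bdry_apply]
  exact this

theorem derivEnd_derivEnd_D : derivEnd X (derivEnd X (univRep X).D) = 0 := by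
  have := endCirc_seq 0 0 0 (by simp) rfl rfl rfl rfl rfl (by norm_num) rfl rfl (univRep X).D
    (univRep X).D (univRep X).D (abc := 1 + 1 + 1)
  rw [derivEnd_D, map_neg, derivEnd_circ X 0 _ _ rfl rfl, derivEnd_D]
  have h1 : ∀ (f g : EndObj (gradedPROP X) 1 (1 + 1)) (h : (1 : ℤ) + 1 + 1 = 1 + 1 + 1)
      (h' : (1 : ℤ) + (1 + 1) = 1 + 1 + 1),
      endCirc 0 rfl h (-f) (univRep X).D + ksign k 1 • endCirc 0 rfl h' (univRep X).D (-g) =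
      -endCirc 0 rfl h f (univRep X).D + endCirc 0 rfl h' (univRep X).D g := by
    intro f g h h'
    rw [ksign_one]
    have e1 : endCirc 0 rfl h (-f) (univRep X).D = -endCirc 0 rfl h f (univRep X).D := by
      change endCircLin 0 rfl h (-f) _ = -endCircLin 0 rfl h f _
      rw [map_neg, LinearMap.neg_apply]
    have e2 : endCirc 0 rfl h' (univRep X).D (-g) = -endCirc 0 rfl h' (univRep X).D g := by
      change endCircLin 0 rfl h' _ (-g) = -endCircLin 0 rfl h' _ g
      rw [map_neg]
    rw [e1, e2, neg_smul, one_smul, neg_neg]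
  rw [h1, this, neg_add_cancel, neg_zero]

theorem derivHom_derivHom {m n : ℕ} {i t t' : ℤ} (h : i + 1 = t) (h' : t + 1 = t')
    (f : (gradedPROP X).Hom m n i) : derivHom X h' (derivHom X h f) = 0 := by
  subst h h'
  let S : ∀ m n i, Submodule k ((gradedPROP X).Hom m n i) := fun m n i =>
    LinearMap.ker ((derivHom X (rfl : i + 1 + 1 = _)).comp (derivHom X (m := m) (n := n) rfl))
  have memS : ∀ {m n : ℕ} {i : ℤ} (f : (gradedPROP X).Hom m n i),
      f ∈ S m n i ↔ derivHom X rfl (derivHom X (rfl : i + 1 = _) f) = 0 := fun f => Iff.rfl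
  have hS : (gradedPROP X).IsClosed S := by
    refine ⟨fun σ => ?_, fun {_ _ _ i j t} e f g hf hg => ?_,
      fun {_ _ _ _ _ _ i j t} hM hN e f g hf hg => ?_⟩
    · rw [memS, derivHom_perm, map_zero]
    · rw [memS] at hf hg ⊢
      subst e
      rw [derivHom_comp X rfl rfl rfl _ (by ring) (by ring), map_add, negOnePow_smul (k := k),
        map_smul, derivHom_comp X _ rfl rfl _ (by ring) (by ring),
        derivHom_comp X _ rfl rfl _ (by ring) (by ring), hf, hg]
      simp only [negOnePow_smul (k := k), map_zero, LinearMap.zero_apply, smul_zero, zero_add,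
        add_zero, ksign_add, ksign_one]
      module
    · rw [memS] at hf hg ⊢
      subst e
      rw [derivHom_hcomp X hM hN rfl rfl rfl _ (by ring) (by ring), map_add,
        negOnePow_smul (k := k),
        map_smul, derivHom_hcomp X hM hN _ rfl rfl _ (by ring) (by ring),
        derivHom_hcomp X hM hN _ rfl rfl _ (by ring) (by ring), hf, hg]
      simp only [negOnePow_smul (k := k), map_zero, LinearMap.zero_apply, smul_zero, zero_add,
        add_zero, ksign_add, ksign_one]
      module
  refine gradedPROP_closed_eq_top hS (fun x r K M h => ?_) (fun l m => ?_) f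
  · exact congrArg (fun f : EndObj (gradedPROP X) _ _ => f.val r K M h) (derivEnd_derivEnd_Φ X x)
  · exact congrArg (fun f : EndObj (gradedPROP X) 1 _ =>
      f.val m (fun _ => l) l (psum_const_one l)) (derivEnd_derivEnd_D X)

/-- The differential of `P(X)`. -/
noncomputable def govDiff : (gradedPROP X).Differential where
  d h := derivHom X h
  d_d := derivHom_derivHom X
  d_perm := derivHom_perm X
  d_comp := derivHom_comp X
  d_hcomp := derivHom_hcomp X

end Differential
end XB

namespace XB
open scoped DirectSum TensorProduct

section UnaryComposition

variable {k : Type u} [Field k] {P : PROP k}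

theorem PROP.pad_zero {m n : ℕ} {i : ℤ} (hM : 0 + m + 0 = m) (hN : 0 + n + 0 = n)
    (f : P.Hom m n i) : P.pad 0 0 hM hN f = f := by
  rw [P.pad_apply' 0 0 (zero_add _) (zero_add _) rfl rfl, P.hcomp_one, P.one_hcomp]

/-- The components of a composition with a unary operation. -/
theorem endCirc_unary_val {n : ℕ} {i j t : ℤ} (hl : n + 1 = 1 + n) (ht : i + j = t)
    (f : EndObj P 1 i) (g : EndObj P n j) (r : ℕ) (K : ℕ → ℕ) (M : ℕ) (hM : psum K n = M) :
    (endCirc 0 hl ht f g).val r K M hM = ∑ q ∈ Finset.range (M + 1),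
      P.comp ht (f.val r (fun _ => q) q (psum_const_one q)) (g.val q K M hM) := by
  have hr : ∀ j < n, res K ((0 : Fin 1) : ℕ) j = K j := fun j _ => by simp [res]
  have hW : psum (res K ((0 : Fin 1) : ℕ)) n = M := by rw [psum_congr hr, hM]
  rw [endCirc_val 0 hl ht f g r K M hM (A := 0) (W := M) (B := 0) (M + 1) rfl hW (by omega)
    (by omega)]
  refine Finset.sum_congr rfl fun q _ => ?_
  rw [g.congr hr hW hM]
  have key : ∀ (N : ℕ) (hN : 0 + q + 0 = N) (h : psum (upd K ((0 : Fin 1) : ℕ) n q) 1 = N),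
      P.comp ht (f.val r (upd K ((0 : Fin 1) : ℕ) n q) N h)
        (P.pad 0 0 (by omega) hN (g.val q K M hM)) =
      P.comp ht (f.val r (fun _ => q) q (psum_const_one q)) (g.val q K M hM) := by
    intro N hN h
    obtain rfl : N = q := by omega
    rw [P.pad_zero]
    congr 2
    refine f.congr (fun j hj => ?_) _ _
    obtain rfl : j = 0 := by omega
    simp [upd]
  exact key _ rfl _

end UnaryComposition

section Differential

variable {k : Type u} [Field k] (X : CoalgOperad k)

theorem opD_eq_zero {l m : ℕ} (h : ¬ (0 < m ∧ m < l)) : opD X l m = 0 :=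
  (univRep X).coder.zero (psum_const_one l) h

theorem sum_Iio_eq_psum {n : ℕ} (κ : Fin n → ℕ) (c : Fin n) :
    ∑ j ∈ Finset.Iio c, κ j = psum (word κ) c := by
  rw [psum]
  refine Finset.sum_bij' (fun j _ => (j : ℕ))
    (fun j hj => ⟨j, (Finset.mem_range.1 hj).trans c.isLt⟩) ?_ ?_ ?_ ?_ ?_
  · intro j hj; simpa using hj
  · intro j hj; exact Finset.mem_Iio.2 (Finset.mem_range.1 hj)
  · intro j hj; rfl
  · intro j hj; rfl
  · intro j hj; rw [word_val]

theorem univRep_circ_D {n M : ℕ} {i t : ℤ} (κ : Fin n → ℕ) (hM : ∑ j, κ j = M) (r : ℕ)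
    (x : X.obj n i) (h : i + 1 = t) (c : Fin n) :
    (endCirc c rfl h ((univRep X).Φ n i x) (univRep X).D).val r (word κ) M
        ((psum_word κ).trans hM) =
      ∑ q ∈ Finset.Ioo 0 (κ c), (gradedPROP X).comp h (phi X (Function.update κ c q) rfl r x)
        ((gradedPROP X).pad (∑ j ∈ Finset.Iio c, κ j) (∑ j ∈ Finset.Ioi c, κ j)
          (sum_pad κ hM c) (sum_pad_update κ c q) (opD X (κ c) q)) := by
  have hW : psum (res (word κ) c) 1 = κ c := by simp [psum, res]
  rw [endCirc_val c rfl h _ _ r (word κ) M _ (κ c + 1) (sum_Iio_eq_psum κ c).symm hW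
    (sum_pad κ hM c) (by omega)]
  symm
  have hsub : Finset.Ioo 0 (κ c) ⊆ Finset.range (κ c + 1) := fun q hq => by
    simp only [Finset.mem_Ioo, Finset.mem_range] at hq ⊢; omega
  refine Eq.trans (Finset.sum_congr rfl fun q _ => ?_) (Finset.sum_subset hsub fun q _ hq => ?_)
  · have hu : ∀ j : Fin n, Function.update κ c q j = upd (word κ) c 1 q j := fun j => by
      unfold upd
      by_cases hj : j = c
      · subst hj; simp
      · rw [Function.update_of_ne hj]
        have : (j : ℕ) ≠ c := fun h => hj (Fin.ext h)
        simp [this]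
    have key : ∀ (N : ℕ) (hN : ∑ j, Function.update κ c q j = N)
        (hN' : ∑ j ∈ Finset.Iio c, κ j + q + ∑ j ∈ Finset.Ioi c, κ j = N)
        (h' : psum (upd (word κ) c 1 q) n = N),
        (gradedPROP X).comp h (phi X (Function.update κ c q) rfl r x)
          ((gradedPROP X).pad (∑ j ∈ Finset.Iio c, κ j) (∑ j ∈ Finset.Ioi c, κ j)
            (sum_pad κ hM c) (sum_pad_update κ c q) (opD X (κ c) q)) =
        (gradedPROP X).comp h (((univRep X).Φ n i x).val r (upd (word κ) c 1 q) N h')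
          ((gradedPROP X).pad (∑ j ∈ Finset.Iio c, κ j) (∑ j ∈ Finset.Ioi c, κ j)
            (sum_pad κ hM c) hN' (opD X (κ c) q)) := by
      intro N hN hN' h'
      subst hN
      rw [univRep_Φ X x r _ _ h' (Function.update κ c q) hu rfl]
    rw [univRep_D]
    exact key _ ((sum_pad_update κ c q).symm) rfl _
  · rw [univRep_D, opD_eq_zero X (by simpa using hq), map_zero, map_zero]

theorem isGoverningDifferential_govDiff : IsGoverningDifferential X (govDiff X) where
  d_D l m h := by
    have e := congrArg (fun f : EndObj (gradedPROP X) 1 (1 + 1) =>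
      f.val m (fun _ => l) l (psum_const_one l)) (derivEnd_D X)
    change derivHom X rfl (opD X l m) = -(endCirc 0 rfl rfl _ _).val m _ l _ at e
    change derivHom X h (opD X l m) = _
    have h' : (1 : ℤ) + 1 = 1 + 1 := rfl
    change derivHom X h' (opD X l m) = - ∑ r ∈ Finset.Ioo m l, (gradedPROP X).comp h' _ _
    rw [e, endCirc_unary_val rfl]
    congr 1
    symm
    refine Finset.sum_subset (fun q hq => ?_) fun q _ hq => ?_
    · simp only [Finset.mem_Ioo, Finset.mem_range] at hq ⊢; omega
    · by_cases hq' : m < q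
      · rw [opD_eq_zero X (l := l) (m := q) (by simp only [Finset.mem_Ioo] at hq; omega), map_zero]
      · rw [opD_eq_zero X (l := q) (m := m) (by omega), map_zero, LinearMap.zero_apply]
  d_phi {n M i t} κ hM r x h h' := by
    subst h
    have e := congrArg (fun f : EndObj (gradedPROP X) n (i + 1) =>
      f.val r (word κ) M ((psum_word κ).trans hM)) (derivEnd_Φ X x)
    change derivHom X rfl (((univRep X).Φ n i x).val r (word κ) M ((psum_word κ).trans hM)) = _ at e
    rw [← phi_eq_univRep X κ hM] at e
    change derivHom X rfl _ = _
    rw [e, Rep.bdry_apply, EndObj.val_add, sub_eq_add_neg, EndObj.val_add]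
    rw [phi_eq_univRep X κ hM r (X.d rfl x), negOnePow_smul (k := k), EndObj.val_smul]
    have e2 : (-endCirc 0 (add_comm n 1) (add_comm 1 i) (univRep X).D ((univRep X).Φ n i x)).val r
        (word κ) M ((psum_word κ).trans hM) =
        -∑ s ∈ Finset.Ioc r M, (gradedPROP X).comp h' (opD X s r) (phi X κ hM s x) := by
      change -(endCirc 0 (add_comm n 1) (add_comm 1 i) (univRep X).D
        ((univRep X).Φ n i x)).val r (word κ) M ((psum_word κ).trans hM) = _
      rw [endCirc_unary_val]
      congr 1
      symm
      refine Eq.trans (Finset.sum_congr rfl fun q _ => ?_)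
        (Finset.sum_subset (s₁ := Finset.Ioc r M) (fun q hq => ?_) fun q _ hq => ?_)
      · rw [phi_eq_univRep]; rfl
      · simp only [Finset.mem_Ioc, Finset.mem_range] at hq ⊢; omega
      · rw [univRep_D, opD_eq_zero X (by
          simp only [Finset.mem_Ioc, Finset.mem_range] at *; omega), map_zero,
          LinearMap.zero_apply]
    have e3 : (endInsert (univRep X).D rfl ((univRep X).Φ n i x)).val r (word κ) M
        ((psum_word κ).trans hM) = ∑ c, ∑ q ∈ Finset.Ioo 0 (κ c),
          (gradedPROP X).comp rfl (phi X (Function.update κ c q) rfl r x)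
            ((gradedPROP X).pad (∑ j ∈ Finset.Iio c, κ j) (∑ j ∈ Finset.Ioi c, κ j)
              (sum_pad κ hM c) (sum_pad_update κ c q) (opD X (κ c) q)) := by
      rw [endInsert_apply]
      refine (map_sum (EndObj.valLin r (word κ) M ((psum_word κ).trans hM)) _ _).trans ?_
      exact Finset.sum_congr rfl fun c _ => univRep_circ_D X κ hM r x rfl c
    rw [e2, e3, ← sub_eq_add_neg]

variable {X}

theorem PROP.Differential.ext_d {P : PROP k} {δ δ' : P.Differential}
    (h : ∀ {m n : ℕ} {i : ℤ} (f : P.Hom m n i), δ.d rfl f = δ'.d rfl f) : δ = δ' := by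
  have key : @PROP.Differential.d k _ P δ = @PROP.Differential.d k _ P δ' := by
    funext m n i t e
    subst e
    exact LinearMap.ext h
  cases δ; cases δ'
  cases key
  rfl

theorem IsGoverningDifferential.eq {δ δ' : (gradedPROP X).Differential}
    (h : IsGoverningDifferential X δ) (h' : IsGoverningDifferential X δ') : δ = δ' := by
  refine PROP.Differential.ext_d fun {m n i} f => ?_
  let S : ∀ m n i, Submodule k ((gradedPROP X).Hom m n i) := fun m n i =>
    LinearMap.eqLocus (δ.d (rfl : i + 1 = i + 1)) (δ'.d rfl)
  have memS : ∀ {m n : ℕ} {i : ℤ} (f : (gradedPROP X).Hom m n i),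
      f ∈ S m n i ↔ δ.d (rfl : i + 1 = i + 1) f = δ'.d rfl f := fun f => Iff.rfl
  have hS : (gradedPROP X).IsClosed S := by
    refine ⟨fun σ => ?_, fun {_ _ _ i j t} e f g hf hg => ?_,
      fun {_ _ _ _ _ _ i j t} hM hN e f g hf hg => ?_⟩
    · rw [memS, δ.d_perm, δ'.d_perm]
    · rw [memS] at hf hg ⊢
      rw [δ.d_comp e rfl rfl rfl (by omega) (by omega),
        δ'.d_comp e rfl rfl rfl (by omega) (by omega), hf, hg]
    · rw [memS] at hf hg ⊢
      rw [δ.d_hcomp hM hN e rfl rfl rfl (by omega) (by omega),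
        δ'.d_hcomp hM hN e rfl rfl rfl (by omega) (by omega), hf, hg]
  refine gradedPROP_closed_eq_top hS (fun {n i} x r K M hM => ?_) (fun l m => ?_) f
  · rw [memS, univRep_Φ X x r K M hM (fun j => K j) (fun _ => rfl)
      ((psum_eq_sum K n).symm.trans hM), h.d_phi _ _ _ _ rfl (add_comm 1 i),
      h'.d_phi _ _ _ _ rfl (add_comm 1 i)]
  · exact (h.d_D l m rfl).trans (h'.d_D l m rfl).symm

end Differential
end XB

namespace XB
open scoped DirectSum TensorProduct

/-! ### Extensions of an operad by a module of operations of one arity -/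

section Counit

variable {k : Type u} [Field k] (X : CoalgOperad k)

/-- The counit as a linear function. -/
noncomputable def CoalgOperad.counitLin (n : ℕ) (i : ℤ) : X.obj n i →ₗ[k] k :=
  (Coalgebra.counit (R := k)).comp (DirectSum.lof k ℤ (X.obj n) i)

theorem CoalgOperad.counitLin_apply {n : ℕ} {i : ℤ} (x : X.obj n i) :
    X.counitLin n i x = X.counit x := rfl

theorem CoalgOperad.counitLin_one : X.counitLin 1 0 X.one = 1 := X.counit_one

theorem CoalgOperad.eq_smul_one (x : X.obj 1 0) : x = X.counitLin 1 0 x • X.one := by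
  refine sub_eq_zero.1 (X.eq_zero_of_counit X.counit_bijective_one _ ?_)
  rw [← X.counitLin_apply, map_sub, map_smul, X.counitLin_one, smul_eq_mul, mul_one, sub_self]

theorem CoalgOperad.eq_zero_of_degree_ne {i : ℤ} (x : X.obj 1 i) (hi : i ≠ 0) : x = 0 :=
  X.eq_zero_of_counit X.counit_bijective_one _ (X.counit_graded x hi)

end Counit

section Extension

variable {k : Type u} [Field k] {X : CoalgOperad k} {N : ℕ} {M : ℤ → Type u}
  [∀ i, AddCommGroup (M i)] [∀ i, Module k (M i)]

variable (X) in
/-- Values on the compositions `x ∘ₛ y` of total arity `N`. -/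
abbrev CircValues (N : ℕ) (M : ℤ → Type u) [∀ i, AddCommGroup (M i)] [∀ i, Module k (M i)] :=
  ∀ {m n : ℕ} {i j t : ℤ}, Fin m → N + 1 = m + n → i + j = t →
    (X.obj m i →ₗ[k] X.obj n j →ₗ[k] M t)

/-- The identifications of operadic compositions hold for the values `β`. -/
structure CircValues.IsAssoc (β : CircValues X N M) : Prop where
  seq : ∀ {m n p l l' : ℕ} {a b c ab bc abc : ℤ} (_ : 2 ≤ m) (_ : 2 ≤ n) (_ : 2 ≤ p)
    (s : Fin m) (r : Fin n) (sr : Fin l)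
    (_ : (sr : ℕ) = s + r) (h₁ : l + 1 = m + n) (h₂ : N + 1 = l + p) (h₃ : l' + 1 = n + p)
    (h₄ : N + 1 = m + l') (e₁ : a + b = ab) (e₂ : ab + c = abc) (e₃ : b + c = bc)
    (e₄ : a + bc = abc) (x : X.obj m a) (y : X.obj n b) (z : X.obj p c),
    β sr h₂ e₂ (X.circ s h₁ e₁ x y) z = β s h₄ e₄ x (X.circ r h₃ e₃ y z)
  par : ∀ {m n p l l' : ℕ} {a b c ab ac abc : ℤ} (_ : 2 ≤ m) (_ : 2 ≤ n) (_ : 2 ≤ p)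
    (s r : Fin m) (_ : s < r)
    (r' : Fin l) (s' : Fin l') (_ : (r' : ℕ) + 1 = r + n) (_ : (s' : ℕ) = s)
    (h₁ : l + 1 = m + n) (h₂ : N + 1 = l + p) (h₃ : l' + 1 = m + p) (h₄ : N + 1 = l' + n)
    (e₁ : a + b = ab) (e₂ : ab + c = abc) (e₃ : a + c = ac) (e₄ : ac + b = abc)
    (x : X.obj m a) (y : X.obj n b) (z : X.obj p c),
    β r' h₂ e₂ (X.circ s h₁ e₁ x y) z =
      (b * c).negOnePow • β s' h₄ e₄ (X.circ r h₃ e₃ x z) y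

variable (X N M) in
/-- `X n`, together with `M` if `n = N`, for `n ≥ 1`. -/
abbrev ExtObj (n : ℕ) (i : ℤ) : Type u := (PLift (1 ≤ n) → X.obj n i) × (PLift (n = N) → M i)

variable (k M) in
/-- The identity between equal degrees. -/
def degCast {i t : ℤ} (h : i = t) : M i →ₗ[k] M t := h ▸ LinearMap.id

/-- The composition of operations of the extension. -/
noncomputable def extCirc (β : CircValues X N M) {m n l : ℕ} {i j t : ℤ} (s : Fin m)
    (hl : l + 1 = m + n) (ht : i + j = t) (x : ExtObj X N M m i) (y : ExtObj X N M n j) :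
    ExtObj X N M l t :=
  (fun _ => if hn : 1 ≤ n then X.circ s hl ht (x.1 ⟨by have := s.isLt; omega⟩) (y.1 ⟨hn⟩) else 0,
    fun h => (if hmn : 2 ≤ m ∧ 2 ≤ n then β s (by have := h.down; omega) ht
        (x.1 ⟨by omega⟩) (y.1 ⟨by omega⟩) else 0) +
      (if h₁ : m = 1 ∧ i = 0 then
        degCast k M (by omega) (X.counitLin m i (x.1 ⟨by omega⟩) •
          y.2 ⟨by have := h.down; omega⟩) else 0) +
      if h₁ : n = 1 ∧ j = 0 then
        degCast k M (by omega) (X.counitLin n j (y.1 ⟨by omega⟩) •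
          x.2 ⟨by have := h.down; omega⟩) else 0)

/-- The composition of operations of the extension as a bilinear map. -/
noncomputable def extCircLin (β : CircValues X N M) {m n l : ℕ} {i j t : ℤ} (s : Fin m)
    (hl : l + 1 = m + n) (ht : i + j = t) :
    ExtObj X N M m i →ₗ[k] ExtObj X N M n j →ₗ[k] ExtObj X N M l t :=
  LinearMap.mk₂ k (extCirc β s hl ht)
    (fun x x' y => by
      refine Prod.ext (funext fun _ => ?_) (funext fun _ => ?_)
      · simp only [extCirc, Prod.fst_add, Pi.add_apply]
        split_ifs <;> simp
      · simp only [extCirc, Prod.fst_add, Prod.snd_add, Pi.add_apply]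
        split_ifs <;> simp [add_smul] <;> abel)
    (fun c x y => by
      refine Prod.ext (funext fun _ => ?_) (funext fun _ => ?_)
      · simp only [extCirc, Prod.smul_fst, Pi.smul_apply]
        split_ifs <;> simp
      · simp only [extCirc, Prod.smul_fst, Prod.smul_snd, Pi.smul_apply]
        split_ifs <;> simp [mul_smul, smul_comm c])
    (fun x y y' => by
      refine Prod.ext (funext fun _ => ?_) (funext fun _ => ?_)
      · simp only [extCirc, Prod.fst_add, Pi.add_apply]
        split_ifs <;> simp
      · simp only [extCirc, Prod.fst_add, Prod.snd_add, Pi.add_apply]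
        split_ifs <;> simp [add_smul] <;> abel)
    (fun c x y => by
      refine Prod.ext (funext fun _ => ?_) (funext fun _ => ?_)
      · simp only [extCirc, Prod.smul_fst, Pi.smul_apply]
        split_ifs <;> simp
      · simp only [extCirc, Prod.smul_fst, Prod.smul_snd, Pi.smul_apply]
        split_ifs <;> simp [mul_smul, smul_comm c])

theorem extCirc_fst (β : CircValues X N M) {m n l : ℕ} {i j t : ℤ} (s : Fin m)
    (hl : l + 1 = m + n) (ht : i + j = t) (x : ExtObj X N M m i) (y : ExtObj X N M n j)
    (hm : PLift (1 ≤ m)) (hn : PLift (1 ≤ n)) (h : PLift (1 ≤ l)) :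
    (extCirc β s hl ht x y).1 h = X.circ s hl ht (x.1 hm) (y.1 hn) := dif_pos hn.down

theorem extCirc_snd (β : CircValues X N M) {m n l : ℕ} {i j t : ℤ} (s : Fin m)
    (hl : l + 1 = m + n) (ht : i + j = t) (x : ExtObj X N M m i) (y : ExtObj X N M n j)
    (hm : 2 ≤ m) (hn : 2 ≤ n) (h : PLift (l = N)) (hl' : N + 1 = m + n) :
    (extCirc β s hl ht x y).2 h = β s hl' ht (x.1 ⟨by omega⟩) (y.1 ⟨by omega⟩) := by
  have h₁ : ¬ (m = 1 ∧ i = 0) := by omega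
  have h₂ : ¬ (n = 1 ∧ j = 0) := by omega
  simp only [extCirc, h₁, h₂, dif_neg, not_false_eq_true, dif_pos (And.intro hm hn), add_zero]

variable (X N M) in
/-- The unit of the extension. -/
def extOne : ExtObj X N M 1 0 := (fun _ => X.one, 0)

theorem extOne_circ (hN : 2 ≤ N) (β : CircValues X N M) {n : ℕ} {i : ℤ} (s : Fin 1)
    (hl : n + 1 = 1 + n) (ht : 0 + i = i) (y : ExtObj X N M n i) :
    extCirc β s hl ht (extOne X N M) y = y := by
  refine Prod.ext (funext fun h => ?_) (funext fun h => ?_)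
  · rw [extCirc_fst β s hl ht _ y ⟨le_rfl⟩ h]
    exact X.one_circ s hl ht _
  · have h₁ : ¬ (2 ≤ 1 ∧ 2 ≤ n) := by omega
    have h₂ : ¬ (n = 1 ∧ i = 0) := by have := h.down; omega
    simp only [extCirc, extOne, h₁, h₂, dif_neg, not_false_eq_true, and_self, dif_pos, zero_add,
      add_zero, X.counitLin_one, one_smul]
    rfl

theorem extCirc_one (hN : 2 ≤ N) (β : CircValues X N M) {m : ℕ} {i : ℤ} (s : Fin m)
    (hl : m + 1 = m + 1) (ht : i + 0 = i) (x : ExtObj X N M m i) :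
    extCirc β s hl ht x (extOne X N M) = x := by
  refine Prod.ext (funext fun h => ?_) (funext fun h => ?_)
  · rw [extCirc_fst β s hl ht x _ h ⟨le_rfl⟩]
    exact X.circ_one s hl ht _
  · have h₁ : ¬ (2 ≤ m ∧ 2 ≤ 1) := by omega
    have h₂ : ¬ (m = 1 ∧ i = 0) := by have := h.down; omega
    simp only [extCirc, extOne, h₁, h₂, dif_neg, not_false_eq_true, and_self, dif_pos, zero_add,
      add_zero, X.counitLin_one, one_smul]
    rfl

omit [∀ i, Module k (M i)] in
theorem extObj_one_of_ne (hN : 2 ≤ N) {i : ℤ} (x : ExtObj X N M 1 i) (hi : i ≠ 0) : x = 0 :=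
  Prod.ext (funext fun _ => X.eq_zero_of_degree_ne _ hi)
    (funext fun h => by have := h.down; omega)

theorem extObj_one (hN : 2 ≤ N) (x : ExtObj X N M 1 0) : ∃ c : k, x = c • extOne X N M :=
  ⟨X.counitLin 1 0 (x.1 ⟨le_rfl⟩), Prod.ext (funext fun _ => X.eq_smul_one _)
    (funext fun h => by have := h.down; omega)⟩

omit [∀ i, Module k (M i)] in
theorem extObj_zero (hN : 2 ≤ N) {i : ℤ} (x : ExtObj X N M 0 i) : x = 0 :=
  Prod.ext (funext fun h => by have := h.down; omega) (funext fun h => by have := h.down; omega)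

/-- The extension of the part of `X` of arity `≥ 1` by the operations `M` of arity `N`. -/
noncomputable def extOperad (hN : 2 ≤ N) {β : CircValues X N M} (hβ : β.IsAssoc) : NSOperad k where
  obj n i := ExtObj X N M n i
  one := extOne X N M
  circ s hl ht := extCircLin β s hl ht
  one_circ := extOne_circ hN β
  circ_one := extCirc_one hN β
  circ_seq {m n p l l' q a b c ab bc abc} s r sr hsr h₁ h₂ h₃ h₄ e₁ e₂ e₃ e₄ x y z := by
    have one_circ : ∀ {n : ℕ} {i : ℤ} (s : Fin 1) (hl : n + 1 = 1 + n) (ht : 0 + i = i) y,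
      extCircLin β s hl ht (extOne X N M) y = y := extOne_circ hN β
    have circ_one : ∀ {m : ℕ} {i : ℤ} (s : Fin m) (hl : m + 1 = m + 1) (ht : i + 0 = i) x,
      extCircLin β s hl ht x (extOne X N M) = x := extCirc_one hN β
    have hm := s.isLt
    have hn := r.isLt
    by_cases m1 : m = 1
    · subst m1
      obtain rfl : l = n := by omega
      obtain rfl : q = l' := by omega
      obtain rfl : sr = r := Fin.ext (by omega)
      by_cases hd : a ≠ 0
      · rw [extObj_one_of_ne hN x hd]; simp
      · obtain rfl : a = 0 := not_not.1 hd
        obtain ⟨u, rfl⟩ := extObj_one hN x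
        obtain rfl : b = ab := by omega
        obtain rfl : bc = abc := by omega
        simp only [map_smul, LinearMap.smul_apply, one_circ]
    by_cases n1 : n = 1
    · subst n1
      obtain rfl : l = m := by omega
      obtain rfl : l' = p := by omega
      obtain rfl : sr = s := Fin.ext (by omega)
      by_cases hd : b ≠ 0
      · rw [extObj_one_of_ne hN y hd]; simp
      · obtain rfl : b = 0 := not_not.1 hd
        obtain ⟨u, rfl⟩ := extObj_one hN y
        obtain rfl : a = ab := by omega
        obtain rfl : c = bc := by omega
        obtain rfl : r = 0 := Subsingleton.elim _ _
        simp only [map_smul, LinearMap.smul_apply, one_circ, circ_one]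
    by_cases p1 : p = 1
    · subst p1
      obtain rfl : q = l := by omega
      obtain rfl : l' = n := by omega
      by_cases hd : c ≠ 0
      · rw [extObj_one_of_ne hN z hd]; simp
      · obtain rfl : c = 0 := not_not.1 hd
        obtain ⟨u, rfl⟩ := extObj_one hN z
        obtain rfl : ab = abc := by omega
        obtain rfl : b = bc := by omega
        simp only [map_smul, circ_one]
    by_cases p0 : p = 0
    · subst p0
      rw [extObj_zero hN z]; simp
    refine Prod.ext (funext fun h => ?_) (funext fun h => ?_)
    · change (extCirc β sr h₂ e₂ (extCirc β s h₁ e₁ x y) z).1 h =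
        (extCirc β s h₄ e₄ x (extCirc β r h₃ e₃ y z)).1 h
      rw [extCirc_fst β sr h₂ e₂ _ z ⟨by omega⟩ ⟨by omega⟩,
        extCirc_fst β s h₁ e₁ x y ⟨by omega⟩ ⟨by omega⟩,
        extCirc_fst β s h₄ e₄ x _ ⟨by omega⟩ ⟨by omega⟩,
        extCirc_fst β r h₃ e₃ y z ⟨by omega⟩ ⟨by omega⟩]
      exact X.circ_seq s r sr hsr h₁ h₂ h₃ h₄ e₁ e₂ e₃ e₄ _ _ _
    · obtain rfl := h.down
      change (extCirc β sr h₂ e₂ (extCirc β s h₁ e₁ x y) z).2 h =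
        (extCirc β s h₄ e₄ x (extCirc β r h₃ e₃ y z)).2 h
      rw [extCirc_snd β sr h₂ e₂ _ z (by omega) (by omega) _ h₂,
        extCirc_fst β s h₁ e₁ x y ⟨by omega⟩ ⟨by omega⟩,
        extCirc_snd β s h₄ e₄ x _ (by omega) (by omega) _ h₄,
        extCirc_fst β r h₃ e₃ y z ⟨by omega⟩ ⟨by omega⟩]
      exact hβ.seq (by omega) (by omega) (by omega) s r sr hsr h₁ h₂ h₃ h₄ e₁ e₂ e₃ e₄ _ _ _
  circ_par {m n p l l' q a b c ab ac abc} s r hsr r' s' hr' hs' h₁ h₂ h₃ h₄ e₁ e₂ e₃ e₄ x y z := by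
    have circ_one : ∀ {m : ℕ} {i : ℤ} (s : Fin m) (hl : m + 1 = m + 1) (ht : i + 0 = i) x,
      extCircLin β s hl ht x (extOne X N M) = x := extCirc_one hN β
    have hm := r.isLt
    have hsr' : (s : ℕ) < r := hsr
    rw [negOnePow_smul (k := k)]
    by_cases n0 : n = 0
    · subst n0
      rw [extObj_zero hN y]; simp
    by_cases p0 : p = 0
    · subst p0
      rw [extObj_zero hN z]; simp
    by_cases n1 : n = 1
    · subst n1
      obtain rfl : l = m := by omega
      obtain rfl : q = l' := by omega
      obtain rfl : r' = r := Fin.ext (by omega)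
      by_cases hd : b ≠ 0
      · rw [extObj_one_of_ne hN y hd]; simp
      · obtain rfl : b = 0 := not_not.1 hd
        obtain ⟨u, rfl⟩ := extObj_one hN y
        obtain rfl : a = ab := by omega
        obtain rfl : ac = abc := by omega
        simp only [map_smul, LinearMap.smul_apply, circ_one, zero_mul, ksign_zero, one_smul]
    by_cases p1 : p = 1
    · subst p1
      obtain rfl : q = l := by omega
      obtain rfl : l' = m := by omega
      obtain rfl : s' = s := Fin.ext (by omega)
      by_cases hd : c ≠ 0
      · rw [extObj_one_of_ne hN z hd]; simp
      · obtain rfl : c = 0 := not_not.1 hd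
        obtain ⟨u, rfl⟩ := extObj_one hN z
        obtain rfl : ab = abc := by omega
        obtain rfl : a = ac := by omega
        simp only [map_smul, LinearMap.smul_apply, circ_one, mul_zero, ksign_zero, one_smul]
    refine Prod.ext (funext fun h => ?_) (funext fun h => ?_)
    · change (extCirc β r' h₂ e₂ (extCirc β s h₁ e₁ x y) z).1 h =
        ksign k (b * c) • (extCirc β s' h₄ e₄ (extCirc β r h₃ e₃ x z) y).1 h
      rw [extCirc_fst β r' h₂ e₂ _ z ⟨by omega⟩ ⟨by omega⟩,
        extCirc_fst β s h₁ e₁ x y ⟨by omega⟩ ⟨by omega⟩,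
        extCirc_fst β s' h₄ e₄ _ y ⟨by omega⟩ ⟨by omega⟩,
        extCirc_fst β r h₃ e₃ x z ⟨by omega⟩ ⟨by omega⟩, ← negOnePow_smul]
      exact X.circ_par s r hsr r' s' hr' hs' h₁ h₂ h₃ h₄ e₁ e₂ e₃ e₄ _ _ _
    · obtain rfl := h.down
      change (extCirc β r' h₂ e₂ (extCirc β s h₁ e₁ x y) z).2 h =
        ksign k (b * c) • (extCirc β s' h₄ e₄ (extCirc β r h₃ e₃ x z) y).2 h
      rw [extCirc_snd β r' h₂ e₂ _ z (by omega) (by omega) _ h₂,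
        extCirc_fst β s h₁ e₁ x y ⟨by omega⟩ ⟨by omega⟩,
        extCirc_snd β s' h₄ e₄ _ y (by omega) (by omega) _ h₄,
        extCirc_fst β r h₃ e₃ x z ⟨by omega⟩ ⟨by omega⟩, ← negOnePow_smul]
      exact hβ.par (by omega) (by omega) (by omega) s r hsr r' s' hr' hs' h₁ h₂ h₃ h₄ e₁ e₂ e₃ e₄
        _ _ _

end Extension
end XB

namespace XB
open scoped DirectSum TensorProduct

section Extension

variable {k : Type u} [Field k] {X : CoalgOperad k} {N : ℕ} {M : ℤ → Type u}
  [∀ i, AddCommGroup (M i)] [∀ i, Module k (M i)] {V : ∀ n i, Submodule k (X.obj n i)}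

/-- The identity of the part of arity `≥ 1`. -/
def NSOperad.PosHom.id (A : NSOperad k) : A.PosHom A where
  map _ _ _ := LinearMap.id
  map_one := rfl
  map_circ _ _ _ _ _ _ _ _ := rfl

/-- The morphism from the extension of `X` to `X`. -/
noncomputable def extFst (hN : 2 ≤ N) {β : CircValues X N M} (hβ : β.IsAssoc) :
    (extOperad hN hβ).PosHom X.toNSOperad where
  map n hn i := (LinearMap.proj (φ := fun _ : PLift (1 ≤ n) => X.obj n i) ⟨hn⟩).comp
    (LinearMap.fst k _ _)
  map_one := rfl
  map_circ hm hn hl' s hl ht x y := extCirc_fst β s hl ht x y ⟨hm⟩ ⟨hn⟩ ⟨hl'⟩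

def NSOperad.PosHom.comp {A B C : NSOperad k} (g : B.PosHom C) (f : A.PosHom B) : A.PosHom C where
  map n hn i := (g.map n hn i).comp (f.map n hn i)
  map_one := by rw [LinearMap.comp_apply, f.map_one, g.map_one]
  map_circ hm hn hl' s hl ht x y := by
    simp only [LinearMap.comp_apply, f.map_circ hm hn hl', g.map_circ hm hn hl']

/-- An element of `M`, as an operation of arity `n = N`. -/
def extIncl {n : ℕ} {i : ℤ} {E : ℕ → Type u} [∀ n, AddCommGroup (E n)] [∀ n, Module k (E n)]
    (f : E N →ₗ[k] M i) : E n →ₗ[k] (PLift (n = N) → M i) :=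
  LinearMap.pi fun h => (h.down ▸ f : E n →ₗ[k] M i)

/-- A linear map on `X N` with values `β` on the decomposable operations, as a section of the
extension. -/
noncomputable def extSection (hN : 2 ≤ N) {β : CircValues X N M} (hβ : β.IsAssoc)
    (g : ∀ i, X.obj N i →ₗ[k] M i)
    (hg : ∀ {m n : ℕ} {i j t : ℤ}, 2 ≤ m → 2 ≤ n → ∀ (s : Fin m) (hl : N + 1 = m + n)
      (ht : i + j = t) (x : X.obj m i) (y : X.obj n j),
      g t (X.circ s hl ht x y) = β s hl ht x y) :
    X.toNSOperad.PosHom (extOperad hN hβ) where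
  map n hn i := LinearMap.prod (LinearMap.pi fun _ => LinearMap.id)
    (extIncl (E := fun n => X.obj n i) (g i))
  map_one := Prod.ext rfl (funext fun h => by have := h.down; omega)
  map_circ {m n l i j t} hm hn hl' s hl ht x y := by
    set F : ∀ n i, X.obj n i →ₗ[k] (extOperad hN hβ).obj n i := fun n i =>
      LinearMap.prod (LinearMap.pi fun _ => LinearMap.id)
        (extIncl (E := fun n => X.obj n i) (g i)) with hF
    have hone : F 1 0 X.one = (extOperad hN hβ).one :=
      Prod.ext rfl (funext fun h => by have := h.down; omega)
    change F l t (X.circ s hl ht x y) = (extOperad hN hβ).circ s hl ht (F m i x) (F n j y)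
    by_cases m1 : m = 1
    · subst m1
      obtain rfl : n = l := by omega
      by_cases hi : i ≠ 0
      · rw [X.eq_zero_of_degree_ne x hi]; simp
      · obtain rfl : i = 0 := not_not.1 hi
        obtain rfl : j = t := by omega
        rw [X.eq_smul_one x]
        simp only [map_smul, LinearMap.smul_apply, hone, X.one_circ, NSOperad.one_circ]
    by_cases n1 : n = 1
    · subst n1
      obtain rfl : m = l := by omega
      by_cases hj : j ≠ 0
      · rw [X.eq_zero_of_degree_ne y hj]; simp
      · obtain rfl : j = 0 := not_not.1 hj
        obtain rfl : i = t := by omega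
        rw [X.eq_smul_one y]
        simp only [map_smul, hone, X.circ_one, NSOperad.circ_one]
    refine Prod.ext (funext fun h => ?_) (funext fun h => ?_)
    · exact (extCirc_fst β s hl ht (F m i x) (F n j y) ⟨hm⟩ ⟨hn⟩ h).symm
    · obtain rfl := h.down
      exact (hg (by omega) (by omega) s hl ht x y).trans
        (extCirc_snd β s hl ht (F m i x) (F n j y) (by omega) (by omega) h hl).symm

/-- Linear maps on a freely generated operad can be prescribed on the generators and on the
decomposable operations. -/
theorem NSOperad.PosFreelyGenerated.exists_extension (hV : X.toNSOperad.PosFreelyGenerated V)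
    (hN : 2 ≤ N) {β : CircValues X N M} (hβ : β.IsAssoc) (f : ∀ i, V N i →ₗ[k] M i) :
    ∃ g : ∀ i, X.obj N i →ₗ[k] M i, (∀ i (v : V N i), g i v = f i v) ∧
      ∀ {m n : ℕ} {i j t : ℤ}, 2 ≤ m → 2 ≤ n → ∀ (s : Fin m) (hl : N + 1 = m + n)
        (ht : i + j = t) (x : X.obj m i) (y : X.obj n j),
        g t (X.circ s hl ht x y) = β s hl ht x y := by
  obtain ⟨g, hg, -⟩ := hV (extOperad hN hβ) fun n _ i =>
    LinearMap.prod (LinearMap.pi fun _ => (V n i).subtype) (extIncl (E := fun n => V n i) (f i))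
  have hid : (extFst hN hβ).comp g = NSOperad.PosHom.id _ := by
    refine (hV X.toNSOperad fun n _ i => (V n i).subtype).unique (fun n hn i v => ?_)
      (fun n hn i v => rfl)
    change ((g.map n hn i v).1 ⟨hn⟩ : X.obj n i) = _
    rw [hg]; rfl
  have hid' : ∀ n (hn : 1 ≤ n) i (x : X.obj n i), (g.map n hn i x).1 ⟨hn⟩ = x := fun n hn i x =>
    congrArg (fun h : X.toNSOperad.PosHom X.toNSOperad => h.map n hn i x) hid
  have hN' : 1 ≤ N := by omega
  refine ⟨fun i => (LinearMap.proj (φ := fun _ : PLift (N = N) => M i) ⟨rfl⟩).comp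
    ((LinearMap.snd k _ _).comp (g.map N hN' i)), fun i v => ?_, ?_⟩
  · change (g.map N hN' i v).2 ⟨rfl⟩ = _
    rw [hg]; rfl
  · intro m n i j t hm hn s hl ht x y
    change (g.map N hN' t (X.circ s hl ht x y)).2 ⟨rfl⟩ = _
    rw [g.map_circ (by omega) (by omega) hN']
    refine (extCirc_snd β s hl ht _ _ hm hn ⟨rfl⟩ hl).trans ?_
    rw [hid', hid']

/-- The operations of a freely generated operad are sums of generators and of decomposable
operations. -/
theorem NSOperad.PosFreelyGenerated.eq_top (hV : X.toNSOperad.PosFreelyGenerated V)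
    (hN : 2 ≤ N) (W : ∀ i, Submodule k (X.obj N i)) (hVW : ∀ i, V N i ≤ W i)
    (hW : ∀ {m n : ℕ} {i j t : ℤ}, 2 ≤ m → 2 ≤ n → ∀ (s : Fin m) (hl : N + 1 = m + n)
      (ht : i + j = t) (x : X.obj m i) (y : X.obj n j), X.circ s hl ht x y ∈ W t)
    {i : ℤ} (x : X.obj N i) : x ∈ W i := by
  let β : CircValues X N fun i => X.obj N i ⧸ W i := fun _ _ _ => 0
  have hβ : β.IsAssoc := ⟨by intros; rfl, by intros; exact (smul_zero _).symm⟩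
  have h := hV (extOperad hN hβ) fun n _ i =>
    LinearMap.prod (LinearMap.pi fun _ => (V n i).subtype) 0
  have e := h.unique (y₁ := extSection hN hβ (fun _ => 0) fun _ _ _ _ _ _ _ => rfl)
    (y₂ := extSection hN hβ (fun i => (W i).mkQ) fun hm hn s hl ht x y =>
      (Submodule.Quotient.mk_eq_zero _).2 (hW hm hn s hl ht x y))
    (fun n hn i v => Prod.ext rfl (funext fun h => by obtain rfl := h.down; rfl))
    (fun n hn i v => Prod.ext rfl (funext fun h => by
      obtain rfl := h.down
      exact (Submodule.Quotient.mk_eq_zero _).2 (hVW i v.2)))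
  have := congrArg (fun g : X.toNSOperad.PosHom (extOperad hN hβ) =>
    (g.map N (by omega) i x).2 ⟨rfl⟩) e
  exact (Submodule.Quotient.mk_eq_zero _).1 (this.symm)

end Extension
end XB

namespace XB
open scoped DirectSum TensorProduct

/-! ### The convolution product of maps from `X n` to families of operations -/

section Convolution

variable {k : Type u} [Field k] {Q : PROP k} {n : ℕ}

variable (Q) in
/-- Families of operations of all degrees. -/
abbrev FamTot (n r : ℕ) : Type u := ⨁ i : ℤ, Fam Q n r i

/-- The convolution of families of operations of all degrees. -/
noncomputable def convTot {r r' R : ℕ} (hR : r + r' = R) :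
    FamTot Q n r →ₗ[k] FamTot Q n r' →ₗ[k] FamTot Q n R :=
  DirectSum.toModule k ℤ _ fun a => LinearMap.flip (DirectSum.toModule k ℤ _ fun b =>
    ((conv hR (rfl : a + b = a + b)).compr₂
      (DirectSum.lof k ℤ (fun i => Fam Q n R i) (a + b))).flip)

theorem convTot_lof {r r' R : ℕ} (hR : r + r' = R) {a b t : ℤ} (e : a + b = t) (f : Fam Q n r a)
    (g : Fam Q n r' b) : convTot hR (DirectSum.lof k ℤ _ a f) (DirectSum.lof k ℤ _ b g) =
      DirectSum.lof k ℤ (fun i => Fam Q n R i) t (conv hR e f g) := by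
  subst e
  rw [convTot, DirectSum.toModule_lof, LinearMap.flip_apply, DirectSum.toModule_lof]
  rfl

theorem convTot_assoc {r₁ r₂ r₃ r₁₂ r₂₃ R : ℕ}
    (h₁ : r₁ + r₂ = r₁₂) (h₂ : r₁₂ + r₃ = R) (h₃ : r₂ + r₃ = r₂₃) (h₄ : r₁ + r₂₃ = R)
    (f : FamTot Q n r₁) (g : FamTot Q n r₂) (h : FamTot Q n r₃) :
    convTot h₂ (convTot h₁ f g) h = convTot h₄ f (convTot h₃ g h) := by
  induction f using DirectSum.induction_on with
  | zero => simp
  | add f f' hf hf' => simp only [map_add, LinearMap.add_apply, hf, hf']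
  | of a f =>
  induction g using DirectSum.induction_on with
  | zero => simp
  | add f f' hf hf' => simp only [map_add, LinearMap.add_apply, hf, hf']
  | of b g =>
  induction h using DirectSum.induction_on with
  | zero => simp
  | add f f' hf hf' => simp only [map_add, hf, hf']
  | of c h =>
    simp only [← DirectSum.lof_eq_of k]
    rw [convTot_lof h₁ rfl, convTot_lof h₂ rfl, convTot_lof h₃ rfl, convTot_lof h₄ (add_assoc a b c).symm,
      conv_assoc h₁ h₂ h₃ h₄ rfl rfl rfl]

theorem convTot_unit_left {r : ℕ} (hR : 0 + r = r) (f : FamTot Q n r) :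
    convTot hR (DirectSum.lof k ℤ _ 0 (famUnit Q n)) f = f := by
  induction f using DirectSum.induction_on with
  | zero => simp
  | add f f' hf hf' => simp only [map_add, hf, hf']
  | of a f =>
    simp only [← DirectSum.lof_eq_of k]
    rw [convTot_lof hR (zero_add a), conv_unit_left]

theorem convTot_unit_right {r : ℕ} (hR : r + 0 = r) (f : FamTot Q n r) :
    convTot hR f (DirectSum.lof k ℤ _ 0 (famUnit Q n)) = f := by
  induction f using DirectSum.induction_on with
  | zero => simp
  | add f f' hf hf' => simp only [map_add, LinearMap.add_apply, hf, hf']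
  | of a f =>
    simp only [← DirectSum.lof_eq_of k]
    rw [convTot_lof hR (add_zero a), conv_unit_right]

variable {C : Type u} [AddCommGroup C] [Module k C] [Coalgebra k C]

/-- The convolution of maps from a coalgebra. -/
noncomputable def convHom {r r' R : ℕ} (hR : r + r' = R) (f : C →ₗ[k] FamTot Q n r)
    (g : C →ₗ[k] FamTot Q n r') : C →ₗ[k] FamTot Q n R :=
  (TensorProduct.lift ((convTot hR).compl₁₂ f g)).comp Coalgebra.comul

theorem convHom_assoc {r₁ r₂ r₃ r₁₂ r₂₃ R : ℕ}
    (h₁ : r₁ + r₂ = r₁₂) (h₂ : r₁₂ + r₃ = R) (h₃ : r₂ + r₃ = r₂₃) (h₄ : r₁ + r₂₃ = R)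
    (f : C →ₗ[k] FamTot Q n r₁) (g : C →ₗ[k] FamTot Q n r₂) (h : C →ₗ[k] FamTot Q n r₃) :
    convHom h₂ (convHom h₁ f g) h = convHom h₄ f (convHom h₃ g h) := by
  have e1 : TensorProduct.lift ((convTot h₂).compl₁₂ (convHom h₁ f g) h) =
      (TensorProduct.lift ((convTot h₂).compl₁₂
        (TensorProduct.lift ((convTot h₁).compl₁₂ f g)) h)).comp
        (LinearMap.rTensor C Coalgebra.comul) := TensorProduct.ext' fun x y => rfl
  have e2 : TensorProduct.lift ((convTot h₄).compl₁₂ f (convHom h₃ g h)) =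
      (TensorProduct.lift ((convTot h₄).compl₁₂ f
        (TensorProduct.lift ((convTot h₃).compl₁₂ g h)))).comp
        (LinearMap.lTensor C Coalgebra.comul) := TensorProduct.ext' fun x y => rfl
  have e3 : TensorProduct.lift ((convTot h₂).compl₁₂
        (TensorProduct.lift ((convTot h₁).compl₁₂ f g)) h) =
      (TensorProduct.lift ((convTot h₄).compl₁₂ f
        (TensorProduct.lift ((convTot h₃).compl₁₂ g h)))).comp
        (TensorProduct.assoc k C C C).toLinearMap :=
    TensorProduct.ext_threefold fun x y z => convTot_assoc h₁ h₂ h₃ h₄ (f x) (g y) (h z)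
  rw [convHom, e1, e3, convHom, e2, LinearMap.comp_assoc, LinearMap.comp_assoc,
    LinearMap.comp_assoc, Coalgebra.coassoc]

/-- The unit of the convolution. -/
noncomputable def unitConv (Q : PROP k) (n : ℕ) : C →ₗ[k] FamTot Q n 0 :=
  (LinearMap.toSpanSingleton k _ (DirectSum.lof k ℤ _ 0 (famUnit Q n))).comp Coalgebra.counit

theorem convHom_unit_left {r : ℕ} (hR : 0 + r = r) (f : C →ₗ[k] FamTot Q n r) :
    convHom hR (unitConv Q n) f = f := by
  have e : TensorProduct.lift ((convTot hR).compl₁₂ (unitConv (C := C) Q n) f) =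
      f.comp ((TensorProduct.lid k C).toLinearMap.comp (LinearMap.rTensor C Coalgebra.counit)) := by
    refine TensorProduct.ext' fun x y => ?_
    simp [unitConv, convTot_unit_left hR]
  ext x : 1
  rw [convHom, e, LinearMap.comp_apply, LinearMap.comp_apply, LinearMap.comp_apply,
    Coalgebra.rTensor_counit_comul]
  simp

theorem convHom_unit_right {r : ℕ} (hR : r + 0 = r) (f : C →ₗ[k] FamTot Q n r) :
    convHom hR f (unitConv Q n) = f := by
  have e : TensorProduct.lift ((convTot hR).compl₁₂ f (unitConv (C := C) Q n)) =
      f.comp ((TensorProduct.rid k C).toLinearMap.comp (LinearMap.lTensor C Coalgebra.counit)) := by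
    refine TensorProduct.ext' fun x y => ?_
    simp [unitConv, convTot_unit_right hR]
  ext x : 1
  rw [convHom, e, LinearMap.comp_apply, LinearMap.comp_apply, LinearMap.comp_apply,
    Coalgebra.lTensor_counit_comul]
  simp

end Convolution

section GradedConvolution

variable {k : Type u} [Field k] {X : CoalgOperad k} {Q : PROP k} {n : ℕ}

/-- The convolution of maps from `X n` to families of operations. -/
noncomputable def convMap {r r' R : ℕ} (hR : r + r' = R) (F : ∀ a, X.obj n a →ₗ[k] Fam Q n r a)
    (G : ∀ b, X.obj n b →ₗ[k] Fam Q n r' b) (i : ℤ) : X.obj n i →ₗ[k] Fam Q n R i :=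
  (convEval hR F G i).comp (Coalgebra.comul.comp (DirectSum.lof k ℤ (X.obj n) i))

theorem convMap_splitting {r r' R : ℕ} (hR : r + r' = R) (F : ∀ a, X.obj n a →ₗ[k] Fam Q n r a)
    (G : ∀ b, X.obj n b →ₗ[k] Fam Q n r' b) {i : ℤ} {x : X.obj n i} (S : Splitting k x) :
    convMap hR F G i x = ∑ a, conv hR (S.deg_add a) (F _ (S.left a)) (G _ (S.right a)) :=
  convEval_splitting hR F G S

/-- The total map of a family of maps of degree `0`. -/
noncomputable def totMap {r : ℕ} (F : ∀ a, X.obj n a →ₗ[k] Fam Q n r a) :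
    (⨁ i, X.obj n i) →ₗ[k] FamTot Q n r :=
  DirectSum.toModule k ℤ _ fun a => (DirectSum.lof k ℤ (fun i => Fam Q n r i) a).comp (F a)

theorem totMap_lof {r : ℕ} (F : ∀ a, X.obj n a →ₗ[k] Fam Q n r a) {i : ℤ} (x : X.obj n i) :
    totMap F (DirectSum.lof k ℤ _ i x) = DirectSum.lof k ℤ (fun i => Fam Q n r i) i (F i x) := by
  rw [totMap, DirectSum.toModule_lof]; rfl

theorem totMap_injective {r : ℕ} {F G : ∀ a, X.obj n a →ₗ[k] Fam Q n r a}
    (h : totMap F = totMap G) : F = G := by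
  refine funext fun i => LinearMap.ext fun x => ?_
  have := LinearMap.congr_fun h (DirectSum.lof k ℤ _ i x)
  rw [totMap_lof, totMap_lof] at this
  exact DirectSum.of_injective (β := fun i => Fam Q n r i) i this

theorem totMap_convMap {r r' R : ℕ} (hR : r + r' = R) (F : ∀ a, X.obj n a →ₗ[k] Fam Q n r a)
    (G : ∀ b, X.obj n b →ₗ[k] Fam Q n r' b) :
    totMap (convMap hR F G) = convHom hR (totMap F) (totMap G) := by
  refine DirectSum.linearMap_ext k fun i => LinearMap.ext fun x => ?_
  obtain ⟨S⟩ := X.comul_graded x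
  rw [LinearMap.comp_apply, LinearMap.comp_apply, totMap_lof, convMap_splitting hR F G S, convHom,
    LinearMap.comp_apply, S.comul_eq, map_sum, map_sum]
  refine Finset.sum_congr rfl fun a _ => ?_
  rw [TensorProduct.lift.tmul, LinearMap.compl₁₂_apply, totMap_lof, totMap_lof,
    convTot_lof hR (S.deg_add a)]

theorem convMap_assoc {r₁ r₂ r₃ r₁₂ r₂₃ R : ℕ}
    (h₁ : r₁ + r₂ = r₁₂) (h₂ : r₁₂ + r₃ = R) (h₃ : r₂ + r₃ = r₂₃) (h₄ : r₁ + r₂₃ = R)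
    (F : ∀ a, X.obj n a →ₗ[k] Fam Q n r₁ a) (G : ∀ b, X.obj n b →ₗ[k] Fam Q n r₂ b)
    (H : ∀ b, X.obj n b →ₗ[k] Fam Q n r₃ b) :
    convMap h₂ (convMap h₁ F G) H = convMap h₄ F (convMap h₃ G H) := by
  refine totMap_injective ?_
  rw [totMap_convMap, totMap_convMap, totMap_convMap, totMap_convMap,
    convHom_assoc h₁ h₂ h₃ h₄]

variable (X) in
/-- The multiples of `w` by the counit. -/
noncomputable def scaleFam {r : ℕ} (w : Fam Q n r 0) (i : ℤ) : X.obj n i →ₗ[k] Fam Q n r i :=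
  if h : i = 0 then h ▸ (LinearMap.toSpanSingleton k _ w).comp (X.counitLin n 0) else 0

theorem scaleFam_zero {r : ℕ} (w : Fam Q n r 0) (x : X.obj n 0) :
    scaleFam X w 0 x = X.counitLin n 0 x • w := rfl

theorem scaleFam_ne {r : ℕ} (w : Fam Q n r 0) {i : ℤ} (hi : i ≠ 0) : scaleFam X w i = 0 :=
  dif_neg hi

theorem totMap_scaleFam : totMap (scaleFam X (famUnit Q n)) = unitConv Q n := by
  refine DirectSum.linearMap_ext k fun i => LinearMap.ext fun x => ?_
  rw [LinearMap.comp_apply, LinearMap.comp_apply, totMap_lof, unitConv, LinearMap.comp_apply]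
  by_cases hi : i = 0
  · subst hi
    rw [scaleFam_zero, map_smul]; rfl
  · rw [scaleFam_ne _ hi, X.counit_graded x hi]; simp

theorem convMap_unit_left {r : ℕ} (hR : 0 + r = r) (F : ∀ a, X.obj n a →ₗ[k] Fam Q n r a) :
    convMap hR (scaleFam X (famUnit Q n)) F = F := by
  refine totMap_injective ?_
  rw [totMap_convMap, totMap_scaleFam, convHom_unit_left]

theorem convMap_unit_right {r : ℕ} (hR : r + 0 = r) (F : ∀ a, X.obj n a →ₗ[k] Fam Q n r a) :
    convMap hR F (scaleFam X (famUnit Q n)) = F := by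
  refine totMap_injective ?_
  rw [totMap_convMap, totMap_scaleFam, convHom_unit_right]

end GradedConvolution
end XB

namespace XB
open scoped DirectSum TensorProduct

section CoalgExtension

variable {k : Type u} [Field k] {X : CoalgOperad k} {Q : PROP k} {n : ℕ}

/-- The components of the coalgebra map with the component `θ` in degree `1`. -/
noncomputable def iterConv (θ : ∀ i, X.obj n i →ₗ[k] Fam Q n 1 i) :
    ∀ r i, X.obj n i →ₗ[k] Fam Q n r i
  | 0 => scaleFam X (famUnit Q n)
  | r + 1 => convMap (add_comm 1 r) θ (iterConv θ r)

theorem convMap_iterConv (θ : ∀ i, X.obj n i →ₗ[k] Fam Q n 1 i) {r r' R : ℕ} (hR : r + r' = R) :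
    convMap hR (iterConv θ r) (iterConv θ r') = iterConv θ R := by
  induction r generalizing R with
  | zero =>
    obtain rfl : r' = R := by omega
    exact convMap_unit_left _ _
  | succ r ih =>
    obtain ⟨R, rfl⟩ : ∃ R', R = R' + 1 := ⟨r + r', by omega⟩
    rw [iterConv, iterConv, convMap_assoc (add_comm 1 r) hR (by omega : r + r' = R)
      (add_comm 1 R), ih]

theorem Fam.val_eq_zero_of_convMap {r r' R : ℕ} (hR : r + r' = R)
    {F : ∀ a, X.obj n a →ₗ[k] Fam Q n r a} {G : ∀ a, X.obj n a →ₗ[k] Fam Q n r' a}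
    (hF : ∀ i (x : X.obj n i) K M (h : psum K n = M), M < r → (F i x).val K M h = 0)
    (hG : ∀ i (x : X.obj n i) K M (h : psum K n = M), M < r' → (G i x).val K M h = 0)
    {i : ℤ} (x : X.obj n i) (K : ℕ → ℕ) (M : ℕ) (h : psum K n = M) (hM : M < R) :
    (convMap hR F G i x).val K M h = 0 := by
  obtain ⟨S⟩ := X.comul_graded x
  rw [convMap_splitting hR F G S, Fam.val_sum]
  exact Finset.sum_eq_zero fun a _ => conv_vanish hR _ (hF _ _) (hG _ _) K M h hM

theorem iterConv_vanish {θ : ∀ i, X.obj n i →ₗ[k] Fam Q n 1 i}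
    (hθ : ∀ i (x : X.obj n i) K M (h : psum K n = M), M < 1 → (θ i x).val K M h = 0) (r : ℕ) :
    ∀ i (x : X.obj n i) K M (h : psum K n = M), M < r → (iterConv θ r i x).val K M h = 0 := by
  induction r with
  | zero => intro i x K M h hM; omega
  | succ r ih => exact fun i x => Fam.val_eq_zero_of_convMap _ hθ ih x

theorem exists_isCoalgMap (θ : ∀ i, X.obj n i →ₗ[k] Fam Q n 1 i)
    (hθ : ∀ i (x : X.obj n i) K M (h : psum K n = M), M < 1 → (θ i x).val K M h = 0) :
    ∃ Φ : ∀ i, X.obj n i →ₗ[k] EndObj Q n i, IsCoalgMap Φ ∧ ∀ i x, (Φ i x).fam 1 = θ i x := by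
  refine ⟨fun i => ⟨⟨fun x => ⟨fun r => iterConv θ r i x, fun r => iterConv_vanish hθ r i x⟩,
    fun x y => Subtype.ext (funext fun r => map_add (iterConv θ r i) x y)⟩,
    fun c x => Subtype.ext (funext fun r => map_smul (iterConv θ r i) c x)⟩, ⟨?_, ?_, ?_⟩, ?_⟩
  · intro i x S r r' R hR
    change iterConv θ R i x = ∑ a, conv hR (S.deg_add a) (iterConv θ r _ (S.left a))
      (iterConv θ r' _ (S.right a))
    rw [← convMap_iterConv θ hR, convMap_splitting _ _ _ S]
  · intro x
    exact scaleFam_zero _ x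
  · intro i x hi
    change scaleFam X (famUnit Q n) i x = 0
    rw [scaleFam_ne _ hi, LinearMap.zero_apply]
  · intro i x
    exact congrFun (congrArg DFunLike.coe
      (congrFun (convMap_unit_right (add_comm 1 0) θ) i)) x

/-! ### Compositions of coalgebra maps are determined by their component in degree `1` -/

theorem endCirc_fam_zero {m l : ℕ} {j : ℤ} (s : Fin m) (hl : l + 1 = m + n) (ht : 0 + j = j)
    {c : k} {f : EndObj Q m 0} {g : EndObj Q n j} (hf : f.fam 0 = c • famUnit Q m) {K : ℕ → ℕ} (hM : psum K l = 0)
    (hW : psum (res K s) n = 0) :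
    (endCirc s hl ht f g).val 0 K 0 hM = c • g.val 0 (res K s) 0 hW := by
  obtain ⟨B, hB⟩ := exists_splitPoint (K := K) s.isLt hl
  have hA : psum K s = 0 := by omega
  obtain rfl : B = 0 := by omega
  rw [endCirc_val s hl ht f g 0 K 0 hM (B := 0) 1 hA hW (by omega) (by omega),
    Finset.sum_range_one]
  change Q.comp ht ((f.fam 0).val (upd K s n 0) 0 _) (Q.pad 0 0 _ _ _) = _
  rw [hf, Fam.val_smul, famUnit_zero, map_smul, LinearMap.smul_apply, Q.one_comp, Q.pad_zero]

theorem endCirc_fam_zero_ne {m l : ℕ} {j : ℤ} (s : Fin m) (hl : l + 1 = m + n) (ht : 0 + j = j)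
    {c : k} {f : EndObj Q m 0} {g : EndObj Q n j} (hf : f.fam 0 = c • famUnit Q m)
    (hg : ∀ K M (h : psum K n = M), M ≠ 0 → g.val 0 K M h = 0) {K : ℕ → ℕ} {M : ℕ}
    (hM : psum K l = M) (h0 : M ≠ 0) : (endCirc s hl ht f g).val 0 K M hM = 0 := by
  subst hM
  obtain ⟨B, hB⟩ := exists_splitPoint (K := K) s.isLt hl
  rw [endCirc_val s hl ht f g 0 K _ rfl _ rfl rfl hB (Nat.lt_succ_self _)]
  refine Finset.sum_eq_zero fun q _ => ?_
  by_cases hq : psum K s + q + B = 0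
  · obtain rfl : q = 0 := by omega
    rw [hg _ _ _ (by omega)]
    simp
  · change Q.comp ht ((f.fam 0).val _ _ _) _ = 0
    rw [hf, Fam.val_smul, famUnit_ne _ hq]
    simp

theorem endCirc_fam_zero_of_eq_zero {m l : ℕ} {i j t : ℤ} (s : Fin m) (hl : l + 1 = m + n)
    (ht : i + j = t) {f : EndObj Q m i} (g : EndObj Q n j) (hf : f.fam 0 = 0) :
    (endCirc s hl ht f g).fam 0 = 0 := by
  refine Fam.ext fun K M hM => ?_
  subst hM
  obtain ⟨B, hB⟩ := exists_splitPoint (K := K) s.isLt hl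
  change (endCirc s hl ht f g).val 0 K _ rfl = 0
  rw [endCirc_val s hl ht f g 0 K _ rfl _ rfl rfl hB (Nat.lt_succ_self _)]
  refine Finset.sum_eq_zero fun q _ => ?_
  change Q.comp ht ((f.fam 0).val _ _ _) _ = 0
  rw [hf]
  simp

theorem CoalgOperad.counit_eq_zero {i : ℤ} (x : X.obj n i) (hi : i ≠ 0) : X.counit x = 0 :=
  X.counit_graded x hi

theorem IsCoalgMap.fam_zero_circ {m l : ℕ} {Φ : ∀ i, X.obj m i →ₗ[k] EndObj Q m i}
    {Φ' : ∀ i, X.obj n i →ₗ[k] EndObj Q n i} {Φ'' : ∀ i, X.obj l i →ₗ[k] EndObj Q l i}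
    (h : IsCoalgMap Φ) (h' : IsCoalgMap Φ') (h'' : IsCoalgMap Φ'') {i j t : ℤ} (s : Fin m)
    (hl : l + 1 = m + n) (ht : i + j = t) (x : X.obj m i) (y : X.obj n j) :
    (Φ'' t (X.circ s hl ht x y)).fam 0 = (endCirc s hl ht (Φ i x) (Φ' j y)).fam 0 := by
  have hc : X.counit (X.circ s hl ht x y) = X.counit x * X.counit y := X.counit_circ s hl ht x y
  by_cases hi : i = 0
  · subst hi
    obtain rfl : j = t := by omega
    have hg : ∀ K M (h : psum K n = M), M ≠ 0 → (Φ' j y).val 0 K M h = 0 := by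
      intro K M hM h0
      change ((Φ' j y).fam 0).val K M hM = 0
      by_cases hj : j = 0
      · subst hj
        rw [h'.counit, Fam.val_smul, famUnit_ne _ h0, smul_zero]
      · rw [h'.counit_ne y hj]; rfl
    refine Fam.ext fun K M hM => ?_
    change _ = (endCirc s hl ht (Φ 0 x) (Φ' j y)).val 0 K M hM
    by_cases h0 : M = 0
    · subst h0
      have hW : psum (res K s) n = 0 := by
        have := res_psum_le (K := K) s.isLt hl
        omega
      rw [endCirc_fam_zero s hl ht (h.counit x) hM hW]
      change _ = X.counit x • ((Φ' j y).fam 0).val _ _ _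
      by_cases hj : j = 0
      · subst hj
        rw [h'.counit, h''.counit, hc, Fam.val_smul, Fam.val_smul, famUnit_zero, famUnit_zero,
          smul_smul]
      · rw [h'.counit_ne y hj, h''.counit_ne _ hj]
        simp
    · rw [endCirc_fam_zero_ne s hl ht (h.counit x) hg hM h0]
      by_cases hj : j = 0
      · subst hj
        rw [h''.counit, Fam.val_smul, famUnit_ne _ h0, smul_zero]
      · rw [h''.counit_ne _ hj]; rfl
  · rw [endCirc_fam_zero_of_eq_zero s hl ht _ (h.counit_ne x hi)]
    by_cases ht0 : t = 0
    · subst ht0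
      rw [h''.counit, hc, X.counit_eq_zero x hi, zero_mul, zero_smul]
    · exact h''.counit_ne _ ht0

theorem IsCoalgMap.map_circ {m l : ℕ} {Φ : ∀ i, X.obj m i →ₗ[k] EndObj Q m i}
    {Φ' : ∀ i, X.obj n i →ₗ[k] EndObj Q n i} {Φ'' : ∀ i, X.obj l i →ₗ[k] EndObj Q l i}
    (h : IsCoalgMap Φ) (h' : IsCoalgMap Φ') (h'' : IsCoalgMap Φ'') (s : Fin m)
    (hl : l + 1 = m + n)
    (H : ∀ {i j t : ℤ} (ht : i + j = t) (x : X.obj m i) (y : X.obj n j),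
      (Φ'' t (X.circ s hl ht x y)).fam 1 = (endCirc s hl ht (Φ i x) (Φ' j y)).fam 1)
    {i j t : ℤ} (ht : i + j = t) (x : X.obj m i) (y : X.obj n j) :
    Φ'' t (X.circ s hl ht x y) = endCirc s hl ht (Φ i x) (Φ' j y) := by
  suffices ∀ (r : ℕ) {i j t : ℤ} (ht : i + j = t) (x : X.obj m i) (y : X.obj n j),
      (Φ'' t (X.circ s hl ht x y)).fam r = (endCirc s hl ht (Φ i x) (Φ' j y)).fam r from
    Subtype.ext (funext fun r => this r ht x y)
  intro r
  induction r with
  | zero => exact fun ht x y => h.fam_zero_circ h' h'' s hl ht x y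
  | succ r ih =>
    intro i j t ht x y
    obtain ⟨S⟩ := X.comul_graded x
    obtain ⟨T⟩ := X.comul_graded y
    rw [h''.fam_eq _ (add_comm 1 r), X.comul_circ s hl ht x y S T, map_sum,
      IsCosplit.endCirc (h.comul x S) (h'.comul y T) s hl ht 1 r (r + 1) (add_comm 1 r),
      Fintype.sum_prod_type]
    refine Finset.sum_congr rfl fun a _ => ?_
    rw [map_sum]
    refine Finset.sum_congr rfl fun b _ => ?_
    have e : S.degL a + T.degL b + (S.degR a + T.degR b) = t := by
      have := S.deg_add a
      have := T.deg_add b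
      omega
    rw [negOnePow_smul (k := k), map_smul, convEval_lof _ _ _ e, LinearMap.comp_apply,
      LinearMap.comp_apply, H, ih, map_smul, map_smul, LinearMap.smul_apply]

end CoalgExtension
end XB

namespace XB
open scoped DirectSum TensorProduct

section Coderivation

variable {k : Type u} [Field k] {Q : PROP k}

theorem endOne_fam_zero : (endOne Q).fam 0 = famUnit Q 1 := by
  refine Fam.ext fun K M h => ?_
  change (endOne Q).val 0 K M h = _
  by_cases hM : M = 0
  · subst hM
    rw [endOne_self, famUnit_zero]
  · rw [endOne_ne _ hM, famUnit_ne _ hM]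

/-- The components of the coderivation with the component `d` in degree `1`. -/
noncomputable def coderFam (d : Fam Q 1 1 1) : ∀ r, Fam Q 1 r 1
  | 0 => 0
  | r + 1 => conv (add_comm 1 r) (add_zero 1) d ((endOne Q).fam r) +
      conv (add_comm 1 r) (zero_add 1) ((endOne Q).fam 1) (coderFam d r)

theorem coderFam_one (d : Fam Q 1 1 1) : coderFam d 1 = d := by
  rw [coderFam, coderFam, endOne_fam_zero, conv_unit_right, map_zero, add_zero]

theorem coderFam_add (d : Fam Q 1 1 1) {r r' R : ℕ} (hR : r + r' = R) : coderFam d R =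
    conv hR (add_zero 1) (coderFam d r) ((endOne Q).fam r') +
      conv hR (zero_add 1) ((endOne Q).fam r) (coderFam d r') := by
  induction r generalizing R with
  | zero =>
    obtain rfl : r' = R := by omega
    rw [endOne_fam_zero, conv_unit_left, coderFam, map_zero, LinearMap.zero_apply, zero_add]
  | succ r ih =>
    obtain ⟨R, rfl⟩ : ∃ R', R = R' + 1 := ⟨r + r', by omega⟩
    have hR' : r + r' = R := by omega
    rw [coderFam, coderFam, ih hR', ← conv_endOne hR' (add_zero 0), map_add, map_add,
      LinearMap.add_apply, ← conv_endOne (add_comm 1 r) (add_zero 0),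
      conv_assoc (add_comm 1 r) hR hR' (add_comm 1 R) (add_zero 1) (add_zero 1) (add_zero 0)
        (add_zero 1),
      conv_assoc (add_comm 1 r) hR hR' (add_comm 1 R) (zero_add 1) (add_zero 1) (add_zero 1)
        (zero_add 1),
      conv_assoc (add_comm 1 r) hR hR' (add_comm 1 R) (add_zero 0) (zero_add 1) (zero_add 1)
        (zero_add 1), add_assoc]

theorem conv_one_eq_zero {r r' R : ℕ} {a b t : ℤ} (hR : r + r' = R) (e : a + b = t)
    {f : Fam Q 1 r a} {g : Fam Q 1 r' b} {M : ℕ} (K : ℕ → ℕ) (hM : psum K 1 = M)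
    (h : ∀ y y', y + y' = M → f.val (fun _ => y) y (psum_const_one y) = 0 ∨
      g.val (fun _ => y') y' (psum_const_one y') = 0) : (conv hR e f g).val K M hM = 0 := by
  rw [conv_one_val]
  refine Finset.sum_eq_zero fun y _ => ?_
  split_ifs with hy
  · rcases h _ _ hy with h | h <;> rw [h] <;> simp
  · rfl

theorem coderFam_vanish {d : Fam Q 1 1 1}
    (hd : ∀ K M (h : psum K 1 = M), M ≤ 1 → d.val K M h = 0) (r : ℕ) :
    ∀ K M (h : psum K 1 = M), ¬ (0 < r ∧ r < M) → (coderFam d r).val K M h = 0 := by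
  induction r with
  | zero => exact fun K M h _ => rfl
  | succ r ih =>
    intro K M h hr
    rw [coderFam, Fam.val_add, conv_one_eq_zero, conv_one_eq_zero, add_zero]
    · intro y y' hy
      by_cases h1 : y = 1
      · exact Or.inr (ih _ _ _ (by omega))
      · exact Or.inl (endOne_ne _ h1)
    · intro y y' hy
      by_cases h1 : y' = r
      · exact Or.inl (hd _ _ _ (by omega))
      · exact Or.inr (endOne_ne _ h1)

theorem exists_isCoder {d : Fam Q 1 1 1}
    (hd : ∀ K M (h : psum K 1 = M), M ≤ 1 → d.val K M h = 0) :
    ∃ D : EndObj Q 1 1, IsCoder D ∧ D.fam 1 = d :=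
  ⟨⟨coderFam d, fun r K M h hr => coderFam_vanish hd r K M h (by omega)⟩,
    ⟨fun {r M K} h hr => coderFam_vanish hd r K M h hr, fun hR => coderFam_add d hR⟩,
    coderFam_one d⟩

end Coderivation

section Unit

variable {k : Type u} [Field k] {Q : PROP k}

variable (Q) in
/-- The unit of the tensor coalgebra. -/
def endUnit : EndObj Q 0 0 :=
  ⟨fun | 0 => famUnit Q 0 | _ + 1 => 0, fun r K M h hr => by
    obtain ⟨r, rfl⟩ : ∃ r', r = r' + 1 := ⟨r - 1, by omega⟩
    rfl⟩

/-- The word `K` without the letter at the position `s`. -/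
def del (K : ℕ → ℕ) (s : ℕ) : ℕ → ℕ := fun j => if j < s then K j else K (j + 1)

theorem upd_del {K : ℕ → ℕ} {s : ℕ} (h : K s = 0) : upd (del K s) s 0 0 = K := by
  funext j
  unfold upd del
  split_ifs with h1 h2 h3
  · rfl
  · rw [h2, h]
  · omega
  · congr 1; omega

theorem del_upd (L : ℕ → ℕ) (s : ℕ) : del (upd L s 0 0) s = L := by
  funext j
  simp only [upd, del]
  split_ifs
  · rfl
  · omega
  · omega
  · rfl

theorem psum_del {K : ℕ → ℕ} {s n M : ℕ} (hs : s < n + 1) (h : K s = 0)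
    (hM : psum K (n + 1) = M) : psum (del K s) n = M := by
  have h1 := upd_psum (K := del K s) (m := n + 1) (n := 0) (l := n) (s := s) (W := 0)
    (B := psum (del K s) n - psum (del K s) s) 0 hs rfl rfl rfl rfl
    (by have := psum_mono (del K s) (by omega : s ≤ n); omega)
  rw [upd_del h, hM] at h1
  have := psum_mono (del K s) (by omega : s ≤ n)
  omega

theorem endCirc_endUnit_val {m l : ℕ} {i : ℤ} (s : Fin m) (hl : l + 1 = m + 0) (ht : i + 0 = i)
    (f : EndObj Q m i) (r : ℕ) (L : ℕ → ℕ) (M : ℕ) (hM : psum L l = M)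
    (h : psum (upd L s 0 0) m = M) :
    (endCirc s hl ht f (endUnit Q)).val r L M hM = f.val r (upd L s 0 0) M h := by
  obtain ⟨B, hB⟩ := exists_splitPoint (K := L) s.isLt hl
  have hB' : psum L s + 0 + B = M := by rw [← hM, ← hB]; rfl
  have h0 : (endUnit Q).val 0 (res L s) 0 (psum_zero _) = Q.perm 1 := famUnit_zero _
  rw [endCirc_val s hl ht f _ r L M hM (W := 0) 1 rfl (psum_zero _) hB' Nat.zero_lt_one,
    Finset.sum_range_one, h0]
  have key : ∀ (N : ℕ) (hN : psum L s + 0 + B = N) (h' : psum (upd L s 0 0) m = N)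
      (h'' : psum L s + 0 + B = M),
      Q.comp ht (f.val r (upd L s 0 0) N h') (Q.pad (psum L s) B h'' hN (Q.perm 1)) =
        f.val r (upd L s 0 0) M h := by
    intro N hN h' h''
    obtain rfl : M = N := by omega
    rw [Q.pad_one, Q.comp_one]
  exact key _ rfl _ _

theorem val_eq_endCirc_endUnit {l : ℕ} {i : ℤ} (s : Fin (l + 1)) (ht : i + 0 = i)
    (f : EndObj Q (l + 1) i) (r : ℕ) (K : ℕ → ℕ) (M : ℕ) (hM : psum K (l + 1) = M)
    (h : K s = 0) : f.val r K M hM =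
      (endCirc s (add_zero _).symm ht f (endUnit Q)).val r (del K s) M (psum_del s.isLt h hM) := by
  rw [endCirc_endUnit_val s _ ht f r _ M _ (by rw [upd_del h]; exact hM)]
  exact f.congr (fun j _ => by rw [upd_del h]) _ _

end Unit
end XB

namespace XB
open scoped DirectSum TensorProduct

section Existence

variable {k : Type u} [Field k] {X : CoalgOperad k} {Q : PROP k}

theorem CoalgOperad.exists_unit (X : CoalgOperad k) : ∃ u : X.obj 0 0, X.counitLin 0 0 u = 1 := by
  by_contra! h
  have h0 : ∀ x : X.obj 0 0, X.counitLin 0 0 x = 0 := by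
    intro x
    by_contra hx
    exact h ((X.counitLin 0 0 x)⁻¹ • x) (by rw [map_smul, smul_eq_mul, inv_mul_cancel₀ hx])
  have h1 : (Coalgebra.counit (R := k) (A := ⨁ i, X.obj 0 i)) = 0 := by
    refine DirectSum.linearMap_ext k fun i => LinearMap.ext fun x => ?_
    by_cases hi : i = 0
    · subst hi
      exact h0 x
    · exact X.counit_graded x hi
  obtain ⟨z, hz⟩ := X.counit_bijective_zero.2 1
  rw [h1] at hz
  exact zero_ne_one hz

theorem CoalgOperad.eq_smul_unit {u : X.obj 0 0} (hu : X.counitLin 0 0 u = 1) (x : X.obj 0 0) :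
    x = X.counitLin 0 0 x • u := by
  refine sub_eq_zero.1 (X.eq_zero_of_counit X.counit_bijective_zero _ ?_)
  rw [← X.counitLin_apply, map_sub, map_smul, hu, smul_eq_mul, mul_one, sub_self]

theorem CoalgOperad.eq_zero_of_nullary {i : ℤ} (x : X.obj 0 i) (hi : i ≠ 0) : x = 0 :=
  X.eq_zero_of_counit X.counit_bijective_zero _ (X.counit_graded x hi)

theorem endCirc_smul_left {m n l : ℕ} {i j t : ℤ} (s : Fin m) (hl : l + 1 = m + n) (ht : i + j = t)
    (c : k) (f : EndObj Q m i) (g : EndObj Q n j) :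
    endCirc s hl ht (c • f) g = c • endCirc s hl ht f g :=
  (endCircLin s hl ht).map_smul₂ c f g

theorem endCirc_smul_right {m n l : ℕ} {i j t : ℤ} (s : Fin m) (hl : l + 1 = m + n)
    (ht : i + j = t) (c : k) (f : EndObj Q m i) (g : EndObj Q n j) :
    endCirc s hl ht f (c • g) = c • endCirc s hl ht f g :=
  (endCircLin s hl ht f).map_smul c g

theorem endCirc_zero_left {m n l : ℕ} {i j t : ℤ} (s : Fin m) (hl : l + 1 = m + n) (ht : i + j = t)
    (g : EndObj Q n j) : endCirc s hl ht (0 : EndObj Q m i) g = 0 :=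
  (endCircLin s hl ht).map_zero₂ g

theorem endCirc_zero_right {m n l : ℕ} {i j t : ℤ} (s : Fin m) (hl : l + 1 = m + n)
    (ht : i + j = t) (f : EndObj Q m i) : endCirc s hl ht f (0 : EndObj Q n j) = 0 :=
  (endCircLin s hl ht f).map_zero

theorem map_circ_unary_left {Φ : ∀ n i, X.obj n i →ₗ[k] EndObj Q n i}
    (h : Φ 1 0 X.one = endOne Q) {n l : ℕ} {i j t : ℤ} (s : Fin 1) (hl : l + 1 = 1 + n)
    (ht : i + j = t) (x : X.obj 1 i) (y : X.obj n j) :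
    Φ l t (X.circ s hl ht x y) = endCirc s hl ht (Φ 1 i x) (Φ n j y) := by
  by_cases hi : i = 0
  · subst hi
    obtain rfl : j = t := by omega
    obtain rfl : n = l := by omega
    rw [X.eq_smul_one x, map_smul, map_smul, LinearMap.smul_apply, X.one_circ, map_smul, h,
      endCirc_smul_left, endOne_circ]
  · rw [X.eq_zero_of_degree_ne x hi, map_zero, map_zero, LinearMap.zero_apply, map_zero,
      endCirc_zero_left]

theorem map_circ_unary_right {Φ : ∀ n i, X.obj n i →ₗ[k] EndObj Q n i}
    (h : Φ 1 0 X.one = endOne Q) {m l : ℕ} {i j t : ℤ} (s : Fin m) (hl : l + 1 = m + 1)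
    (ht : i + j = t) (x : X.obj m i) (y : X.obj 1 j) :
    Φ l t (X.circ s hl ht x y) = endCirc s hl ht (Φ m i x) (Φ 1 j y) := by
  by_cases hi : j = 0
  · subst hi
    obtain rfl : i = t := by omega
    obtain rfl : m = l := by omega
    rw [X.eq_smul_one y, map_smul, map_smul, X.circ_one, map_smul, h,
      endCirc_smul_right, endCirc_one]
  · rw [X.eq_zero_of_degree_ne y hi, map_zero, map_zero, map_zero, endCirc_zero_right]

theorem exists_glue {E : Type*} [AddCommGroup E] [Module k E] {n : ℕ} {i : ℤ}
    (Λ : Fin (n + 1) → E →ₗ[k] EndObj Q n i) (g : E →ₗ[k] Fam Q (n + 1) 1 i)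
    (hΛ : ∀ a b : Fin (n + 1), a < b → ∀ (x : E) (K : ℕ → ℕ) (M : ℕ) (h : psum K (n + 1) = M)
      (ha : K a = 0) (hb : K b = 0), (Λ a x).val 1 (del K a) M (psum_del a.isLt ha h) =
        (Λ b x).val 1 (del K b) M (psum_del b.isLt hb h)) :
    ∃ θ : E →ₗ[k] Fam Q (n + 1) 1 i,
      (∀ (x : E) (a : Fin (n + 1)) (K : ℕ → ℕ) (M : ℕ) (h : psum K (n + 1) = M) (ha : K a = 0),
        (θ x).val K M h = (Λ a x).val 1 (del K a) M (psum_del a.isLt ha h)) ∧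
      ∀ (x : E) (K : ℕ → ℕ) (M : ℕ) (h : psum K (n + 1) = M), (∀ a : Fin (n + 1), K a ≠ 0) →
        (θ x).val K M h = (g x).val K M h := by
  classical
  have hΛ' : ∀ (a b : Fin (n + 1)) (x : E) (K : ℕ → ℕ) (M : ℕ) (h : psum K (n + 1) = M)
      (ha : K a = 0) (hb : K b = 0), (Λ a x).val 1 (del K a) M (psum_del a.isLt ha h) =
        (Λ b x).val 1 (del K b) M (psum_del b.isLt hb h) := by
    intro a b x K M h ha hb
    rcases lt_trichotomy a b with hab | rfl | hab
    · exact hΛ a b hab x K M h ha hb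
    · rfl
    · exact (hΛ b a hab x K M h hb ha).symm
  have hval : ∀ (x : E) (K : ℕ → ℕ) (M : ℕ) (h : psum K (n + 1) = M), ∃ v : Q.Hom M 1 i,
      (∀ (a : Fin (n + 1)) (ha : K a = 0), v = (Λ a x).val 1 (del K a) M (psum_del a.isLt ha h)) ∧
      ((∀ a : Fin (n + 1), K a ≠ 0) → v = (g x).val K M h) := by
    intro x K M h
    by_cases hz : ∃ a : Fin (n + 1), K a = 0
    · obtain ⟨a, ha⟩ := hz
      exact ⟨_, fun b hb => hΛ' a b x K M h ha hb, fun h0 => absurd ha (h0 a)⟩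
    · push Not at hz
      exact ⟨_, fun a ha => absurd ha (hz a), fun _ => rfl⟩
  choose v hv₁ hv₂ using hval
  have hcases : ∀ K : ℕ → ℕ, (∃ a : Fin (n + 1), K a = 0) ∨ ∀ a : Fin (n + 1), K a ≠ 0 := by
    intro K
    by_cases hz : ∃ a : Fin (n + 1), K a = 0
    · exact Or.inl hz
    · exact Or.inr fun a ha => hz ⟨a, ha⟩
  refine ⟨⟨⟨fun x => Fam.mk (v x) fun K K' hK M h h' => ?_, fun x y => Fam.ext fun K M h => ?_⟩,
    fun c x => Fam.ext fun K M h => ?_⟩, fun x a K M h ha => hv₁ x K M h a ha,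
    fun x K M h h0 => hv₂ x K M h h0⟩
  · rcases hcases K with ⟨a, ha⟩ | h0
    · rw [hv₁ x K M h a ha, hv₁ x K' M h' a (by rw [← hK a a.isLt, ha])]
      refine EndObj.congr _ (fun j hj => ?_) _ _
      unfold del
      split_ifs
      · exact hK j (by omega)
      · exact hK _ (by omega)
    · rw [hv₂ x K M h h0, hv₂ x K' M h' fun a => by rw [← hK a a.isLt]; exact h0 a]
      exact Fam.congr _ hK _ _
  · change v (x + y) K M h = v x K M h + v y K M h
    rcases hcases K with ⟨a, ha⟩ | h0
    · rw [hv₁ _ K M h a ha, hv₁ _ K M h a ha, hv₁ _ K M h a ha, map_add, EndObj.val_add]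
    · rw [hv₂ _ K M h h0, hv₂ _ K M h h0, hv₂ _ K M h h0, map_add, Fam.val_add]
  · change v (c • x) K M h = c • v x K M h
    rcases hcases K with ⟨a, ha⟩ | h0
    · rw [hv₁ _ K M h a ha, hv₁ _ K M h a ha, map_smul, EndObj.val_smul]
    · rw [hv₂ _ K M h h0, hv₂ _ K M h h0, map_smul, Fam.val_smul]

variable {V : ∀ n i, Submodule k (X.obj n i)}

/-- An `X`-algebra structure for the operations of arity `≤ N`, with given values on
generators. -/
structure IsPartialRep (G : ∀ n i, V n i →ₗ[k] Fam Q n 1 i) (N : ℕ)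
    (Φ : ∀ n i, X.obj n i →ₗ[k] EndObj Q n i) : Prop where
  coalg : ∀ n ≤ N, IsCoalgMap (Φ n)
  map_unit : ∀ u : X.obj 0 0, X.counitLin 0 0 u = 1 → Φ 0 0 u = endUnit Q
  map_one : Φ 1 0 X.one = endOne Q
  map_circ : ∀ {m n l : ℕ} {i j t : ℤ}, m ≤ N → n ≤ N → l ≤ N → ∀ (s : Fin m)
    (hl : l + 1 = m + n) (ht : i + j = t) (x : X.obj m i) (y : X.obj n j),
    Φ l t (X.circ s hl ht x y) = endCirc s hl ht (Φ m i x) (Φ n j y)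
  gen : ∀ n, 2 ≤ n → n ≤ N → ∀ (i : ℤ) (v : V n i) (K : ℕ → ℕ) (M : ℕ) (h : psum K n = M),
    (∀ a : Fin n, K a ≠ 0) → (Φ n i v).val 1 K M h = (G n i v).val K M h

variable {G : ∀ n i, V n i →ₗ[k] Fam Q n 1 i} {Φ : ∀ n i, X.obj n i →ₗ[k] EndObj Q n i} {p : ℕ}
  {u : X.obj 0 0}

theorem IsPartialRep.unit_circ_unit (hΦ : IsPartialRep G (p + 1) Φ) (hu : X.counitLin 0 0 u = 1)
    {i : ℤ} (x : X.obj (p + 2) i) (a b : Fin (p + 2)) (hab : a < b) (K : ℕ → ℕ) (M : ℕ)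
    (h : psum K (p + 2) = M) (ha : K a = 0) (hb : K b = 0) :
    (Φ (p + 1) i (X.circ a (add_zero _).symm (add_zero i) x u)).val 1 (del K a) M
        (psum_del a.isLt ha h) =
      (Φ (p + 1) i (X.circ b (add_zero _).symm (add_zero i) x u)).val 1 (del K b) M
        (psum_del b.isLt hb h) := by
  have hab' : (a : ℕ) < b := hab
  have hb' := b.isLt
  have e : del (del K b) a = del (del K a) (b - 1) := by
    funext j
    unfold del
    split_ifs <;> first | rfl | omega
  have ha1 : del K b a = 0 := by simp [del, hab', ha]
  have hb1 : del K a (b - 1) = 0 := by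
    rw [del, if_neg (by omega), show (b : ℕ) - 1 + 1 = b by omega, hb]
  rw [val_eq_endCirc_endUnit (⟨b - 1, by omega⟩ : Fin (p + 1)) (add_zero i) _ 1 _ M _ hb1,
    val_eq_endCirc_endUnit (⟨a, by omega⟩ : Fin (p + 1)) (add_zero i) _ 1 _ M _ ha1,
    ← hΦ.map_unit u hu, ← hΦ.map_circ le_rfl (by omega) (by omega),
    ← hΦ.map_circ le_rfl (by omega) (by omega),
    X.circ_par (l := p + 1) (l' := p + 1) a b hab ⟨b - 1, by omega⟩ ⟨a, by omega⟩ (by simp; omega) rfl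
      (add_zero (p + 1 + 1)).symm (add_zero (p + 1)).symm (add_zero (p + 1 + 1)).symm
      (add_zero (p + 1)).symm (add_zero i) (add_zero i) (add_zero i) (add_zero i) x u u]
  simp only [mul_zero, Int.negOnePow_zero, one_smul]
  exact EndObj.congr _ (fun j _ => by simp only [e]) _ _

theorem IsPartialRep.circ_circ_unit (hΦ : IsPartialRep G (p + 1) Φ) (hu : X.counitLin 0 0 u = 1)
    {m n : ℕ} {i j t : ℤ} (hm : 2 ≤ m) (hn : 2 ≤ n) (s : Fin m) (hl : p + 2 + 1 = m + n)
    (ht : i + j = t) (x : X.obj m i) (y : X.obj n j) (a : Fin (p + 2)) :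
    Φ (p + 1) t (X.circ a (add_zero _).symm (add_zero t) (X.circ s hl ht x y) u) =
      endCirc a (add_zero _).symm (add_zero t) (endCirc s hl ht (Φ m i x) (Φ n j y))
        (endUnit Q) := by
  have hs := s.isLt
  have ha := a.isLt
  rw [← hΦ.map_unit u hu]
  by_cases h1 : (a : ℕ) < s
  · have hX := X.circ_par (⟨a, by omega⟩ : Fin m) s h1 (⟨s - 1, by omega⟩ : Fin (m - 1)) a
      (by simp; omega) rfl (by omega) (by omega : p + 1 + 1 = m - 1 + n) hl (add_zero _).symm
      (add_zero i) ht ht (add_zero t) x u y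
    have hE := endCirc_par (P := Q) (⟨a, by omega⟩ : Fin m) s h1 (⟨s - 1, by omega⟩ : Fin (m - 1)) a
      (by simp; omega) rfl (by omega) (by omega : p + 1 + 1 = m - 1 + n) hl (add_zero _).symm
      (add_zero i) ht ht (add_zero t) (Φ m i x) (Φ 0 0 u) (Φ n j y)
    simp only [zero_mul, Int.negOnePow_zero, one_smul] at hX hE
    rw [← hX, ← hE, hΦ.map_circ (by omega) (by omega) (by omega),
      hΦ.map_circ (by omega) (by omega) (by omega)]
  by_cases h2 : (a : ℕ) < s + n
  · rw [X.circ_seq s (⟨a - s, by omega⟩ : Fin n) a (by simp; omega) hl (add_zero _).symm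
      (by omega : n - 1 + 1 = n + 0) (by omega) ht (add_zero t) (add_zero j) ht,
      endCirc_seq s (⟨a - s, by omega⟩ : Fin n) a (by simp; omega) hl (add_zero _).symm
      (by omega : n - 1 + 1 = n + 0) (by omega) ht (add_zero t) (add_zero j) ht,
      hΦ.map_circ (by omega) (by omega) (by omega), hΦ.map_circ (by omega) (by omega) (by omega)]
  · have h3 : s < (⟨a + 1 - n, by omega⟩ : Fin m) := by
      rw [Fin.lt_def]; simp; omega
    rw [X.circ_par s (⟨a + 1 - n, by omega⟩ : Fin m) h3 a (⟨s, by omega⟩ : Fin (m - 1))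
        (by simp; omega) rfl hl (add_zero _).symm (by omega : m - 1 + 1 = m + 0) (by omega) ht
        (add_zero t) (add_zero i) ht,
      endCirc_par s (⟨a + 1 - n, by omega⟩ : Fin m) h3 a (⟨s, by omega⟩ : Fin (m - 1))
        (by simp; omega) rfl hl (add_zero _).symm (by omega : m - 1 + 1 = m + 0) (by omega) ht
        (add_zero t) (add_zero i) ht]
    simp only [mul_zero, Int.negOnePow_zero, one_smul]
    rw [hΦ.map_circ (by omega) (by omega) (by omega), hΦ.map_circ (by omega) (by omega) (by omega)]

end Existence
end XB

namespace XB
open scoped DirectSum TensorProduct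

section Existence

variable {k : Type u} [Field k] {X : CoalgOperad k} {Q : PROP k}
  {V : ∀ n i, Submodule k (X.obj n i)} {G : ∀ n i, V n i →ₗ[k] Fam Q n 1 i}
  {Φ : ∀ n i, X.obj n i →ₗ[k] EndObj Q n i} {p : ℕ}

/-- The components in degree `1` of the compositions of arity `N` in the endomorphism operad. -/
noncomputable def endCircValues (Φ : ∀ n i, X.obj n i →ₗ[k] EndObj Q n i) (N : ℕ) :
    CircValues X N (fun t => Fam Q N 1 t) :=
  fun {m n i j _} s hl ht => ((endCircLin s hl ht).compl₁₂ (Φ m i) (Φ n j)).compr₂ (EndObj.fam 1)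

theorem endCircValues_apply (Φ : ∀ n i, X.obj n i →ₗ[k] EndObj Q n i) {N m n : ℕ} {i j t : ℤ}
    (s : Fin m) (hl : N + 1 = m + n) (ht : i + j = t) (x : X.obj m i) (y : X.obj n j) :
    endCircValues Φ N s hl ht x y = (endCirc s hl ht (Φ m i x) (Φ n j y)).fam 1 := rfl

theorem IsPartialRep.isAssoc {N : ℕ} (hΦ : IsPartialRep G N Φ) :
    CircValues.IsAssoc (endCircValues Φ (N + 1)) where
  seq hm hn hp s r sr hsr h₁ h₂ h₃ h₄ e₁ e₂ e₃ e₄ x y z := by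
    have hs := s.isLt
    have hr := r.isLt
    rw [endCircValues_apply, endCircValues_apply, hΦ.map_circ (by omega) (by omega) (by omega),
      hΦ.map_circ (by omega) (by omega) (by omega),
      endCirc_seq s r sr hsr h₁ h₂ h₃ h₄ e₁ e₂ e₃ e₄]
  par hm hn hp s r hsr r' s' hr' hs' h₁ h₂ h₃ h₄ e₁ e₂ e₃ e₄ x y z := by
    rw [endCircValues_apply, endCircValues_apply, hΦ.map_circ (by omega) (by omega) (by omega),
      hΦ.map_circ (by omega) (by omega) (by omega),
      endCirc_par s r hsr r' s' hr' hs' h₁ h₂ h₃ h₄ e₁ e₂ e₃ e₄, negOnePow_smul (k := k),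
      negOnePow_smul (k := k), map_smul]

theorem IsPartialRep.exists_component (hV : X.toNSOperad.PosFreelyGenerated V)
    (hΦ : IsPartialRep G (p + 1) Φ) {u : X.obj 0 0} (hu : X.counitLin 0 0 u = 1) :
    ∃ θ : ∀ i, X.obj (p + 2) i →ₗ[k] Fam Q (p + 2) 1 i,
      (∀ i (x : X.obj (p + 2) i) (a : Fin (p + 2)) (K : ℕ → ℕ) (M : ℕ) (h : psum K (p + 2) = M)
        (ha : K a = 0), (θ i x).val K M h =
          (Φ (p + 1) i (X.circ a (add_zero _).symm (add_zero i) x u)).val 1 (del K a) M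
            (psum_del a.isLt ha h)) ∧
      (∀ {m n : ℕ} {i j t : ℤ}, 2 ≤ m → 2 ≤ n → ∀ (s : Fin m) (hl : p + 2 + 1 = m + n)
        (ht : i + j = t) (x : X.obj m i) (y : X.obj n j),
        θ t (X.circ s hl ht x y) = (endCirc s hl ht (Φ m i x) (Φ n j y)).fam 1) ∧
      (∀ i (v : V (p + 2) i) (K : ℕ → ℕ) (M : ℕ) (h : psum K (p + 2) = M),
        (∀ a : Fin (p + 2), K a ≠ 0) → (θ i v).val K M h = (G (p + 2) i v).val K M h) := by
  obtain ⟨g, hg₁, hg₂⟩ := hV.exists_extension (by omega) hΦ.isAssoc (G (p + 1 + 1))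
  choose θ hθ₁ hθ₂ using fun i => exists_glue
    (fun a => (Φ (p + 1) i).comp ((X.circ a (add_zero (p + 1 + 1)).symm (add_zero i)).flip u)) (g i)
    (fun a b hab x => hΦ.unit_circ_unit hu x a b hab)
  refine ⟨θ, hθ₁, fun {m n i j t} hm hn s hl ht x y => Fam.ext fun K M h => ?_,
    fun i v K M h h0 => by rw [hθ₂ i v K M h h0, hg₁]⟩
  by_cases hz : ∃ a : Fin (p + 1 + 1), K a = 0
  · obtain ⟨a, ha⟩ := hz
    rw [hθ₁ t _ a K M h ha]
    change (Φ (p + 1) t (X.circ a _ _ _ u)).val 1 _ _ _ = (endCirc s hl ht _ _).val 1 _ _ _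
    rw [hΦ.circ_circ_unit hu hm hn, val_eq_endCirc_endUnit a (add_zero t) _ 1 K M h ha]
  · rw [hθ₂ t _ K M h fun a ha => hz ⟨a, ha⟩, hg₂ hm hn s hl ht, endCircValues_apply]

theorem IsPartialRep.exists_succ (hV : X.toNSOperad.PosFreelyGenerated V)
    (hΦ : IsPartialRep G (p + 1) Φ) :
    ∃ Φ', IsPartialRep G (p + 2) Φ' ∧ ∀ n ≤ p + 1, Φ' n = Φ n := by
  obtain ⟨u, hu⟩ := X.exists_unit
  obtain ⟨θ, hθ₁, hθ₂, hθ₃⟩ := hΦ.exists_component hV hu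
  obtain ⟨Ψ, hΨ, hΨθ⟩ := exists_isCoalgMap θ fun i x K M h hM => by
    obtain rfl : M = 0 := by omega
    rw [hθ₁ i x 0 K 0 h (eq_zero_of_psum h 0 (by omega)), EndObj.vanish _ _ hM]
  obtain ⟨Φ', hself, hne⟩ : ∃ Φ' : ∀ n i, X.obj n i →ₗ[k] EndObj Q n i,
      Φ' (p + 2) = Ψ ∧ ∀ n ≤ p + 1, Φ' n = Φ n :=
    ⟨Function.update Φ (p + 2) Ψ, Function.update_self _ _ _,
      fun n hn => Function.update_of_ne (by omega) _ _⟩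
  have hone : Φ' 1 0 X.one = endOne Q := by rw [hne 1 (by omega), hΦ.map_one]
  have hcoalg : ∀ n ≤ p + 2, IsCoalgMap (Φ' n) := by
    intro n hn
    by_cases h : n = p + 2
    · subst h
      rw [hself]
      exact hΨ
    · rw [hne n (by omega)]
      exact hΦ.coalg n (by omega)
  refine ⟨Φ', ⟨hcoalg, fun v hv => by rw [hne 0 (by omega), hΦ.map_unit v hv], hone, ?_, ?_⟩, hne⟩
  · intro m n l i j t hm hn hlN s hl ht x y
    have hs := s.isLt
    by_cases hm1 : m = 1
    · subst hm1
      exact map_circ_unary_left hone s hl ht x y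
    by_cases hn1 : n = 1
    · subst hn1
      exact map_circ_unary_right hone s hl ht x y
    refine (hcoalg m hm).map_circ (hcoalg n hn) (hcoalg l hlN) s hl ?_ ht x y
    intro i j t ht x y
    by_cases hn0 : n = 0
    · subst hn0
      by_cases hmN : m = p + 2
      · subst hmN
        obtain rfl : l = p + 1 := by omega
        rw [hne (p + 1) le_rfl, hne 0 (by omega), hself]
        by_cases hj : j = 0
        · subst hj
          obtain rfl : i = t := by omega
          rw [X.eq_smul_unit hu y, map_smul, map_smul, map_smul, map_smul, endCirc_smul_right,
            map_smul, hΦ.map_unit u hu]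
          congr 1
          refine Fam.ext fun L M hM => ?_
          have hL : psum (upd L s 0 0) (p + 2) = M := by
            obtain ⟨B, hB⟩ := exists_splitPoint (K := L) hs hl
            rw [upd_psum 0 hs hl rfl rfl rfl hB, ← hM, ← hB]; rfl
          change _ = (endCirc s hl ht _ _).val 1 L M hM
          rw [endCirc_endUnit_val s hl ht _ 1 L M hM hL]
          change _ = ((Ψ i x).fam 1).val _ _ _
          rw [hΨθ, hθ₁ i x s _ M hL (upd_same _ _ _ _)]
          exact EndObj.congr _ (fun j _ => by rw [del_upd]) _ _
        · rw [X.eq_zero_of_nullary y hj, map_zero, map_zero, map_zero, map_zero, endCirc_zero_right,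
            map_zero]
      · rw [hne m (by omega), hne 0 (by omega), hne l (by omega),
          hΦ.map_circ (by omega) (by omega) (by omega)]
    · by_cases hlN' : l = p + 2
      · subst hlN'
        rw [hne m (by omega), hne n (by omega), hself, hΨθ, hθ₂ (by omega) (by omega)]
      · rw [hne m (by omega), hne n (by omega), hne l (by omega),
          hΦ.map_circ (by omega) (by omega) (by omega)]
  · intro n hn hnN i v K M h h0
    by_cases hnp : n = p + 2
    · subst hnp
      rw [hself]
      change ((Ψ i v).fam 1).val K M h = _
      rw [hΨθ, hθ₃ i v K M h h0]
    · rw [hne n (by omega)]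
      exact hΦ.gen n hn (by omega) i v K M h h0

theorem IsCoalgMap.map_unit {Φ : ∀ i, X.obj 0 i →ₗ[k] EndObj Q 0 i} (hΦ : IsCoalgMap Φ)
    {u : X.obj 0 0} (hu : X.counitLin 0 0 u = 1) : Φ 0 u = endUnit Q := by
  refine Subtype.ext (funext fun r => ?_)
  cases r with
  | zero =>
    change (Φ 0 u).fam 0 = _
    rw [hΦ.counit, ← X.counitLin_apply, hu, one_smul]; rfl
  | succ r =>
    refine Fam.ext fun K M hM => (Φ 0 u).vanish hM ?_
    rw [← hM]
    exact Nat.succ_pos r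

theorem exists_isPartialRep_one (G : ∀ n i, V n i →ₗ[k] Fam Q n 1 i) :
    ∃ Φ, IsPartialRep G 1 Φ := by
  obtain ⟨Φ₀, h₀, _⟩ := exists_isCoalgMap (X := X) (Q := Q) (n := 0) (fun _ => 0)
    (fun _ _ _ _ _ _ => rfl)
  obtain ⟨Φ₁, h₁, h₁'⟩ := exists_isCoalgMap (X := X) (scaleFam X ((endOne Q).fam 1))
    (fun i x K M h hM => by
      by_cases hi : i = 0
      · subst hi
        rw [scaleFam_zero, Fam.val_smul]
        exact (congrArg _ (endOne_ne h (by omega))).trans (smul_zero _)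
      · rw [scaleFam_ne _ hi]; rfl)
  obtain ⟨Φ, e₀, e₁⟩ : ∃ Φ : ∀ n i, X.obj n i →ₗ[k] EndObj Q n i, Φ 0 = Φ₀ ∧ Φ 1 = Φ₁ :=
    ⟨fun | 0 => Φ₀ | 1 => Φ₁ | _ + 2 => fun _ => 0, rfl, rfl⟩
  have hone : Φ 1 0 X.one = endOne Q := by
    rw [e₁]
    have h : ∀ r, (Φ₁ 0 X.one).fam r = (endOne Q).fam r := by
      intro r
      induction r with
      | zero => rw [h₁.counit, endOne_fam_zero, ← X.counitLin_apply, X.counitLin_one, one_smul]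
      | succ r ih =>
        rw [h₁.fam_eq X.one (add_comm 1 r), X.comul_one, convEval_lof _ _ _ (add_zero 0),
          LinearMap.comp_apply, LinearMap.comp_apply, ih, h₁', scaleFam_zero, X.counitLin_one,
          one_smul, conv_endOne]
    exact Subtype.ext (funext h)
  refine ⟨Φ, fun n hn => ?_, fun u hu => ?_, hone, ?_, fun n hn hn' => by omega⟩
  · interval_cases n
    · rw [e₀]; exact h₀
    · rw [e₁]; exact h₁
  · rw [e₀, h₀.map_unit hu]
  · intro m n l i j t hm hn hl' s hl ht x y
    have hs := s.isLt
    obtain rfl : m = 1 := by omega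
    exact map_circ_unary_left hone s hl ht x y

theorem exists_representation (hV : X.toNSOperad.PosFreelyGenerated V)
    (G : ∀ n i, V n i →ₗ[k] Fam Q n 1 i) {d : Fam Q 1 1 1}
    (hd : ∀ K M (h : psum K 1 = M), M ≤ 1 → d.val K M h = 0) :
    ∃ ρ : Rep X Q, ρ.D.fam 1 = d ∧ ∀ n, 2 ≤ n → ∀ (i : ℤ) (v : V n i) (K : ℕ → ℕ) (M : ℕ)
      (h : psum K n = M), (∀ a : Fin n, K a ≠ 0) →
      (ρ.Φ n i v).val 1 K M h = (G n i v).val K M h := by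
  obtain ⟨D, hD, hDd⟩ := exists_isCoder hd
  obtain ⟨Φ₁, h₁⟩ := exists_isPartialRep_one (Q := Q) G
  choose next hnext hagree using fun (p : ℕ) (Φ : {Φ // IsPartialRep G (p + 1) Φ}) =>
    Φ.2.exists_succ hV
  let seq : ∀ p, {Φ // IsPartialRep G (p + 1) Φ} := fun p =>
    Nat.rec ⟨Φ₁, h₁⟩ (fun p Φ => ⟨next p Φ, hnext p Φ⟩) p
  have hseq : ∀ p n, n ≤ p + 1 → (seq (p + 1)).1 n = (seq p).1 n :=
    fun p n hn => hagree p (seq p) n hn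
  have hseq' : ∀ p n, n ≤ p + 1 → (seq p).1 n = (seq n).1 n := by
    intro p n hn
    induction p with
    | zero =>
      interval_cases n
      · rfl
      · exact (hseq 0 1 le_rfl).symm
    | succ p ih =>
      by_cases h : n ≤ p + 1
      · rw [hseq p n h, ih h]
      · obtain rfl : n = p + 1 + 1 := by omega
        exact (hseq (p + 1) _ le_rfl).symm
  refine ⟨⟨fun n => (seq n).1 n, D, fun n => (seq n).2.coalg n (by omega), hD, ?_, ?_⟩, hDd, ?_⟩
  · exact (seq 1).2.map_one
  · intro m n l i j t s hl ht x y
    rw [← hseq' (m + n) m (by omega), ← hseq' (m + n) n (by omega),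
      ← hseq' (m + n) l (by omega)]
    exact (seq (m + n)).2.map_circ (by omega) (by omega) (by omega) s hl ht x y
  · intro n hn i v K M h h0
    exact (seq n).2.gen n hn (by omega) i v K M h h0

end Existence
end XB

namespace XB
open scoped DirectSum TensorProduct

section Generation

variable {k : Type u} [Field k] {P : PROP k} {S : ∀ m n i, Submodule k (P.Hom m n i)}

theorem PROP.IsClosed.conv_mem (hS : P.IsClosed S) {n r r' R : ℕ} {a b t : ℤ} (hR : r + r' = R)
    (e : a + b = t) {f : Fam P n r a} {g : Fam P n r' b}
    (hf : ∀ K M (h : psum K n = M), f.val K M h ∈ S M r a)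
    (hg : ∀ K M (h : psum K n = M), g.val K M h ∈ S M r' b) (K : ℕ → ℕ) (M : ℕ)
    (h : psum K n = M) : (conv hR e f g).val K M h ∈ S M R t := by
  rw [conv_val]
  refine Submodule.sum_mem _ fun p hp => ?_
  have h' := psum_add_sub (mem_box.1 hp).1 h
  rw [convTerm_eq hR e f g rfl rfl h' h']
  exact hS.comp_mem _ _ _ (hS.hcomp_mem _ _ _ _ _ (hf _ _ _) (hg _ _ _)) (hS.perm_mem _)

theorem PROP.IsClosed.endCirc_mem (hS : P.IsClosed S) {m n l : ℕ} {i j t : ℤ} (s : Fin m)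
    (hl : l + 1 = m + n) (ht : i + j = t) {f : EndObj P m i} {g : EndObj P n j}
    (hf : ∀ r K M (h : psum K m = M), f.val r K M h ∈ S M r i)
    (hg : ∀ r K M (h : psum K n = M), g.val r K M h ∈ S M r j) (r : ℕ) (K : ℕ → ℕ) (M : ℕ)
    (h : psum K l = M) : (endCirc s hl ht f g).val r K M h ∈ S M r t := by
  subst h
  obtain ⟨B, hB⟩ := exists_splitPoint (K := K) s.isLt hl
  rw [endCirc_val s hl ht f g r K _ rfl _ rfl rfl hB (Nat.lt_succ_self _)]
  exact Submodule.sum_mem _ fun q _ => hS.comp_mem _ _ _ (hf _ _ _ _) (hS.pad_mem _ _ _ _ (hg _ _ _ _))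

theorem PROP.IsClosed.endOne_mem (hS : P.IsClosed S) (r : ℕ) (K : ℕ → ℕ) (M : ℕ)
    (h : psum K 1 = M) : (endOne P).val r K M h ∈ S M r 0 := by
  by_cases hM : M = r
  · subst hM
    rw [endOne_self]
    exact hS.perm_mem 1
  · rw [endOne_ne h hM]
    exact Submodule.zero_mem _

theorem PROP.IsClosed.coder_mem (hS : P.IsClosed S) {D : EndObj P 1 1} (hD : IsCoder D)
    (h : ∀ l, 1 < l → D.val 1 (fun _ => l) l (psum_const_one l) ∈ S l 1 1) (r : ℕ) :
    ∀ K M (hM : psum K 1 = M), D.val r K M hM ∈ S M r 1 := by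
  have h1 : ∀ K M (hM : psum K 1 = M), D.val 1 K M hM ∈ S M 1 1 := by
    intro K M hM
    by_cases hM1 : 1 < M
    · rw [D.congr (K' := fun _ => M) (fun j hj => by
        obtain rfl : j = 0 := by omega
        rw [← hM]; simp [psum]) _ (psum_const_one M)]
      exact h M hM1
    · rw [hD.zero hM (by omega)]
      exact Submodule.zero_mem _
  induction r with
  | zero =>
    intro K M hM
    rw [hD.zero hM (by omega)]
    exact Submodule.zero_mem _
  | succ r ih =>
    intro K M hM
    change (D.fam (r + 1)).val K M hM ∈ _
    rw [hD.comul (add_comm 1 r)]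
    exact Submodule.add_mem _ (hS.conv_mem _ _ h1 (hS.endOne_mem r) K M hM)
      (hS.conv_mem _ _ (hS.endOne_mem 1) ih K M hM)

variable {X : CoalgOperad k}

theorem PROP.IsClosed.coalg_mem (hS : P.IsClosed S) {n : ℕ}
    {Φ : ∀ i, X.obj n i →ₗ[k] EndObj P n i} (hΦ : IsCoalgMap Φ)
    (h : ∀ i (x : X.obj n i) K M (hM : psum K n = M), (Φ i x).val 1 K M hM ∈ S M 1 i) (r : ℕ) :
    ∀ {i : ℤ} (x : X.obj n i) K M (hM : psum K n = M), (Φ i x).val r K M hM ∈ S M r i := by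
  induction r with
  | zero =>
    intro i x K M hM
    change ((Φ i x).fam 0).val K M hM ∈ _
    by_cases hi : i = 0
    · subst hi
      rw [hΦ.counit, Fam.val_smul]
      refine Submodule.smul_mem _ _ ?_
      by_cases h0 : M = 0
      · subst h0
        rw [famUnit_zero]
        exact hS.perm_mem 1
      · rw [famUnit_ne hM h0]
        exact Submodule.zero_mem _
    · rw [hΦ.counit_ne x hi]
      exact Submodule.zero_mem _
  | succ r ih =>
    intro i x K M hM
    obtain ⟨T⟩ := X.comul_graded x
    change ((Φ i x).fam (r + 1)).val K M hM ∈ _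
    rw [hΦ.comul x T 1 r (r + 1) (add_comm 1 r), Fam.val_sum]
    exact Submodule.sum_mem _ fun a _ =>
      hS.conv_mem _ _ (h _ (T.left a)) (ih (T.right a)) K M hM

variable {V : ∀ n i, Submodule k (X.obj n i)}

theorem PROP.IsClosed.rep_mem (hS : P.IsClosed S) (hV : X.toNSOperad.PosFreelyGenerated V)
    (ρ : Rep X P) (h : ∀ n, 2 ≤ n → ∀ (i : ℤ) (v : V n i) (K : ℕ → ℕ) (M : ℕ) (hM : psum K n = M),
      (∀ a : Fin n, K a ≠ 0) → (ρ.Φ n i v).val 1 K M hM ∈ S M 1 i) (n : ℕ) :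
    ∀ (r : ℕ) {i : ℤ} (x : X.obj n i) (K : ℕ → ℕ) (M : ℕ) (hM : psum K n = M),
      (ρ.Φ n i x).val r K M hM ∈ S M r i := by
  obtain ⟨u, hu⟩ := X.exists_unit
  have hu' := (ρ.coalg 0).map_unit hu
  induction n using Nat.strong_induction_on with
  | _ n ih =>
    refine hS.coalg_mem (ρ.coalg n) ?_
    obtain rfl | rfl | ⟨p, rfl⟩ : n = 0 ∨ n = 1 ∨ ∃ p, n = p + 2 := by
      rcases n with _ | _ | p
      exacts [Or.inl rfl, Or.inr (Or.inl rfl), Or.inr (Or.inr ⟨p, rfl⟩)]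
    · intro i x K M hM
      rw [EndObj.vanish _ hM (by rw [← hM]; exact Nat.one_pos)]
      exact Submodule.zero_mem _
    · intro i x K M hM
      by_cases hi : i = 0
      · subst hi
        rw [X.eq_smul_one x, map_smul, ρ.map_one, EndObj.val_smul]
        exact Submodule.smul_mem _ _ (hS.endOne_mem _ _ _ _)
      · rw [X.eq_zero_of_degree_ne x hi, map_zero]
        exact Submodule.zero_mem _
    · intro i x K M hM
      by_cases hz : ∃ a : Fin (p + 2), K a = 0
      · obtain ⟨a, ha⟩ := hz
        rw [val_eq_endCirc_endUnit a (add_zero i) _ 1 K M hM ha, ← hu', ← ρ.map_circ]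
        exact ih (p + 1) (by omega) _ _ _ _ _
      · let W : ∀ i, Submodule k (X.obj (p + 2) i) := fun i =>
          (S M 1 i).comap ((EndObj.valLin 1 K M hM).comp (ρ.Φ (p + 2) i))
        exact hV.eq_top (by omega) W
          (fun i v hv => h (p + 2) (by omega) i ⟨v, hv⟩ K M hM fun a ha => hz ⟨a, ha⟩)
          (fun {m n i j t} hm hn s hl ht x y => by
            change (ρ.Φ (p + 2) t (X.circ s hl ht x y)).val 1 K M hM ∈ S M 1 t
            rw [ρ.map_circ]
            exact hS.endCirc_mem s hl ht (fun r => ih m (by omega) r x)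
              (fun r => ih n (by omega) r y) 1 K M hM) x

/-- `P(X)` is generated by the operations `φ(v)^1_κ` and `D^1_l`. -/
theorem gradedPROP_eq_top (hV : X.toNSOperad.PosFreelyGenerated V)
    {S : ∀ m n i, Submodule k ((gradedPROP X).Hom m n i)} (hS : (gradedPROP X).IsClosed S)
    (hgen : ∀ s v, genMap V s v ∈ S s.arity 1 s.degree) {m n : ℕ} {i : ℤ}
    (f : (gradedPROP X).Hom m n i) : f ∈ S m n i := by
  refine gradedPROP_closed_eq_top hS (fun {n i} x r K M h => hS.rep_mem hV (univRep X) ?_ n r x K M h)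
    (fun l m => ?_) f
  · intro n hn i v K M hM h0
    obtain rfl : ∑ a : Fin n, K a = M := by rw [← psum_eq_sum, hM]
    rw [univRep_Φ X _ 1 K _ hM (fun a : Fin n => K a) (fun _ => rfl) rfl]
    exact hgen (.phi n hn (fun a => K a) (fun a => Nat.one_le_iff_ne_zero.2 (h0 a)) i) v
  · rw [← univRep_D X m (fun _ => l) l (psum_const_one l)]
    refine hS.coder_mem (univRep X).coder (fun l hl => ?_) m _ _ _
    rw [univRep_D]
    have e : genMap V (.D l hl) (1 : k) = opD X l 1 := one_smul k (opD X l 1)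
    exact e ▸ hgen (.D l hl) (1 : k)

end Generation
end XB

namespace XB
open scoped DirectSum TensorProduct

section FreePROP

variable {k : Type u} [Field k] {X : CoalgOperad k} {V : ∀ n i, Submodule k (X.obj n i)}
  {Q : PROP k}

/-- The identity between operations with equal numbers of inputs. -/
def PROP.castInputs (Q : PROP k) {M M' r : ℕ} {i : ℤ} (h : M = M') :
    Q.Hom M r i →ₗ[k] Q.Hom M' r i :=
  h ▸ LinearMap.id

/-- Values on the generators `φ(v)^1_κ` as a family of operations, extended by zero. -/
noncomputable def genFam (f : ∀ s, genSpace V s →ₗ[k] Q.Hom s.arity 1 s.degree) (n : ℕ) (i : ℤ) :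
    V n i →ₗ[k] Fam Q n 1 i :=
  open Classical in
  let val (κ : Fin n → ℕ) (M : ℕ) (h : ∑ a, κ a = M) : V n i →ₗ[k] Q.Hom M 1 i :=
    if h' : 2 ≤ n ∧ ∀ a, 1 ≤ κ a then
      (Q.castInputs h).comp (f (.phi n h'.1 κ h'.2 i))
    else 0
  have hval : ∀ (κ κ' : Fin n → ℕ) (_ : κ = κ') (M : ℕ) (h : ∑ a, κ a = M) (h' : ∑ a, κ' a = M),
      val κ M h = val κ' M h' := by
    rintro κ _ rfl M h h'
    rfl
  { toFun v := Fam.mk (fun K M h => val (fun a => K a) M (by rw [← psum_eq_sum, h]) v)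
      fun K K' hK M h h' => by
        rw [hval _ (fun a => K' a) (funext fun a => hK a a.isLt)]
    map_add' v w := Fam.ext fun K M h => map_add (val (fun a => K a) M _) v w
    map_smul' c v := Fam.ext fun K M h => map_smul (val (fun a => K a) M _) c v }

theorem genFam_val (f : ∀ s, genSpace V s →ₗ[k] Q.Hom s.arity 1 s.degree) {n : ℕ} (hn : 2 ≤ n)
    (κ : Fin n → ℕ) (hκ : ∀ a, 1 ≤ κ a) {i : ℤ} (v : V n i) :
    (genFam f n i v).val (word κ) (∑ a, κ a) (psum_word κ) = f (.phi n hn κ hκ i) v := by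
  have key : ∀ (κ' : Fin n → ℕ) (_ : κ' = κ) (h : ∑ a, κ' a = ∑ a, κ a)
      (h' : 2 ≤ n ∧ ∀ a, 1 ≤ κ' a),
      Q.castInputs h (f (.phi n h'.1 κ' h'.2 i) v) = f (.phi n hn κ hκ i) v := by
    rintro κ' rfl h h'
    rfl
  have e : (fun a : Fin n => word κ a) = κ := funext fun a => word_lt κ a.isLt
  change (dite (2 ≤ n ∧ ∀ a : Fin n, 1 ≤ word κ a) _ _ : V n i →ₗ[k] _) v = _
  have hw : 2 ≤ n ∧ ∀ a : Fin n, 1 ≤ word κ a := ⟨hn, fun a => by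
    rw [word_lt κ a.isLt]; exact hκ a⟩
  rw [dif_pos hw]
  exact key _ e _ hw

/-- Values on the generators `D^1_l` as a family of operations, extended by zero. -/
noncomputable def genCoder (f : ∀ s, genSpace V s →ₗ[k] Q.Hom s.arity 1 s.degree) : Fam Q 1 1 1 :=
  Fam.mk (fun _ M _ => if h : 1 < M then f (.D M h) (1 : k) else 0) fun _ _ _ _ _ _ => rfl

/-- The graded PROP `P(X)` is free. -/
theorem gradedPROP_freelyGenerated (hV : X.toNSOperad.PosFreelyGenerated V) :
    (gradedPROP X).FreelyGenerated GenIndex.arity (fun _ => 1) GenIndex.degree (genSpace V)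
      (genMap V) := by
  intro Q f
  obtain ⟨ρ, hD, hΦ⟩ := exists_representation hV (genFam f) (d := genCoder f)
    (fun K M h hM => dif_neg (by omega))
  have hρ : ∀ s (v : genSpace V s), ρ.toMor.map s.arity 1 s.degree (genMap V s v) = f s v := by
    rintro (⟨n, hn, κ, hκ, i⟩ | ⟨l, hl⟩) v
    · change ρ.toMor.map _ 1 i (phi X κ rfl 1 v.1) = _
      rw [ρ.toMor_phi]
      refine (hΦ n hn i v (word κ) _ (psum_word κ) fun a => ?_).trans (genFam_val f hn κ hκ v)
      rw [word_lt κ a.isLt]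
      exact Nat.one_le_iff_ne_zero.1 (hκ a)
    · change ρ.toMor.map l 1 1 ((show k from v) • opD X l 1) = _
      rw [map_smul, ρ.toMor_opD]
      change (show k from v) • (ρ.D.fam 1).val (fun _ => l) l _ = _
      rw [hD]
      have e : (genCoder f).val (fun _ => l) l (psum_const_one l) = f (.D l hl) (1 : k) :=
        dif_pos hl
      rw [e]
      exact ((f (.D l hl)).map_smul (show k from v) (1 : k)).symm.trans
        (congrArg _ (mul_one (show k from v)))
  refine ⟨ρ.toMor, hρ, fun g hg => PROP.Mor.ext_map fun m n i x => ?_⟩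
  exact gradedPROP_eq_top hV (g.isClosed_eqLocus ρ.toMor)
    (fun s v => (hg s v).trans (hρ s v).symm) x

end FreePROP
end XB

namespace XB
open scoped DirectSum TensorProduct

section PermValues

/-- The value of a permutation of `{0, …, n - 1}`, extended by the identity. -/
def pval {n : ℕ} (σ : Equiv.Perm (Fin n)) (x : ℕ) : ℕ := if h : x < n then σ ⟨x, h⟩ else x

theorem pval_coe {n : ℕ} (σ : Equiv.Perm (Fin n)) (x : Fin n) : pval σ x = σ x := dif_pos x.isLt

theorem pval_lt {n x : ℕ} (σ : Equiv.Perm (Fin n)) (h : x < n) : pval σ x < n := by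
  rw [pval, dif_pos h]; exact (σ _).isLt

theorem pval_ge {n x : ℕ} (σ : Equiv.Perm (Fin n)) (h : n ≤ x) : pval σ x = x :=
  dif_neg (by omega)

theorem perm_ext_pval {n : ℕ} {σ τ : Equiv.Perm (Fin n)} (h : ∀ x < n, pval σ x = pval τ x) :
    σ = τ :=
  Equiv.ext fun x => Fin.ext (by rw [← pval_coe, ← pval_coe, h x x.isLt])

theorem pval_one {n x : ℕ} : pval (1 : Equiv.Perm (Fin n)) x = x := by
  unfold pval; split_ifs <;> rfl

theorem pval_mul {n x : ℕ} (σ τ : Equiv.Perm (Fin n)) : pval (σ * τ) x = pval σ (pval τ x) := by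
  by_cases h : x < n
  · rw [pval, dif_pos h, pval, dif_pos (pval_lt τ h), Equiv.Perm.mul_apply]
    congr 2
    exact Fin.ext (pval_coe τ ⟨x, h⟩).symm
  · rw [pval_ge τ (by omega), pval_ge _ (by omega), pval_ge _ (by omega)]

theorem pval_blockSum {m m' M x : ℕ} (h : m + m' = M) (σ : Equiv.Perm (Fin m))
    (τ : Equiv.Perm (Fin m')) :
    pval (blockSum h σ τ) x = if x < m then pval σ x else m + pval τ (x - m) := by
  by_cases hx : x < m
  · rw [if_pos hx, pval, dif_pos (by omega), blockSum_val_left h σ τ _ ⟨x, hx⟩ rfl, ← pval_coe]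
  · rw [if_neg hx]
    by_cases hx' : x < M
    · rw [pval, dif_pos hx', blockSum_val_right h σ τ _ ⟨x - m, by omega⟩ (by simp; omega),
        ← pval_coe]
    · rw [pval_ge _ (by omega), pval_ge _ (by omega)]
      omega

theorem pval_blockSwap {m m' M x : ℕ} (h : m + m' = M) (h' : m' + m = M) :
    pval (blockSwap h h') x = if x < m then x + m' else if x < M then x - m else x := by
  by_cases hx : x < M
  · rw [pval, dif_pos hx, blockSwap_val, if_pos hx]
  · rw [pval_ge _ (by omega), if_neg (by omega), if_neg hx]

/-- The permutation that acts by `α`, `σ` and `γ` on three consecutive blocks. -/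
def triSum {A n C N : ℕ} (h : A + n + C = N) (α : Equiv.Perm (Fin A)) (σ : Equiv.Perm (Fin n))
    (γ : Equiv.Perm (Fin C)) : Equiv.Perm (Fin N) :=
  blockSum h (blockSum rfl α σ) γ

theorem pval_triSum {A n C N x : ℕ} (h : A + n + C = N) (α : Equiv.Perm (Fin A))
    (σ : Equiv.Perm (Fin n)) (γ : Equiv.Perm (Fin C)) : pval (triSum h α σ γ) x =
      if x < A then pval α x else if x < A + n then A + pval σ (x - A) else
        A + n + pval γ (x - (A + n)) := by
  rw [triSum, pval_blockSum, pval_blockSum]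
  split_ifs <;> first | rfl | omega

theorem triSum_one {A n C N : ℕ} (h : A + n + C = N) : triSum h 1 1 1 = 1 := by
  rw [triSum, blockSum_one, blockSum_one]

theorem triSum_mul {A n C N : ℕ} (h : A + n + C = N) (α α' : Equiv.Perm (Fin A))
    (σ σ' : Equiv.Perm (Fin n)) (γ γ' : Equiv.Perm (Fin C)) :
    triSum h (α * α') (σ * σ') (γ * γ') = triSum h α σ γ * triSum h α' σ' γ' := by
  rw [triSum, blockSum_mul, blockSum_mul]; rfl

end PermValues

section Operators

variable {k : Type u} [Field k] {B : SymOperad k}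

/-- A context of an operation of degree `i` with `m` inputs and `n` outputs: `A` further inputs on
its left and `C` further inputs on its right, and degrees. -/
structure OpIndex (m n : ℕ) (i : ℤ) where
  A : ℕ
  C : ℕ
  N : ℕ
  M : ℕ
  j : ℤ
  t : ℤ
  hN : A + n + C = N
  hM : A + m + C = M
  ht : j + i = t

variable (B) in
/-- Families of maps `x ↦ x ∘ (id ⊗ F ⊗ id)`, for a formal operation `F` with `m` inputs and `n`
outputs. -/
abbrev Op (m n : ℕ) (i : ℤ) : Type u :=
  ∀ c : OpIndex m n i, B.obj c.N c.j →ₗ[k] B.obj c.M c.t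

/-- The operator `F` in a context. -/
def Op.app {m n : ℕ} {i : ℤ} (F : Op B m n i) (A C : ℕ) {N M : ℕ} {j t : ℤ} (hN : A + n + C = N)
    (hM : A + m + C = M) (ht : j + i = t) : B.obj N j →ₗ[k] B.obj M t :=
  F ⟨A, C, N, M, j, t, hN, hM, ht⟩

theorem Op.ext_app {m n : ℕ} {i : ℤ} {F G : Op B m n i}
    (h : ∀ (A C : ℕ) {N M : ℕ} {j t : ℤ} (hN : A + n + C = N) (hM : A + m + C = M)
      (ht : j + i = t) (x : B.obj N j), F.app A C hN hM ht x = G.app A C hN hM ht x) : F = G :=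
  funext fun c => LinearMap.ext fun x => h c.A c.C c.hN c.hM c.ht x

/-- Permutations of the context may be moved through `F`. -/
def Op.Equivariant {m n : ℕ} {i : ℤ} (F : Op B m n i) : Prop :=
  ∀ {A C N M : ℕ} {j t : ℤ} (hN : A + n + C = N) (hM : A + m + C = M) (ht : j + i = t)
    (α : Equiv.Perm (Fin A)) (γ : Equiv.Perm (Fin C)) (x : B.obj N j),
    F.app A C hN hM ht (B.act (triSum hN α 1 γ) x) =
      B.act (triSum hM α 1 γ) (F.app A C hN hM ht x)

/-- `F` may be moved to another place by a permutation. -/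
def Op.Movable {m n : ℕ} {i : ℤ} (F : Op B m n i) : Prop :=
  ∀ {A p C A' C' N M : ℕ} {j t : ℤ} (_ : A + p = A') (_ : p + C = C')
    (hN : A + n + C' = N) (hM : A + m + C' = M) (hN' : A' + n + C = N) (hM' : A' + m + C = M)
    (h : A + (n + p) + C = N) (h' : A + (m + p) + C = M) (ht : j + i = t) (x : B.obj N j),
    F.app A C' hN hM ht (B.act (triSum h 1 (blockSwap rfl (add_comm p n)) 1) x) =
      B.act (triSum h' 1 (blockSwap rfl (add_comm p m)) 1) (F.app A' C hN' hM' ht x)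

/-- `F` may be moved inside of a composition `z ∘ₛ w`. -/
def Op.Inner {m n : ℕ} {i : ℤ} (F : Op B m n i) : Prop :=
  ∀ {A C A' C' N M Z L L' : ℕ} {c j d t t' : ℤ} (s : Fin Z) (_ : s + A = A')
    (hN : A + n + C = N) (hM : A + m + C = M) (hL : A' + n + C' = L) (hL' : A' + m + C' = L')
    (ht : j + i = t) (ht' : d + i = t') (hl : L + 1 = Z + N) (e : c + j = d)
    (hl' : L' + 1 = Z + M) (e' : c + t = t') (z : B.obj Z c) (w : B.obj N j),
    F.app A' C' hL hL' ht' (B.circ s hl e z w) = B.circ s hl' e' z (F.app A C hN hM ht w)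

/-- `F` and `G` commute if `F` is applied on the left of `G`. -/
def Op.Commutes {m n m' n' : ℕ} {a b : ℤ} (F : Op B m n a) (G : Op B m' n' b) : Prop :=
  ∀ {A D C A₁ A₂ C₁ C₂ N L₁ L₂ M : ℕ} {j t₁ t₂ t : ℤ}
    (_ : A + n + D = A₁) (_ : A + m + D = A₂) (_ : D + n' + C = C₁) (_ : D + m' + C = C₂)
    (hF : A + n + C₁ = N) (hF' : A + m + C₁ = L₁) (hG : A₂ + n' + C = L₁) (hG' : A₂ + m' + C = M)
    (kG : A₁ + n' + C = N) (kG' : A₁ + m' + C = L₂) (kF : A + n + C₂ = L₂) (kF' : A + m + C₂ = M)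
    (e₁ : j + a = t₁) (e₂ : t₁ + b = t) (e₃ : j + b = t₂) (e₄ : t₂ + a = t) (x : B.obj N j),
    G.app A₂ C hG hG' e₂ (F.app A C₁ hF hF' e₁ x) =
      (a * b).negOnePow • F.app A C₂ kF kF' e₄ (G.app A₁ C kG kG' e₃ x)

/-- The composition of operators. -/
def opComp {l m n : ℕ} {i j t : ℤ} (e : i + j = t) (F : Op B m n i) (G : Op B l m j) :
    Op B l n t := fun c =>
  (G.app c.A c.C rfl c.hM (by rw [add_assoc, e]; exact c.ht)).comp (F.app c.A c.C c.hN rfl rfl)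

theorem opComp_app {l m n : ℕ} {i j t : ℤ} (e : i + j = t) (F : Op B m n i) (G : Op B l m j)
    {A C N M L : ℕ} {a b c : ℤ} (hN : A + n + C = N) (hM : A + l + C = M) (ht : a + t = c)
    (hL : A + m + C = L) (h₁ : a + i = b) (h₂ : b + j = c) (x : B.obj N a) :
    (opComp e F G).app A C hN hM ht x = G.app A C hL hM h₂ (F.app A C hN hL h₁ x) := by
  subst hL h₁; rfl

/-- The tensor product of operators. -/
def opTensor {m m' M n n' N : ℕ} {i j t : ℤ} (hM : m + m' = M) (hN : n + n' = N) (e : i + j = t)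
    (F : Op B m n i) (G : Op B m' n' j) : Op B M N t := fun c =>
  (G.app (c.A + m) c.C (by omega : _ = c.A + m + (n' + c.C)) (by rw [← c.hM]; omega)
    (by rw [add_assoc, e]; exact c.ht)).comp
    (F.app c.A (n' + c.C) (by rw [← c.hN]; omega) rfl rfl)

theorem opTensor_app {m m' M n n' N : ℕ} {i j t : ℤ} (hM : m + m' = M) (hN : n + n' = N)
    (e : i + j = t) (F : Op B m n i) (G : Op B m' n' j) {A C A' C' K K' L : ℕ} {a b c : ℤ}
    (hK : A + N + C = K) (hK' : A + M + C = K') (ht : a + t = c) (hA : A + m = A')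
    (hC : n' + C = C') (h₁ : A + n + C' = K) (h₂ : A + m + C' = L) (h₃ : A' + n' + C = L)
    (h₄ : A' + m' + C = K') (e₁ : a + i = b) (e₂ : b + j = c) (x : B.obj K a) :
    (opTensor hM hN e F G).app A C hK hK' ht x = G.app A' C h₃ h₄ e₂ (F.app A C' h₁ h₂ e₁ x) := by
  subst hA hC h₂ e₁; rfl

/-- The identity between equal arities and degrees. -/
def SymOperad.cast (B : SymOperad k) {N M : ℕ} {j t : ℤ} (h : N = M) (h' : j = t) :
    B.obj N j →ₗ[k] B.obj M t :=
  h ▸ h' ▸ LinearMap.id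

variable (B) in
/-- The operator of a permutation. -/
def permOp {n : ℕ} (σ : Equiv.Perm (Fin n)) : Op B n n 0 := fun c =>
  (B.cast (c.hN.symm.trans c.hM) ((add_zero _).symm.trans c.ht)).comp (B.act (triSum c.hN 1 σ 1))

theorem permOp_app {n : ℕ} (σ : Equiv.Perm (Fin n)) {A C N : ℕ} {j : ℤ} (hN hN' : A + n + C = N)
    (ht : j + 0 = j) (x : B.obj N j) :
    (permOp B σ).app A C hN hN' ht x = B.act (triSum hN 1 σ 1) x := rfl

/-- The operator of the insertion of `y`. -/
def insOp {q : ℕ} {i : ℤ} : B.obj q i →ₗ[k] Op B q 1 i where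
  toFun y := fun c => (B.circ (⟨c.A, by have := c.hN; omega⟩ : Fin c.N)
    (by have := c.hN; have := c.hM; omega) c.ht).flip y
  map_add' y z := funext fun c => map_add _ y z
  map_smul' r y := funext fun c => map_smul _ r y

theorem insOp_app {q : ℕ} {i : ℤ} (y : B.obj q i) {A C N M : ℕ} {j t : ℤ} (hN : A + 1 + C = N)
    (hM : A + q + C = M) (ht : j + i = t) (s : Fin N) (hs : s = A) (hl : M + 1 = N + q)
    (x : B.obj N j) : (insOp y).app A C hN hM ht x = B.circ s hl ht x y := by
  subst hs; rfl

end Operators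
end XB

namespace XB
open scoped DirectSum TensorProduct

section RegularOperators

variable {k : Type u} [Field k] {B : SymOperad k}

theorem isBlockPerm_of_pval {m n l : ℕ} {σ : Equiv.Perm (Fin m)} {s : Fin m}
    {τ : Equiv.Perm (Fin n)} {ρ : Equiv.Perm (Fin l)}
    (h₁ : ∀ a < m, a ≠ s → shiftPos n s a < l →
      pval ρ (shiftPos n s a) = shiftPos n (pval σ s) (pval σ a))
    (h₂ : ∀ b < n, pval ρ (s + b) = pval σ s + pval τ b) : IsBlockPerm σ s τ ρ := by
  refine ⟨fun c a ha hc => ?_, fun c b hc => ?_⟩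
  · rw [← pval_coe, ← pval_coe, ← pval_coe, hc]
    exact h₁ a a.isLt (fun h => ha (Fin.ext h)) (hc ▸ c.isLt)
  · rw [← pval_coe, ← pval_coe, ← pval_coe, hc]
    exact h₂ b b.isLt

theorem circ_act_left {m n l : ℕ} {i j t : ℤ} (s s' : Fin m) (hl : l + 1 = m + n) (ht : i + j = t)
    (σ : Equiv.Perm (Fin m)) (ρ : Equiv.Perm (Fin l)) (hs : pval σ s = s')
    (h : IsBlockPerm σ s (1 : Equiv.Perm (Fin n)) ρ) (x : B.obj m i) (y : B.obj n j) :
    B.circ s hl ht (B.act σ x) y = B.act ρ (B.circ s' hl ht x y) := by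
  have := B.act_circ s hl ht σ 1 ρ h x y
  rw [B.act_one] at this
  rw [this, B.circ_congr (s' := s') (by rw [← pval_coe, hs])]

theorem insOp_equivariant {q : ℕ} {e : ℤ} (y : B.obj q e) : (insOp y).Equivariant := by
  intro A C N M j t hN hM ht α γ x
  have hA : A < N := by omega
  rw [insOp_app y hN hM ht ⟨A, hA⟩ rfl (by omega), insOp_app y hN hM ht ⟨A, hA⟩ rfl (by omega)]
  refine circ_act_left _ _ _ _ _ _ (by simp [pval_triSum, pval_one]) (isBlockPerm_of_pval ?_ ?_) x y
  · intro a ha hne _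
    have hs : pval (triSum hN α 1 γ) A = A := by simp [pval_triSum, pval_one]
    simp only [shiftPos, hs, pval_triSum, pval_one]
    simp only at hne
    by_cases h : a < A
    · have := pval_lt α h
      simp [h, this]
    · have e1 : a + q - 1 - (A + q) = a - (A + 1) := by omega
      have h1 : ¬ a + q - 1 < A := by omega
      have h2 : ¬ a + q - 1 < A + q := by omega
      have h3 : ¬ a < A + 1 := by omega
      simp only [h, h1, h2, h3, if_false, e1]
      split_ifs <;> omega
  · intro b hb
    simp only [pval_triSum, pval_one]
    split_ifs <;> omega

theorem insOp_movable {q : ℕ} {e : ℤ} (y : B.obj q e) : (insOp y).Movable := by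
  intro A p C A' C' N M j t hA' hC' hN hM hN' hM' h h' ht x
  have hA : A < N := by omega
  rw [insOp_app y hN hM ht ⟨A, hA⟩ rfl (by omega),
    insOp_app y hN' hM' ht ⟨A', by omega⟩ rfl (by omega)]
  have hs : pval (triSum h 1 (blockSwap (m := 1) (m' := p) rfl (add_comm p 1)) 1) A = A' := by
    simp only [pval_triSum, pval_one, pval_blockSwap]
    split_ifs <;> omega
  refine circ_act_left _ _ _ _ _ _ hs (isBlockPerm_of_pval ?_ ?_) x y
  · intro a ha hne _
    simp only [shiftPos, hs, pval_triSum, pval_one, pval_blockSwap]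
    simp only at hne
    split_ifs <;> omega
  · intro b hb
    simp only [hs]
    simp only [pval_triSum, pval_one, pval_blockSwap]
    split_ifs <;> omega

theorem insOp_inner {q : ℕ} {e : ℤ} (y : B.obj q e) : (insOp y).Inner := by
  intro A C A' C' N M Z L L' c j d t t' s hA hN hM hL hL' ht ht' hl e hl' e' z w
  rw [insOp_app y hL hL' ht' ⟨A', by omega⟩ rfl (by omega),
    insOp_app y hN hM ht ⟨A, by omega⟩ rfl (by omega)]
  exact B.circ_seq _ _ _ hA.symm _ _ _ _ _ _ _ _ z w y

theorem insOp_commutes {q q' : ℕ} {e e' : ℤ} (y : B.obj q e) (z : B.obj q' e') :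
    (insOp y).Commutes (insOp z) := by
  intro A D C A₁ A₂ C₁ C₂ N L₁ L₂ M j t₁ t₂ t hA₁ hA₂ hC₁ hC₂ hF hF' hG hG' kG kG' kF kF' e₁ e₂ e₃
    e₄ x
  rw [insOp_app z hG hG' e₂ ⟨A₂, by omega⟩ rfl (by omega),
    insOp_app y hF hF' e₁ ⟨A, by omega⟩ rfl (by omega),
    insOp_app y kF kF' e₄ ⟨A, by omega⟩ rfl (by omega),
    insOp_app z kG kG' e₃ ⟨A₁, by omega⟩ rfl (by omega)]
  have h : (⟨A, by omega⟩ : Fin N) < ⟨A₁, by omega⟩ := by rw [Fin.lt_def]; simp; omega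
  exact B.circ_par _ _ h (⟨A₂, by omega⟩ : Fin L₁) (⟨A, by omega⟩ : Fin L₂) (by simp; omega) rfl
    _ _ _ _ _ _ _ _ x y z

theorem permOp_equivariant {n : ℕ} (σ : Equiv.Perm (Fin n)) : (permOp B σ).Equivariant := by
  intro A C N M j t hN hM ht α γ x
  obtain rfl : N = M := by omega
  obtain rfl : j = t := by omega
  rw [permOp_app, permOp_app, ← B.act_mul, ← B.act_mul, ← triSum_mul, ← triSum_mul]
  simp only [one_mul, mul_one]

theorem permOp_movable {n : ℕ} (σ : Equiv.Perm (Fin n)) : (permOp B σ).Movable := by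
  intro A p C A' C' N M j t hA' hC' hN hM hN' hM' h h' ht x
  obtain rfl : N = M := by omega
  obtain rfl : j = t := by omega
  rw [permOp_app, permOp_app, ← B.act_mul, ← B.act_mul]
  congr 2
  refine perm_ext_pval fun x hx => ?_
  simp only [pval_mul, pval_triSum, pval_one, pval_blockSwap]
  by_cases h1 : x < A
  · simp [h1, show x < A' by omega]
  by_cases h2 : x < A + n
  · have h3 := pval_lt σ (x := x - A) (by omega)
    have h4 : A + (x - A + p) - A' = x - A := by omega
    simp only [h1, h2, if_false, if_true, show x < A + (n + p) by omega,
      show x - A < n by omega, show ¬ A + (x - A + p) < A' by omega,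
      show A + (x - A + p) < A' + n by omega, h4, show ¬ A + pval σ (x - A) < A by omega,
      show A + pval σ (x - A) < A + (n + p) by omega, Nat.add_sub_cancel_left, h3]
    omega
  · simp only [h1, h2, if_false]
    split_ifs <;> omega

theorem permOp_inner {n : ℕ} (σ : Equiv.Perm (Fin n)) : (permOp B σ).Inner := by
  intro A C A' C' N M Z L L' c j d t t' s hA hN hM hL hL' ht ht' hl e hl' e' z w
  obtain rfl : N = M := by omega
  obtain rfl : j = t := by omega
  obtain rfl : L = L' := by omega
  obtain rfl : d = t' := by omega
  rw [permOp_app, permOp_app]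
  have := B.act_circ s hl e 1 (triSum hN 1 σ 1) (triSum hL 1 σ 1) (isBlockPerm_of_pval ?_ ?_) z w
  · rw [B.act_one] at this
    exact this.symm
  · intro a ha hne hlt
    have hs := s.isLt
    simp only [shiftPos, pval_triSum, pval_one] at hlt ⊢
    split_ifs <;> omega
  · intro b hb
    have e1 : s + b - A' = b - A := by omega
    simp only [pval_triSum, pval_one, e1]
    split_ifs <;> omega

theorem permOp_commutes {n m' n' : ℕ} {b : ℤ} (σ : Equiv.Perm (Fin n)) {G : Op B m' n' b}
    (hG : G.Equivariant) : (permOp B σ).Commutes G := by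
  intro A D C A₁ A₂ C₁ C₂ N L₁ L₂ M j t₁ t₂ t hA₁ hA₂ hC₁ hC₂ hF hF' hG₁ hG' kG kG' kF kF' e₁ e₂ e₃
    e₄ x
  obtain rfl : A₁ = A₂ := by omega
  obtain rfl : N = L₁ := by omega
  obtain rfl : L₂ = M := by omega
  obtain rfl : j = t₁ := by omega
  obtain rfl : t₂ = t := by omega
  rw [permOp_app, permOp_app, zero_mul, Int.negOnePow_zero, one_smul]
  have h1 : triSum hF 1 σ 1 = triSum kG (triSum hA₁ 1 σ 1) 1 1 := by
    refine perm_ext_pval fun x _ => ?_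
    simp only [pval_triSum, pval_one]
    split_ifs <;> omega
  have h2 : triSum kF 1 σ 1 = triSum kG' (triSum hA₁ 1 σ 1) 1 1 := by
    refine perm_ext_pval fun x _ => ?_
    simp only [pval_triSum, pval_one]
    split_ifs <;> omega
  rw [h1, h2, hG]

theorem commutes_permOp {n m' n' : ℕ} {b : ℤ} (σ : Equiv.Perm (Fin n)) {G : Op B m' n' b}
    (hG : G.Equivariant) : G.Commutes (permOp B σ) := by
  intro A D C A₁ A₂ C₁ C₂ N L₁ L₂ M j t₁ t₂ t hA₁ hA₂ hC₁ hC₂ hF hF' hG₁ hG' kG kG' kF kF' e₁ e₂ e₃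
    e₄ x
  obtain rfl : C₁ = C₂ := by omega
  obtain rfl : L₁ = M := by omega
  obtain rfl : N = L₂ := by omega
  obtain rfl : j = t₂ := by omega
  obtain rfl : t₁ = t := by omega
  rw [permOp_app, permOp_app, mul_zero, Int.negOnePow_zero, one_smul]
  have h1 : triSum hG₁ 1 σ 1 = triSum hF' 1 1 (triSum hC₁ 1 σ 1) := by
    refine perm_ext_pval fun x _ => ?_
    have e1 : x - (A + m') - D = x - A₂ := by omega
    simp only [pval_triSum, pval_one, e1]
    split_ifs <;> omega
  have h2 : triSum kG 1 σ 1 = triSum kF 1 1 (triSum hC₁ 1 σ 1) := by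
    refine perm_ext_pval fun x _ => ?_
    have e1 : x - (A + n') - D = x - A₁ := by omega
    simp only [pval_triSum, pval_one, e1]
    split_ifs <;> omega
  rw [h1, h2, hG]

end RegularOperators
end XB

namespace XB
open scoped DirectSum TensorProduct

section PermValues

theorem pval_triSum_blockSwap {A n p C N x : ℕ} (h : A + (n + p) + C = N) :
    pval (triSum h 1 (blockSwap (m := n) (m' := p) rfl (add_comm p n)) 1) x =
      if x < A then x else if x < A + n then x + p else if x < A + n + p then x - n else x := by
  rw [pval_triSum, pval_blockSwap, pval_one, pval_one]
  split_ifs <;> omega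

theorem triSum_nest_right {A n p C C' N : ℕ} (h : A + n + C' = N) (hC : 0 + p + C = C')
    (h' : A + n + p + C = N) (σ : Equiv.Perm (Fin p)) :
    triSum h 1 1 (triSum hC 1 σ 1) = triSum h' 1 σ 1 := by
  refine perm_ext_pval fun x _ => ?_
  have e : x - (A + n) - 0 = x - (A + n) := by omega
  simp only [pval_triSum, pval_one, e]
  split_ifs <;> omega

theorem triSum_nest_left {A A' n p C N : ℕ} (h : A' + n + C = N) (hA : A + p + 0 = A')
    (h' : A + p + (n + C) = N) (σ : Equiv.Perm (Fin p)) :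
    triSum h (triSum hA 1 σ 1) 1 1 = triSum h' 1 σ 1 := by
  refine perm_ext_pval fun x _ => ?_
  simp only [pval_triSum, pval_one]
  split_ifs <;> omega

theorem triSum_blockSwap_add {A n n' p C N K : ℕ} (hN : n + n' = N) (h : A + (N + p) + C = K)
    (h₁ : A + (n + p) + (n' + C) = K) (h₂ : A + n + (n' + p) + C = K) :
    triSum h 1 (blockSwap (m := N) (m' := p) rfl (add_comm p N)) 1 =
      triSum h₁ 1 (blockSwap (m := n) (m' := p) rfl (add_comm p n)) 1 *
      triSum h₂ 1 (blockSwap (m := n') (m' := p) rfl (add_comm p n')) 1 := by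
  refine perm_ext_pval fun x _ => ?_
  subst hN
  rw [pval_mul, pval_triSum_blockSwap, pval_triSum_blockSwap, pval_triSum_blockSwap]
  rcases lt_or_ge x (A + n) with hx | hx
  · rw [if_pos (c := x < A + n) hx]
    split_ifs <;> omega
  · rw [if_neg (c := x < A + n) (by omega)]
    split_ifs <;> omega

end PermValues

section RegularOperators

variable {k : Type u} [Field k] {B : SymOperad k}

/-- `G` commutes with permutations of the context and with insertions in the context. -/
structure Op.Natural {m n : ℕ} {i : ℤ} (G : Op B m n i) : Prop where
  equivariant : G.Equivariant
  ins_left : ∀ {q : ℕ} {e : ℤ} (y : B.obj q e), (insOp y).Commutes G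
  ins_right : ∀ {q : ℕ} {e : ℤ} (y : B.obj q e), G.Commutes (insOp y)

/-- The operators that behave like compositions and tensor products of insertions. -/
structure Op.IsRegular {m n : ℕ} {i : ℤ} (F : Op B m n i) : Prop where
  equivariant : F.Equivariant
  movable : F.Movable
  inner : F.Inner
  left : ∀ {m' n' : ℕ} {b : ℤ} {G : Op B m' n' b}, G.Natural → F.Commutes G
  right : ∀ {m' n' : ℕ} {b : ℤ} {G : Op B m' n' b}, G.Natural → G.Commutes F

theorem insOp_natural {q : ℕ} {e : ℤ} (y : B.obj q e) : (insOp y).Natural :=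
  ⟨insOp_equivariant y, fun z => insOp_commutes z y, fun z => insOp_commutes y z⟩

theorem insOp_isRegular {q : ℕ} {e : ℤ} (y : B.obj q e) : (insOp y).IsRegular :=
  ⟨insOp_equivariant y, insOp_movable y, insOp_inner y, fun hG => hG.ins_left y,
    fun hG => hG.ins_right y⟩

theorem permOp_isRegular {n : ℕ} (σ : Equiv.Perm (Fin n)) : (permOp B σ).IsRegular :=
  ⟨permOp_equivariant σ, permOp_movable σ, permOp_inner σ,
    fun hG => permOp_commutes σ hG.equivariant, fun hG => commutes_permOp σ hG.equivariant⟩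

theorem Op.IsRegular.natural {m n : ℕ} {i : ℤ} {F : Op B m n i} (hF : F.IsRegular) : F.Natural :=
  ⟨hF.equivariant, fun y => hF.right (insOp_natural y), fun y => hF.left (insOp_natural y)⟩

section Comp

variable {l m n : ℕ} {i j t : ℤ} (e : i + j = t) {F : Op B m n i} {F' : Op B l m j}

theorem Op.Equivariant.comp (hF : F.Equivariant) (hF' : F'.Equivariant) :
    (opComp e F F').Equivariant := by
  intro A C N M a c hN hM ht α γ x
  rw [opComp_app e F F' hN hM ht rfl rfl (by omega), hF hN rfl rfl, hF',
    opComp_app e F F' hN hM ht rfl rfl (by omega)]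

theorem Op.Movable.comp (hF : F.Movable) (hF' : F'.Movable) : (opComp e F F').Movable := by
  intro A p C A' C' N M a c hA' hC' hN hM hN' hM' h h' ht x
  rw [opComp_app e F F' hN hM ht (L := A + (m + p) + C) (by omega) rfl (by omega),
    hF hA' hC' hN _ hN' (by omega) h rfl rfl, hF' hA' hC' _ hM _ hM' rfl h',
    opComp_app e F F' hN' hM' ht (L := A + (m + p) + C) (by omega) rfl (by omega)]

theorem Op.Inner.comp (hF : F.Inner) (hF' : F'.Inner) : (opComp e F F').Inner := by
  intro A C A' C' N M Z L L' c j d t t' s hA hN hM hL hL' ht ht' hl e₁ hl' e' z w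
  rw [opComp_app e F F' hL hL' ht' rfl rfl (by omega),
    hF s hA hN rfl hL rfl rfl rfl hl e₁ (by omega) (by omega),
    hF' s hA rfl hM rfl hL' (by omega) (by omega) _ _ hl' e',
    opComp_app e F F' hN hM ht rfl rfl (by omega)]

variable {m' n' : ℕ} {b : ℤ} {G : Op B m' n' b}

theorem Op.Commutes.comp_left (hF : F.Commutes G) (hF' : F'.Commutes G) :
    (opComp e F F').Commutes G := by
  intro A D C A₁ A₂ C₁ C₂ N L₁ L₂ M a t₁ t₂ c hA₁ hA₂ hC₁ hC₂ h₁ h₂ h₃ h₄ h₅ h₆ h₇ h₈ e₁ e₂ e₃ e₄ x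
  rw [opComp_app e F F' h₁ h₂ e₁ rfl rfl (by omega),
    hF' (A := A) (D := D) (C₂ := C₂) (L₂ := A + m + C₂) (t₂ := a + i + b) rfl hA₂ hC₁ hC₂ rfl h₂ h₃
      h₄ (by omega) (by omega) rfl h₈ (by omega) e₂ rfl (by omega),
    hF (A := A) (D := D) (C₂ := C₂) (L₂ := L₂) (t₂ := t₂) hA₁ rfl hC₁ hC₂ h₁ rfl (by omega)
      (by omega) h₅ h₆ h₇ rfl rfl rfl e₃ (by omega),
    opComp_app e F F' h₇ h₈ e₄ rfl (by omega : _ = a + i + b) (by omega)]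
  simp only [negOnePow_smul (k := k), map_smul, smul_smul, ← ksign_add]
  congr 2
  rw [← e]; ring

theorem Op.Commutes.comp_right (hF : G.Commutes F) (hF' : G.Commutes F') :
    G.Commutes (opComp e F F') := by
  intro A D C A₁ A₂ C₁ C₂ N L₁ L₂ M a t₁ t₂ c hA₁ hA₂ hC₁ hC₂ h₁ h₂ h₃ h₄ h₅ h₆ h₇ h₈ e₁ e₂ e₃ e₄ x
  rw [opComp_app e F F' h₃ h₄ e₂ rfl rfl (by omega),
    hF (A := A) (D := D) (C₂ := D + m + C) (L₂ := A₁ + m + C) (t₂ := a + i) hA₁ hA₂ hC₁ rfl h₁ h₂ h₃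
      rfl h₅ rfl (by omega) (by omega) e₁ rfl rfl (by omega)]
  simp only [negOnePow_smul (k := k), map_smul]
  rw [hF' (A := A) (D := D) (C₂ := C₂) (L₂ := L₂) (t₂ := t₂) hA₁ hA₂ rfl hC₂ (by omega) (by omega)
      rfl h₄ rfl h₆ h₇ h₈ (by omega) (by omega) (by omega) e₄,
    opComp_app e F F' h₅ h₆ e₃ rfl rfl (by omega)]
  simp only [negOnePow_smul (k := k), smul_smul, ← ksign_add]
  congr 2
  rw [← e]; ring

end Comp

theorem Op.IsRegular.comp {l m n : ℕ} {i j t : ℤ} (e : i + j = t) {F : Op B m n i}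
    {F' : Op B l m j} (hF : F.IsRegular) (hF' : F'.IsRegular) : (opComp e F F').IsRegular :=
  ⟨Op.Equivariant.comp e hF.equivariant hF'.equivariant, Op.Movable.comp e hF.movable hF'.movable,
    Op.Inner.comp e hF.inner hF'.inner,
    fun hG => Op.Commutes.comp_left e (hF.left hG) (hF'.left hG),
    fun hG => Op.Commutes.comp_right e (hF.right hG) (hF'.right hG)⟩

section Tensor

variable {m m' n n' M N : ℕ} {i j t : ℤ} (hM : m + m' = M) (hN : n + n' = N) (e : i + j = t)
  {F : Op B m n i} {F' : Op B m' n' j}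

theorem Op.Equivariant.tensor (hF : F.Equivariant) (hF' : F'.Equivariant) :
    (opTensor hM hN e F F').Equivariant := by
  intro A C K K' a c hK hK' ht α γ x
  have g₁ : A + n + (n' + C) = K := by omega
  have g₂ : A + m + (n' + C) = A + m + n' + C := by omega
  have g₃ : A + m + m' + C = K' := by omega
  have p₁ : triSum hK α 1 γ = triSum g₁ α 1 (blockSum rfl 1 γ) := by
    refine perm_ext_pval fun x _ => ?_
    have e1 : x - (A + n) - n' = x - (A + N) := by omega
    simp only [pval_triSum, pval_one, pval_blockSum, e1]
    split_ifs <;> omega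
  have p₂ : triSum g₂ α 1 (blockSum rfl 1 γ) =
      triSum (rfl : A + m + n' + C = _) (blockSum rfl α 1) 1 γ := by
    refine perm_ext_pval fun x _ => ?_
    have e1 : x - (A + m) - n' = x - (A + m + n') := by omega
    simp only [pval_triSum, pval_one, pval_blockSum, e1]
    split_ifs <;> omega
  have p₃ : triSum g₃ (blockSum rfl α 1) 1 γ = triSum hK' α 1 γ := by
    refine perm_ext_pval fun x _ => ?_
    have e1 : x - (A + m + m') = x - (A + M) := by omega
    simp only [pval_triSum, pval_one, pval_blockSum, e1]
    split_ifs <;> omega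
  rw [opTensor_app hM hN e F F' hK hK' ht rfl rfl g₁ g₂ rfl g₃ rfl (by omega), p₁,
    hF g₁ g₂ rfl, p₂, hF', p₃, opTensor_app hM hN e F F' hK hK' ht rfl rfl g₁ g₂ rfl g₃ rfl
    (by omega)]

theorem Op.Movable.tensor (hF : F.Movable) (hF' : F'.Movable) (hFe : F.Equivariant)
    (hFe' : F'.Equivariant) : (opTensor hM hN e F F').Movable := by
  intro A p C A' C' K K' a c hA' hC' hK hK' hk hk' h h' ht x
  have g₀ : A + (n + p) + (n' + C) = K := by omega
  have g₁ : A + n + (n' + C') = K := by omega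
  have g₂ : A + m + (n' + C') = A + m + n' + C' := by omega
  have g₃ : A + m + m' + C' = K' := by omega
  have g₄ : A + m + (n' + p) + C = A + m + n' + C' := by omega
  have g₅ : A + (m + p) + (n' + C) = A + m + n' + C' := by omega
  have g₆ : A + (m + p) + n' + C = A + m + n' + C' := by omega
  have g₇ : A + n + (n' + p) + C = K := by omega
  have g₈ : A + (m + p) + m' + C = K' := by omega
  have g₉ : A + m + (m' + p) + C = K' := by omega
  have hC₀ : 0 + (n' + p) + C = n' + C' := by omega
  have hA₀ : A + (m + p) + 0 = A + (m + p) := rfl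
  rw [opTensor_app hM hN e F F' hK hK' ht rfl rfl g₁ g₂ rfl g₃ rfl (by omega),
    triSum_blockSwap_add hN h g₀ g₇, B.act_mul,
    ← triSum_nest_right g₁ hC₀, hFe g₁ g₂ rfl,
    hF (p := p) (C := n' + C) hA' (by omega) g₁ g₂ (by omega) (by omega) g₀ g₅ rfl,
    triSum_nest_right g₂ hC₀ g₄, hF' (p := p) (C := C) (A' := A + (m + p)) (by omega) hC' rfl g₃ g₆
      g₈ g₄ g₉,
    ← triSum_nest_left g₆ hA₀ g₅, hFe' g₆ g₈, triSum_nest_left g₈ hA₀ (by omega),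
    triSum_blockSwap_add hM h' (by omega) g₉, B.act_mul,
    opTensor_app hM hN e F F' hk hk' ht (A' := A + (m + p)) (C' := n' + C) (by omega) rfl
      (by omega) (by omega) g₆ (by omega) rfl (by omega)]

theorem Op.Inner.tensor (hF : F.Inner) (hF' : F'.Inner) : (opTensor hM hN e F F').Inner := by
  intro A C A' C' K K' Z L L' c j d t t' s hA hK hK' hL hL' ht ht' hl e₁ hl' e' z w
  rw [opTensor_app hM hN e F F' hL hL' ht' rfl rfl (by omega) rfl (by omega) (by omega) rfl
      (by omega),
    hF s hA (by omega : A + n + (n' + C) = K) rfl _ rfl rfl rfl hl e₁ (by omega) (by omega),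
    hF' s (A := A + m) (C := C) (by omega) (by omega) (by omega : _ = K') _ _ (by omega) (by omega)
      _ _ hl' e',
    opTensor_app hM hN e F F' hK hK' ht rfl rfl (by omega) rfl (by omega) (by omega) rfl
      (by omega)]

variable {q r : ℕ} {b : ℤ} {G : Op B q r b}

theorem Op.Commutes.tensor_left (hF : F.Commutes G) (hF' : F'.Commutes G) :
    (opTensor hM hN e F F').Commutes G := by
  intro A D C A₁ A₂ C₁ C₂ K L₁ L₂ K' a t₁ t₂ c hA₁ hA₂ hC₁ hC₂ h₁ h₂ h₃ h₄ h₅ h₆ h₇ h₈ e₁ e₂ e₃ e₄ x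
  rw [opTensor_app hM hN e F F' h₁ h₂ e₁ rfl rfl (by omega) rfl (by omega) (by omega) rfl
      (by omega),
    hF' (A := A + m) (D := D) (A₁ := A + m + n' + D) (C₂ := C₂) (L₂ := A + m + n' + C₂)
      (t₂ := a + i + b) (A₂ := A₂) rfl (by omega) hC₁ hC₂ _ _ h₃ h₄ (by omega) (by omega)
      rfl (by omega) _ e₂ rfl (by omega),
    hF (A := A) (D := n' + D) (A₁ := A₁) (C₂ := n' + C₂) (L₂ := L₂) (t₂ := t₂) (by omega) (by omega)
      (by omega) (by omega) _ _ _ _ h₅ h₆ (by omega) (by omega) rfl _ e₃ (by omega),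
    opTensor_app hM hN e F F' h₇ h₈ e₄ (L := A + m + n' + C₂) (b := a + i + b) rfl rfl (by omega)
      (by omega) rfl (by omega) (by omega) (by omega)]
  simp only [negOnePow_smul (k := k), map_smul, smul_smul, ← ksign_add]
  congr 2
  rw [← e]; ring

theorem Op.Commutes.tensor_right (hF : G.Commutes F) (hF' : G.Commutes F') :
    G.Commutes (opTensor hM hN e F F') := by
  intro A D C A₁ A₂ C₁ C₂ K L₁ L₂ K' a t₁ t₂ c hA₁ hA₂ hC₁ hC₂ h₁ h₂ h₃ h₄ h₅ h₆ h₇ h₈ e₁ e₂ e₃ e₄ x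
  rw [opTensor_app hM hN e F F' h₃ h₄ e₂ rfl rfl (by omega) rfl (by omega) (by omega) rfl
      (by omega),
    hF (A := A) (D := D) (C := n' + C) (A₁ := A₁) (C₂ := D + m + (n' + C))
      (L₂ := A₁ + m + (n' + C)) (t₂ := a + i) hA₁ hA₂ (by omega) rfl h₁ h₂ _
      _ (by omega) rfl (by omega) (by omega) e₁ _ rfl (by omega)]
  simp only [negOnePow_smul (k := k), map_smul]
  rw [hF' (A := A) (D := D + m) (C := C) (A₁ := A₁ + m) (C₂ := C₂) (L₂ := L₂) (t₂ := t₂) (by omega)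
      (by omega) (by omega) (by omega) _ _ _ _ (by omega) (by omega) h₇ h₈ _ _ (by omega) e₄,
    opTensor_app hM hN e F F' h₅ h₆ e₃ rfl rfl (by omega) rfl (by omega) (by omega) rfl (by omega)]
  simp only [negOnePow_smul (k := k), smul_smul, ← ksign_add]
  congr 2
  rw [← e]; ring

end Tensor

theorem Op.IsRegular.tensor {m m' n n' M N : ℕ} {i j t : ℤ} (hM : m + m' = M) (hN : n + n' = N)
    (e : i + j = t) {F : Op B m n i} {F' : Op B m' n' j} (hF : F.IsRegular) (hF' : F'.IsRegular) :
    (opTensor hM hN e F F').IsRegular :=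
  ⟨Op.Equivariant.tensor hM hN e hF.equivariant hF'.equivariant,
    Op.Movable.tensor hM hN e hF.movable hF'.movable hF.equivariant hF'.equivariant,
    Op.Inner.tensor hM hN e hF.inner hF'.inner,
    fun hG => Op.Commutes.tensor_left hM hN e (hF.left hG) (hF'.left hG),
    fun hG => Op.Commutes.tensor_right hM hN e (hF.right hG) (hF'.right hG)⟩

end RegularOperators
end XB

namespace XB
open scoped DirectSum TensorProduct

section Envelope

variable {k : Type u} [Field k] {B : SymOperad k}

theorem Op.add_app {m n : ℕ} {i : ℤ} (F G : Op B m n i) {A C N M : ℕ} {j t : ℤ}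
    (hN : A + n + C = N) (hM : A + m + C = M) (ht : j + i = t) :
    (F + G).app A C hN hM ht = F.app A C hN hM ht + G.app A C hN hM ht := rfl

theorem Op.smul_app {m n : ℕ} {i : ℤ} (c : k) (F : Op B m n i) {A C N M : ℕ} {j t : ℤ}
    (hN : A + n + C = N) (hM : A + m + C = M) (ht : j + i = t) :
    (c • F).app A C hN hM ht = c • F.app A C hN hM ht := rfl

theorem Op.zero_app {m n : ℕ} {i : ℤ} {A C N M : ℕ} {j t : ℤ}
    (hN : A + n + C = N) (hM : A + m + C = M) (ht : j + i = t) :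
    (0 : Op B m n i).app A C hN hM ht = 0 := rfl

theorem Op.IsRegular.add {m n : ℕ} {i : ℤ} {F G : Op B m n i} (hF : F.IsRegular)
    (hG : G.IsRegular) : (F + G).IsRegular where
  equivariant := by
    intro A C N M j t hN hM ht α γ x
    simp only [Op.add_app, LinearMap.add_apply, map_add, hF.equivariant hN hM, hG.equivariant hN hM]
  movable := by
    intro A p C A' C' N M j t hA hC hN hM hN' hM' h h' ht x
    simp only [Op.add_app, LinearMap.add_apply, map_add, hF.movable hA hC hN hM hN' hM' h h',
      hG.movable hA hC hN hM hN' hM' h h']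
  inner := by
    intro A C A' C' N M Z L L' c j d t t' s hA hN hM hL hL' ht ht' hl e hl' e' z w
    simp only [Op.add_app, LinearMap.add_apply, map_add,
      hF.inner s hA hN hM hL hL' ht ht' hl e hl' e',
      hG.inner s hA hN hM hL hL' ht ht' hl e hl' e']
  left := by
    intro m' n' b H hH A D C A₁ A₂ C₁ C₂ N L₁ L₂ M j t₁ t₂ t g₁ g₂ g₃ g₄ h₁ h₂ h₃ h₄ h₅ h₆ h₇ h₈ e₁
      e₂ e₃ e₄ x
    simp only [Op.add_app, LinearMap.add_apply, map_add, smul_add,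
      hF.left hH g₁ g₂ g₃ g₄ h₁ h₂ h₃ h₄ h₅ h₆ h₇ h₈ e₁ e₂ e₃ e₄,
      hG.left hH g₁ g₂ g₃ g₄ h₁ h₂ h₃ h₄ h₅ h₆ h₇ h₈ e₁ e₂ e₃ e₄]
  right := by
    intro m' n' b H hH A D C A₁ A₂ C₁ C₂ N L₁ L₂ M j t₁ t₂ t g₁ g₂ g₃ g₄ h₁ h₂ h₃ h₄ h₅ h₆ h₇ h₈ e₁
      e₂ e₃ e₄ x
    simp only [Op.add_app, LinearMap.add_apply, map_add, smul_add,
      hF.right hH g₁ g₂ g₃ g₄ h₁ h₂ h₃ h₄ h₅ h₆ h₇ h₈ e₁ e₂ e₃ e₄,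
      hG.right hH g₁ g₂ g₃ g₄ h₁ h₂ h₃ h₄ h₅ h₆ h₇ h₈ e₁ e₂ e₃ e₄]

theorem Op.IsRegular.smul {m n : ℕ} {i : ℤ} (c : k) {F : Op B m n i} (hF : F.IsRegular) :
    (c • F).IsRegular where
  equivariant := by
    intro A C N M j t hN hM ht α γ x
    simp only [Op.smul_app, LinearMap.smul_apply, map_smul, hF.equivariant hN hM]
  movable := by
    intro A p C A' C' N M j t hA hC hN hM hN' hM' h h' ht x
    simp only [Op.smul_app, LinearMap.smul_apply, map_smul, hF.movable hA hC hN hM hN' hM' h h']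
  inner := by
    intro A C A' C' N M Z L L' c j d t t' s hA hN hM hL hL' ht ht' hl e hl' e' z w
    simp only [Op.smul_app, LinearMap.smul_apply, map_smul,
      hF.inner s hA hN hM hL hL' ht ht' hl e hl' e']
  left := by
    intro m' n' b H hH A D C A₁ A₂ C₁ C₂ N L₁ L₂ M j t₁ t₂ t g₁ g₂ g₃ g₄ h₁ h₂ h₃ h₄ h₅ h₆ h₇ h₈ e₁
      e₂ e₃ e₄ x
    simp only [Op.smul_app, LinearMap.smul_apply, map_smul,
      hF.left hH g₁ g₂ g₃ g₄ h₁ h₂ h₃ h₄ h₅ h₆ h₇ h₈ e₁ e₂ e₃ e₄, negOnePow_smul (k := k)]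
    rw [smul_comm]
  right := by
    intro m' n' b H hH A D C A₁ A₂ C₁ C₂ N L₁ L₂ M j t₁ t₂ t g₁ g₂ g₃ g₄ h₁ h₂ h₃ h₄ h₅ h₆ h₇ h₈ e₁
      e₂ e₃ e₄ x
    simp only [Op.smul_app, LinearMap.smul_apply, map_smul,
      hF.right hH g₁ g₂ g₃ g₄ h₁ h₂ h₃ h₄ h₅ h₆ h₇ h₈ e₁ e₂ e₃ e₄, negOnePow_smul (k := k)]
    rw [smul_comm]

theorem Op.IsRegular.zero {m n : ℕ} {i : ℤ} : (0 : Op B m n i).IsRegular where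
  equivariant := by
    intro A C N M j t hN hM ht α γ x
    simp only [Op.zero_app, LinearMap.zero_apply, map_zero]
  movable := by
    intro A p C A' C' N M j t hA hC hN hM hN' hM' h h' ht x
    simp only [Op.zero_app, LinearMap.zero_apply, map_zero]
  inner := by
    intro A C A' C' N M Z L L' c j d t t' s hA hN hM hL hL' ht ht' hl e hl' e' z w
    simp only [Op.zero_app, LinearMap.zero_apply, map_zero]
  left := by
    intro m' n' b H hH A D C A₁ A₂ C₁ C₂ N L₁ L₂ M j t₁ t₂ t g₁ g₂ g₃ g₄ h₁ h₂ h₃ h₄ h₅ h₆ h₇ h₈ e₁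
      e₂ e₃ e₄ x
    simp only [Op.zero_app, LinearMap.zero_apply, map_zero, smul_zero]
  right := by
    intro m' n' b H hH A D C A₁ A₂ C₁ C₂ N L₁ L₂ M j t₁ t₂ t g₁ g₂ g₃ g₄ h₁ h₂ h₃ h₄ h₅ h₆ h₇ h₈ e₁
      e₂ e₃ e₄ x
    simp only [Op.zero_app, LinearMap.zero_apply, map_zero, smul_zero]

variable (B) in
/-- The space of regular operators. -/
def regSub (m n : ℕ) (i : ℤ) : Submodule k (Op B m n i) where
  carrier := {F | F.IsRegular}
  add_mem' := Op.IsRegular.add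
  zero_mem' := Op.IsRegular.zero
  smul_mem' c _ := Op.IsRegular.smul c

variable (B) in
/-- The data of the PROP of regular operators. -/
def envelopeData : PROPData k where
  Hom m n i := regSub B m n i
  perm σ := ⟨permOp B σ, permOp_isRegular σ⟩
  comp e := LinearMap.mk₂ k (fun F G => ⟨opComp e F.1 G.1, F.2.comp e G.2⟩)
    (fun _ _ G => Subtype.ext (Op.ext_app fun _ _ _ _ _ _ _ _ _ _ =>
      (G.1.app _ _ _ _ _).map_add _ _))
    (fun _ _ G => Subtype.ext (Op.ext_app fun _ _ _ _ _ _ _ _ _ _ =>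
      (G.1.app _ _ _ _ _).map_smul _ _))
    (fun _ _ _ => rfl) (fun _ _ _ => rfl)
  hcomp hM hN e := LinearMap.mk₂ k
    (fun F G => ⟨opTensor hM hN e F.1 G.1, F.2.tensor hM hN e G.2⟩)
    (fun _ _ G => Subtype.ext (Op.ext_app fun _ _ _ _ _ _ _ _ _ _ =>
      (G.1.app _ _ _ _ _).map_add _ _))
    (fun _ _ G => Subtype.ext (Op.ext_app fun _ _ _ _ _ _ _ _ _ _ =>
      (G.1.app _ _ _ _ _).map_smul _ _))
    (fun _ _ _ => rfl) (fun _ _ _ => rfl)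

theorem opComp_assoc {p l m n : ℕ} {a b c ab bc abc : ℤ} (e₁ : a + b = ab) (e₂ : ab + c = abc)
    (e₃ : b + c = bc) (e₄ : a + bc = abc) (F : Op B m n a) (G : Op B l m b) (H : Op B p l c) :
    opComp e₂ (opComp e₁ F G) H = opComp e₄ F (opComp e₃ G H) := by
  refine Op.ext_app fun A C N M j t hN hM ht x => ?_
  rw [opComp_app e₂ _ H hN hM ht rfl (by omega : _ = j + a + b) (by omega),
    opComp_app e₁ F G hN rfl _ rfl rfl rfl,
    opComp_app e₄ F _ hN hM ht rfl rfl (by omega),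
    opComp_app e₃ G H rfl hM (by omega) rfl (rfl : _ = j + a + b) (by omega)]

theorem permOp_one_opComp {m n : ℕ} {i : ℤ} (e : 0 + i = i) (F : Op B m n i) :
    opComp e (permOp B 1) F = F := by
  refine Op.ext_app fun A C N M j t hN hM ht x => ?_
  rw [opComp_app e _ F hN hM ht hN (add_zero j) ht, permOp_app, triSum_one, B.act_one]

theorem opComp_permOp_one {m n : ℕ} {i : ℤ} (e : i + 0 = i) (F : Op B m n i) :
    opComp e F (permOp B 1) = F := by
  refine Op.ext_app fun A C N M j t hN hM ht x => ?_
  rw [opComp_app e F _ hN hM ht hM ht (add_zero t), permOp_app, triSum_one, B.act_one]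

theorem permOp_mul {n : ℕ} (e : (0 : ℤ) + 0 = 0) (σ τ : Equiv.Perm (Fin n)) :
    permOp B (σ * τ) = opComp e (permOp B σ) (permOp B τ) := by
  refine Op.ext_app fun A C N M j t hN hM ht x => ?_
  obtain rfl : N = M := hN.symm.trans hM
  obtain rfl : j = t := by omega
  rw [opComp_app e _ _ hN hM ht hN ht ht, permOp_app, permOp_app, permOp_app, ← B.act_mul,
    ← triSum_mul, one_mul, one_mul]

theorem opTensor_assoc {m₁ m₂ m₃ m₁₂ m₂₃ M n₁ n₂ n₃ n₁₂ n₂₃ N : ℕ} {a b c ab bc abc : ℤ}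
    (hm₁ : m₁ + m₂ = m₁₂) (hm₂ : m₁₂ + m₃ = M) (hm₃ : m₂ + m₃ = m₂₃) (hm₄ : m₁ + m₂₃ = M)
    (hn₁ : n₁ + n₂ = n₁₂) (hn₂ : n₁₂ + n₃ = N) (hn₃ : n₂ + n₃ = n₂₃) (hn₄ : n₁ + n₂₃ = N)
    (e₁ : a + b = ab) (e₂ : ab + c = abc) (e₃ : b + c = bc) (e₄ : a + bc = abc)
    (F : Op B m₁ n₁ a) (G : Op B m₂ n₂ b) (H : Op B m₃ n₃ c) :
    opTensor hm₂ hn₂ e₂ (opTensor hm₁ hn₁ e₁ F G) H =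
      opTensor hm₄ hn₄ e₄ F (opTensor hm₃ hn₃ e₃ G H) := by
  refine Op.ext_app fun A C K K' j t hK hK' ht x => ?_
  rw [opTensor_app hm₂ hn₂ e₂ _ H hK hK' ht (A' := A + m₁ + m₂) (by omega) rfl (by omega)
      (rfl : _ = A + m₁₂ + (n₃ + C)) (by omega) (by omega) (by omega : _ = j + a + b) (by omega),
    opTensor_app hm₁ hn₁ e₁ F G _ _ _ rfl (rfl : n₂ + (n₃ + C) = _) (by omega)
      (rfl : _ = A + m₁ + (n₂ + (n₃ + C))) (by omega) (by omega) rfl rfl,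
    opTensor_app hm₄ hn₄ e₄ F _ hK hK' ht rfl (by omega : _ = n₂ + (n₃ + C)) (by omega) rfl
      (by omega) (by omega) rfl (by omega),
    opTensor_app hm₃ hn₃ e₃ G H _ _ _ rfl rfl (by omega) (by omega : _ = A + m₁₂ + (n₃ + C))
      (by omega) (by omega) rfl (by omega)]

theorem permOp_opTensor {m n : ℕ} {i : ℤ} (hm : 0 + m = m) (hn : 0 + n = n) (e : 0 + i = i)
    (F : Op B m n i) : opTensor hm hn e (permOp B (1 : Equiv.Perm (Fin 0))) F = F := by
  refine Op.ext_app fun A C K K' j t hK hK' ht x => ?_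
  rw [opTensor_app hm hn e _ F hK hK' ht (A' := A) rfl rfl (by omega) (by omega) hK hK' (add_zero j)
    ht, permOp_app, triSum_one, B.act_one]

theorem opTensor_permOp {m n : ℕ} {i : ℤ} (hm : m + 0 = m) (hn : n + 0 = n) (e : i + 0 = i)
    (F : Op B m n i) : opTensor hm hn e F (permOp B (1 : Equiv.Perm (Fin 0))) = F := by
  refine Op.ext_app fun A C K K' j t hK hK' ht x => ?_
  rw [opTensor_app hm hn e F _ hK hK' ht rfl (C' := C) (by omega) hK hK' (by omega) (by omega) ht
    (add_zero t), permOp_app, triSum_one, B.act_one]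

theorem permOp_opTensor_permOp {m m' M : ℕ} (h : m + m' = M) (e : (0 : ℤ) + 0 = 0)
    (σ : Equiv.Perm (Fin m)) (τ : Equiv.Perm (Fin m')) :
    opTensor h h e (permOp B σ) (permOp B τ) = permOp B (blockSum h σ τ) := by
  refine Op.ext_app fun A C K K' j t hK hK' ht x => ?_
  obtain rfl : K = K' := hK.symm.trans hK'
  obtain rfl : j = t := by omega
  have h₁ : A + m + (m' + C) = K := by omega
  have h₂ : A + m + m' + C = K := by omega
  rw [opTensor_app h h e _ _ hK hK' ht rfl rfl h₁ h₁ h₂ h₂ ht ht, permOp_app, permOp_app, permOp_app,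
    ← B.act_mul]
  congr 2
  refine perm_ext_pval fun x _ => ?_
  have e₁ : x - (A + m) = x - A - m := by omega
  rw [pval_mul]
  rcases lt_or_ge x (A + m) with hx | hx
  · have : pval (triSum h₂ (1 : Equiv.Perm (Fin (A + m))) τ 1) x = x := by
      rw [pval_triSum, if_pos hx, pval_one]
    rw [this]
    simp only [pval_triSum, pval_one, pval_blockSum]
    split_ifs <;> omega
  · have : A + m ≤ pval (triSum h₂ (1 : Equiv.Perm (Fin (A + m))) τ 1) x := by
      rw [pval_triSum, if_neg (by omega)]; split_ifs <;> omega
    rw [pval_triSum h₁, if_neg (by omega), if_neg (by omega), pval_one]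
    rw [Nat.add_sub_cancel' this]
    simp only [pval_triSum, pval_one, pval_blockSum, e₁]
    split_ifs <;> omega

theorem opComp_opTensor {l m n l' m' n' L M N : ℕ} {a b c d ab cd ac bd t : ℤ}
    (hL : l + l' = L) (hM : m + m' = M) (hN : n + n' = N)
    (e₁ : a + b = ab) (e₂ : c + d = cd) (e₃ : ab + cd = t)
    (e₄ : a + c = ac) (e₅ : b + d = bd) (e₆ : ac + bd = t)
    (F : Op B m n a) {G : Op B m' n' b} {F' : Op B l m c} (G' : Op B l' m' d) (h : F'.Commutes G) :
    opComp e₃ (opTensor hM hN e₁ F G) (opTensor hL hM e₂ F' G') =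
      (b * c).negOnePow • opTensor hL hN e₆ (opComp e₄ F F') (opComp e₅ G G') := by
  rw [negOnePow_smul (k := k)]
  refine Op.ext_app fun A C K K' j s hK hK' hs x => ?_
  rw [Op.smul_app, LinearMap.smul_apply,
    opComp_app e₃ _ _ hK hK' hs (L := A + m + m' + C) (b := j + a + b) (by omega) (by omega)
      (by omega),
    opTensor_app hM hN e₁ F G hK _ _ rfl rfl (by omega) (rfl : _ = A + m + (n' + C)) (by omega) rfl
      rfl (by omega),
    opTensor_app hL hM e₂ F' G' _ hK' _ rfl rfl (by omega) (rfl : _ = A + l + (m' + C)) (by omega)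
      (by omega) rfl (by omega),
    opTensor_app hL hN e₆ _ _ hK hK' hs rfl rfl (by omega) (rfl : _ = A + l + (n' + C)) (by omega)
      (by omega) rfl (by omega),
    opComp_app e₄ F F' _ _ _ (rfl : _ = A + m + (n' + C)) rfl (by omega),
    opComp_app e₅ G G' _ _ _ (by omega : _ = A + l + (m' + C)) (by omega : _ = j + a + b + c)
      (by omega),
    h (A := A) (D := 0) (A₁ := A + m) (A₂ := A + l) (C₁ := n' + C) (C₂ := m' + C)
      (L₂ := A + m + m' + C) (t₂ := j + a + b) rfl rfl (by omega) (by omega) _ _ _ _ (by omega) (by omega) (by omega) (by omega) (by omega) _ rfl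
      (by omega)]
  simp only [negOnePow_smul (k := k), map_smul, smul_smul]
  rw [mul_comm c b, ksign_mul_self, one_smul]

theorem Op.Movable.symm {m n : ℕ} {i : ℤ} {F : Op B m n i} (hF : F.Movable) {A p C A' C' N M : ℕ}
    {j t : ℤ} (hA : A + p = A') (hC : p + C = C')
    (hN : A + n + C' = N) (hM : A + m + C' = M) (hN' : A' + n + C = N) (hM' : A' + m + C = M)
    (h : A + (p + n) + C = N) (h' : A + (p + m) + C = M) (ht : j + i = t) (x : B.obj N j) :
    F.app A' C hN' hM' ht (B.act (triSum h 1 (blockSwap rfl (add_comm n p)) 1) x) =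
      B.act (triSum h' 1 (blockSwap rfl (add_comm m p)) 1) (F.app A C' hN hM ht x) := by
  have key : ∀ {q K : ℕ} (g : A + (p + q) + C = K) (g' : A + (q + p) + C = K),
      triSum g 1 (blockSwap rfl (add_comm q p)) 1 *
        triSum g' 1 (blockSwap rfl (add_comm p q)) 1 = 1 := by
    intro q K g g'
    refine perm_ext_pval fun x _ => ?_
    rw [pval_mul, pval_one, pval_triSum_blockSwap, pval_triSum_blockSwap]
    split_ifs <;> omega
  have key' : ∀ {q K : ℕ} (g : A + (p + q) + C = K) (g' : A + (q + p) + C = K),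
      triSum g' 1 (blockSwap rfl (add_comm p q)) 1 *
        triSum g 1 (blockSwap rfl (add_comm q p)) 1 = 1 :=
    fun g g' => mul_eq_one_iff_eq_inv.2 (eq_inv_of_mul_eq_one_right (key g g'))
  have := hF hA hC hN hM hN' hM' (by omega) (by omega) ht
    (B.act (triSum h 1 (blockSwap rfl (add_comm n p)) 1) x)
  rw [← B.act_mul, key, B.act_one] at this
  rw [this, ← B.act_mul, key', B.act_one]

theorem opTensor_comm {m n m' n' M N : ℕ} {a b ab : ℤ} (hM : m + m' = M) (hM' : m' + m = M)
    (hN : n + n' = N) (hN' : n' + n = N) (e₁ : a + b = ab) (e₂ : b + a = ab)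
    (e₃ : ab + 0 = ab) (e₄ : 0 + ab = ab) {F : Op B m n a} {G : Op B m' n' b} (hF : F.Movable)
    (hG : G.Movable) (h : G.Commutes F) :
    opComp e₃ (opTensor hM' hN' e₂ G F) (permOp B (blockSwap hM hM')) =
      (a * b).negOnePow • opComp e₄ (permOp B (blockSwap hN hN')) (opTensor hM hN e₁ F G) := by
  subst hM hN
  rw [negOnePow_smul (k := k)]
  refine Op.ext_app fun A C K K' j s hK hK' hs x => ?_
  rw [Op.smul_app, LinearMap.smul_apply,
    opComp_app e₃ _ _ hK hK' hs hK' hs (add_zero s), permOp_app,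
    opComp_app e₄ _ _ hK hK' hs hK (add_zero j) hs, permOp_app,
    opTensor_app _ _ e₂ G F hK hK' hs rfl rfl (by omega) (rfl : _ = A + m' + (n + C)) (by omega)
      (by omega) rfl (by omega),
    opTensor_app _ _ e₁ F G hK hK' hs rfl rfl (by omega) (rfl : _ = A + m + (n' + C)) (by omega)
      (by omega) rfl (by omega),
    hF (p := n') (C := C) (A' := A + n') rfl rfl _ _ (by omega) (by omega) _ (by omega) rfl,
    hG.symm (p := m) (C := C) (A := A) rfl rfl (by omega) (by omega) _ _ (by omega) hK',
    h (A := A) (D := 0) (A₁ := A + n') (A₂ := A + m') (C₁ := n + C) (C₂ := m + C)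
      (L₂ := A + m + (n' + C)) (t₂ := j + a) rfl rfl (by omega) (by omega) _ _ _ _ (by omega) (by omega) (by omega) (by omega) _ _ rfl
      (by omega)]
  simp only [negOnePow_smul (k := k), map_smul]
  rw [mul_comm b a]

variable (B) in
/-- The PROP of regular operators. -/
def envelope : PROP k where
  toPROPData := envelopeData B
  comp_assoc e₁ e₂ e₃ e₄ f g h := Subtype.ext (opComp_assoc e₁ e₂ e₃ e₄ f.1 g.1 h.1)
  one_comp e f := Subtype.ext (permOp_one_opComp e f.1)
  comp_one e f := Subtype.ext (opComp_permOp_one e f.1)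
  perm_mul e σ τ := Subtype.ext (permOp_mul e σ τ)
  hcomp_assoc hm₁ hm₂ hm₃ hm₄ hn₁ hn₂ hn₃ hn₄ e₁ e₂ e₃ e₄ f g h := Subtype.ext
    (opTensor_assoc hm₁ hm₂ hm₃ hm₄ hn₁ hn₂ hn₃ hn₄ e₁ e₂ e₃ e₄ f.1 g.1 h.1)
  one_hcomp hm hn e f := Subtype.ext (permOp_opTensor hm hn e f.1)
  hcomp_one hm hn e f := Subtype.ext (opTensor_permOp hm hn e f.1)
  perm_hcomp h e σ τ := Subtype.ext (permOp_opTensor_permOp h e σ τ)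
  interchange hL hM hN e₁ e₂ e₃ e₄ e₅ e₆ f g f' g' := Subtype.ext
    (opComp_opTensor hL hM hN e₁ e₂ e₃ e₄ e₅ e₆ f.1 g'.1 (f'.2.left g.2.natural))
  symmetry hM hM' hN hN' e₁ e₂ e₃ e₄ f g := Subtype.ext
    (opTensor_comm hM hM' hN hN' e₁ e₂ e₃ e₄ f.2.movable g.2.movable (g.2.left f.2.natural))

end Envelope
end XB

namespace XB
open scoped DirectSum TensorProduct

section OperadFreeness

variable {k : Type u} [Field k]

theorem envelope_pad_app {B : SymOperad k} {m n M N : ℕ} {i j t : ℤ} (A C : ℕ)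
    (hM : A + m + C = M) (hN : A + n + C = N) (F : (envelope B).Hom m n i) (h₁ : 0 + N + 0 = N)
    (h₂ : 0 + M + 0 = M) (ht : j + i = t) (z : B.obj N j) :
    ((envelope B).pad A C hM hN F).1.app 0 0 h₁ h₂ ht z = F.1.app A C hN hM ht z := by
  refine (opTensor_app hM hN (add_zero i) (opTensor rfl rfl (zero_add i) (permOp B 1) F.1)
    (permOp B 1) h₁ h₂ ht (A' := A + m) (C' := C) (by omega) rfl (by omega : 0 + (A + n) + C = N)
    (by omega : 0 + (A + m) + C = M) hM hM ht (add_zero t) z).trans ?_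
  rw [permOp_app, triSum_one, B.act_one, opTensor_app rfl rfl (zero_add i) (permOp B 1) F.1 _ _ ht
    (A' := A) (C' := n + C) (L := N) (by omega) rfl (by omega) (by omega) hN hM (add_zero j) ht,
    permOp_app, triSum_one, B.act_one]

theorem triSum_zero {n : ℕ} (h : 0 + n + 0 = n) (σ : Equiv.Perm (Fin n)) : triSum h 1 σ 1 = σ := by
  refine perm_ext_pval fun x hx => ?_
  rw [pval_triSum, if_neg (by omega), if_pos (by omega), Nat.sub_zero, zero_add]

section Eval

variable {P : PROP k} {B : SymOperad k} (Γ : P.Mor (envelope B))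

/-- The value of the operator of an operation with one output on the unit. -/
def PROP.Mor.eval (n : ℕ) (i : ℤ) : P.Hom n 1 i →ₗ[k] B.obj n i where
  toFun x := (Γ.map n 1 i x).1.app 0 0 rfl (by omega) (zero_add i) B.one
  map_add' x y := by rw [map_add]; rfl
  map_smul' c x := by rw [map_smul]; rfl

theorem PROP.Mor.eval_apply {n : ℕ} {i : ℤ} (x : P.Hom n 1 i) (h : 0 + n + 0 = n) :
    Γ.eval n i x = (Γ.map n 1 i x).1.app 0 0 rfl h (zero_add i) B.one := rfl

theorem PROP.Mor.eval_one : Γ.eval 1 0 (P.perm 1) = B.one := by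
  rw [Γ.eval_apply _ rfl, Γ.map_perm]
  refine (permOp_app (A := 0) (n := 1) (C := 0) (N := 1) 1 rfl rfl (zero_add 0) B.one).trans ?_
  rw [triSum_one, B.act_one]

theorem PROP.Mor.eval_comp_perm {n : ℕ} {i : ℤ} (σ : Equiv.Perm (Fin n)) (x : P.Hom n 1 i) :
    Γ.eval n i (P.comp (add_zero i) x (P.perm σ)) = B.act σ (Γ.eval n i x) := by
  have h : 0 + n + 0 = n := by omega
  rw [Γ.eval_apply _ h, Γ.eval_apply _ h, Γ.map_comp, Γ.map_perm]
  refine (opComp_app (add_zero i) (Γ.map n 1 i x).1 _ rfl h (zero_add i) h (zero_add i) (add_zero i)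
    B.one).trans ?_
  refine (permOp_app σ h h (add_zero i) _).trans ?_
  rw [triSum_zero]

theorem PROP.Mor.eval_comp_pad {A C m n l : ℕ} {i j t : ℤ} (hM : A + n + C = l) (hN : A + 1 + C = m)
    (s : Fin m) (hs : s = A) (hl : l + 1 = m + n) (ht : i + j = t) (x : P.Hom m 1 i)
    (y : P.Hom n 1 j) :
    Γ.eval l t (P.comp ht x (P.pad A C hM hN y)) = B.circ s hl ht (Γ.eval m i x) (Γ.eval n j y) := by
  have h : ∀ n : ℕ, 0 + n + 0 = n := fun n => by omega
  rw [Γ.eval_apply _ (h l), Γ.map_comp, Γ.map_pad]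
  refine (opComp_app ht (Γ.map m 1 i x).1 _ rfl (h l) (zero_add t) (h m) (zero_add i) ht
    B.one).trans ?_
  rw [envelope_pad_app, ← Γ.eval_apply]
  have := (Γ.map n 1 j y).2.inner (A := 0) s hs (C := 0) (C' := C) (M := n) rfl (h n) hN hM (zero_add j) ht
    rfl (add_zero i) hl ht (Γ.eval m i x) B.one
  rw [B.circ_one] at this
  exact this

/-- A morphism from a PROP to the PROP of regular operators of an operad yields a morphism of
operads. -/
def PROP.Mor.evalHom : P.operad.Hom B where
  map := Γ.eval
  map_one := Γ.eval_one
  map_circ s hl ht x y := Γ.eval_comp_pad _ _ s rfl hl ht x y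
  map_act σ x := Γ.eval_comp_perm σ x

end Eval

section Stable

variable {P : PROP k} (E : ∀ n i, Submodule k (P.Hom n 1 i))

/-- The operations `f` such that `x ∘ (id ⊗ f ⊗ id)` belongs to `E` for all `x` in `E`. -/
def stableSub (m n : ℕ) (i : ℤ) : Submodule k (P.Hom m n i) where
  carrier := {f | ∀ (A C M N : ℕ) (j t : ℤ) (hM : A + m + C = M) (hN : A + n + C = N)
    (e : j + i = t), ∀ x ∈ E N j, P.comp e x (P.pad A C hM hN f) ∈ E M t}
  add_mem' hf hf' := by
    intro A C M N j t hM hN e x hx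
    rw [map_add, map_add]
    exact add_mem (hf A C M N j t hM hN e x hx) (hf' A C M N j t hM hN e x hx)
  zero_mem' := by
    intro A C M N j t hM hN e x hx
    rw [map_zero, map_zero]
    exact zero_mem _
  smul_mem' c f hf := by
    intro A C M N j t hM hN e x hx
    rw [map_smul, map_smul]
    exact Submodule.smul_mem _ c (hf A C M N j t hM hN e x hx)

variable {E}

theorem pad_mem_stableSub {m n M N : ℕ} {i : ℤ} {f : P.Hom m n i} (hf : f ∈ stableSub E m n i)
    (A C : ℕ) (hM : A + m + C = M) (hN : A + n + C = N) :
    P.pad A C hM hN f ∈ stableSub E M N i := by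
  intro A' C' M' N' j t hM' hN' e x hx
  rw [P.pad_pad A C A' C' hM hN hM' hN' (by omega) (by omega)]
  exact hf _ _ _ _ _ _ _ _ e x hx

theorem comp_mem_stableSub {l m n : ℕ} {i j t : ℤ} (e : i + j = t) {f : P.Hom m n i}
    {f' : P.Hom l m j} (hf : f ∈ stableSub E m n i) (hf' : f' ∈ stableSub E l m j) :
    P.comp e f f' ∈ stableSub E l n t := by
  intro A C M N a b hM hN e' x hx
  rw [P.pad_comp A C hM rfl hN e, ← P.comp_assoc (ab := a + i) rfl (by omega) e e']
  exact hf' _ _ _ _ _ _ _ _ _ _ (hf _ _ _ _ _ _ _ _ _ x hx)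

theorem isClosed_stableSub (hE : ∀ {n : ℕ} {i : ℤ} (σ : Equiv.Perm (Fin n)), ∀ x ∈ E n i,
    P.comp (add_zero i) x (P.perm σ) ∈ E n i) : P.IsClosed (stableSub E) where
  perm_mem σ := by
    intro A C M N j t hM hN e x hx
    obtain rfl : M = N := hM.symm.trans hN
    obtain rfl : j = t := by omega
    rw [P.pad_perm]
    exact hE _ x hx
  comp_mem e f f' hf hf' := comp_mem_stableSub e hf hf'
  hcomp_mem {m m' M n n' N i j t} hM hN e f f' hf hf' := by
    have h₁ := pad_mem_stableSub hf 0 n' (by omega : _ = m + n') (by omega : _ = N)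
    have h₂ := pad_mem_stableSub hf' m 0 (by omega : _ = M) (rfl : _ = m + n')
    rw [P.hcomp_eq_comp hM hN rfl e, P.hcomp_perm_one rfl hN (by omega) (by omega),
      P.perm_one_hcomp hM rfl (by omega) rfl]
    exact comp_mem_stableSub e h₁ h₂

end Stable

variable {X : CoalgOperad.{u} k} {V : ∀ n i, Submodule k (X.obj n i)}

theorem gradedPROP_operad_hom_ext (hV : X.toNSOperad.PosFreelyGenerated V) {B : SymOperad k}
    {g g' : (gradedPROP X).operad.Hom B}
    (h : ∀ s (v : genSpace V s), g.map _ _ (genMap V s v) = g'.map _ _ (genMap V s v)) : g = g' := by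
  let u : ∀ n i, (gradedPROP X).Hom n 1 i →ₗ[k] B.obj n i := g.map
  let u' : ∀ n i, (gradedPROP X).Hom n 1 i →ₗ[k] B.obj n i := g'.map
  have hcirc : ∀ {A C m n l : ℕ} {i j t : ℤ} (hM : A + n + C = l) (hN : A + 1 + C = m)
      (ht : i + j = t) (x : (gradedPROP X).Hom m 1 i) (y : (gradedPROP X).Hom n 1 j),
      u m i x = u' m i x → u n j y = u' n j y →
      u l t ((gradedPROP X).comp ht x ((gradedPROP X).pad A C hM hN y)) =
        u' l t ((gradedPROP X).comp ht x ((gradedPROP X).pad A C hM hN y)) := by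
    intro A C m n l i j t hM hN ht x y hx hy
    rw [(gradedPROP X).pad_congr rfl (by omega : C = m - 1 - A) hM hN (by omega) (by omega)]
    refine (g.map_circ (⟨A, by omega⟩ : Fin m) (by omega) ht x y).trans (Eq.trans ?_
      (g'.map_circ (⟨A, by omega⟩ : Fin m) (by omega) ht x y).symm)
    exact congrArg₂ (fun a b => B.circ _ _ _ a b) hx hy
  have hcl := isClosed_stableSub (E := fun n i => LinearMap.eqLocus (u n i) (u' n i))
    (fun σ x hx => (g.map_act σ x).trans ((congrArg (B.act σ) hx).trans (g'.map_act σ x).symm))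
  have : u = u' := by
    funext m i
    refine LinearMap.ext fun f => ?_
    have := gradedPROP_eq_top hV hcl (fun s v _ _ _ _ _ _ hM hN e x hx => hcirc hM hN e x _ hx (h s v)) f
      0 0 m 1 0 i (by omega) rfl (zero_add i) ((gradedPROP X).perm 1)
      (g.map_one.trans g'.map_one.symm)
    rwa [PROP.one_comp, PROP.pad_zero] at this
  cases g; cases g'
  congr

theorem gradedPROP_operad_freelyGenerated (hV : X.toNSOperad.PosFreelyGenerated V) :
    (gradedPROP X).operad.FreelyGenerated GenIndex.arity GenIndex.degree (genSpace V)
      (genMap V) := by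
  intro B f
  obtain ⟨Γ, hΓ, -⟩ := gradedPROP_freelyGenerated hV (envelope B) fun s =>
    LinearMap.codRestrict (regSub B _ _ _) (insOp.comp (f s)) fun v => insOp_isRegular (f s v)
  have h : ∀ s (v : genSpace V s), Γ.eval _ _ (genMap V s v) = f s v := by
    intro s v
    rw [Γ.eval_apply _ (by omega), hΓ]
    exact (insOp_app (A := 0) (C := 0) (M := s.arity) (f s v) rfl (by omega) (zero_add _) (0 : Fin 1)
      rfl (by omega) B.one).trans
      (B.one_circ _ _ _ _)
  exact ⟨Γ.evalHom, h, fun g hg => gradedPROP_operad_hom_ext hV fun s v =>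
    (hg s v).trans (h s v).symm⟩

end OperadFreeness
end XB

theorem mainTheorem7 {k : Type u} [Field k] [CharZero k] (X : XB.CoalgOperad.{u} k)
    (V : ∀ n i, Submodule k (X.obj n i)) (hV : X.toNSOperad.PosFreelyGenerated V) :
    ∃ δ : (XB.gradedPROP X).Differential,
      XB.IsGoverningDifferential X δ ∧
      (∀ δ', XB.IsGoverningDifferential X δ' → δ' = δ) ∧
      (XB.dgPROP X δ).SemiFreeOn XB.GenIndex.arity (fun _ => 1) XB.GenIndex.degree
        (XB.genSpace V) (XB.genMap V) ∧
      (XB.dgOperad X δ).SemiFreeOn XB.GenIndex.arity XB.GenIndex.degree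
        (XB.genSpace V) (XB.genMap V) := by
  exact ⟨XB.govDiff X, XB.isGoverningDifferential_govDiff X,
    fun _ h => h.eq (XB.isGoverningDifferential_govDiff X), XB.gradedPROP_freelyGenerated hV,
    XB.gradedPROP_operad_freelyGenerated hV⟩
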